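/- **Setting.** Let $K=\mathbb Z\oplus\mathbb Z$ with basic idempotents $\iota_0,\iota_1$, and let $A_0$ be the path algebra over $\mathbb Z$ of the quiver with vertices $0,1$ and arrows $\rho_1,\rho_3\colon 0\to1$, $\rho_2,\rho_4\colon 1\to 0$ (products are read from left to right, $\iota_0\rho_1\iota_1=\rho_1$), modulo $\rho_2\rho_1=\rho_3\rho_2=\rho_4\rho_3=\rho_1\rho_4=0$. It has the $\mathbb Z$-basis $\iota_0,\iota_1$ and the chords $\rho_{i,i+1,\dots,i+n}=\rho_i\rho_{i+1}\cdots\rho_{i+n}$ ($i\in\mathbb Z/4$, $n\ge 0$). Let $A=A_0[U]$, a $K$-bimodule with unit $1=\iota_0+\iota_1$, placed in even $\mathbb Z/2$-degree. *The undeformed algebra.* The $A_\infty$-algebra $\mathcal A_-^{0}=(A,\{\mu^0_n\})$ has $U$-multilinear operations, $\mu^0_2$ is the product, and for $n\ne2$ the operation $\mu_n^0$ vanishes if an input is an idempotent $\iota_j$, while $\mu_n^0(\rho^1,\dots,\rho^n)$ for chords $\rho^1,\dots,\rho^n$ is the sum of the outputs of all tree-like tiling patterns with chord sequence $(\rho^1,\dots,\rho^n)$.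 Here a tree-like tiling pattern is a plane tree $T$ in the disk, rooted at a leaf, having $d\ge1$ internal vertices, all of valence $4$, with the four sectors at each vertex labelled by $\mathbb Z/4$ so that, walking around $T$ from the root, labels of consecutive sectors around a vertex decrease by $1$, and the label increases by $1$ when one walks along an internal edge from the sector at one of its ends to the sector at the other. Such a pattern may be extended by $k\ge1$ vertices of valence $2$ on the root edge, each with one labelled sector, all on the same side of the root edge, with the same rule along edges. The chord sequence is obtained by walking around $T$ from root to root and multiplying the $\rho_x$ over the labels $x$ met between consecutive leaves. The output is $U^d$ times the left idempotent of $\rho_x$, $x$ the first label met, if the pattern is not extended, and $U^d$ times the product of the $\rho_x$ over the labels $x$ at the vertices of valence $2$, in the order met, if it is extended. For example $\mu^0_4(\rho_4,\rho_3,\rho_2,\rho_1)=U\iota_1$. *Gradings.* Let $G$ be the group of triples $(m;a,b)\in(\tfrac12\mathbb Z)^3$ with $a+b\in\mathbb Z$ and $m+\frac{(2a+1)(a+b+1)+1}{2}\in\mathbb Z$, with $(m;a,b)(n;c,d)=(m+n+ad-bc;a+c,b+d)$, and let $\Gamma=G\times\mathbb Z$. The $\Gamma$-grading $\gamma$ on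 $A$ is multiplicative on nonzero products of basis elements and given by $\gamma(\iota_j)=1$, $\gamma(\rho_1)=(-\frac12;\frac12,-\frac12)\times0$, $\gamma(\rho_2)=(-\frac12;\frac12,\frac12)\times 0$, $\gamma(\rho_3)=(-\frac12;-\frac12,\frac12)\times0$, $\gamma(\rho_4)=(-\frac32;-\frac12,-\frac12)\times1$, $\gamma(U)=(-2;0,0)\times1$. Put $\lambda_d=(1;0,0)\times0$ and $\lambda_w=(0;0,0)\times1$. *Weighted deformations.* A $\Gamma$-graded weighted deformation of $\mathcal A^0_-$ consists of $K$-bimodule maps $\mu_n^w\colon A^{\otimes_K n}\to A$ ($n,w\ge0$), zero for odd $n$ and homogeneous of degree $\lambda_d^{n-2}\lambda_w^w$, whose weight-zero operations are those of $\mathcal A^0_-$ (in particular $\mu^0_0=0$), which are strictly unital ($\mu_n^w$ vanishes if $(n,w)\ne(2,0)$ and an input lies in $K\cdot 1$), and which satisfy, for all $n,w$, $$\sum_{\substack{r+s+t=n\\u+v=w}}(-1)^{r+st}\mu^u_{r+1+t}\circ(\mathrm{Id}^{\otimes r}\otimes\mu_s^v\otimes\mathrm{Id}^{\otimes t})=0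 .$$ A $\Gamma$-graded homomorphism of deformations $f\colon\mu\to\bar\mu$ consists of $K$-bimodule maps $f_n^w\colon A^{\otimes_Kn}\to A$, zero for even $n$ and homogeneous of degree $\lambda_d^{n-1}\lambda_w^w$, with $f^0_1=\mathrm{Id}$, $f^0_n=0$ for $n\neq1$, $f_n^w=0$ for $w>0$ whenever an input lies in $K\cdot 1$, and $$\sum_{\substack{r+s+t=n\\u+v=w}}(-1)^{r+st}f^u_{r+1+t}\circ(\mathrm{Id}^{\otimes r}\otimes\mu_s^v\otimes\mathrm{Id}^{\otimes t})=\sum_{\substack{i_1+\cdots+i_m=n\\w_0+\cdots+w_m=w}}(-1)^{\sigma}\bar\mu_m^{w_0}\circ(f_{i_1}^{w_1}\otimes\cdots\otimes f_{i_m}^{w_m}),\quad \sigma=\sum_{k}(m-k)(i_k-1).$$ An isomorphism is a homomorphism of this kind with a two-sided inverse of this kind. **Theorem.** There is a $\Gamma$-graded weighted deformation of $\mathcal A_-^0$ with $$\mu^1_0=\rho_{1234}+\rho_{2341}+\rho_{3412}+\rho_{4123},$$ and any two such deformations are isomorphic, as $\Gamma$-graded weighted deformations of $\mathcal A_-^0$.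 -/

import Mathlib

open scoped RightActions

/-! ### Weighted `A_∞`-algebras over a commutative ground ring `K`

`A` is a `K`-bimodule, regarded as concentrated in even `ℤ/2`-degree.  A family of maps
`A^{⊗ n} → A` (tensor products over `K`), one for every `n ≥ 0`, is encoded as one function
`List A → A`, whose value on `[a₁, …, aₙ]` is the value of the `n`-input map on
`a₁ ⊗ ⋯ ⊗ aₙ`.  A weighted family `μ : ℕ → List A → A` has `μ w [a₁, …, aₙ] = μₙʷ(a₁, …, aₙ)`. -/

namespace WeightedAInf

section General

variable (K : Type*) {A : Type*} [CommRing K] [AddCommGroup A] [Module K A] [Module Kᵐᵒᵖ A]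

/-- `f` is a sequence of `K`-bimodule maps `A^{⊗_K n} → A`, `n ≥ 0`.  For `n = 0` this is a
bimodule map `K → A`, given by the image `f []` of `1`. -/
structure IsTensorMap (f : List A → A) : Prop where
  add : ∀ (l l' : List A) (a b : A), f (l ++ (a + b) :: l') = f (l ++ a :: l') + f (l ++ b :: l')
  balanced : ∀ (l l' : List A) (a b : A) (k : K),
    f (l ++ (a <• k) :: b :: l') = f (l ++ a :: (k •> b) :: l')
  left : ∀ (l : List A) (a : A) (k : K), f ((k •> a) :: l) = k •> f (a :: l)
  right : ∀ (l : List A) (a : A) (k : K), f (l ++ [a <• k]) = f (l ++ [a]) <• k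
  empty : ∀ k : K, k •> f [] = f [] <• k

/-- `∑_{n=r+s+t, w=u+v} (-1)^{r+st} f^u_{r+1+t} ∘ (Id^{⊗r} ⊗ g^v_s ⊗ Id^{⊗t})`, for `n` inputs.
No Koszul signs appear on elements since `A` is in even degree. -/
def insertion (f g : ℕ → List A → A) (w : ℕ) (l : List A) : A :=
  ∑ p ∈ Finset.HasAntidiagonal.antidiagonal w, ∑ r ∈ Finset.range (l.length + 1),
    ∑ s ∈ Finset.range (l.length - r + 1),
      (-1 : ℤ) ^ (r + s * (l.length - r - s)) •
        f p.1 (l.take r ++ g p.2 ((l.drop r).take s) :: l.drop (r + s))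

/-- The `k`-th of the consecutive blocks of lengths `i 0, i 1, …` into which `l` is cut. -/
def block {m : ℕ} (l : List A) (i : Fin m → ℕ) (k : Fin m) : List A :=
  (l.drop (∑ j ∈ Finset.univ.filter (· < k), i j)).take (i k)

/-- `∑ (-1)^σ g^{w₀}_m ∘ (f^{w₁}_{i₁} ⊗ ⋯ ⊗ f^{w_m}_{i_m})`, the sum over all `m ≥ 0`,
`n = i₁ + ⋯ + i_m` and `w = w₀ + ⋯ + w_m`, with `σ = ∑_k (m - k)(i_k - 1)`.  Blocks may be empty;
since `f⁰₀ = 0` in all uses, the terms with `m > n + w` vanish and are left out.  (The integer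
`i_k - 1` is replaced by `i_k + 1`, which has the same parity.) -/
def compose (g f : ℕ → List A → A) (w : ℕ) (l : List A) : A :=
  ∑ m ∈ Finset.range (l.length + w + 1), ∑ i ∈ Finset.Nat.antidiagonalTuple m l.length,
    ∑ v ∈ Finset.Nat.antidiagonalTuple (m + 1) w,
      (-1 : ℤ) ^ (∑ k : Fin m, (m - 1 - (k : ℕ)) * (i k + 1)) •
        g (v 0) (List.ofFn fun k : Fin m => f (v k.succ) (block l i k))

/-- The identity homomorphism. -/
def idHom : ℕ → List A → A
  | 0, [a] => a
  | _, _ => 0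

/-- `μ` is a (strictly unital) weighted `A_∞`-algebra structure on the `K`-bimodule `A`, with
unit `1 ∈ A`. -/
structure IsWeightedAInf [One A] (μ : ℕ → List A → A) : Prop where
  tensor : ∀ w, IsTensorMap K (μ w)
  /-- `μₙʷ` has `ℤ/2`-degree `n - 2`, and `A` is in even degree. -/
  parity : ∀ w (l : List A), Odd l.length → μ w l = 0
  /-- There is no curvature in weight `0`. -/
  uncurved : μ 0 [] = 0
  mul_unit : ∀ (a : A) (k : K), μ 0 [a, k •> (1 : A)] = a <• k
  unit_mul : ∀ (a : A) (k : K), μ 0 [k •> (1 : A), a] = k •> a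
  unital : ∀ w (l : List A), ¬ (w = 0 ∧ l.length = 2) → (∃ k : K, k •> (1 : A) ∈ l) → μ w l = 0
  relation : ∀ w (l : List A), insertion μ μ w l = 0

/-- `f` is homogeneous: it sends homogeneous `a₁, …, aₙ` of gradings `g₁, …, gₙ` to a homogeneous
element of grading `c n * (g₁ ⋯ gₙ)`. -/
def IsHomogeneousMap {Γ : Type*} [Group Γ] (𝒜 : Γ → AddSubgroup A) (c : ℕ → Γ)
    (f : List A → A) : Prop :=
  ∀ l : List (Γ × A), (∀ p ∈ l, p.2 ∈ 𝒜 p.1) →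
    f (l.map Prod.snd) ∈ 𝒜 (c l.length * (l.map Prod.fst).prod)

/-- `μₙʷ` has degree `λ_d^{n-2} λ_w^w`. -/
def IsGradedStructure {Γ : Type*} [Group Γ] (𝒜 : Γ → AddSubgroup A) (ld lw : Γ)
    (μ : ℕ → List A → A) : Prop :=
  ∀ w, IsHomogeneousMap 𝒜 (fun n => ld ^ ((n : ℤ) - 2) * lw ^ w) (μ w)

/-- `f` is a graded homomorphism of weighted deformations (of the same undeformed
`A_∞`-algebra) from `μ` to `μ'`: a strictly unital weighted `A_∞`-homomorphism whose weight `0`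
part is the identity and whose components `fₙʷ` have degree `λ_d^{n-1} λ_w^w`. -/
structure IsDeformationHom [One A] {Γ : Type*} [Group Γ] (𝒜 : Γ → AddSubgroup A) (ld lw : Γ)
    (μ μ' f : ℕ → List A → A) : Prop where
  tensor : ∀ w, IsTensorMap K (f w)
  /-- `fₙʷ` has `ℤ/2`-degree `n - 1`, and `A` is in even degree. -/
  parity : ∀ w (l : List A), Even l.length → f w l = 0
  weight_zero : f 0 = idHom 0
  unital : ∀ w (l : List A), 0 < w → (∃ k : K, k •> (1 : A) ∈ l) → f w l = 0
  graded : ∀ w, IsHomogeneousMap 𝒜 (fun n => ld ^ ((n : ℤ) - 1) * lw ^ w) (f w)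
  relation : ∀ w (l : List A), insertion f μ w l = compose μ' f w l

/-- `μ` and `μ'` are isomorphic as graded weighted deformations. -/
def DeformationIso [One A] {Γ : Type*} [Group Γ] (𝒜 : Γ → AddSubgroup A) (ld lw : Γ)
    (μ μ' : ℕ → List A → A) : Prop :=
  ∃ f g : ℕ → List A → A,
    IsDeformationHom K 𝒜 ld lw μ μ' f ∧ IsDeformationHom K 𝒜 ld lw μ' μ g ∧
    compose g f = idHom ∧ compose f g = idHom

end General

end WeightedAInf

namespace TorusAlgebra

/-! ### The bimodule underlying the torus algebra -/

/-- The ground ring `ℤ ⊕ ℤ`. -/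
abbrev Ground : Type := Fin 2 → ℤ

/-- The initial vertex of the arrow `ρ_i`: `ρ₁, ρ₃` go from `0` to `1`, and `ρ₂, ρ₄` from `1` to
`0`.  (Indices are in `ℤ/4`, so that `ρ₄` has index `0`.) -/
def source (i : ZMod 4) : Fin 2 := if i = 1 ∨ i = 3 then 0 else 1

/-- The basic elements of the path algebra with relations
`ρ₂ρ₁ = ρ₃ρ₂ = ρ₄ρ₃ = ρ₁ρ₄ = 0`: the idempotents `ι₀, ι₁`, and the chords
`reeb i n = ρ_{i,i+1,…,i+n} = ρ_i ρ_{i+1} ⋯ ρ_{i+n}`. -/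
inductive Basic : Type
  | idem (j : Fin 2)
  | reeb (i : ZMod 4) (n : ℕ)

namespace Basic

/-- Left idempotent. -/
def left : Basic → Fin 2
  | idem j => j
  | reeb i _ => source i

/-- Right idempotent. -/
def right : Basic → Fin 2
  | idem j => j
  | reeb i n => source (i + n + 1)

/-- The product of two basic elements; `none` stands for `0`. -/
def mul : Basic → Basic → Option Basic
  | idem j, b => if j = b.left then some b else none
  | reeb i n, idem j => if (reeb i n).right = j then some (reeb i n) else none
  | reeb i n, reeb i' n' => if i' = i + n + 1 then some (reeb i (n + n' + 1)) else none

end Basic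

/-- The free abelian group on the elements `U^m b`, where `m ≥ 0` and `b` is basic; the pair
`(m, b)` stands for `U^m b`. -/
def Alg : Type := (ℕ × Basic) →₀ ℤ

noncomputable section

instance : AddCommGroup Alg := inferInstanceAs (AddCommGroup ((ℕ × Basic) →₀ ℤ))

/-- The element `U^m b`. -/
def elt (m : ℕ) (b : Basic) : Alg := (Finsupp.single (m, b) 1 : (ℕ × Basic) →₀ ℤ)

/-- The coefficient of `a` at a basis element. -/
def coeff (a : Alg) (b : ℕ × Basic) : ℤ := (show (ℕ × Basic) →₀ ℤ from a) b

theorem alg_ext {a a' : Alg} (h : ∀ b, coeff a b = coeff a' b) : a = a' := Finsupp.ext h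

theorem coeff_add (a a' : Alg) (b : ℕ × Basic) : coeff (a + a') b = coeff a b + coeff a' b := rfl

theorem coeff_zero (b : ℕ × Basic) : coeff 0 b = 0 := rfl

/-- Multiplication of the coefficient at each basis element `b` by an integer `c b`. -/
def scale (c : ℕ × Basic → ℤ) (a : Alg) : Alg :=
  (Finsupp.onFinset (show (ℕ × Basic) →₀ ℤ from a).support (fun b => c b * coeff a b)
    (fun _ hb => Finsupp.mem_support_iff.2 (right_ne_zero_of_mul hb)) : (ℕ × Basic) →₀ ℤ)

theorem coeff_scale (c : ℕ × Basic → ℤ) (a : Alg) (b : ℕ × Basic) :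
    coeff (scale c a) b = c b * coeff a b := rfl

/-- The left action of the ground ring: `ι_j` acts by multiplication by the idempotent `ι_j`. -/
instance : SMul Ground Alg := ⟨fun k a => scale (fun b => k b.2.left) a⟩

/-- The right action of the ground ring. -/
instance : SMul Groundᵐᵒᵖ Alg := ⟨fun k a => scale (fun b => k.unop b.2.right) a⟩

theorem coeff_smul (k : Ground) (a : Alg) (b : ℕ × Basic) :
    coeff (k • a) b = k b.2.left * coeff a b := rfl

theorem coeff_op_smul (k : Groundᵐᵒᵖ) (a : Alg) (b : ℕ × Basic) :
    coeff (k • a) b = k.unop b.2.right * coeff a b := rfl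

instance : Module Ground Alg where
  one_smul a := alg_ext fun b => by simp [coeff_smul]
  mul_smul k k' a := alg_ext fun b => by simp [coeff_smul, mul_assoc]
  smul_zero k := alg_ext fun b => by simp [coeff_smul, coeff_zero]
  smul_add k a a' := alg_ext fun b => by simp [coeff_smul, coeff_add, mul_add]
  add_smul k k' a := alg_ext fun b => by simp [coeff_smul, coeff_add, add_mul]
  zero_smul a := alg_ext fun b => by simp [coeff_smul, coeff_zero]

instance : Module Groundᵐᵒᵖ Alg where
  one_smul a := alg_ext fun b => by simp [coeff_op_smul]
  mul_smul k k' a := alg_ext fun b => by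
    simp [coeff_op_smul, mul_assoc, mul_left_comm]
  smul_zero k := alg_ext fun b => by simp [coeff_op_smul, coeff_zero]
  smul_add k a a' := alg_ext fun b => by simp [coeff_op_smul, coeff_add, mul_add]
  add_smul k k' a := alg_ext fun b => by simp [coeff_op_smul, coeff_add, add_mul]
  zero_smul a := alg_ext fun b => by simp [coeff_op_smul, coeff_zero]

instance : SMulCommClass Ground Groundᵐᵒᵖ Alg where
  smul_comm k k' a := alg_ext fun b => by
    simp [coeff_smul, coeff_op_smul, mul_left_comm]

/-- The unit is `ι₀ + ι₁`. -/
instance : One Alg := ⟨elt 0 (.idem 0) + elt 0 (.idem 1)⟩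

/-! ### The undeformed algebra: counting tree-like tiling patterns -/

/-- Rooted plane trees all of whose internal vertices have valence `4`; the root edge comes from
below, and the three other edges at an internal vertex are ordered. -/
inductive PlaneTree : Type
  | leaf
  | node (t₁ t₂ t₃ : PlaneTree)

namespace PlaneTree

/-- The number of internal vertices. -/
def size : PlaneTree → ℕ
  | leaf => 0
  | node t₁ t₂ t₃ => t₁.size + t₂.size + t₃.size + 1

/-- Walk around the tree, starting and ending at the root edge, and record the labels of the
sectors that are passed, and a mark `none` for each leaf.  The argument `x` is the label of the
first sector of the lowest internal vertex.  The labels of the consecutive sectors around a vertex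
decrease by `1`; the labels of the two sectors before and after passing along an internal edge
increase by `1`. -/
def walk : PlaneTree → ZMod 4 → List (Option (ZMod 4))
  | leaf, _ => [none]
  | node t₁ t₂ t₃, x =>
      [some x] ++ t₁.walk (x + 1) ++ [some (x - 1)] ++ t₂.walk x ++
        [some (x - 2)] ++ t₃.walk (x - 1) ++ [some (x - 3)]

end PlaneTree

/-- A tiling pattern may be centered, or be extended by `k + 1` vertices of valence `2` on the root
edge, with distinguished sectors either on the side of the root edge that is passed first
(`right k`) or on the side that is passed last (`left k`). -/
inductive Extension : Type
  | centered
  | right (k : ℕ)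
  | left (k : ℕ)

/-- A tiling pattern of weight `0`, i.e. one whose underlying graph is a tree.  The tree has at
least one internal vertex of valence `4`; the lowest one has the three subtrees `t₁, t₂, t₃`.  The
labelling is determined by the label of the first sector of that vertex. -/
structure TilingPattern : Type where
  t₁ : PlaneTree
  t₂ : PlaneTree
  t₃ : PlaneTree
  label : ZMod 4
  ext : Extension

/-- The labels of the chord `ρ_{i,…,i+n}`. -/
def letters (i : ZMod 4) (n : ℕ) : List (Option (ZMod 4)) :=
  (List.range (n + 1)).map fun j => some (i + (j : ZMod 4))

namespace TilingPattern

/-- The underlying tree of the pattern, without the vertices of valence `2`. -/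
def tree (P : TilingPattern) : PlaneTree := .node P.t₁ P.t₂ P.t₃

/-- The distinguished sectors (by their labels) and the leaves other than the root (marked
`none`), in the order in which they are met along the boundary of the disk, starting at the
root. -/
def walk (P : TilingPattern) : List (Option (ZMod 4)) :=
  match P.ext with
  | .centered => P.tree.walk P.label
  | .right k => letters (P.label - (k + 1)) k ++ P.tree.walk P.label
  | .left k => P.tree.walk P.label ++ letters (P.label - 2) k

/-- `P` has chord sequence `ρ^1 ⊗ ⋯ ⊗ ρ^n`, where the list consists of the pairs `(i, m)` that
describe the chords `ρ_{i,…,i+m}`: between consecutive leaves one reads the labels of one chord. -/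
def HasChordSequence (P : TilingPattern) (c : List (ZMod 4 × ℕ)) : Prop :=
  P.walk = List.intercalate [none] (c.map fun p => letters p.1 p.2)

/-- The output element is `U^d` times this basic element, `d` being the number of vertices of
valence `4`. -/
def output (P : TilingPattern) : Basic :=
  match P.ext with
  | .centered => .idem (source P.label)
  | .right k => .reeb (P.label - (k + 1)) k
  | .left k => .reeb (P.label - 2) k

end TilingPattern

theorem PlaneTree.walk_injective (t t' : PlaneTree) (x : ZMod 4)
    (r r' : List (Option (ZMod 4))) (h : t.walk x ++ r = t'.walk x ++ r') : t = t' ∧ r = r' := by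
  induction t generalizing t' x r r' with
  | leaf => cases t' <;> simp_all [PlaneTree.walk]
  | node t₁ t₂ t₃ h₁ h₂ h₃ =>
    cases t' with
    | leaf => simp [PlaneTree.walk] at h
    | node s₁ s₂ s₃ =>
      simp only [PlaneTree.walk, List.append_assoc, List.cons_append, List.nil_append,
        List.cons.injEq, true_and] at h
      obtain ⟨rfl, h1⟩ := h₁ _ _ _ _ h
      simp only [List.cons.injEq, true_and] at h1
      obtain ⟨rfl, h2⟩ := h₂ _ _ _ _ h1
      simp only [List.cons.injEq, true_and] at h2
      obtain ⟨rfl, h3⟩ := h₃ _ _ _ _ h2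
      simp only [List.cons.injEq, true_and] at h3
      exact ⟨rfl, h3⟩

/-- Only finitely many tiling patterns have a given chord sequence. -/
theorem finite_patterns (c : List (ZMod 4 × ℕ)) :
    {P : TilingPattern | P.HasChordSequence c}.Finite := by
  set w := List.intercalate [none] (c.map fun p => letters p.1 p.2) with hw
  have hfin : ((Set.univ : Set (ZMod 4)) ×ˢ ({Extension.centered} ∪
      (Extension.right '' Set.Iio w.length ∪ Extension.left '' Set.Iio w.length))).Finite :=
    Set.finite_univ.prod ((Set.finite_singleton _).union
      (((Set.finite_Iio _).image _).union ((Set.finite_Iio _).image _)))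
  refine Set.Finite.of_injOn (f := fun P => (P.label, P.ext)) ?_ ?_ hfin
  · rintro ⟨t₁, t₂, t₃, x, e⟩ hP
    have hP : TilingPattern.walk _ = w := hP
    have hl := congrArg List.length hP
    cases e <;> simp [TilingPattern.walk, letters] at hl ⊢ <;> omega
  · rintro ⟨t₁, t₂, t₃, x, e⟩ hP ⟨s₁, s₂, s₃, y, e'⟩ hQ h
    obtain ⟨rfl, rfl⟩ := Prod.mk.inj h
    have hPQ := (show TilingPattern.walk _ = w from hP).trans
      (show TilingPattern.walk _ = w from hQ).symm
    have key : PlaneTree.node t₁ t₂ t₃ = PlaneTree.node s₁ s₂ s₃ := by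
      cases e with
      | centered =>
        exact (PlaneTree.walk_injective _ _ x [] [] (by simpa [TilingPattern.walk,
          TilingPattern.tree] using hPQ)).1
      | right k =>
        exact (PlaneTree.walk_injective _ _ x [] [] (by simpa [TilingPattern.walk,
          TilingPattern.tree] using hPQ)).1
      | left k =>
        exact (PlaneTree.walk_injective _ _ x _ _ hPQ).1
    cases key
    rfl

/-- The sum of `U^m` times the output elements of all the tiling patterns of weight `0` with chord
sequence `c`. -/
def countPatterns (m : ℕ) (c : List (ZMod 4 × ℕ)) : Alg :=
  ∑ᶠ (P : TilingPattern) (_ : P.HasChordSequence c), elt (m + P.tree.size) P.output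

/-- The chords in a list of basis elements, if all of them are (`U`-multiples of) chords. -/
def toChords : List (ℕ × Basic) → Option (List (ZMod 4 × ℕ))
  | [] => some []
  | (_, .idem _) :: _ => none
  | (_, .reeb i n) :: l => (toChords l).map fun c => (i, n) :: c

/-- The undeformed operations on basis elements `U^m b`.  They are `U`-multilinear, the
two-input operation is the product, and the other ones count tiling patterns and vanish if an
input is a `U`-multiple of an idempotent. -/
def undefBasic : List (ℕ × Basic) → Alg
  | [(m, b), (m', b')] => (b.mul b').elim 0 (elt (m + m'))
  | l => (toChords l).elim 0 (countPatterns (l.map Prod.fst).sum)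

/-- The multilinear extension of a function of lists of basis elements. -/
def extend : (List (ℕ × Basic) → Alg) → List Alg → Alg
  | F, [] => F []
  | F, a :: l => Finsupp.sum (show (ℕ × Basic) →₀ ℤ from a)
      fun b c => c • extend (fun bs => F (b :: bs)) l

/-- The operations `μ⁰ₙ` of the undeformed `A_∞`-algebra. -/
def undef : List Alg → Alg := extend undefBasic

/-! ### Gradings -/

/-- Triples `(m; a, b)` with
`(m; a, b) · (n; c, d) = (m + n + ad - bc; a + c, b + d)`. -/
@[ext] structure Triple : Type where
  m : ℚ
  a : ℚ
  b : ℚ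

namespace Triple

instance : Group Triple where
  mul g h := ⟨g.m + h.m + (g.a * h.b - g.b * h.a), g.a + h.a, g.b + h.b⟩
  one := ⟨0, 0, 0⟩
  inv g := ⟨-g.m, -g.a, -g.b⟩
  mul_assoc g h k := by
    apply Triple.ext
    · change (g.m + h.m + (g.a * h.b - g.b * h.a)) + k.m +
        ((g.a + h.a) * k.b - (g.b + h.b) * k.a) = g.m + (h.m + k.m + (h.a * k.b - h.b * k.a)) +
        (g.a * (h.b + k.b) - g.b * (h.a + k.a))
      ring
    · exact add_assoc _ _ _
    · exact add_assoc _ _ _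
  one_mul g := by
    apply Triple.ext
    · change 0 + g.m + (0 * g.b - 0 * g.a) = g.m
      ring
    · exact zero_add _
    · exact zero_add _
  mul_one g := by
    apply Triple.ext
    · change g.m + 0 + (g.a * 0 - g.b * 0) = g.m
      ring
    · exact add_zero _
    · exact add_zero _
  inv_mul_cancel g := by
    apply Triple.ext
    · change -g.m + g.m + (-g.a * g.b - -g.b * g.a) = 0
      ring
    · exact neg_add_cancel _
    · exact neg_add_cancel _

theorem mul_def (g h : Triple) :
    g * h = ⟨g.m + h.m + (g.a * h.b - g.b * h.a), g.a + h.a, g.b + h.b⟩ := rfl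

theorem inv_def (g : Triple) : g⁻¹ = ⟨-g.m, -g.a, -g.b⟩ := rfl

end Triple

/-- `x` is an integer. -/
def IsInt (x : ℚ) : Prop := ∃ z : ℤ, x = z

/-- `x ∈ ½ℤ`. -/
def IsHalfInt (x : ℚ) : Prop := IsInt (2 * x)

/-- Membership in the intermediate grading group: `m, a, b ∈ ½ℤ`, `a + b ∈ ℤ` and
`m + ((2a + 1)(a + b + 1) + 1) / 2 ∈ ℤ`. -/
def InG (g : Triple) : Prop :=
  IsHalfInt g.m ∧ IsHalfInt g.a ∧ IsHalfInt g.b ∧ IsInt (g.a + g.b) ∧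
    IsInt (g.m + ((2 * g.a + 1) * (g.a + g.b + 1) + 1) / 2)

theorem inG_iff (g : Triple) : InG g ↔ ∃ x y z : ℤ, g.a = x / 2 ∧ g.a + g.b = y ∧
    g.m + ((x + 1 : ℤ) * (y + 1 : ℤ) + 1) / 2 = z := by
  constructor
  · rintro ⟨-, ⟨x, hx⟩, -, ⟨y, hy⟩, ⟨z, hz⟩⟩
    refine ⟨x, y, z, by linarith, hy, ?_⟩
    rw [← hz, hy, hx]; push_cast; ring
  · rintro ⟨x, y, z, hx, hy, hz⟩
    refine ⟨⟨2 * z - ((x + 1) * (y + 1) + 1), ?_⟩, ⟨x, by linarith⟩, ⟨2 * y - x, ?_⟩, ⟨y, hy⟩,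
      ⟨z, ?_⟩⟩
    · push_cast at hz ⊢; linarith
    · push_cast; linarith
    · rw [← hz, hy, hx]; push_cast; ring

/-- The intermediate grading group `G`. -/
def G : Subgroup Triple where
  carrier := {g | InG g}
  one_mem' := (inG_iff _).2 ⟨0, 0, 1, by change (0 : ℚ) = _; norm_num,
    by change (0 : ℚ) + 0 = _; norm_num, by change (0 : ℚ) + _ = _; norm_num⟩
  mul_mem' := by
    intro g h hg hh
    obtain ⟨x, y, z, h1, h2, h3⟩ := (inG_iff _).1 hg
    obtain ⟨x', y', z', h1', h2', h3'⟩ := (inG_iff _).1 hh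
    have hb : g.b = y - x / 2 := by linarith
    have hb' : h.b = y' - x' / 2 := by linarith
    refine (inG_iff _).2 ⟨x + x', y + y', z + z' + x * y' - 1, ?_, ?_, ?_⟩
    · simp only [Triple.mul_def]; push_cast; linarith
    · simp only [Triple.mul_def]; push_cast; linarith
    · simp only [Triple.mul_def]
      rw [hb, hb', h1, h1']
      push_cast at h3 h3' ⊢
      linear_combination h3 + h3'
  inv_mem' := by
    intro g hg
    obtain ⟨x, y, z, h1, h2, h3⟩ := (inG_iff _).1 hg
    refine (inG_iff _).2 ⟨-x, -y, -z + x * y + 2, ?_, ?_, ?_⟩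
    · simp only [Triple.inv_def]; push_cast; linarith
    · simp only [Triple.inv_def]; push_cast; linarith
    · simp only [Triple.inv_def]
      push_cast at h3 ⊢
      linear_combination -h3

/-- `Γ = G × ℤ`. -/
abbrev Gam : Type := G × Multiplicative ℤ

/-- `gr(ρ_i)`: `(-1/2; 1/2, -1/2)`, `(-1/2; 1/2, 1/2)`, `(-1/2; -1/2, 1/2)` and
`(-3/2; -1/2, -1/2)` for `i = 1, 2, 3, 4`. -/
def grRho (i : ZMod 4) : G :=
  if i = 1 then ⟨⟨-1/2, 1/2, -1/2⟩, (inG_iff _).2 ⟨1, 0, 1, by norm_num⟩⟩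
  else if i = 2 then ⟨⟨-1/2, 1/2, 1/2⟩, (inG_iff _).2 ⟨1, 1, 2, by norm_num⟩⟩
  else if i = 3 then ⟨⟨-1/2, -1/2, 1/2⟩, (inG_iff _).2 ⟨-1, 0, 0, by norm_num⟩⟩
  else ⟨⟨-3/2, -1/2, -1/2⟩, (inG_iff _).2 ⟨-1, -1, -1, by norm_num⟩⟩

/-- `γ(ρ_i) = gr(ρ_i) × win(ρ_i)`, where the winding number `win` is the multiplicity
of `ρ₄`. -/
def gammaRho (i : ZMod 4) : Gam := (grRho i, Multiplicative.ofAdd (if i = 0 then 1 else 0))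

/-- `γ(U) = (-2; 0, 0) × 1`. -/
def gammaU : Gam :=
  (⟨⟨-2, 0, 0⟩, (inG_iff _).2 ⟨0, 0, -1, by norm_num⟩⟩, Multiplicative.ofAdd 1)

/-- `λ_d = (1; 0, 0) × 0`. -/
def lamD : Gam :=
  (⟨⟨1, 0, 0⟩, (inG_iff _).2 ⟨0, 0, 2, by norm_num⟩⟩, Multiplicative.ofAdd 0)

/-- `λ_w = (0; 0, 0) × 1`. -/
def lamW : Gam := (1, Multiplicative.ofAdd 1)

/-- The grading of a basic element; `γ` is multiplicative. -/
def gammaBasic : Basic → Gam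
  | .idem _ => 1
  | .reeb i n => ((List.range (n + 1)).map fun j => gammaRho (i + (j : ZMod 4))).prod

/-- The homogeneous elements of grading `g`: the combinations of the `U^m b` of grading
`γ(U)^m γ(b) = g`. -/
def homog (g : Gam) : AddSubgroup Alg where
  carrier := {a | ∀ b, coeff a b ≠ 0 → gammaU ^ b.1 * gammaBasic b.2 = g}
  zero_mem' := fun _ h => absurd (coeff_zero _) h
  add_mem' := by
    intro a a' h h' b hb
    by_cases h0 : coeff a b = 0
    · exact h' b fun h1 => hb (by rw [coeff_add, h0, h1, add_zero])
    · exact h b h0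
  neg_mem' := fun h b hb => h b fun h0 => hb (neg_eq_zero.2 h0)

/-! ### Weighted deformations of the torus algebra -/

/-- `ρ₁₂₃₄ + ρ₂₃₄₁ + ρ₃₄₁₂ + ρ₄₁₂₃`. -/
def curvatureElt : Alg := 
  elt 0 (.reeb 1 3) + elt 0 (.reeb 2 3) + elt 0 (.reeb 3 3) + elt 0 (.reeb 4 3)

/-- `μ` is a `Γ`-graded weighted deformation of the undeformed algebra, with
`μ¹₀ = ρ₁₂₃₄ + ρ₂₃₄₁ + ρ₃₄₁₂ + ρ₄₁₂₃`. -/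
structure IsDeformation (μ : ℕ → List Alg → Alg) : Prop where
  weighted : WeightedAInf.IsWeightedAInf Ground μ
  undeformed : μ 0 = undef
  graded : WeightedAInf.IsGradedStructure homog lamD lamW μ
  curvature : μ 1 [] = curvatureElt

end

end TorusAlgebra

/-! ### Sums over deconcatenations of a list -/

namespace BarConstruction

section SplitSum

variable {α N N' : Type*} [AddCommGroup N] [AddCommGroup N']

/-! All operations of all weights are packed into one cochain M on lists of basis elements. The
weight of a coefficient can be read off from winding numbers, so nothing is lost (`part`,
`exists_total`). The A∞-relations of all weights become the single equation `circ M M = 0`, saying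
that a coderivation of the tensor coalgebra squares to zero. Homomorphisms become coalgebra maps
with identity linear part, and these are invertible by a geometric series.

Write M = μ₂ + h, and give a coefficient of weight w with n inputs the order n - 1 + 3w. The product
has order 1, the curvature order 2, and the operations counting tiling patterns have order at least
3, so h has order at least 2. To leading order, the equations for a deformation and for a
homomorphism are therefore governed by the Hochschild differential `hdiff` of the product alone. The
leading part of the error is a Hochschild cocycle (`gr_hdiff_circ`, `gr_hdiff_error`), and
subtracting a primitive of it from the candidate raises the order of the error. For given inputs the
gradings bound the weight (`exists_bound`), so the corrections stabilise on every list and the limit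
solves the equation exactly.

The cohomological input is `exists_hdiff_eq`. Apart from the central variable U, the algebra has the
monomial relations ρ_i ρ_{i-1} = 0. A matching of Anick type on the bar complex (`Active`,
`splitEntry`) leaves unmatched only the chains ρ_i, ρ_{i-1}, ρ_{i-2}, … and such chains followed by
one U. Hence a normalized cocycle is a coboundary if it vanishes on chains and on chains with one U
inserted. The gradings nearly force this in positive weight (`degRel_chain`, `degRel_chain_U`). The
obstruction to a deformation can be nonzero only on chains of length 1 or 3 and on U alone, in
weight 1. The obstruction to a homomorphism can be nonzero only on the empty list.

For existence, the remaining obstructions vanish because the prescribed curvature commutes with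
every ρ_i and with U, and because its insertions into μ₄ along a chain of length three cancel
(`circ_und_curv_chain_three`). For uniqueness, the value on the empty list vanishes because the two
curvatures agree.

The relations of the undeformed algebra (`circ_und_und`) follow from the same triangularity. They
need to be verified only on lists that are not `Active`. There the cancellation is `high_merge`,
which describes how a tiling pattern is cut at the sector where the first letter of a chord is split
off. -/

/-- The sum of `Φ p s` over all decompositions `l = p ++ s`. -/
def splitSum : List α → (List α → List α → N) → N
  | [], Φ => Φ [] []
  | b :: l, Φ => Φ [] (b :: l) + splitSum l fun p s => Φ (b :: p) s

@[simp] theorem splitSum_nil (Φ : List α → List α → N) : splitSum [] Φ = Φ [] [] := rfl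

theorem splitSum_cons (b : α) (l : List α) (Φ : List α → List α → N) :
    splitSum (b :: l) Φ = Φ [] (b :: l) + splitSum l fun p s => Φ (b :: p) s := rfl

theorem splitSum_congr {l : List α} {Φ Ψ : List α → List α → N}
    (h : ∀ p s, p ++ s = l → Φ p s = Ψ p s) : splitSum l Φ = splitSum l Ψ := by
  induction l generalizing Φ Ψ with
  | nil => exact h _ _ rfl
  | cons b l ih =>
    rw [splitSum_cons, splitSum_cons, h [] (b :: l) rfl]
    congr 1
    exact ih fun p s hps => h _ _ (by rw [List.cons_append, hps])

theorem splitSum_zero (l : List α) : splitSum l (fun _ _ => (0 : N)) = 0 := by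
  induction l with
  | nil => rfl
  | cons b l ih => rw [splitSum_cons, ih, add_zero]

theorem splitSum_eq_zero {l : List α} {Φ : List α → List α → N}
    (h : ∀ p s, p ++ s = l → Φ p s = 0) : splitSum l Φ = 0 := by
  rw [splitSum_congr h, splitSum_zero]

theorem splitSum_eq_single {l : List α} {Φ : List α → List α → N} (p s : List α) (hl : p ++ s = l)
    (h : ∀ p' s', p' ++ s' = l → p' ≠ p → Φ p' s' = 0) : splitSum l Φ = Φ p s := by
  induction l generalizing Φ p with
  | nil =>
    obtain ⟨rfl, rfl⟩ := List.append_eq_nil_iff.1 hl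
    rfl
  | cons b l ih =>
    rw [splitSum_cons]
    cases p with
    | nil =>
      rw [List.nil_append] at hl
      rw [← hl, splitSum_eq_zero, add_zero]
      intro p' s' h'
      exact h _ _ (by rw [List.cons_append, h']) (by simp)
    | cons c p =>
      rw [List.cons_append, List.cons.injEq] at hl
      obtain ⟨rfl, hl⟩ := hl
      rw [h [] (c :: l) rfl (by simp), zero_add, ih p hl]
      intro p' s' h' hp
      exact h _ _ (by rw [List.cons_append, h']) (by simpa using hp)

theorem exists_of_splitSum_ne_zero {l : List α} {Φ : List α → List α → N}
    (h : splitSum l Φ ≠ 0) : ∃ p s, p ++ s = l ∧ Φ p s ≠ 0 := by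
  by_contra! H
  exact h (splitSum_eq_zero H)

theorem splitSum_add (l : List α) (Φ Ψ : List α → List α → N) :
    splitSum l (fun p s => Φ p s + Ψ p s) = splitSum l Φ + splitSum l Ψ := by
  induction l generalizing Φ Ψ with
  | nil => rfl
  | cons b l ih => rw [splitSum_cons, ih, splitSum_cons, splitSum_cons]; abel

theorem map_splitSum {F : Type*} [FunLike F N N'] [AddMonoidHomClass F N N'] (f : F)
    (l : List α) (Φ : List α → List α → N) :
    f (splitSum l Φ) = splitSum l fun p s => f (Φ p s) := by
  induction l generalizing Φ with
  | nil => rfl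
  | cons b l ih => rw [splitSum_cons, map_add, ih, splitSum_cons]

theorem splitSum_neg (l : List α) (Φ : List α → List α → N) :
    splitSum l (fun p s => -Φ p s) = -splitSum l Φ :=
  (map_splitSum (-AddMonoidHom.id N) l Φ).symm

theorem splitSum_sub (l : List α) (Φ Ψ : List α → List α → N) :
    splitSum l (fun p s => Φ p s - Ψ p s) = splitSum l Φ - splitSum l Ψ := by
  simp only [sub_eq_add_neg, splitSum_add, splitSum_neg]

theorem splitSum_finset_sum {ι : Type*} (t : Finset ι) (l : List α)
    (Φ : ι → List α → List α → N) :
    splitSum l (fun p s => ∑ i ∈ t, Φ i p s) = ∑ i ∈ t, splitSum l (Φ i) := by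
  induction l generalizing Φ with
  | nil => rfl
  | cons b l ih => simp only [splitSum_cons, ih, Finset.sum_add_distrib]

/-- Both sides run over the decompositions of `l` into three consecutive pieces. -/
theorem splitSum_assoc (l : List α) (g : List α → List α → List α → N) :
    (splitSum l fun p s => splitSum s fun s₁ s₂ => g p s₁ s₂) =
      splitSum l fun q s₂ => splitSum q fun p s₁ => g p s₁ s₂ := by
  induction l generalizing g with
  | nil => rfl
  | cons b l ih =>
    rw [splitSum_cons, ih, splitSum_cons, splitSum_cons]
    simp only [splitSum_cons, splitSum_nil, splitSum_add]
    abel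

theorem splitSum_eq_sum (l : List α) (Φ : List α → List α → N) :
    splitSum l Φ = ∑ r ∈ Finset.range (l.length + 1), Φ (l.take r) (l.drop r) := by
  induction l generalizing Φ with
  | nil => simp
  | cons b l ih =>
    rw [splitSum_cons, ih, List.length_cons, Finset.sum_range_succ' _ (l.length + 1), add_comm]
    simp

end SplitSum

/-! ### Linear extensions and the tensor coalgebra -/

noncomputable section Tensor

variable {B X : Type} {N N' : Type*} [AddCommGroup N] [AddCommGroup N']

/-- The free abelian group on `B`. -/
abbrev Vec (B : Type) : Type := B →₀ ℤ

/-- The tensor coalgebra on `Vec B`. -/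
abbrev Ten (B : Type) : Type := List B →₀ ℤ

/-- The linear extension of a function on a basis. -/
def lin (φ : X → N) : (X →₀ ℤ) →ₗ[ℤ] N := Finsupp.linearCombination ℤ φ

/-- The basis element of a free abelian group. -/
abbrev bas (x : X) : X →₀ ℤ := Finsupp.single x 1

@[simp] theorem lin_bas (φ : X → N) (x : X) : lin φ (bas x) = φ x := by
  simp [lin, Finsupp.linearCombination_single]

theorem lin_apply (φ : X → N) (v : X →₀ ℤ) : lin φ v = ∑ x ∈ v.support, v x • φ x := rfl

theorem linear_ext {f g : (X →₀ ℤ) →ₗ[ℤ] N} (h : ∀ x, f (bas x) = g (bas x)) : f = g :=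
  Finsupp.lhom_ext' fun x => LinearMap.ext_ring (h x)

theorem linear_ext_apply (f g : (X →₀ ℤ) →ₗ[ℤ] N) (h : ∀ x, f (bas x) = g (bas x))
    (v : X →₀ ℤ) : f v = g v := by rw [linear_ext h]

theorem map_lin (f : N →ₗ[ℤ] N') (φ : X → N) (v : X →₀ ℤ) :
    f (lin φ v) = lin (fun x => f (φ x)) v :=
  linear_ext_apply (f ∘ₗ lin φ) _ (fun x => by simp) v

theorem lin_add_fun (φ ψ : X → N) (v : X →₀ ℤ) :
    lin (fun x => φ x + ψ x) v = lin φ v + lin ψ v :=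
  linear_ext_apply (lin fun x => φ x + ψ x) (lin φ + lin ψ) (fun x => by simp) v

theorem lin_sub_fun (φ ψ : X → N) (v : X →₀ ℤ) :
    lin (fun x => φ x - ψ x) v = lin φ v - lin ψ v :=
  linear_ext_apply (lin fun x => φ x - ψ x) (lin φ - lin ψ) (fun x => by simp) v

theorem lin_smul_fun (c : ℤ) (φ : X → N) (v : X →₀ ℤ) :
    lin (fun x => c • φ x) v = c • lin φ v :=
  linear_ext_apply (lin fun x => c • φ x) (c • lin φ) (fun x => by simp) v

@[simp] theorem lin_zero_fun (v : X →₀ ℤ) : lin (fun _ => (0 : N)) v = 0 :=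
  linear_ext_apply (lin fun _ => 0) 0 (fun x => by simp) v

@[simp] theorem lin_bas_fun (v : X →₀ ℤ) : lin (fun x => bas x) v = v :=
  linear_ext_apply (lin fun x => bas x) LinearMap.id (fun x => by simp) v

theorem lin_congr {φ ψ : X → N} {v : X →₀ ℤ} (h : ∀ x, v x ≠ 0 → φ x = ψ x) :
    lin φ v = lin ψ v := by
  rw [lin_apply, lin_apply]
  exact Finset.sum_congr rfl fun x hx => by rw [h x (Finsupp.mem_support_iff.1 hx)]

theorem lin_eq_zero {φ : X → N} {v : X →₀ ℤ} (h : ∀ x, v x ≠ 0 → φ x = 0) : lin φ v = 0 := by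
  rw [lin_congr h, lin_zero_fun]

theorem lin_splitSum {α : Type*} (l : List α) (Φ : X → List α → List α → N) (v : X →₀ ℤ) :
    lin (fun x => splitSum l (Φ x)) v = splitSum l fun p s => lin (fun x => Φ x p s) v := by
  induction l generalizing Φ with
  | nil => rfl
  | cons b l ih => simp only [splitSum_cons, lin_add_fun, ih]

theorem exists_of_lin_ne_zero {Y : Type} {φ : X → (Y →₀ ℤ)} {v : X →₀ ℤ} {y : Y}
    (h : lin φ v y ≠ 0) : ∃ x, v x ≠ 0 ∧ φ x y ≠ 0 := by
  by_contra! H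
  apply h
  rw [lin_apply, Finsupp.finsetSum_apply]
  refine Finset.sum_eq_zero fun x hx => ?_
  rw [Finsupp.smul_apply, H x (Finsupp.mem_support_iff.1 hx), smul_zero]

theorem lin_comm {Y : Type} (Ψ : X → Y → N) (v : X →₀ ℤ) (w : Y →₀ ℤ) :
    lin (fun x => lin (Ψ x) w) v = lin (fun y => lin (fun x => Ψ x y) v) w := by
  simp only [lin_apply, Finset.smul_sum]
  rw [Finset.sum_comm]
  exact Finset.sum_congr rfl fun y _ => Finset.sum_congr rfl fun x _ => smul_comm _ _ _

/-- Concatenation of an element of `Vec B` and a tensor. -/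
def cns : Vec B →ₗ[ℤ] Ten B →ₗ[ℤ] Ten B := lin fun b => lin fun l => bas (b :: l)

@[simp] theorem cns_bas (b : B) (l : List B) : cns (bas b) (bas l) = bas (b :: l) := by simp [cns]

theorem cns_bas_left (b : B) (x : Ten B) : cns (bas b) x = lin (fun l => bas (b :: l)) x := by
  simp [cns]

theorem cns_bas_right (v : Vec B) (l : List B) : cns v (bas l) = lin (fun b => bas (b :: l)) v :=
  linear_ext_apply (cns.flip (bas l)) (lin _) (fun x => by simp) v

theorem lin_cns (φ : List B → N) (v : Vec B) (x : Ten B) :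
    lin φ (cns v x) = lin (fun b => lin (fun l => φ (b :: l)) x) v := by
  refine linear_ext_apply (lin φ ∘ₗ cns.flip x) (lin _) (fun b => ?_) v
  simp only [LinearMap.coe_comp, Function.comp_apply, LinearMap.flip_apply, lin_bas]
  rw [cns_bas_left, map_lin]
  simp

theorem exists_of_cns_ne_zero {v : Vec B} {x : Ten B} {l : List B} (h : cns v x l ≠ 0) :
    ∃ b t, l = b :: t ∧ v b ≠ 0 ∧ x t ≠ 0 := by
  have h' : lin (fun b => lin (fun l => bas (b :: l)) x) v l ≠ 0 := by
    rwa [← lin_cns, lin_bas_fun]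
  obtain ⟨b, hb, h₁⟩ := exists_of_lin_ne_zero h'
  obtain ⟨t, ht, h₂⟩ := exists_of_lin_ne_zero h₁
  refine ⟨b, t, ?_, hb, ht⟩
  by_contra hne
  exact h₂ (Finsupp.single_eq_of_ne hne)

/-- A bilinear extension. -/
def bil (Φ : List B → List B → N) (x y : Ten B) : N := lin (fun p => lin (Φ p) y) x

/-- The pairing of a function on pairs of lists with the deconcatenation coproduct. -/
def copair (Φ : List B → List B → N) : Ten B →ₗ[ℤ] N := lin fun l => splitSum l Φ

@[simp] theorem copair_bas (Φ : List B → List B → N) (l : List B) :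
    copair Φ (bas l) = splitSum l Φ := by simp [copair]

/-- A cut of `v ⊗ x` is either in front of `v`, or is a cut of `x` with `v` added to its first
piece. -/
theorem copair_cns (Φ : List B → List B → N) (v : Vec B) (x : Ten B) :
    copair Φ (cns v x) =
      lin (Φ []) (cns v x) + copair (fun p s => lin (fun b => Φ (b :: p) s) v) x := by
  simp only [copair, lin_cns, splitSum_cons, lin_add_fun, ← lin_splitSum]
  congr 1
  exact lin_comm _ _ _

end Tensor

end BarConstruction

/-! ### Coderivations of the tensor coalgebra -/

namespace BarConstruction

noncomputable section Coderivation

variable {B : Type} {N : Type*} [AddCommGroup N]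

/-- Apply `c` to all the initial segments of a list. -/
def applyPrefix (c : List B → Vec B) (l : List B) : Ten B :=
  splitSum l fun p s => cns (c p) (bas s)

/-- The coderivation of the tensor coalgebra with corestriction `c`, with the signs of an odd
operation on odd inputs. -/
def coder (c : List B → Vec B) : List B → Ten B
  | [] => applyPrefix c []
  | b :: l => applyPrefix c (b :: l) - cns (bas b) (coder c l)

theorem coder_nil (c : List B → Vec B) : coder c [] = applyPrefix c [] := rfl

theorem coder_cons (c : List B → Vec B) (b : B) (l : List B) :
    coder c (b :: l) = applyPrefix c (b :: l) - cns (bas b) (coder c l) := rfl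

/-- A cut of `c(q) ⊗ s` lies in front of the new entry or behind it. In the second case it comes
from a cut of the input list behind `q`. -/
theorem copair_applyPrefix (Φ : List B → List B → N) (c : List B → Vec B) (l : List B) :
    copair Φ (applyPrefix c l) = lin (Φ []) (applyPrefix c l) +
      splitSum l fun q s => lin (fun p => Φ p s) (applyPrefix c q) := by
  simp only [applyPrefix, map_splitSum, copair_cns, splitSum_add, copair_bas]
  congr 1
  rw [splitSum_assoc]
  simp only [cns_bas_right, map_lin, lin_bas]

/-- The co-Leibniz rule: the operation acts on one side of the cut, and the sign comes from moving
an odd operation past the odd entries of the left piece. -/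
theorem copair_coder (Φ : List B → List B → N) (c : List B → Vec B) (l : List B) :
    copair Φ (coder c l) = splitSum l fun p s => lin (fun p' => Φ p' s) (coder c p) +
      (-1 : ℤ) ^ p.length • lin (Φ p) (coder c s) := by
  induction l generalizing Φ with
  | nil => simp [coder_nil, copair_applyPrefix, add_comm]
  | cons b l ih =>
    rw [coder_cons, map_sub, copair_applyPrefix, copair_cns]
    simp only [lin_bas, ih, splitSum_cons, List.length_nil, pow_zero, one_smul, coder_nil,
      coder_cons, map_sub, List.length_cons, pow_succ, mul_neg, mul_one, neg_smul, lin_cns]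
    simp only [splitSum_add, splitSum_sub, splitSum_neg]
    abel

/-- The projection to tensors of length one. -/
def proj : Ten B →ₗ[ℤ] Vec B := lin fun l => match l with
  | [b] => bas b
  | _ => 0

/-- The coefficient of the empty tensor. -/
def counit : Ten B →ₗ[ℤ] ℤ := Finsupp.lapply []

theorem counit_cns (v : Vec B) (x : Ten B) : counit (cns v x) = 0 := by
  by_contra h
  obtain ⟨b, t, h, -⟩ := exists_of_cns_ne_zero (l := []) h
  simp at h

theorem proj_cns (v : Vec B) (x : Ten B) : proj (cns v x) = counit x • v := by
  refine linear_ext_apply (proj ∘ₗ cns v) (counit.smulRight v) (fun l => ?_) x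
  simp only [LinearMap.coe_comp, Function.comp_apply, cns_bas_right, map_lin,
    LinearMap.smulRight_apply, counit, Finsupp.lapply_apply]
  cases l with
  | nil => simp [proj]
  | cons c l => simp [proj]

theorem counit_applyPrefix (c : List B → Vec B) (l : List B) : counit (applyPrefix c l) = 0 := by
  simp only [applyPrefix, map_splitSum, counit_cns, splitSum_zero]

theorem counit_coder (c : List B → Vec B) (l : List B) : counit (coder c l) = 0 := by
  cases l with
  | nil => exact counit_applyPrefix _ _
  | cons b l => rw [coder_cons, map_sub, counit_applyPrefix, counit_cns, sub_zero]

theorem counit_bas_cons (b : B) (l : List B) : counit (bas (b :: l)) = 0 := by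
  simp [counit]

theorem proj_applyPrefix (c : List B → Vec B) (l : List B) : proj (applyPrefix c l) = c l := by
  simp only [applyPrefix, map_splitSum, proj_cns]
  rw [splitSum_eq_single l [] (by simp)]
  · simp [counit]
  · intro p s h hp
    cases s with
    | nil => simp_all
    | cons b s => rw [counit_bas_cons, zero_smul]

theorem proj_coder (c : List B → Vec B) (l : List B) : proj (coder c l) = c l := by
  cases l with
  | nil => exact proj_applyPrefix _ _
  | cons b l => rw [coder_cons, map_sub, proj_applyPrefix, proj_cns, counit_coder, zero_smul,
      sub_zero]

/-- The composite `c ∘ coder c'` of cochains. -/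
def circ (c c' : List B → Vec B) (l : List B) : Vec B := lin c (coder c' l)

/-- The operation `c'` acts either inside the initial segment that `c` then consumes, or behind it.
In the second case the sign is the parity of that segment, which is even wherever `c` is nonzero. -/
theorem applyPrefix_coder {c : List B → Vec B} (hc : ∀ l, Odd l.length → c l = 0)
    (c' : List B → Vec B) (l : List B) : lin (applyPrefix c) (coder c' l) =
      applyPrefix (circ c c') l + splitSum l fun p s => cns (c p) (coder c' s) := by
  have h : lin (applyPrefix c) (coder c' l) =
      copair (fun p s => cns (c p) (bas s)) (coder c' l) := rfl
  rw [h, copair_coder, splitSum_add]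
  congr 1
  · refine splitSum_congr fun p s _ => ?_
    exact (map_lin (cns.flip (bas s)) c (coder c' p)).symm
  · refine splitSum_congr fun p s _ => ?_
    rw [← map_lin (cns (c p)), lin_bas_fun]
    rcases Nat.even_or_odd p.length with h | h
    · rw [h.neg_one_pow, one_smul]
    · rw [hc p h]; simp

theorem applyPrefix_cns (c : List B → Vec B) (b : B) (x : Ten B) :
    lin (coder c) (cns (bas b) x) =
      lin (applyPrefix c) (cns (bas b) x) - cns (bas b) (lin (coder c) x) := by
  simp only [lin_cns, lin_bas, coder_cons, lin_sub_fun, map_lin]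

/-- The coderivation `coder c` applied to `c(p) ⊗ s`. -/
theorem coder_applyPrefix (c : List B → Vec B) (l : List B) : lin (coder c) (applyPrefix c l) =
    lin (applyPrefix c) (applyPrefix c l) - splitSum l fun p s => cns (c p) (coder c s) := by
  simp only [applyPrefix, map_splitSum, ← splitSum_sub]
  refine splitSum_congr fun p s _ => ?_
  simp only [cns_bas_right, map_lin, lin_bas, coder_cons, lin_sub_fun]
  congr 1
  have := map_lin (cns.flip (coder c s)) (fun b => bas b) (c p)
  rw [lin_bas_fun] at this
  exact this.symm

theorem coder_coder_nil {c : List B → Vec B} (hc : ∀ l, Odd l.length → c l = 0) :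
    lin (coder c) (coder c []) = applyPrefix (circ c c) [] := by
  have h := applyPrefix_coder hc c []
  rw [splitSum_nil, coder_nil] at h
  rw [coder_nil, coder_applyPrefix, h, splitSum_nil, coder_nil, add_sub_cancel_right]

/-- The square of an odd coderivation is again a coderivation, now an even one. Two operations
acting on disjoint segments occur in both orders with opposite signs, so only nested operations
remain. -/
theorem coder_coder_cons {c : List B → Vec B} (hc : ∀ l, Odd l.length → c l = 0) (b : B)
    (l : List B) : lin (coder c) (coder c (b :: l)) =
      applyPrefix (circ c c) (b :: l) + cns (bas b) (lin (coder c) (coder c l)) := by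
  have h := applyPrefix_coder hc c (b :: l)
  rw [coder_cons, map_sub, coder_applyPrefix, applyPrefix_cns]
  rw [coder_cons, map_sub] at h
  rw [← sub_eq_zero] at h ⊢
  rw [← h]
  abel

end Coderivation

end BarConstruction

/-! ### Coalgebra maps, and their failure to commute with coderivations -/

namespace BarConstruction

noncomputable section CoalgebraMap

variable {B : Type} {N : Type*} [AddCommGroup N]

/-- Auxiliary function for `coalg`: the sum over the decompositions of `acc ++ l` into blocks, the
first of which contains `acc`. -/
def coalgAux (f : List B → Vec B) : List B → List B → Ten B
  | acc, [] => cns (f acc) (bas [])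
  | acc, b :: l => cns (f acc) (coalgAux f [b] l) + coalgAux f (acc ++ [b]) l

/-- The morphism of tensor coalgebras with corestriction `f`, where `f []` is ignored. -/
def coalg (f : List B → Vec B) : List B → Ten B
  | [] => bas []
  | b :: l => coalgAux f [b] l

theorem coalgAux_eq (f : List B → Vec B) (acc l : List B) :
    coalgAux f acc l = splitSum l fun p s => cns (f (acc ++ p)) (coalg f s) := by
  induction l generalizing acc with
  | nil => simp [coalgAux, coalg]
  | cons b l ih =>
    rw [coalgAux, splitSum_cons, List.append_nil, coalg, ih (acc ++ [b])]
    simp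

@[simp] theorem coalg_nil (f : List B → Vec B) : coalg f [] = bas [] := rfl

theorem coalg_cons (f : List B → Vec B) (b : B) (l : List B) :
    coalg f (b :: l) = splitSum l fun p s => cns (f (b :: p)) (coalg f s) := coalgAux_eq f [b] l

/-- A family of tensors satisfying the recursion of a coalgebra map is one. -/
theorem eq_coalg {f : List B → Vec B} {K : List B → Ten B} (hK : K [] = bas [])
    (h : ∀ b l, K (b :: l) = splitSum l fun p s => cns (f (b :: p)) (K s)) : K = coalg f := by
  funext l
  induction hn : l.length using Nat.strong_induction_on generalizing l with
  | _ n ih =>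
    cases l with
    | nil => exact hK
    | cons b l =>
      rw [h, coalg_cons]
      refine splitSum_congr fun p s hps => ?_
      rw [ih s.length _ s rfl]
      rw [← hn, ← hps]; simp

theorem copair_congr_lin (Φ : List B → List B → N) (v : Vec B) (x y : Ten B) :
    bil Φ (cns v x) y = bil (fun p s => lin (fun b => Φ (b :: p) s) v) x y := by
  simp only [bil, lin_cns]
  rw [lin_comm]
  refine lin_congr fun l _ => ?_
  rw [lin_comm]

theorem bil_bas_nil (Φ : List B → List B → N) (y : Ten B) : bil Φ (bas []) y = lin (Φ []) y := by
  simp [bil]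

theorem bil_splitSum (Φ : List B → List B → N) {α : Type*} (l : List α)
    (Ψ : List α → List α → Ten B) (y : Ten B) :
    bil Φ (splitSum l Ψ) y = splitSum l fun p s => bil Φ (Ψ p s) y :=
  map_splitSum (lin fun p => lin (Φ p) y) l Ψ

/-- A cut of the sequence of outputs is a cut of the input list between two blocks. This makes
`coalg f` a map of coalgebras. -/
theorem copair_coalg (Φ : List B → List B → N) (f : List B → Vec B) (l : List B) :
    copair Φ (coalg f l) = splitSum l fun p s => bil Φ (coalg f p) (coalg f s) := by
  induction hn : l.length using Nat.strong_induction_on generalizing l Φ with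
  | _ n ih =>
    cases l with
    | nil => simp [bil_bas_nil]
    | cons b l =>
      rw [splitSum_cons, coalg_nil, bil_bas_nil]
      simp only [coalg_cons, map_splitSum, copair_cns, splitSum_add, bil_splitSum]
      congr 1
      rw [← splitSum_assoc]
      refine splitSum_congr fun p s hps => ?_
      rw [ih s.length (by rw [← hn, ← hps]; simp) _ s rfl]
      simp only [copair_congr_lin]

theorem counit_coalg_cons (f : List B → Vec B) (b : B) (l : List B) :
    counit (coalg f (b :: l)) = 0 := by
  rw [coalg_cons, map_splitSum]
  simp only [counit_cns, splitSum_zero]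

theorem proj_coalg {f : List B → Vec B} (hf : f [] = 0) (l : List B) : proj (coalg f l) = f l := by
  cases l with
  | nil => simp [proj, hf]
  | cons b l =>
    rw [coalg_cons, map_splitSum]
    simp only [proj_cns]
    rw [splitSum_eq_single l [] (by simp)]
    · simp [counit]
    · intro p s h hp
      cases s with
      | nil => simp_all
      | cons b s => rw [counit_coalg_cons, zero_smul]

theorem even_of_coalg_ne_zero {f : List B → Vec B} (hf : ∀ l, Even l.length → f l = 0)
    (l l' : List B) (h : coalg f l l' ≠ 0) : Even (l.length + l'.length) := by
  induction hn : l.length using Nat.strong_induction_on generalizing l l' with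
  | _ n ih =>
    cases l with
    | nil =>
      by_cases h' : l' = []
      · subst h'; subst hn; simp
      · exact absurd (Finsupp.single_eq_of_ne h') h
    | cons b l =>
      rw [coalg_cons] at h
      have h2 := map_splitSum (Finsupp.applyAddHom l') l
        (fun p s => cns (f (b :: p)) (coalg f s))
      simp only [Finsupp.applyAddHom_apply] at h2
      rw [h2] at h
      obtain ⟨p, s, hps, h3⟩ := exists_of_splitSum_ne_zero h
      obtain ⟨c, t, rfl, hc, ht⟩ := exists_of_cns_ne_zero h3
      have hlt : s.length < n := by rw [← hn, ← hps]; simp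
      have h4 := ih s.length hlt s t ht rfl
      have h5 : ¬ Even (b :: p).length := fun h => hc (by rw [hf _ h]; rfl)
      rw [← hn, ← hps]
      simp only [List.length_cons, List.length_append] at h5 ⊢
      simp only [Nat.even_add_one, Nat.even_add, not_not] at h4 h5 ⊢
      tauto

/-- The coproduct followed by the projection of its first factor to length one gives back the
tensor, up to the empty component. Hence maps compatible with coproducts are determined by their
corestrictions. -/
theorem recover (x : Ten B) :
    copair (fun p s => cns (proj (bas p)) (bas s)) x = x - counit x • bas [] := by
  refine linear_ext_apply (copair _) (LinearMap.id - counit.smulRight (bas [])) (fun l => ?_) x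
  simp only [copair_bas, LinearMap.sub_apply, LinearMap.id_apply, LinearMap.smulRight_apply]
  cases l with
  | nil => simp [proj, counit]
  | cons b l =>
    rw [counit_bas_cons, zero_smul, sub_zero, splitSum_eq_single [b] l (by simp)]
    · simp [proj]
    · intro p s h hp
      have : proj (bas p) = 0 := by
        rcases p with _ | ⟨c, _ | ⟨d, p⟩⟩
        · simp [proj]
        · simp_all
        · simp [proj]
      simp [this]

theorem bil_recover (x y : Ten B) :
    bil (fun p s => cns (proj (bas p)) (bas s)) x y = cns (proj x) y := by
  simp only [bil]
  have h1 : ∀ p : List B, lin (fun s => cns (proj (bas p)) (bas s)) y = cns (proj (bas p)) y :=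
    fun p => by rw [← map_lin (cns _), lin_bas_fun]
  simp only [h1]
  refine (map_lin (cns.flip y ∘ₗ proj) (fun p => bas p) x).symm.trans ?_
  rw [lin_bas_fun]
  rfl

/-- The difference `F ∘ D - D' ∘ F`, for the coderivations `D`, `D'` given by `c`, `c'` and the
coalgebra map `F` given by `f`. -/
def defect (f c c' : List B → Vec B) (l : List B) : Ten B :=
  lin (coalg f) (coder c l) - lin (coder c') (coalg f l)

theorem bil_sub_left (Φ : List B → List B → N) (x x' y : Ten B) :
    bil Φ (x - x') y = bil Φ x y - bil Φ x' y := map_sub _ _ _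

theorem bil_sub_right (Φ : List B → List B → N) (x y y' : Ten B) :
    bil Φ x (y - y') = bil Φ x y - bil Φ x y' := by
  simp only [bil, map_sub, lin_sub_fun]

theorem copair_lin_coalg (Φ : List B → List B → N) (f : List B → Vec B) (x : Ten B) :
    copair Φ (lin (coalg f) x) = copair (fun p s => bil Φ (coalg f p) (coalg f s)) x := by
  rw [map_lin]
  simp only [copair_coalg]
  rfl

theorem copair_lin_coder (Φ : List B → List B → N) (c : List B → Vec B) (x : Ten B) :
    copair Φ (lin (coder c) x) = copair (fun p s => lin (fun p' => Φ p' s) (coder c p) +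
      (-1 : ℤ) ^ p.length • lin (Φ p) (coder c s)) x := by
  rw [map_lin]
  simp only [copair_coder]
  rfl

theorem bil_lin_left (Φ : List B → List B → N) (K : List B → Ten B) (x y : Ten B) :
    lin (fun p => bil Φ (K p) y) x = bil Φ (lin K x) y := by
  simp only [bil]
  rw [map_lin]

theorem bil_lin_right (Φ : List B → List B → N) (K : List B → Ten B) (x y : Ten B) :
    lin (fun s => bil Φ x (K s)) y = bil Φ x (lin K y) := by
  simp only [bil]
  rw [lin_comm]
  refine lin_congr fun l _ => ?_
  rw [map_lin]

/-- The difference F D - D' F is a coderivation along F, because D and D' are coderivations and F is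
a coalgebra map. -/
theorem copair_defect (Φ : List B → List B → N) {f : List B → Vec B}
    (hf : ∀ l, Even l.length → f l = 0) (c c' : List B → Vec B) (l : List B) :
    copair Φ (defect f c c' l) = splitSum l fun p s => bil Φ (defect f c c' p) (coalg f s) +
      (-1 : ℤ) ^ p.length • bil Φ (coalg f p) (defect f c c' s) := by
  rw [defect, map_sub, copair_lin_coalg, copair_coder, copair_lin_coder, copair_coalg,
    ← splitSum_sub]
  refine splitSum_congr fun p s _ => ?_
  rw [bil_lin_left, bil_lin_right, defect, bil_sub_left, defect, bil_sub_right]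
  have : bil (fun p s => lin (fun p' => Φ p' s) (coder c' p) +
      (-1 : ℤ) ^ p.length • lin (Φ p) (coder c' s)) (coalg f p) (coalg f s) =
      bil Φ (lin (coder c') (coalg f p)) (coalg f s) +
      (-1 : ℤ) ^ p.length • bil Φ (coalg f p) (lin (coder c') (coalg f s)) := by
    conv_lhs => rw [bil]
    simp only [lin_add_fun]
    congr 1
    · rw [← bil_lin_left]
      refine lin_congr fun q _ => ?_
      rw [bil, lin_comm]
    · rw [bil, ← lin_smul_fun]
      refine lin_congr fun q hq => ?_
      -- The sign of D' refers to the length of the image of `p`. As `f` is nonzero only on blocks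
      -- of odd length, F preserves the parity of the length.
      have h1 : (-1 : ℤ) ^ q.length = (-1) ^ p.length := by
        have := even_of_coalg_ne_zero hf p q hq
        rw [Nat.even_add] at this
        rcases Nat.even_or_odd q.length with h | h
        · rw [h.neg_one_pow, (this.2 h).neg_one_pow]
        · rw [h.neg_one_pow, Odd.neg_one_pow]
          rw [← Nat.not_even_iff_odd] at h ⊢
          tauto
      rw [lin_smul_fun, h1, map_lin]
  rw [this, smul_sub]
  abel

theorem counit_lin_coder (c : List B → Vec B) (x : Ten B) : counit (lin (coder c) x) = 0 := by
  rw [map_lin]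
  exact lin_eq_zero fun l _ => counit_coder c l

theorem counit_lin_coalg (f : List B → Vec B) (x : Ten B) :
    counit (lin (coalg f) x) = counit x := by
  refine linear_ext_apply (counit ∘ₗ lin (coalg f)) counit (fun l => ?_) x
  simp only [LinearMap.comp_apply, lin_bas]
  cases l with
  | nil => rfl
  | cons b l => rw [counit_coalg_cons, counit_bas_cons]

/-- Combining `copair_defect` with `recover` expresses a coderivation along F through its
corestriction. -/
theorem defect_eq {f : List B → Vec B} (hf : ∀ l, Even l.length → f l = 0)
    (c c' : List B → Vec B) (l : List B) :
    defect f c c' l = splitSum l fun p s => cns (proj (defect f c c' p)) (coalg f s) +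
      (-1 : ℤ) ^ p.length • cns (f p) (defect f c c' s) := by
  have h := copair_defect (fun p s => cns (proj (bas p)) (bas s)) hf c c' l
  rw [recover] at h
  have h0 : counit (defect f c c' l) = 0 := by
    rw [defect, map_sub, counit_lin_coder, counit_lin_coalg, counit_coder, sub_zero]
  rw [h0, zero_smul, sub_zero] at h
  rw [h]
  refine splitSum_congr fun p s _ => ?_
  rw [bil_recover, bil_recover, proj_coalg (hf [] (by simp))]

theorem proj_lin_coder (c : List B → Vec B) (x : Ten B) : proj (lin (coder c) x) = lin c x := by
  rw [map_lin]
  simp only [proj_coder]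

theorem proj_lin_coalg {f : List B → Vec B} (hf : f [] = 0) (x : Ten B) :
    proj (lin (coalg f) x) = lin f x := by
  rw [map_lin]
  simp only [proj_coalg hf]

/-- The corestriction of `defect`. -/
theorem proj_defect {f : List B → Vec B} (hf : f [] = 0) (c c' : List B → Vec B) (l : List B) :
    proj (defect f c c' l) = lin f (coder c l) - lin c' (coalg f l) := by
  rw [defect, map_sub, proj_lin_coalg hf, proj_lin_coder]

/-- In the recursion `defect_eq` the terms with nonempty `p` involve shorter lists, and the one with
empty `p` vanishes because `f []` does. It is thus enough to check the morphism relation after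
projection. -/
theorem defect_eq_zero {f : List B → Vec B} (hf : ∀ l, Even l.length → f l = 0)
    {c c' : List B → Vec B} (h : ∀ l, proj (defect f c c' l) = 0) (l : List B) :
    defect f c c' l = 0 := by
  induction hn : l.length using Nat.strong_induction_on generalizing l with
  | _ n ih =>
    rw [defect_eq hf]
    refine splitSum_eq_zero fun p s hps => ?_
    rw [h, map_zero, LinearMap.zero_apply, zero_add]
    cases p with
    | nil => rw [hf [] (by simp)]; simp
    | cons b p =>
      rw [ih s.length (by rw [← hn, ← hps]; simp) s rfl, map_zero, smul_zero]

theorem coder_coder_eq_zero {c : List B → Vec B} (hc : ∀ l, Odd l.length → c l = 0)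
    (h : ∀ l, circ c c l = 0) (l : List B) : lin (coder c) (coder c l) = 0 := by
  have h' : ∀ l, applyPrefix (circ c c) l = 0 := fun l =>
    splitSum_eq_zero fun p s _ => by rw [h, map_zero, LinearMap.zero_apply]
  induction l with
  | nil => rw [coder_coder_nil hc, h']
  | cons b l ih => rw [coder_coder_cons hc, h', ih, map_zero, add_zero]

end CoalgebraMap

end BarConstruction

/-! ### Inverses of unipotent coalgebra maps -/

namespace BarConstruction

noncomputable section Inverse

variable {B : Type} {N : Type*} [AddCommGroup N]

theorem exists_of_coalg_cons_ne_zero {f : List B → Vec B} {b : B} {l l' : List B}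
    (h : coalg f (b :: l) l' ≠ 0) : ∃ p s c t, p ++ s = l ∧ l' = c :: t ∧ f (b :: p) c ≠ 0 ∧
      coalg f s t ≠ 0 := by
  rw [coalg_cons] at h
  have h2 := map_splitSum (Finsupp.applyAddHom l') l fun p s => cns (f (b :: p)) (coalg f s)
  simp only [Finsupp.applyAddHom_apply] at h2
  rw [h2] at h
  obtain ⟨p, s, hps, h3⟩ := exists_of_splitSum_ne_zero h
  obtain ⟨c, t, rfl, hc, ht⟩ := exists_of_cns_ne_zero h3
  exact ⟨p, s, c, t, hps, rfl, hc, ht⟩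

theorem coalg_induction {f : List B → Vec B} {R : List B → List B → Prop} (h0 : R [] [])
    (hc : ∀ b p s c t, f (b :: p) c ≠ 0 → R s t → R (b :: p ++ s) (c :: t)) (l l' : List B)
    (h : coalg f l l' ≠ 0) : R l l' := by
  induction hn : l.length using Nat.strong_induction_on generalizing l l' with
  | _ n ih =>
    cases l with
    | nil =>
      by_cases h' : l' = []
      · exact h' ▸ h0
      · exact absurd (Finsupp.single_eq_of_ne h') h
    | cons b l =>
      obtain ⟨p, s, c, t, rfl, rfl, h1, h2⟩ := exists_of_coalg_cons_ne_zero h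
      exact hc b p s c t h1 (ih s.length (by rw [← hn]; simp) s t h2 rfl)

theorem length_le_of_coalg_ne_zero (f : List B → Vec B) (l l' : List B) (h : coalg f l l' ≠ 0) :
    l'.length ≤ l.length :=
  coalg_induction (R := fun l l' => l'.length ≤ l.length) le_rfl
    (fun b p s c t _ h => by simp; omega) l l' h

/-- The difference of the identity and a coalgebra map. -/
def unip (f : List B → Vec B) : Module.End ℤ (Ten B) := 1 - lin (coalg f)

theorem unip_bas_nil (f : List B → Vec B) : unip f (bas []) = 0 := by simp [unip]

/-- Cutting everything into blocks of length one gives the identity, which cancels. Every other term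
has a block with at least two entries and so shortens the list. Hence `unip f` is nilpotent on each
list. -/
theorem length_lt_of_unip_ne_zero {f : List B → Vec B} (hf : ∀ b, f [b] = bas b) (l l' : List B)
    (h : unip f (bas l) l' ≠ 0) : l'.length < l.length := by
  induction l generalizing l' with
  | nil => rw [unip_bas_nil] at h; exact absurd rfl h
  | cons b l ih =>
    have e : unip f (bas (b :: l)) = cns (bas b) (unip f (bas l)) -
        (splitSum l fun p s => if p = [] then 0 else cns (f (b :: p)) (coalg f s)) := by
      simp only [unip, LinearMap.sub_apply, Module.End.one_apply, lin_bas, map_sub, cns_bas,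
        coalg_cons]
      cases l with
      | nil => simp [hf]
      | cons d l => simp [splitSum_cons, hf]; abel
    rw [e, Finsupp.sub_apply] at h
    by_cases h1 : cns (bas b) (unip f (bas l)) l' = 0
    · rw [h1, zero_sub, neg_ne_zero] at h
      have h2 := map_splitSum (Finsupp.applyAddHom l') l
        fun p s => if p = [] then 0 else cns (f (b :: p)) (coalg f s)
      simp only [Finsupp.applyAddHom_apply] at h2
      rw [h2] at h
      obtain ⟨p, s, hps, h3⟩ := exists_of_splitSum_ne_zero h
      split_ifs at h3 with hp
      · exact absurd rfl h3
      · obtain ⟨c, t, rfl, -, ht⟩ := exists_of_cns_ne_zero h3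
        have := length_le_of_coalg_ne_zero f s t ht
        have := List.length_pos_iff.2 hp
        rw [← hps]; simp; omega
    · obtain ⟨c, t, rfl, -, ht⟩ := exists_of_cns_ne_zero h1
      have := ih t ht
      simpa using this

theorem apply_eq_lin (φ : Module.End ℤ (Ten B)) (x : Ten B) : φ x = lin (fun l => φ (bas l)) x := by
  rw [← map_lin, lin_bas_fun]

theorem unip_pow_ne_zero {f : List B → Vec B} (hf : ∀ b, f [b] = bas b) (k : ℕ) (l l' : List B)
    (h : (unip f ^ k) (bas l) l' ≠ 0) : l'.length + k ≤ l.length := by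
  induction k generalizing l' with
  | zero =>
    by_cases h' : l' = l
    · simp [h']
    · exact absurd (Finsupp.single_eq_of_ne h') h
  | succ k ih =>
    rw [pow_succ', Module.End.mul_apply, apply_eq_lin] at h
    obtain ⟨m, h1, h2⟩ := exists_of_lin_ne_zero h
    have := ih m h1
    have := length_lt_of_unip_ne_zero hf m l' h2
    omega

theorem unip_pow_eq_zero {f : List B → Vec B} (hf : ∀ b, f [b] = bas b) {k : ℕ} {l : List B}
    (h : l.length < k) : (unip f ^ k) (bas l) = 0 := by
  ext l'
  by_contra h'
  have := unip_pow_ne_zero hf k l l' h'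
  omega

/-- The inverse of a unipotent coalgebra map. -/
def inv (f : List B → Vec B) (l : List B) : Ten B :=
  ∑ k ∈ Finset.range (l.length + 1), (unip f ^ k) (bas l)

theorem inv_eq {f : List B → Vec B} (hf : ∀ b, f [b] = bas b) {n : ℕ} {l : List B}
    (h : l.length < n) : inv f l = ∑ k ∈ Finset.range n, (unip f ^ k) (bas l) := by
  refine Finset.sum_subset (Finset.range_mono (by omega)) fun k _ hk => ?_
  exact unip_pow_eq_zero hf (by simpa using hk)

theorem lin_coalg_eq (f : List B → Vec B) : lin (coalg f) = 1 - unip f := by simp [unip]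

theorem coalg_inv {f : List B → Vec B} (hf : ∀ b, f [b] = bas b) (x : Ten B) :
    lin (coalg f) (lin (inv f) x) = x := by
  refine linear_ext_apply (lin (coalg f) ∘ₗ lin (inv f)) LinearMap.id (fun l => ?_) x
  simp only [LinearMap.comp_apply, lin_bas, LinearMap.id_apply, inv]
  rw [← LinearMap.sum_apply, lin_coalg_eq, ← Module.End.mul_apply, mul_neg_geom_sum,
    LinearMap.sub_apply, unip_pow_eq_zero hf (by omega), sub_zero, Module.End.one_apply]

theorem inv_coalg {f : List B → Vec B} (hf : ∀ b, f [b] = bas b) (x : Ten B) :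
    lin (inv f) (lin (coalg f) x) = x := by
  refine linear_ext_apply (lin (inv f) ∘ₗ lin (coalg f)) LinearMap.id (fun l => ?_) x
  simp only [LinearMap.comp_apply, LinearMap.id_apply]
  have h : lin (inv f) (lin (coalg f) (bas l)) =
      (∑ k ∈ Finset.range (l.length + 1), unip f ^ k) (lin (coalg f) (bas l)) := by
    rw [apply_eq_lin (∑ k ∈ Finset.range (l.length + 1), unip f ^ k)]
    refine lin_congr fun m hm => ?_
    rw [lin_bas] at hm
    have := length_le_of_coalg_ne_zero f l m hm
    rw [inv_eq hf (n := l.length + 1) (by omega), LinearMap.sum_apply]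
  rw [h, lin_coalg_eq, ← Module.End.mul_apply, geom_sum_mul_neg,
    LinearMap.sub_apply, unip_pow_eq_zero hf (by omega), sub_zero, Module.End.one_apply]

/-- The inverse of a coalgebra map is one: apply the compatibility of `coalg f` with coproducts to
`inv f l` and cancel. -/
theorem copair_inv (Φ : List B → List B → N) {f : List B → Vec B} (hf : ∀ b, f [b] = bas b)
    (l : List B) : copair Φ (inv f l) = splitSum l fun p s => bil Φ (inv f p) (inv f s) := by
  have h := copair_lin_coalg (fun p s => bil Φ (inv f p) (inv f s)) f (inv f l)
  have h2 : lin (coalg f) (inv f l) = bas l := by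
    have := coalg_inv hf (bas l)
    rwa [lin_bas] at this
  rw [h2, copair_bas] at h
  have h4 : ∀ p, lin (inv f) (coalg f p) = bas p := fun p => by
    have := inv_coalg hf (bas p)
    rwa [lin_bas] at this
  have hΦ : (fun p s => bil (fun p s => bil Φ (inv f p) (inv f s)) (coalg f p) (coalg f s)) =
      Φ := by
    funext p s
    rw [bil]
    simp only [bil_lin_right]
    rw [bil_lin_left, h4, h4]
    simp [bil]
  rw [h, hΦ]

theorem inv_nil (f : List B → Vec B) : inv f [] = bas [] := by simp [inv]

theorem inv_eq_coalg {f : List B → Vec B} (hf : ∀ b, f [b] = bas b) :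
    inv f = coalg fun l => proj (inv f l) := by
  refine eq_coalg (inv_nil f) fun b l => ?_
  have h := copair_inv (fun p s => cns (proj (bas p)) (bas s)) hf (b :: l)
  have h0 : counit (inv f (b :: l)) = 0 := by
    rw [← counit_lin_coalg f]
    have := coalg_inv hf (bas (b :: l))
    rw [lin_bas] at this
    rw [this, counit_bas_cons]
  rw [recover, h0, zero_smul, sub_zero, splitSum_cons, inv_nil] at h
  rw [h]
  simp only [bil_recover]
  simp [proj]

/-- On each list the inverse is a polynomial in `coalg f`, so it stays within every reflexive and
transitive relation that contains the support of `coalg f`. In this way bounds on degrees and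
unitality pass to the inverse. -/
theorem inv_induction {f : List B → Vec B} {R : List B → List B → Prop} (hR : ∀ l, R l l)
    (hT : ∀ l m n, R l m → R m n → R l n) (hf : ∀ l l', coalg f l l' ≠ 0 → R l l')
    (l l' : List B) (h : inv f l l' ≠ 0) : R l l' := by
  have key : ∀ k l', (unip f ^ k) (bas l) l' ≠ 0 → R l l' := by
    intro k
    induction k with
    | zero =>
      intro l' h
      by_cases h' : l' = l
      · exact h' ▸ hR l
      · exact absurd (Finsupp.single_eq_of_ne h') h
    | succ k ih =>
      intro l' h
      rw [pow_succ', Module.End.mul_apply, apply_eq_lin] at h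
      obtain ⟨m, h1, h2⟩ := exists_of_lin_ne_zero h
      refine hT _ _ _ (ih m h1) ?_
      by_cases h' : l' = m
      · exact h' ▸ hR m
      · refine hf _ _ fun h0 => h2 ?_
        rw [unip, LinearMap.sub_apply, Finsupp.sub_apply, lin_bas, h0, Module.End.one_apply,
          Finsupp.single_eq_of_ne h', sub_zero]
  rw [inv, Finsupp.finsetSum_apply] at h
  obtain ⟨k, -, hk⟩ := Finset.exists_ne_zero_of_sum_ne_zero h
  exact key k l' hk

/-- Unipotent coalgebra maps are invertible. -/
theorem exists_inverse {f : List B → Vec B} (hf : ∀ b, f [b] = bas b) :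
    ∃ g : List B → Vec B, g [] = 0 ∧ (∀ b, g [b] = bas b) ∧
      (∀ x, lin (coalg g) (lin (coalg f) x) = x) ∧ (∀ x, lin (coalg f) (lin (coalg g) x) = x) ∧
      ∀ R : List B → List B → Prop, (∀ l, R l l) → (∀ l m n, R l m → R m n → R l n) →
        (∀ l l', coalg f l l' ≠ 0 → R l l') → ∀ l l', coalg g l l' ≠ 0 → R l l' := by
  refine ⟨fun l => proj (inv f l), by simp [inv_nil, proj], fun b => ?_, ?_, ?_, ?_⟩
  · have := inv_coalg hf (bas [b])
    rw [lin_bas, coalg_cons, splitSum_nil, hf, coalg_nil, cns_bas, lin_bas] at this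
    simp [this, proj]
  all_goals rw [← inv_eq_coalg hf]
  · exact inv_coalg hf
  · exact coalg_inv hf
  · exact fun R h1 h2 h3 => inv_induction h1 h2 h3

end Inverse

end BarConstruction

/-! ### The associative product and its Hochschild complex -/

namespace TorusAlgebra

open BarConstruction

noncomputable section Product

/-- The basis elements `U^m b` of the torus algebra. -/
abbrev BasisElt : Type := ℕ × Basic

namespace Basic

theorem mul_left_right {a b c : Basic} (h : a.mul b = some c) :
    c.left = a.left ∧ c.right = b.right ∧ a.right = b.left := by
  cases a with
  | idem j =>
    simp only [mul] at h
    split_ifs at h with hj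
    cases h
    exact ⟨hj.symm, rfl, hj⟩
  | reeb i n =>
    cases b with
    | idem j =>
      simp only [mul] at h
      split_ifs at h with hj
      cases h
      exact ⟨rfl, hj, hj⟩
    | reeb i' n' =>
      simp only [mul] at h
      split_ifs at h with hj
      cases h
      subst hj
      refine ⟨rfl, ?_, rfl⟩
      simp only [right]
      congr 1
      push_cast
      ring

theorem idem_mul (j : Fin 2) (b : Basic) :
    (idem j).mul b = if j = b.left then some b else none := by
  cases b <;> rfl

theorem mul_idem (b : Basic) (j : Fin 2) :
    b.mul (idem j) = if b.right = j then some b else none := by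
  cases b with
  | idem j' =>
    by_cases h : j' = j
    · subst h; simp [idem_mul, left, right]
    · simp [idem_mul, left, right, h]
  | reeb i n => rfl

theorem reeb_mul_reeb (i i' : ZMod 4) (n n' : ℕ) : (reeb i n).mul (reeb i' n') =
    if i' = i + n + 1 then some (reeb i (n + n' + 1)) else none := rfl

theorem mul_eq_none {a b : Basic} (h : a.right ≠ b.left) : a.mul b = none := by
  cases hab : a.mul b with
  | none => rfl
  | some c => exact absurd (mul_left_right hab).2.2 h

theorem mul_assoc' (a b c : Basic) :
    ((a.mul b).bind fun d => d.mul c) = (b.mul c).bind fun d => a.mul d := by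
  cases a with
  | idem j =>
    simp only [idem_mul]
    cases hbc : b.mul c with
    | none => split_ifs <;> simp [hbc]
    | some d =>
      have := (mul_left_right hbc).1
      simp only [Option.bind_some, this]
      split_ifs <;> simp [hbc]
  | reeb i n =>
    cases b with
    | idem j =>
      rw [mul_idem]
      simp only [idem_mul]
      split_ifs with h1 h2 h2
      · rfl
      · simp only [Option.bind_some, Option.bind_none]
        exact mul_eq_none (by rwa [h1])
      · simp only [Option.bind_some, Option.bind_none]
        exact (mul_eq_none (by rwa [← h2])).symm
      · rfl
    | reeb i' n' =>
      cases c with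
      | idem j =>
        simp only [mul_idem]
        cases hab : (reeb i n).mul (reeb i' n') with
        | none => split_ifs <;> simp [hab]
        | some d =>
          have := (mul_left_right hab).2.1
          simp only [Option.bind_some, this]
          split_ifs <;> simp [hab]
      | reeb i'' n'' =>
        simp only [reeb_mul_reeb]
        by_cases h1 : i' = i + n + 1
        · by_cases h2 : i'' = i' + n' + 1
          · rw [if_pos h1, if_pos h2, Option.bind_some, Option.bind_some, reeb_mul_reeb,
              reeb_mul_reeb, if_pos h1, if_pos]
            · congr 2; ring
            · rw [h2, h1]; push_cast; ring
          · rw [if_pos h1, if_neg h2, Option.bind_some, Option.bind_none, reeb_mul_reeb, if_neg]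
            intro h; apply h2; rw [h, h1]; push_cast; ring
        · rw [if_neg h1, Option.bind_none]
          split_ifs
          · rw [Option.bind_some, reeb_mul_reeb, if_neg h1]
          · rfl

end Basic

/-- The product of basis elements. -/
def mulV (x y : BasisElt) : Vec BasisElt := (x.2.mul y.2).elim 0 fun b => bas (x.1 + y.1, b)

theorem mulV_ne_zero {x y z : BasisElt} (h : mulV x y z ≠ 0) :
    z.1 = x.1 + y.1 ∧ x.2.mul y.2 = some z.2 := by
  unfold mulV at h
  cases hxy : x.2.mul y.2 with
  | none => rw [hxy] at h; exact absurd rfl h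
  | some b =>
    rw [hxy] at h
    by_cases hz : z = (x.1 + y.1, b)
    · subst hz; simp
    · exact absurd (Finsupp.single_eq_of_ne hz) h

theorem mulV_of_mul {x y : BasisElt} {b : Basic} (h : x.2.mul y.2 = some b) :
    mulV x y = bas (x.1 + y.1, b) := by simp [mulV, h]

theorem mulV_of_mul_none {x y : BasisElt} (h : x.2.mul y.2 = none) : mulV x y = 0 := by
  simp [mulV, h]

/-- Left multiplication. -/
def lmul (x : BasisElt) : Vec BasisElt →ₗ[ℤ] Vec BasisElt := lin (mulV x)

/-- Right multiplication. -/
def rmul (y : BasisElt) : Vec BasisElt →ₗ[ℤ] Vec BasisElt := lin fun x => mulV x y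

@[simp] theorem lmul_bas (x y : BasisElt) : lmul x (bas y) = mulV x y := lin_bas _ _
@[simp] theorem rmul_bas (x y : BasisElt) : rmul y (bas x) = mulV x y := lin_bas _ _

theorem mulV_assoc (x y z : BasisElt) : rmul z (mulV x y) = lmul x (mulV y z) := by
  have h := Basic.mul_assoc' x.2 y.2 z.2
  cases hxy : x.2.mul y.2 with
  | none =>
    rw [mulV_of_mul_none hxy, map_zero]
    rw [hxy, Option.bind_none] at h
    cases hyz : y.2.mul z.2 with
    | none => rw [mulV_of_mul_none hyz, map_zero]
    | some c =>
      rw [hyz, Option.bind_some] at h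
      rw [mulV_of_mul hyz, lmul_bas, mulV_of_mul_none h.symm]
  | some b =>
    rw [hxy, Option.bind_some] at h
    rw [mulV_of_mul hxy, rmul_bas]
    cases hyz : y.2.mul z.2 with
    | none =>
      rw [hyz, Option.bind_none] at h
      rw [mulV_of_mul_none hyz, map_zero, mulV_of_mul_none h]
    | some c =>
      rw [hyz, Option.bind_some] at h
      rw [mulV_of_mul hyz, lmul_bas]
      simp only [mulV, h, add_assoc]

theorem rmul_lmul (x z : BasisElt) (v : Vec BasisElt) :
    rmul z (lmul x v) = lmul x (rmul z v) :=
  linear_ext_apply (rmul z ∘ₗ lmul x) (lmul x ∘ₗ rmul z) (fun y => by simp [mulV_assoc]) v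

theorem lmul_lmul (x y : BasisElt) (v : Vec BasisElt) :
    lmul x (lmul y v) = lin (fun z => lmul z v) (mulV x y) := by
  refine (linear_ext_apply (lmul x ∘ₗ lmul y) (lin fun w => lin (fun z => mulV z w) (mulV x y))
    (fun w => ?_) v).trans ?_
  · simp only [LinearMap.comp_apply, lmul_bas, lin_bas]
    exact (mulV_assoc x y w).symm
  · exact lin_comm (fun w z => mulV z w) v (mulV x y)

theorem rmul_rmul (x y : BasisElt) (v : Vec BasisElt) :
    rmul y (rmul x v) = lin (fun z => rmul z v) (mulV x y) := by
  refine (linear_ext_apply (rmul y ∘ₗ rmul x) (lin fun w => lin (mulV w) (mulV x y))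
    (fun w => ?_) v).trans ?_
  · simp only [LinearMap.comp_apply, rmul_bas, lin_bas]
    exact mulV_assoc w x y
  · exact lin_comm (fun w z => mulV w z) v (mulV x y)

/-- The product as a cochain. -/
def mu2 : List BasisElt → Vec BasisElt
  | [x, y] => mulV x y
  | _ => 0

theorem mu2_of_length {l : List BasisElt} (h : l.length ≠ 2) : mu2 l = 0 := by
  rcases l with _ | ⟨x, _ | ⟨y, _ | ⟨z, l⟩⟩⟩
  · rfl
  · rfl
  · simp at h
  · rfl

theorem mu2_odd (l : List BasisElt) (h : Odd l.length) : mu2 l = 0 :=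
  mu2_of_length fun h2 => by rw [h2] at h; exact absurd h (by decide)

theorem applyPrefix_mu2 (x y : BasisElt) (l : List BasisElt) :
    applyPrefix mu2 (x :: y :: l) = lin (fun z => bas (z :: l)) (mulV x y) := by
  rw [applyPrefix, splitSum_eq_single (l := x :: y :: l) [x, y] l rfl]
  · rw [mu2, cns_bas_right]
  · intro p s h hp
    rw [mu2_of_length, map_zero, LinearMap.zero_apply]
    intro h2
    rcases p with _ | ⟨a, _ | ⟨b, _ | ⟨c, p⟩⟩⟩ <;> simp at h2
    simp only [List.cons_append, List.nil_append, List.cons.injEq] at h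
    exact hp (by rw [h.1, h.2.1])

theorem coder_mu2_nil : coder mu2 [] = 0 := by
  rw [coder_nil, applyPrefix, splitSum_nil, mu2_of_length (by simp), map_zero,
    LinearMap.zero_apply]

theorem coder_mu2_singleton (x : BasisElt) : coder mu2 [x] = 0 := by
  rw [coder_cons, coder_mu2_nil, map_zero, sub_zero, applyPrefix]
  refine splitSum_eq_zero fun p s h => ?_
  rw [mu2_of_length, map_zero, LinearMap.zero_apply]
  intro h2
  have := congrArg List.length h
  simp at this
  omega

theorem coder_mu2_cons (x y : BasisElt) (l : List BasisElt) : coder mu2 (x :: y :: l) =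
    lin (fun z => bas (z :: l)) (mulV x y) - cns (bas x) (coder mu2 (y :: l)) := by
  rw [coder_cons, applyPrefix_mu2]

theorem length_of_coder_mu2_ne_zero {l l' : List BasisElt} (h : coder mu2 l l' ≠ 0) :
    l'.length + 1 = l.length := by
  rcases l with _ | ⟨x, l⟩
  · rw [coder_mu2_nil] at h; exact absurd rfl h
  induction l generalizing x l' with
  | nil => rw [coder_mu2_singleton] at h; exact absurd rfl h
  | cons y l ih =>
    rw [coder_mu2_cons, Finsupp.sub_apply] at h
    by_cases h0 : lin (fun z => bas (z :: l)) (mulV x y) l' = 0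
    · rw [h0, zero_sub, neg_ne_zero] at h
      obtain ⟨b, t, rfl, -, ht⟩ := exists_of_cns_ne_zero h
      simpa using ih _ ht
    · obtain ⟨z, -, hz⟩ := exists_of_lin_ne_zero h0
      by_contra hne
      exact hz (Finsupp.single_eq_of_ne (by rintro rfl; simp at hne))

theorem circ_mu2_mu2 (l : List BasisElt) : circ mu2 mu2 l = 0 := by
  by_cases h3 : l.length = 3
  · obtain ⟨x, y, z, rfl⟩ := List.length_eq_three.1 h3
    rw [circ, coder_mu2_cons, coder_mu2_cons, coder_mu2_singleton, map_zero, sub_zero]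
    simp only [map_sub, map_lin, lin_bas, cns_bas]
    simp only [mu2]
    exact sub_eq_zero.2 (mulV_assoc x y z)
  · refine lin_eq_zero fun l' hl' => mu2_of_length fun h2 => h3 ?_
    rw [← length_of_coder_mu2_ne_zero hl', h2]

theorem coder_mu2_coder_mu2 (l : List BasisElt) : lin (coder mu2) (coder mu2 l) = 0 :=
  coder_coder_eq_zero mu2_odd circ_mu2_mu2 l

/-! ### The Hochschild differential -/

/-- The inner part of the Hochschild differential. -/
def mergeSum (φ : List BasisElt → Vec BasisElt) (l : List BasisElt) : Vec BasisElt :=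
  lin φ (coder mu2 l)

@[simp] theorem mergeSum_nil (φ : List BasisElt → Vec BasisElt) : mergeSum φ [] = 0 := by
  rw [mergeSum, coder_mu2_nil, map_zero]

@[simp] theorem mergeSum_singleton (φ : List BasisElt → Vec BasisElt) (x : BasisElt) :
    mergeSum φ [x] = 0 := by rw [mergeSum, coder_mu2_singleton, map_zero]

theorem mergeSum_cons (φ : List BasisElt → Vec BasisElt) (x y : BasisElt) (l : List BasisElt) :
    mergeSum φ (x :: y :: l) = lin (fun z => φ (z :: l)) (mulV x y) -
      mergeSum (fun t => φ (x :: t)) (y :: l) := by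
  rw [mergeSum, coder_mu2_cons, map_sub, map_lin, lin_cns, lin_bas]
  simp only [lin_bas]
  rfl

theorem mergeSum_pair (φ : List BasisElt → Vec BasisElt) (x y : BasisElt) :
    mergeSum φ [x, y] = lin (fun z => φ [z]) (mulV x y) := by
  rw [mergeSum_cons, mergeSum_singleton, sub_zero]

/-- Splitting the sum over merges at an entry. -/
theorem mergeSum_append (φ : List BasisElt → Vec BasisElt) (p : List BasisElt) (x : BasisElt)
    (s : List BasisElt) : mergeSum φ (p ++ x :: s) = mergeSum (fun t => φ (t ++ s)) (p ++ [x]) +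
      (-1 : ℤ) ^ p.length • mergeSum (fun t => φ (p ++ t)) (x :: s) := by
  induction p generalizing φ with
  | nil => simp
  | cons a p ih =>
    cases p with
    | nil =>
      simp only [List.cons_append, List.nil_append, mergeSum_cons, mergeSum_singleton, sub_zero,
        List.length_cons, List.length_nil, zero_add, pow_one, neg_smul, one_smul]
      rw [sub_eq_add_neg]
    | cons b p =>
      simp only [List.cons_append, mergeSum_cons] at ih ⊢
      rw [ih]
      simp only [List.length_cons, pow_succ, mul_neg, mul_one, neg_smul, List.append_assoc,
        List.cons_append, List.nil_append]
      abel

/-- The left-most term of the Hochschild differential. -/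
def leftTerm (c : List BasisElt → Vec BasisElt) : List BasisElt → Vec BasisElt
  | [] => 0
  | x :: l => lmul x (c l)

/-- The right-most term of the Hochschild differential. -/
def rightTerm (c : List BasisElt → Vec BasisElt) (l : List BasisElt) : Vec BasisElt :=
  splitSum l fun p s => match s with
    | [y] => rmul y (c p)
    | _ => 0

@[simp] theorem rightTerm_nil (c : List BasisElt → Vec BasisElt) : rightTerm c [] = 0 := rfl

@[simp] theorem rightTerm_snoc (c : List BasisElt → Vec BasisElt) (p : List BasisElt)
    (y : BasisElt) : rightTerm c (p ++ [y]) = rmul y (c p) := by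
  rw [rightTerm, splitSum_eq_single p [y] rfl]
  intro p' s' h hp
  rcases s' with _ | ⟨a, _ | ⟨b, s⟩⟩
  · rfl
  · exact absurd (List.append_inj_left' h rfl) hp
  · rfl

@[simp] theorem rightTerm_singleton (c : List BasisElt → Vec BasisElt) (y : BasisElt) :
    rightTerm c [y] = rmul y (c []) := rightTerm_snoc c [] y

/-- The Hochschild differential of the algebra over the ground ring. -/
def hdiff (c : List BasisElt → Vec BasisElt) (l : List BasisElt) : Vec BasisElt :=
  mergeSum c l - leftTerm c l - (-1 : ℤ) ^ l.length • rightTerm c l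

theorem hdiff_nil (c : List BasisElt → Vec BasisElt) : hdiff c [] = 0 := by
  simp [hdiff, leftTerm]

theorem mergeSum_add (c c' : List BasisElt → Vec BasisElt) (l : List BasisElt) :
    mergeSum (fun l => c l + c' l) l = mergeSum c l + mergeSum c' l := lin_add_fun _ _ _

theorem hdiff_add (c c' : List BasisElt → Vec BasisElt) (l : List BasisElt) :
    hdiff (fun l => c l + c' l) l = hdiff c l + hdiff c' l := by
  have h1 : leftTerm (fun l => c l + c' l) l = leftTerm c l + leftTerm c' l := by
    cases l <;> simp [leftTerm]
  have h2 : rightTerm (fun l => c l + c' l) l = rightTerm c l + rightTerm c' l := by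
    simp only [rightTerm, ← splitSum_add]
    refine splitSum_congr fun p s _ => ?_
    split <;> simp
  rw [hdiff, mergeSum_add, h1, h2, hdiff, hdiff, smul_add]
  abel

theorem hdiff_neg (c : List BasisElt → Vec BasisElt) (l : List BasisElt) :
    hdiff (fun l => -c l) l = -hdiff c l := by
  have h := hdiff_add c (fun l => -c l) l
  have h0 : hdiff (fun _ => 0) l = 0 := by
    have := hdiff_add (fun _ => 0) (fun _ => 0) l
    simpa using this
  simp only [add_neg_cancel, h0] at h
  exact (neg_eq_of_add_eq_zero_right h.symm).symm

theorem hdiff_sub (c c' : List BasisElt → Vec BasisElt) (l : List BasisElt) :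
    hdiff (fun l => c l - c' l) l = hdiff c l - hdiff c' l := by
  simp only [sub_eq_add_neg, hdiff_add, hdiff_neg]

theorem mergeSum_leftTerm (c : List BasisElt → Vec BasisElt) (x y : BasisElt)
    (l : List BasisElt) : mergeSum (leftTerm c) (x :: y :: l) =
      lmul x (lmul y (c l)) - lmul x (mergeSum c (y :: l)) := by
  rw [mergeSum_cons, lmul_lmul]
  congr 1
  exact (map_lin (lmul x) c _).symm

theorem mergeSum_rightTerm (c : List BasisElt → Vec BasisElt) (l : List BasisElt)
    (x y : BasisElt) : mergeSum (rightTerm c) (l ++ [x, y]) =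
      rmul y (mergeSum c (l ++ [x])) + (-1 : ℤ) ^ l.length • rmul y (rmul x (c l)) := by
  rw [mergeSum_append, mergeSum_pair, rmul_rmul]
  congr 1
  · simp only [rightTerm_snoc]
    exact (map_lin (rmul y) c _).symm
  · simp only [rightTerm_snoc]

/-- Two merges cancel because the bar differential of an associative product squares to zero. A
merge and an outer multiplication cancel except when the merged entries are the two outermost ones,
and those terms cancel by associativity. The two outer multiplications on opposite sides commute. -/
theorem hdiff_hdiff (c : List BasisElt → Vec BasisElt) (l : List BasisElt) :
    hdiff (hdiff c) l = 0 := by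
  rcases l with _ | ⟨x, _ | ⟨y, l⟩⟩
  · exact hdiff_nil _
  · rw [hdiff, mergeSum_singleton, leftTerm, rightTerm_singleton, hdiff_nil]
    simp
  have e : hdiff (hdiff c) (x :: y :: l) = mergeSum (mergeSum c) (x :: y :: l) -
      mergeSum (leftTerm c) (x :: y :: l) -
      mergeSum (fun l => (-1 : ℤ) ^ l.length • rightTerm c l) (x :: y :: l) -
      lmul x (hdiff c (y :: l)) - (-1 : ℤ) ^ (l.length + 2) • rightTerm (hdiff c) (x :: y :: l) := by
    rw [hdiff]
    congr 1
    congr 1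
    simp only [mergeSum, ← lin_sub_fun]
    rfl
  have h1 : mergeSum (mergeSum c) (x :: y :: l) = 0 := by
    have := coder_mu2_coder_mu2 (x :: y :: l)
    have h := congrArg (lin c) this
    rwa [map_zero, map_lin] at h
  have h2 : mergeSum (fun l => (-1 : ℤ) ^ l.length • rightTerm c l) (x :: y :: l) =
      -(-1 : ℤ) ^ l.length • mergeSum (rightTerm c) (x :: y :: l) := by
    rw [mergeSum, mergeSum, ← lin_smul_fun]
    refine lin_congr fun l' hl' => ?_
    have : l'.length = l.length + 1 := by
      have := length_of_coder_mu2_ne_zero hl'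
      simpa using this
    rw [this, pow_succ]
    simp
  rw [e, h1, h2, mergeSum_leftTerm]
  obtain ⟨m, z, hm⟩ : ∃ m z, y :: l = m ++ [z] := by
    rcases List.eq_nil_or_concat (y :: l) with h | ⟨m, z, h⟩
    · simp at h
    · exact ⟨m, z, by rw [h]; simp⟩
  have hlen : m.length = l.length := by
    have := congrArg List.length hm
    simpa using this.symm
  have h3 : rightTerm (hdiff c) (x :: y :: l) = rmul z (hdiff c (x :: m)) := by
    rw [hm, ← List.cons_append, rightTerm_snoc]
  have h4 : hdiff c (y :: l) = mergeSum c (y :: l) - lmul y (c l) -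
      (-1 : ℤ) ^ (l.length + 1) • rmul z (c m) := by
    rw [hdiff, leftTerm]
    congr 2
    rw [hm, rightTerm_snoc]
  obtain ⟨m', z', hm'⟩ : ∃ m' z', x :: m = m' ++ [z'] := by
    rcases List.eq_nil_or_concat (x :: m) with h | ⟨m, z, h⟩
    · simp at h
    · exact ⟨m, z, by rw [h]; simp⟩
  have hlen' : m'.length = l.length := by
    have := congrArg List.length hm'
    simp only [List.length_cons, List.length_append, List.length_nil] at this
    omega
  have h5 : mergeSum (rightTerm c) (x :: y :: l) = rmul z (mergeSum c (x :: m)) +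
      (-1 : ℤ) ^ l.length • rmul z (rmul z' (c m')) := by
    have e2 : x :: y :: l = m' ++ [z', z] := by
      rw [hm, ← List.cons_append, hm']; simp
    rw [e2, mergeSum_rightTerm, ← hm', hlen']
  have h6 : hdiff c (x :: m) = mergeSum c (x :: m) - lmul x (c m) -
      (-1 : ℤ) ^ (l.length + 1) • rmul z' (c m') := by
    rw [hdiff, leftTerm, List.length_cons, hlen]
    congr 2
    rw [hm', rightTerm_snoc]
  rw [h3, h4, h5, h6]
  rcases Nat.even_or_odd l.length with h | h
  · simp only [map_sub, map_smul, h.neg_one_pow, pow_succ, rmul_lmul]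
    simp only [mul_neg, mul_one, neg_neg, neg_smul, one_smul]
    abel
  · simp only [map_sub, map_smul, h.neg_one_pow, pow_succ, rmul_lmul]
    simp only [mul_neg, mul_one, neg_neg, neg_smul, one_smul]
    abel

end Product

end TorusAlgebra

namespace TorusAlgebra

open BarConstruction

noncomputable section Degrees

/-! ### Paths and gradings of lists of basis elements -/

/-- The list is composable, from the idempotent `j` to the idempotent `j'`. -/
def IsPath : Fin 2 → List BasisElt → Fin 2 → Prop
  | j, [], j' => j = j'
  | j, b :: l, j' => b.2.left = j ∧ IsPath b.2.right l j'

theorem isPath_append {j j' : Fin 2} {l m : List BasisElt} :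
    IsPath j (l ++ m) j' ↔ ∃ i, IsPath j l i ∧ IsPath i m j' := by
  induction l generalizing j with
  | nil => simp [IsPath]
  | cons b l ih => simp [IsPath, ih, and_assoc]

/-- The central element `λ_d^a λ_w^b`. -/
def shift (a b : ℤ) : Gam := lamD ^ a * lamW ^ b

theorem lamD_comm (g : Gam) : lamD * g = g * lamD := by
  refine Prod.ext (Subtype.ext (Triple.ext ?_ ?_ ?_)) (mul_comm _ _)
  · change 1 + g.1.1.m + (0 * g.1.1.b - 0 * g.1.1.a) = g.1.1.m + 1 + (g.1.1.a * 0 - g.1.1.b * 0)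
    ring
  · exact add_comm _ _
  · exact add_comm _ _

theorem lamW_comm (g : Gam) : lamW * g = g * lamW :=
  Prod.ext ((one_mul _).trans (mul_one _).symm) (mul_comm _ _)

theorem shift_comm (a b : ℤ) (g : Gam) : shift a b * g = g * shift a b := by
  have h1 : Commute lamD g := lamD_comm g
  have h2 : Commute lamW g := lamW_comm g
  exact (h1.zpow_left a).mul_left (h2.zpow_left b)

theorem shift_mul (a b a' b' : ℤ) : shift a b * shift a' b' = shift (a + a') (b + b') := by
  have h : lamW ^ b * lamD ^ a' = lamD ^ a' * lamW ^ b :=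
    (Commute.zpow_zpow (lamW_comm lamD) b a').eq
  rw [shift, shift, shift, zpow_add, zpow_add, mul_assoc, ← mul_assoc (lamW ^ b), h]
  simp only [mul_assoc]

@[simp] theorem shift_zero : shift 0 0 = 1 := by simp [shift]

theorem gammaU_eq : gammaU = shift (-2) 1 := by
  have : shift (-2) 1 = (lamD * lamD)⁻¹ * lamW := by
    rw [shift, zpow_one, zpow_neg, zpow_ofNat, pow_two]
  rw [this]
  refine Prod.ext (Subtype.ext (Triple.ext ?_ ?_ ?_)) ?_
  · change (-2 : ℚ) = -(1 + 1 + (0 * 0 - 0 * 0)) + 0 + _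
    norm_num [Triple.mul_def, Triple.inv_def, lamD, lamW]
  · norm_num [gammaU, Triple.mul_def, Triple.inv_def, lamD, lamW]
  · norm_num [gammaU, Triple.mul_def, Triple.inv_def, lamD, lamW]
  · rfl

theorem shift_pow (a b : ℤ) (n : ℕ) : shift a b ^ n = shift (n * a) (n * b) := by
  induction n with
  | zero => simp
  | succ n ih => rw [pow_succ, ih, shift_mul]; congr 1 <;> push_cast <;> ring

/-- The grading of the basis element `U^m b`. -/
def gamma (x : BasisElt) : Gam := gammaU ^ x.1 * gammaBasic x.2

/-- The product of the gradings of the entries of a list. -/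
def gam (l : List BasisElt) : Gam := (l.map gamma).prod

@[simp] theorem gam_nil : gam [] = 1 := rfl
theorem gam_cons (x : BasisElt) (l : List BasisElt) : gam (x :: l) = gamma x * gam l := by
  simp [gam]
theorem gam_append (l m : List BasisElt) : gam (l ++ m) = gam l * gam m := by simp [gam]
@[simp] theorem gam_singleton (x : BasisElt) : gam [x] = gamma x := by simp [gam]

theorem gamma_eq (m : ℕ) (b : Basic) : gamma (m, b) = shift (-2 * m) m * gammaBasic b := by
  rw [gamma, gammaU_eq, shift_pow]; congr 2 <;> ring

theorem gammaBasic_reeb (i : ZMod 4) (n : ℕ) : gammaBasic (.reeb i n) =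
    ((List.range (n + 1)).map fun j : ℕ => gammaRho (i + (j : ZMod 4))).prod := by
  simp only [gammaBasic]
  congr 1
  induction List.range (n + 1) with
  | nil => rfl
  | cons a l ih => rw [List.map_cons, ← ih]; rfl

theorem gammaBasic_mul {a b c : Basic} (h : a.mul b = some c) :
    gammaBasic c = gammaBasic a * gammaBasic b := by
  cases a with
  | idem j =>
    rw [Basic.idem_mul] at h
    split_ifs at h
    cases h
    simp [gammaBasic]
  | reeb i n =>
    cases b with
    | idem j =>
      rw [Basic.mul_idem] at h
      split_ifs at h
      cases h
      simp [gammaBasic]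
    | reeb i' n' =>
      rw [Basic.reeb_mul_reeb] at h
      split_ifs at h with hi
      cases h
      simp only [gammaBasic_reeb]
      rw [show n + n' + 1 + 1 = (n + 1) + (n' + 1) by ring, List.range_add, List.map_append,
        List.prod_append, List.map_map]
      congr 2
      refine List.map_congr_left fun j _ => ?_
      simp only [Function.comp_apply, hi]
      congr 1
      push_cast
      ring

theorem gamma_mul {x y z : BasisElt} (h1 : z.1 = x.1 + y.1) (h : x.2.mul y.2 = some z.2) :
    gamma z = gamma x * gamma y := by
  obtain ⟨m, a⟩ := x
  obtain ⟨n, b⟩ := y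
  obtain ⟨k, c⟩ := z
  simp only at h1 h
  rw [gamma_eq, gamma_eq, gamma_eq, gammaBasic_mul h, h1]
  rw [mul_assoc (shift _ _) (gammaBasic a), ← mul_assoc (gammaBasic a) (shift _ _), ← shift_comm,
    mul_assoc (shift _ _) (gammaBasic a), ← mul_assoc (shift _ _) (shift _ _), shift_mul]
  congr 2
  · push_cast; ring

/-- A list of basis elements `l'` may occur in the image of `l` under a map of degree
`λ_d^{|l| - |l'| + d} λ_w^w`, where `w₀ ≤ w` and `k ≤ |l| - |l'| + 3 w`. -/
def DegRel (d : ℤ) (w₀ : ℕ) (k : ℤ) (l l' : List BasisElt) : Prop :=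
  (∀ j j', IsPath j l' j' → IsPath j l j') ∧ Even ((l.length : ℤ) + l'.length + d) ∧
    ∃ w : ℕ, w₀ ≤ w ∧ k ≤ (l.length : ℤ) - l'.length + 3 * w ∧
      gam l' = shift ((l.length : ℤ) - l'.length + d) w * gam l

namespace DegRel

theorem refl (l : List BasisElt) : DegRel 0 0 0 l l :=
  ⟨fun _ _ h => h, by simp, 0, le_rfl, by simp, by simp⟩

theorem trans {d d' k k' : ℤ} {w w' : ℕ} {l m n : List BasisElt} (h : DegRel d w k l m)
    (h' : DegRel d' w' k' m n) : DegRel (d + d') (w + w') (k + k') l n := by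
  obtain ⟨h1, h2, v, h3, h4, h5⟩ := h
  obtain ⟨h1', h2', v', h3', h4', h5'⟩ := h'
  refine ⟨fun j j' h => h1 j j' (h1' j j' h), ?_, v + v', by omega, by push_cast; omega, ?_⟩
  · have := h2.add h2'
    rw [Int.even_iff] at this ⊢
    omega
  · rw [h5', h5, ← mul_assoc, shift_mul]
    congr 2
    · ring
    · push_cast; ring

theorem append {d d' k k' : ℤ} {w w' : ℕ} {l l' m m' : List BasisElt} (h : DegRel d w k l l')
    (h' : DegRel d' w' k' m m') : DegRel (d + d') (w + w') (k + k') (l ++ m) (l' ++ m') := by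
  obtain ⟨h1, h2, v, h3, h4, h5⟩ := h
  obtain ⟨h1', h2', v', h3', h4', h5'⟩ := h'
  refine ⟨fun j j' h => ?_, ?_, v + v', by omega, by push_cast [List.length_append]; omega, ?_⟩
  · obtain ⟨i, hi, hi'⟩ := isPath_append.1 h
    exact isPath_append.2 ⟨i, h1 _ _ hi, h1' _ _ hi'⟩
  · have := h2.add h2'
    rw [Int.even_iff] at this ⊢
    push_cast [List.length_append]
    omega
  · rw [gam_append, gam_append, h5, h5', mul_assoc, ← mul_assoc (gam l), ← shift_comm,
      ← mul_assoc, ← mul_assoc, shift_mul, mul_assoc]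
    congr 2
    · push_cast [List.length_append]; ring

theorem mono {d k k' : ℤ} {w w' : ℕ} {l l' : List BasisElt} (h : DegRel d w k l l')
    (hw : w' ≤ w) (hk : k' ≤ k) : DegRel d w' k' l l' := by
  obtain ⟨h1, h2, v, h3, h4, h5⟩ := h
  exact ⟨h1, h2, v, hw.trans h3, hk.trans h4, h5⟩

theorem cons {d k : ℤ} {w : ℕ} {l l' : List BasisElt} (x : BasisElt) (h : DegRel d w k l l') :
    DegRel d w k (x :: l) (x :: l') := by
  simpa using (refl [x]).append h

theorem append_left {d k : ℤ} {w : ℕ} {l l' : List BasisElt} (p : List BasisElt)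
    (h : DegRel d w k l l') : DegRel d w k (p ++ l) (p ++ l') := by
  simpa using (refl p).append h

theorem append_right {d k : ℤ} {w : ℕ} {l l' : List BasisElt} (s : List BasisElt)
    (h : DegRel d w k l l') : DegRel d w k (l ++ s) (l' ++ s) := by
  simpa using h.append (refl s)

theorem of_mul {x y z : BasisElt} (h1 : z.1 = x.1 + y.1) (h : x.2.mul y.2 = some z.2) :
    DegRel (-1) 0 1 [x, y] [z] := by
  obtain ⟨hl, hr, hm⟩ := Basic.mul_left_right h
  refine ⟨fun j j' hj => ?_, by simp, 0, le_rfl, by simp, ?_⟩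
  · exact ⟨hl.symm.trans hj.1, hm.symm, hr.symm.trans hj.2⟩
  · simp [gam_cons, gamma_mul h1 h]

theorem of_mul_symm {x y z : BasisElt} (h1 : z.1 = x.1 + y.1) (h : x.2.mul y.2 = some z.2) :
    DegRel 1 0 (-1) [z] [x, y] := by
  obtain ⟨hl, hr, hm⟩ := Basic.mul_left_right h
  refine ⟨fun j j' hj => ?_, by simp; decide, 0, le_rfl, by simp, ?_⟩
  · exact ⟨hl.trans hj.1, hr.trans hj.2.2⟩
  · simp [gam_cons, gamma_mul h1 h]

theorem of_mulV {x y z : BasisElt} (h : mulV x y z ≠ 0) : DegRel (-1) 0 1 [x, y] [z] :=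
  of_mul (mulV_ne_zero h).1 (mulV_ne_zero h).2

end DegRel

/-- No entry of the list is an idempotent. -/
def NoIdem (l : List BasisElt) : Prop := ∀ j, ((0, .idem j) : BasisElt) ∉ l

/-- The cochain `c` is normalized, and its values are of degree as in `DegRel`. -/
def Adm (d : ℤ) (w₀ : ℕ) (k : ℤ) (c : List BasisElt → Vec BasisElt) : Prop :=
  ∀ l x, c l x ≠ 0 → NoIdem l ∧ DegRel d w₀ k l [x]

/-- The values of the cochain `c` are of degree as in `DegRel`. -/
def Gr (d : ℤ) (w₀ : ℕ) (k : ℤ) (c : List BasisElt → Vec BasisElt) : Prop :=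
  ∀ l x, c l x ≠ 0 → DegRel d w₀ k l [x]

theorem Adm.gr {d k : ℤ} {w : ℕ} {c : List BasisElt → Vec BasisElt} (h : Adm d w k c) :
    Gr d w k c := fun l x hx => (h l x hx).2

theorem Gr.mono {d k k' : ℤ} {w w' : ℕ} {c : List BasisElt → Vec BasisElt} (h : Gr d w k c)
    (hw : w' ≤ w) (hk : k' ≤ k) : Gr d w' k' c := fun l x hx => (h l x hx).mono hw hk

theorem Adm.mono {d k k' : ℤ} {w w' : ℕ} {c : List BasisElt → Vec BasisElt} (h : Adm d w k c)
    (hw : w' ≤ w) (hk : k' ≤ k) : Adm d w' k' c :=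
  fun l x hx => ⟨(h l x hx).1, (h l x hx).2.mono hw hk⟩

theorem add_apply_ne_zero {X : Type*} {v w : X →₀ ℤ} {x : X} (h : (v + w) x ≠ 0) :
    v x ≠ 0 ∨ w x ≠ 0 := by
  by_contra! H
  exact h (by rw [Finsupp.add_apply, H.1, H.2, add_zero])

theorem sub_apply_ne_zero {X : Type*} {v w : X →₀ ℤ} {x : X} (h : (v - w) x ≠ 0) :
    v x ≠ 0 ∨ w x ≠ 0 := by
  by_contra! H
  exact h (by rw [Finsupp.sub_apply, H.1, H.2, sub_zero])

theorem smul_apply_ne_zero {X : Type*} {a : ℤ} {v : X →₀ ℤ} {x : X} (h : (a • v) x ≠ 0) :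
    v x ≠ 0 := by
  intro H
  exact h (by rw [Finsupp.smul_apply, H, smul_zero])

theorem Adm.add {d k : ℤ} {w : ℕ} {c c' : List BasisElt → Vec BasisElt} (h : Adm d w k c)
    (h' : Adm d w k c') : Adm d w k fun l => c l + c' l :=
  fun l x hx => (add_apply_ne_zero hx).elim (h l x) (h' l x)

theorem Adm.sub {d k : ℤ} {w : ℕ} {c c' : List BasisElt → Vec BasisElt} (h : Adm d w k c)
    (h' : Adm d w k c') : Adm d w k fun l => c l - c' l :=
  fun l x hx => (sub_apply_ne_zero hx).elim (h l x) (h' l x)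

theorem Gr.add {d k : ℤ} {w : ℕ} {c c' : List BasisElt → Vec BasisElt} (h : Gr d w k c)
    (h' : Gr d w k c') : Gr d w k fun l => c l + c' l :=
  fun l x hx => (add_apply_ne_zero hx).elim (h l x) (h' l x)

theorem Gr.sub {d k : ℤ} {w : ℕ} {c c' : List BasisElt → Vec BasisElt} (h : Gr d w k c)
    (h' : Gr d w k c') : Gr d w k fun l => c l - c' l :=
  fun l x hx => (sub_apply_ne_zero hx).elim (h l x) (h' l x)

/-- In the conventions of `DegRel`, operations of degree `λ_d^{n-2}` have `d = -1`, components of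
homomorphisms have `d = 0`, and A∞-relations have `d = -2`. -/
theorem gr_mu2 : Gr (-1) 0 1 mu2 := by
  intro l x hx
  rcases l with _ | ⟨y, _ | ⟨z, _ | ⟨t, l⟩⟩⟩
  · exact absurd rfl hx
  · exact absurd rfl hx
  · exact DegRel.of_mulV hx
  · exact absurd rfl hx

end Degrees

end TorusAlgebra

/-! ### Supports of coderivations -/

namespace BarConstruction

noncomputable section

variable {B : Type}

theorem exists_of_splitSum_apply_ne_zero {α X : Type*} {l : List α}
    {Φ : List α → List α → (X →₀ ℤ)} {x : X} (h : splitSum l Φ x ≠ 0) :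
    ∃ p s, p ++ s = l ∧ Φ p s x ≠ 0 := by
  have h2 := map_splitSum (Finsupp.applyAddHom x) l Φ
  simp only [Finsupp.applyAddHom_apply] at h2
  rw [h2] at h
  exact exists_of_splitSum_ne_zero h

theorem exists_of_applyPrefix_ne_zero {c : List B → Vec B} {l l' : List B}
    (h : applyPrefix c l l' ≠ 0) : ∃ q s x, l = q ++ s ∧ l' = x :: s ∧ c q x ≠ 0 := by
  rw [applyPrefix] at h
  obtain ⟨q, s, rfl, h'⟩ := exists_of_splitSum_apply_ne_zero h
  obtain ⟨x, t, rfl, hx, ht⟩ := exists_of_cns_ne_zero h'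
  refine ⟨q, s, x, rfl, ?_, hx⟩
  by_contra hne
  exact ht (Finsupp.single_eq_of_ne fun h => hne (by rw [h]))

theorem exists_of_coder_ne_zero {c : List B → Vec B} {l l' : List B} (h : coder c l l' ≠ 0) :
    ∃ p q s x, l = p ++ (q ++ s) ∧ l' = p ++ x :: s ∧ c q x ≠ 0 := by
  induction l generalizing l' with
  | nil =>
    obtain ⟨q, s, x, h1, h2, h3⟩ := exists_of_applyPrefix_ne_zero h
    exact ⟨[], q, s, x, h1, h2, h3⟩
  | cons b l ih =>
    rw [coder_cons] at h
    rcases TorusAlgebra.sub_apply_ne_zero h with h | h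
    · obtain ⟨q, s, x, h1, h2, h3⟩ := exists_of_applyPrefix_ne_zero h
      exact ⟨[], q, s, x, h1, h2, h3⟩
    · obtain ⟨y, t, rfl, hy, ht⟩ := exists_of_cns_ne_zero h
      have hyb : y = b := by
        by_contra hne
        exact hy (Finsupp.single_eq_of_ne hne)
      obtain ⟨p, q, s, x, rfl, rfl, h3⟩ := ih ht
      exact ⟨b :: p, q, s, x, rfl, by rw [hyb]; rfl, h3⟩

end

end BarConstruction

/-! ### Degrees of composites and of the Hochschild differential -/

namespace TorusAlgebra

open BarConstruction

noncomputable section Degrees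

theorem Gr.coder {d k : ℤ} {w : ℕ} {c : List BasisElt → Vec BasisElt} (h : Gr d w k c)
    {l l' : List BasisElt} (hl : coder c l l' ≠ 0) : DegRel d w k l l' := by
  obtain ⟨p, q, s, x, rfl, rfl, hx⟩ := exists_of_coder_ne_zero hl
  exact ((h q x hx).append_right s).append_left p

theorem Gr.coalg {c : List BasisElt → Vec BasisElt} (h : Gr 0 0 0 c) {l l' : List BasisElt}
    (hl : coalg c l l' ≠ 0) : DegRel 0 0 0 l l' :=
  coalg_induction (DegRel.refl []) (fun b p s x t hx hs => by
    simpa using (h (b :: p) x hx).append hs) l l' hl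

theorem Gr.lin {d d' k k' : ℤ} {w w' : ℕ} {c : List BasisElt → Vec BasisElt} (h : Gr d w k c)
    {l : List BasisElt} {v : Ten BasisElt} (hv : ∀ l', v l' ≠ 0 → DegRel d' w' k' l l')
    {x : BasisElt} (hx : lin c v x ≠ 0) : DegRel (d' + d) (w' + w) (k' + k) l [x] := by
  obtain ⟨l', h1, h2⟩ := exists_of_lin_ne_zero hx
  exact (hv l' h1).trans (h l' x h2)

theorem Gr.circ {d d' k k' : ℤ} {w w' : ℕ} {c c' : List BasisElt → Vec BasisElt} (h : Gr d w k c)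
    (h' : Gr d' w' k' c') : Gr (d' + d) (w' + w) (k' + k) (circ c c') :=
  fun _ _ hx => h.lin (fun _ => h'.coder) hx

theorem Gr.parity {d k : ℤ} {w : ℕ} {c : List BasisElt → Vec BasisElt} (h : Gr d w k c)
    {l : List BasisElt} (hl : ¬ Even ((l.length : ℤ) + 1 + d)) : c l = 0 := by
  ext x
  by_contra hx
  exact hl (by simpa using (h l x hx).2.1)

theorem Gr.path {d k : ℤ} {w : ℕ} {c : List BasisElt → Vec BasisElt} (h : Gr d w k c)
    {l : List BasisElt} {x : BasisElt} (hx : c l x ≠ 0) : IsPath x.2.left l x.2.right :=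
  (h l x hx).1 _ _ ⟨rfl, rfl⟩

theorem Gr.leftTerm {d k : ℤ} {w : ℕ} {c : List BasisElt → Vec BasisElt} (h : Gr d w k c) :
    Gr (d - 1) w (k + 1) (leftTerm c) := by
  intro l x hx
  cases l with
  | nil => exact absurd rfl hx
  | cons y l =>
    obtain ⟨z, hz, hyz⟩ := exists_of_lin_ne_zero hx
    have := ((h l z hz).cons y).trans (DegRel.of_mulV hyz)
    simpa [sub_eq_add_neg] using this

theorem exists_of_rightTerm_ne_zero {c : List BasisElt → Vec BasisElt} {l : List BasisElt}
    {x : BasisElt} (h : rightTerm c l x ≠ 0) :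
    ∃ p y z, l = p ++ [y] ∧ c p z ≠ 0 ∧ mulV z y x ≠ 0 := by
  rcases List.eq_nil_or_concat l with rfl | ⟨p, y, rfl⟩
  · exact absurd rfl h
  · rw [List.concat_eq_append, rightTerm_snoc] at h
    obtain ⟨z, hz, hyz⟩ := exists_of_lin_ne_zero h
    exact ⟨p, y, z, List.concat_eq_append, hz, hyz⟩

theorem Gr.rightTerm {d k : ℤ} {w : ℕ} {c : List BasisElt → Vec BasisElt} (h : Gr d w k c) :
    Gr (d - 1) w (k + 1) (rightTerm c) := by
  intro l x hx
  obtain ⟨p, y, z, rfl, hz, hyz⟩ := exists_of_rightTerm_ne_zero hx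
  have := ((h p z hz).append_right [y]).trans (DegRel.of_mulV hyz)
  simpa [sub_eq_add_neg] using this

theorem Gr.mergeSum {d k : ℤ} {w : ℕ} {c : List BasisElt → Vec BasisElt} (h : Gr d w k c) :
    Gr (d - 1) w (k + 1) (mergeSum c) := by
  intro l x hx
  have := h.circ gr_mu2 l x hx
  rw [neg_add_eq_sub, zero_add, add_comm] at this
  exact this

theorem Gr.smul {d k : ℤ} {w : ℕ} {c : List BasisElt → Vec BasisElt} (h : Gr d w k c)
    (a : List BasisElt → ℤ) : Gr d w k fun l => a l • c l :=
  fun l x hx => h l x (smul_apply_ne_zero hx)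

theorem Gr.hdiff {d k : ℤ} {w : ℕ} {c : List BasisElt → Vec BasisElt} (h : Gr d w k c) :
    Gr (d - 1) w (k + 1) (hdiff c) :=
  (h.mergeSum.sub h.leftTerm).sub (h.rightTerm.smul _)

end Degrees

end TorusAlgebra

namespace TorusAlgebra

open BarConstruction

noncomputable section Normalized

/-! ### Normalized cochains -/

/-- Multiplication by `U^m`. -/
def mulU (m : ℕ) : Vec BasisElt →ₗ[ℤ] Vec BasisElt := lin fun x => bas (m + x.1, x.2)

@[simp] theorem mulU_bas (m : ℕ) (x : BasisElt) : mulU m (bas x) = bas (m + x.1, x.2) :=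
  lin_bas _ _

@[simp] theorem mulU_zero (v : Vec BasisElt) : mulU 0 v = v := by
  simp only [mulU, zero_add]
  exact lin_bas_fun v

theorem mulV_idem_left {y : BasisElt} {j : Fin 2} (m : ℕ) (h : y.2.left = j) :
    mulV (m, .idem j) y = bas (m + y.1, y.2) :=
  mulV_of_mul (b := y.2) (by rw [Basic.idem_mul, if_pos h.symm])

theorem mulV_idem_right {y : BasisElt} {j : Fin 2} (m : ℕ) (h : y.2.right = j) :
    mulV y (m, .idem j) = bas (m + y.1, y.2) := by
  rw [mulV_of_mul (b := y.2) (by rw [Basic.mul_idem, if_pos h]), add_comm]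

theorem lmul_idem {v : Vec BasisElt} {j : Fin 2} (m : ℕ) (h : ∀ x, v x ≠ 0 → x.2.left = j) :
    lmul (m, .idem j) v = mulU m v :=
  lin_congr fun x hx => mulV_idem_left m (h x hx)

theorem rmul_idem {v : Vec BasisElt} {j : Fin 2} (m : ℕ) (h : ∀ x, v x ≠ 0 → x.2.right = j) :
    rmul (m, .idem j) v = mulU m v :=
  lin_congr fun x hx => mulV_idem_right m (h x hx)

theorem lmul_idem_eq_rmul_idem {v : Vec BasisElt} (m : ℕ) (j : Fin 2)
    (h : ∀ x, v x ≠ 0 → x.2.left = x.2.right) : lmul (m, .idem j) v = rmul (m, .idem j) v := by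
  refine lin_congr fun x hx => ?_
  by_cases hj : x.2.left = j
  · rw [mulV_idem_left m hj, mulV_idem_right m ((h x hx).symm.trans hj)]
  · rw [mulV_of_mul_none, mulV_of_mul_none]
    · rw [Basic.mul_idem, if_neg]; rwa [← h x hx]
    · rw [Basic.idem_mul, if_neg (Ne.symm hj)]

theorem not_noIdem (p s : List BasisElt) (j : Fin 2) : ¬ NoIdem (p ++ (0, .idem j) :: s) :=
  fun h => h j (by simp)

theorem mergeSum_eq_zero {φ : List BasisElt → Vec BasisElt} {l : List BasisElt}
    (h : ∀ t, φ t = 0) : mergeSum φ l = 0 := lin_eq_zero fun t _ => h t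

theorem exists_of_not_noIdem {l : List BasisElt} (h : ¬ NoIdem l) :
    ∃ p j s, l = p ++ ((0, .idem j) : BasisElt) :: s := by
  unfold NoIdem at h
  push Not at h
  obtain ⟨j, hj⟩ := h
  obtain ⟨p, s, rfl⟩ := List.append_of_mem hj
  exact ⟨p, j, s, rfl⟩

/-- The Hochschild differential of a cochain which is linear with respect to `U^m` and vanishes if
an input is `U^m` times an idempotent has the same vanishing property. -/
theorem hdiff_idem {d k : ℤ} {w : ℕ} {c : List BasisElt → Vec BasisElt} (hc : Gr d w k c)
    {m : ℕ} {j : Fin 2} (h0 : ∀ p s, c (p ++ (m, .idem j) :: s) = 0)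
    (hU : ∀ p b s, c (p ++ (m + b.1, b.2) :: s) = mulU m (c (p ++ b :: s)))
    (p s : List BasisElt) : hdiff c (p ++ (m, .idem j) :: s) = 0 := by
  by_contra hne
  obtain ⟨x, hx⟩ : ∃ x, hdiff c (p ++ (m, .idem j) :: s) x ≠ 0 := by
    by_contra! H
    exact hne (Finsupp.ext H)
  -- A nonzero value forces the list to be composable. Then `U^m` times the idempotent acts as `U^m`
  -- on both neighbours. Its merges to the left and to the right cancel, and at an end of the list
  -- an outer term replaces the missing merge.
  obtain ⟨i, hp, hi, hs⟩ := isPath_append.1 (hc.hdiff.path hx)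
  have hi : j = i := hi
  subst hi
  have hs : IsPath j s x.2.right := hs
  apply hne
  rcases List.eq_nil_or_concat p with rfl | ⟨p, a, rfl⟩
  · rcases s with _ | ⟨b, s⟩
    · rw [List.nil_append, hdiff, mergeSum_singleton, rightTerm_singleton]
      rw [leftTerm, lmul_idem_eq_rmul_idem m j fun x hx => hc.path (l := []) hx]
      simp
    · have e1 : lmul (m, .idem j) (c (b :: s)) = mulU m (c (b :: s)) := lmul_idem m fun x hx => by
        rw [← (hc.path hx).1, hs.1]
      have e2 : rightTerm c ((m, .idem j) :: b :: s) = 0 := by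
        obtain ⟨s', y, h⟩ := List.eq_nil_or_concat (b :: s) |>.resolve_left (by simp)
        rw [h, List.concat_eq_append, ← List.cons_append, rightTerm_snoc]
        have := h0 [] s'
        rw [List.nil_append] at this
        rw [this, map_zero]
      have e3 := mergeSum_eq_zero (φ := fun t => c ((m, .idem j) :: t)) (l := b :: s)
        fun t => h0 [] t
      have e4 := hU [] b s
      rw [List.nil_append, List.nil_append] at e4
      rw [List.nil_append, hdiff, mergeSum_cons, mulV_idem_left m hs.1, lin_bas, e3, leftTerm, e1,
        e2, e4]
      simp
  · rw [List.concat_eq_append] at hp ⊢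
    obtain ⟨i, hp, ha⟩ := isPath_append.1 hp
    have ha' : a.2.right = j := ha.2
    have e1 : mergeSum c (p ++ [a] ++ (m, .idem j) :: s) =
        (-1 : ℤ) ^ p.length • mulU m (c (p ++ a :: s)) +
        (-1 : ℤ) ^ (p.length + 1) • mergeSum (fun t => c (p ++ [a] ++ t)) ((m, .idem j) :: s) := by
      rw [mergeSum_append, List.append_assoc, List.singleton_append, mergeSum_append,
        mergeSum_pair, mulV_idem_right m ha', lin_bas, mergeSum_eq_zero, zero_add, ← hU]
      · simp
      · intro t
        simpa using h0 t s
    have e2 : leftTerm c (p ++ [a] ++ (m, .idem j) :: s) = 0 := by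
      rcases p with _ | ⟨b, p⟩
      · exact (congrArg _ (h0 [] s)).trans (map_zero _)
      · exact (congrArg _ (h0 (p ++ [a]) s)).trans (map_zero _)
    rcases s with _ | ⟨b, s⟩
    · have e3 : rmul (m, .idem j) (c (p ++ [a])) = mulU m (c (p ++ [a])) :=
        rmul_idem m fun x hx => by
          obtain ⟨i, -, h1⟩ := isPath_append.1 (hc.path hx)
          rw [← ha', h1.2]
      rw [hdiff, e1, e2, rightTerm_snoc, e3, mergeSum_singleton]
      simp [pow_add]
    · have e3 : rightTerm c (p ++ [a] ++ (m, .idem j) :: b :: s) = 0 := by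
        obtain ⟨s', y, h⟩ := List.eq_nil_or_concat (b :: s) |>.resolve_left (by simp)
        rw [h, List.concat_eq_append, ← List.cons_append, ← List.append_assoc, rightTerm_snoc,
          h0, map_zero]
      rw [hdiff, e1, e2, e3, mergeSum_cons, mulV_idem_left m hs.1, lin_bas, hU, mergeSum_eq_zero]
      · simp [pow_add]
      · exact fun t => h0 _ t

/-- This is `hdiff_idem` for `m = 0`, where linearity with respect to `U^m` is automatic. -/
theorem Adm.hdiff {d k : ℤ} {w : ℕ} {c : List BasisElt → Vec BasisElt} (hc : Adm d w k c) :
    Adm (d - 1) w (k + 1) (hdiff c) := by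
  refine fun l x hx => ⟨?_, hc.gr.hdiff l x hx⟩
  by_contra h
  obtain ⟨p, j, s, rfl⟩ := exists_of_not_noIdem h
  rw [hdiff_idem hc.gr (fun p s => ?_) fun p b s => by simp] at hx
  · exact hx rfl
  · ext x
    by_contra hx
    exact not_noIdem p s j (hc _ x hx).1

end Normalized

noncomputable section Anick

/-! ### Contraction of the normalized Hochschild complex -/

/-- The list starts with letters `ρ_i, ρ_{i-1}, …` followed by an entry which is not a generator
but whose first generator continues the chain; the option is the previous letter. -/
def Active : Option (ZMod 4) → List BasisElt → Prop
  | _, [] => False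
  | _, (0, .idem _) :: _ => False
  | s, (0, .reeb i 0) :: r => (∀ j ∈ s, j = i + 1) ∧ Active (some i) r
  | s, (0, .reeb i (_ + 1)) :: _ => ∀ j ∈ s, j = i + 1
  | _, (m + 1, a) :: _ => ¬ (m = 0 ∧ ∃ j, a = .idem j)

/-- Split the first generator off the entry found in `Active`. -/
def splitEntry : List BasisElt → List BasisElt
  | [] => []
  | (0, .idem _) :: _ => []
  | (0, .reeb i 0) :: r => (0, .reeb i 0) :: splitEntry r
  | (0, .reeb i (n + 1)) :: r => (0, .reeb i 0) :: (0, .reeb (i + 1) n) :: r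
  | (m + 1, a) :: r => (1, .idem a.left) :: (m, a) :: r

/-- The sign in `mergeSum_splitEntry`. -/
def splitSign : List BasisElt → ℤ
  | (0, .reeb _ 0) :: r => -splitSign r
  | _ => 1

theorem splitSign_mul_self (l : List BasisElt) : splitSign l * splitSign l = 1 := by
  induction l with
  | nil => rfl
  | cons b l ih =>
    rcases b with ⟨_ | m, j | ⟨i, _ | n⟩⟩ <;> simp [splitSign, ih]

/-- The number of letters before the first multiple of `U`. -/
def leadLength : List BasisElt → ℕ
  | [] => 0
  | (0, .idem _) :: _ => 0
  | (0, .reeb _ n) :: r => n + 1 + leadLength r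
  | (_ + 1, _) :: _ => 0

theorem mul_reeb_idem_right (m : ℕ) (i : ZMod 4) (n : ℕ) (y z : BasisElt)
    (h : mulV (m, .reeb i n) y z ≠ 0) : ∃ n', z = (m + y.1, .reeb i n') := by
  obtain ⟨h1, h2⟩ := mulV_ne_zero h
  rcases y with ⟨m', j | ⟨i', n'⟩⟩
  · rw [Basic.mul_idem] at h2
    split_ifs at h2
    exact ⟨n, Prod.ext h1 (Option.some.inj h2).symm⟩
  · rw [Basic.reeb_mul_reeb] at h2
    split_ifs at h2
    exact ⟨_, Prod.ext h1 (Option.some.inj h2).symm⟩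

/-- The letter that continues a chain after `ρ_j` is `ρ_{j-1}`, while the letter with a nonzero
product with `ρ_j` is `ρ_{j+1}`. The matching rests on these being different. -/
theorem zmod_four_ne (i : ZMod 4) : i ≠ i + 1 + 1 := by revert i; decide

/-- The exponent of `U` in a list. -/
def powerU (l : List BasisElt) : ℕ := (l.map Prod.fst).sum

@[simp] theorem powerU_cons (b : BasisElt) (l : List BasisElt) :
    powerU (b :: l) = b.1 + powerU l := by simp [powerU]

/-- The merge that undoes `splitEntry` is the only one that matters. -/
theorem mergeSum_splitEntry (l : List BasisElt) (s : Option (ZMod 4))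
    (φ : List BasisElt → Vec BasisElt) (hl : Active s l) (h1 : ∀ t, ¬ Active s t → φ t = 0)
    (h2 : ∀ t, powerU t = powerU l → leadLength t < leadLength l → φ t = 0) :
    mergeSum φ (splitEntry l) = splitSign l • φ l := by
  induction l generalizing s φ with
  | nil => exact hl.elim
  | cons b r ih =>
    rcases b with ⟨_ | m, j | ⟨i, _ | n⟩⟩
    · exact hl.elim
    · have hs : ∀ j ∈ s, j = i + 1 := hl.1
      have hr : Active (some i) r := hl.2
      have key := ih (some i) (fun t => φ ((0, .reeb i 0) :: t)) hr
        (fun t hA => h1 _ fun h => hA h.2)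
        (fun t ht hA => h2 _ (by simpa using ht) (by simpa [leadLength] using hA))
      -- Merging `ρ_i` with the next entry is harmless. If that entry starts with `ρ_{i-1}` the
      -- product is zero. If it is the split-off `U` then the power of `U` moves forward, which
      -- lowers `leadLength`.
      obtain ⟨x, r', hx, h0⟩ : ∃ x r', splitEntry r = x :: r' ∧
          lin (fun z => φ (z :: r')) (mulV (0, .reeb i 0) x) = 0 := by
        rcases r with _ | ⟨⟨_ | m, j | ⟨i', n⟩⟩, r⟩
        · exact hr.elim
        · exact hr.elim
        · have hi' : i = i' + 1 := by
            rcases n with _ | n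
            · exact hr.1 i rfl
            · exact hr i rfl
          have : mulV (0, .reeb i 0) (0, .reeb i' 0) = 0 := by
            apply mulV_of_mul_none
            rw [Basic.reeb_mul_reeb, if_neg]
            rw [hi']; simpa using zmod_four_ne i'
          rcases n with _ | n
          · exact ⟨_, _, rfl, by rw [this, map_zero]⟩
          · exact ⟨_, _, rfl, by rw [this, map_zero]⟩
        all_goals
          refine ⟨_, _, rfl, lin_eq_zero fun z hz => ?_⟩
          obtain ⟨n', rfl⟩ := mul_reeb_idem_right _ _ _ _ _ hz
          exact h2 _ (by simp; omega) (by simp [leadLength])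
      have e : splitEntry ((0, .reeb i 0) :: r) = (0, .reeb i 0) :: splitEntry r := rfl
      rw [e, hx, mergeSum_cons, h0, ← hx, key, splitSign, neg_smul, zero_sub]
    · have hs : ∀ j ∈ s, j = i + 1 := hl
      have hm : mulV (0, .reeb i 0) (0, .reeb (i + 1) n) = bas (0, .reeb i (n + 1)) := by
        refine (mulV_of_mul (b := .reeb i (n + 1)) ?_).trans rfl
        rw [Basic.reeb_mul_reeb, if_pos (by simp)]
        congr 2; omega
      -- After a later merge, `ρ_i` is still followed by an entry starting with `ρ_{i+1}`, which
      -- does not continue the chain. The list is then inactive, unless that entry acquired a power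
      -- of `U`, and then `leadLength` dropped.
      have h0 : mergeSum (fun t => φ ((0, .reeb i 0) :: t)) ((0, .reeb (i + 1) n) :: r) = 0 := by
        have hna : ∀ n t, ¬ Active s ((0, .reeb i 0) :: (0, .reeb (i + 1) n) :: t) := by
          rintro (_ | n) t ⟨-, h⟩
          · exact zmod_four_ne i (h.1 i rfl)
          · exact zmod_four_ne i (h i rfl)
        rcases r with _ | ⟨y, r⟩
        · exact mergeSum_singleton _ _
        · rw [mergeSum_cons, lin_eq_zero, zero_sub, neg_eq_zero]
          · exact mergeSum_eq_zero fun t => h1 _ (hna n t)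
          · intro z hz
            obtain ⟨n', rfl⟩ := mul_reeb_idem_right _ _ _ _ _ hz
            rcases y with ⟨_ | m, b⟩
            · exact h1 _ (hna n' r)
            · exact h2 _ (by simp) (by simp [leadLength])
      rw [splitEntry, mergeSum_cons, hm, lin_bas, h0, sub_zero]
      simp [splitSign]
    all_goals
      rw [splitEntry, mergeSum_cons, mulV_of_mul (Basic.idem_mul _ _ |>.trans (if_pos rfl)),
        lin_bas, mergeSum_eq_zero, sub_zero, add_comm]
      · simp [splitSign]
      · exact fun t => h1 _ fun h => h ⟨rfl, _, rfl⟩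

/-- Active lists and split lists are disjoint, as a matching requires. In a split list the chain is
interrupted by a bare `U`, or by a letter that composes with the previous one. -/
theorem not_active_splitEntry (l : List BasisElt) (s s' : Option (ZMod 4)) (hl : Active s l) :
    ¬ Active s' (splitEntry l) := by
  induction l generalizing s s' with
  | nil => exact hl.elim
  | cons b r ih =>
    rcases b with ⟨_ | m, j | ⟨i, _ | n⟩⟩
    · exact hl.elim
    · exact fun h => ih (some i) (some i) hl.2 h.2
    · rintro ⟨-, h⟩
      rcases n with _ | n
      · exact zmod_four_ne i (h.1 i rfl)
      · exact zmod_four_ne i (h i rfl)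
    all_goals exact fun h => h ⟨rfl, _, rfl⟩

theorem not_active_of_splitEntry_eq (l : List BasisElt) (s s' : Option (ZMod 4))
    (hl : Active s l) (q : List BasisElt) (y : BasisElt) (h : splitEntry l = q ++ [y]) :
    ¬ Active s' q := by
  induction l generalizing s s' q with
  | nil => exact hl.elim
  | cons b r ih =>
    rcases b with ⟨_ | m, j | ⟨i, _ | n⟩⟩
    · exact hl.elim
    · rcases q with _ | ⟨x, q⟩
      · exact fun h => h
      · simp only [splitEntry, List.cons_append, List.cons.injEq] at h
        rw [← h.1]
        exact fun hA => ih (some i) (some i) hl.2 q h.2 hA.2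
    · rcases q with _ | ⟨x, _ | ⟨x', q⟩⟩
      · exact fun h => h
      · simp only [splitEntry, List.cons_append, List.cons.injEq] at h
        rw [← h.1]
        exact fun hA => hA.2
      · simp only [splitEntry, List.cons_append, List.cons.injEq] at h
        rw [← h.1, ← h.2.1]
        rintro ⟨-, h⟩
        rcases n with _ | n
        · exact zmod_four_ne i (h.1 i rfl)
        · exact zmod_four_ne i (h i rfl)
    all_goals
      rcases q with _ | ⟨x, q⟩
      · exact fun h => h
      · simp only [splitEntry, List.cons_append, List.cons.injEq] at h
        rw [← h.1]
        exact fun h => h ⟨rfl, _, rfl⟩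

/-- The order for the recursion. -/
def Prior (t l : List BasisElt) : Prop :=
  powerU t < powerU l ∨ powerU t = powerU l ∧ leadLength t < leadLength l

theorem prior_induction {P : List BasisElt → Prop} (h : ∀ l, (∀ t, Prior t l → P t) → P l)
    (l : List BasisElt) : P l := by
  have wf : WellFounded (Prod.Lex (· < · : ℕ → ℕ → Prop) (· < · : ℕ → ℕ → Prop)) :=
    WellFounded.prod_lex wellFounded_lt wellFounded_lt
  refine (InvImage.wf (fun l : List BasisElt => (powerU l, leadLength l)) wf).induction l ?_
  exact fun l ih => h l fun t ht => ih t (Prod.lex_def.2 ht)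

/-- The outer terms evaluate `φ` on the tail and on the initial segment of the split list. These are
inactive or precede `l`, so only the merge undoing the split survives. -/
theorem hdiff_splitEntry {l : List BasisElt} {φ : List BasisElt → Vec BasisElt}
    (hl : Active none l) (h1 : ∀ t, ¬ Active none t → φ t = 0) (h2 : ∀ t, Prior t l → φ t = 0) :
    hdiff φ (splitEntry l) = splitSign l • φ l := by
  have e1 : leftTerm φ (splitEntry l) = 0 := by
    rcases l with _ | ⟨⟨_ | m, j | ⟨i, _ | n⟩⟩, r⟩
    · exact hl.elim
    · exact hl.elim
    · rw [splitEntry, leftTerm, h1 _ (not_active_splitEntry r _ _ hl.2), map_zero]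
    · rw [splitEntry, leftTerm, h2 _ (Or.inr ⟨by simp, by simp [leadLength]⟩), map_zero]
    all_goals rw [splitEntry, leftTerm, h2 _ (Or.inl (by simp)), map_zero]
  have e2 : rightTerm φ (splitEntry l) = 0 := by
    rcases List.eq_nil_or_concat (splitEntry l) with h | ⟨q, y, h⟩
    · rw [h, rightTerm_nil]
    · rw [List.concat_eq_append] at h
      rw [h, rightTerm_snoc, h1 _ (not_active_of_splitEntry_eq l _ _ hl q y h), map_zero]
  rw [hdiff, e1, e2, smul_zero, sub_zero, sub_zero,
    mergeSum_splitEntry l none φ hl h1 fun t h h' => h2 t (Or.inr ⟨h, h'⟩)]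

/-- By `hdiff_splitEntry` the differential is triangular from active lists to split lists, with
signs on the diagonal. The values on active lists then vanish by induction over `Prior`. -/
theorem eq_zero_of_hdiff_eq_zero {c : List BasisElt → Vec BasisElt} (hc : ∀ l, hdiff c l = 0)
    (h : ∀ l, ¬ Active none l → c l = 0) (l : List BasisElt) : c l = 0 := by
  induction l using prior_induction with
  | _ l ih =>
    by_cases hl : Active none l
    · have := hdiff_splitEntry hl h ih
      rw [hc] at this
      have h2 := congrArg (fun v => splitSign l • v) this
      simp only [smul_zero, smul_smul, splitSign_mul_self, one_smul] at h2
      exact h2.symm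
    · exact h l hl

open Classical in
/-- A cochain with prescribed Hochschild differential on the lists `splitEntry l`. -/
def solve (c : List BasisElt → Vec BasisElt) (l : List BasisElt) : Vec BasisElt :=
  if Active none l then splitSign l • (c (splitEntry l) -
    hdiff (fun t => if _ : Prior t l then solve c t else 0) (splitEntry l)) else 0
termination_by (powerU l, leadLength l)
decreasing_by exact Prod.lex_def.2 (by assumption)

open Classical in
theorem solve_of_active (c : List BasisElt → Vec BasisElt) {l : List BasisElt}
    (hl : Active none l) : solve c l = splitSign l • (c (splitEntry l) -
      hdiff (fun t => if Prior t l then solve c t else 0) (splitEntry l)) := by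
  rw [solve, if_pos hl]
  simp

theorem solve_of_not_active (c : List BasisElt → Vec BasisElt) {l : List BasisElt}
    (hl : ¬ Active none l) : solve c l = 0 := by
  rw [solve, if_neg hl]

theorem not_prior_self (l : List BasisElt) : ¬ Prior l l := by simp [Prior]

/-- Divide `solve c` into its part on lists prior to `l`, whose contribution the recursion
subtracts, and the rest, to which `hdiff_splitEntry` applies. -/
theorem hdiff_solve_splitEntry (c : List BasisElt → Vec BasisElt) {l : List BasisElt}
    (hl : Active none l) : hdiff (solve c) (splitEntry l) = c (splitEntry l) := by
  classical
  have h := hdiff_add (fun t => if Prior t l then solve c t else 0)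
    (fun t => if Prior t l then 0 else solve c t) (splitEntry l)
  have e : (fun t => (if Prior t l then solve c t else 0) +
      if Prior t l then 0 else solve c t) = solve c := by
    funext t
    split_ifs <;> simp
  rw [e] at h
  rw [h, hdiff_splitEntry (φ := fun t => if Prior t l then 0 else solve c t) hl, solve_of_active c hl,
    if_neg (not_prior_self l), smul_smul, splitSign_mul_self, one_smul, add_sub_cancel]
  · intro t ht
    simp [solve_of_not_active c ht]
  · intro t ht
    simp [ht]

theorem degRel_splitEntry {l : List BasisElt} {s : Option (ZMod 4)} (hl : Active s l) :
    DegRel 1 0 (-1) l (splitEntry l) := by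
  induction l generalizing s with
  | nil => exact hl.elim
  | cons b r ih =>
    rcases b with ⟨_ | m, j | ⟨i, _ | n⟩⟩
    · exact hl.elim
    · exact (ih hl.2).cons _
    · refine (DegRel.of_mul_symm ?_ ?_).append_right r
      · rfl
      · rw [Basic.reeb_mul_reeb, if_pos (by simp)]
        congr 2; omega
    all_goals
      refine (DegRel.of_mul_symm ?_ ?_).append_right r
      · simp only []; omega
      · exact Basic.idem_mul _ _ |>.trans (if_pos rfl)

theorem noIdem_of_splitEntry {l : List BasisElt} {s : Option (ZMod 4)} (hl : Active s l)
    (h : NoIdem (splitEntry l)) : NoIdem l := by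
  induction l generalizing s with
  | nil => exact hl.elim
  | cons b r ih =>
    intro j' hj
    rcases b with ⟨_ | m, j | ⟨i, _ | n⟩⟩
    · exact hl.elim
    · have := ih hl.2 fun j hj => h j (List.mem_cons_of_mem _ hj)
      exact this j' (by simpa using hj)
    all_goals
      have hr : ((0, .idem j') : BasisElt) ∈ r := by simpa using hj
      exact h j' (by simp [splitEntry, hr])

theorem adm_solve {d k : ℤ} {w : ℕ} {c : List BasisElt → Vec BasisElt} (hc : Adm d w k c) :
    Adm (d + 1) w (k - 1) (solve c) := by
  classical
  intro l
  induction l using prior_induction with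
  | _ l ih =>
    intro x hx
    by_cases hl : Active none l
    · rw [solve_of_active c hl] at hx
      have key : NoIdem (splitEntry l) ∧ DegRel d w k (splitEntry l) [x] := by
        rcases sub_apply_ne_zero (smul_apply_ne_zero hx) with h | h
        · exact hc _ x h
        · have : Adm (d + 1) w (k - 1) fun t => if Prior t l then solve c t else 0 := by
            intro t y hy
            by_cases ht : Prior t l <;> dsimp only at hy
            · rw [if_pos ht] at hy
              exact ih t ht y hy
            · rw [if_neg ht] at hy
              exact absurd rfl hy
          have := this.hdiff _ x h
          simpa using this
      refine ⟨noIdem_of_splitEntry hl key.1, ?_⟩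
      have := (degRel_splitEntry hl).trans key.2
      rwa [zero_add, add_comm, add_comm (-1)] at this
    · rw [solve_of_not_active c hl] at hx
      exact absurd rfl hx

end Anick

end TorusAlgebra

namespace TorusAlgebra

open BarConstruction

noncomputable section Chains

/-! ### Solving the Hochschild equation -/

/-- The list `ρ_i, ρ_{i-1}, …` of length `k`. -/
def chain : ZMod 4 → ℕ → List BasisElt
  | _, 0 => []
  | i, k + 1 => (0, .reeb i 0) :: chain (i - 1) k

theorem chain_eq_append {i : ZMod 4} {k : ℕ} {p s : List BasisElt} (h : p ++ s = chain i k) :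
    p = chain i p.length ∧ s = chain (i - p.length) s.length := by
  induction p generalizing i k with
  | nil =>
    have : s.length = k := by
      rw [List.nil_append] at h
      rw [h]; clear h
      induction k generalizing i with
      | zero => rfl
      | succ k ih => simp [chain, ih]
    refine ⟨rfl, ?_⟩
    rw [this]; simpa using h
  | cons b p ih =>
    cases k with
    | zero => simp [chain] at h
    | succ k =>
      rw [chain, List.cons_append, List.cons.injEq] at h
      obtain ⟨h1, h2⟩ := ih h.2
      rw [h.1]
      refine ⟨by rw [List.length_cons, chain, ← h1], ?_⟩
      rw [h2]
      simp only [List.length_cons]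
      congr 1
      · push_cast; ring
      · exact congrArg List.length h2

theorem coder_mu2_chain (i : ZMod 4) (k : ℕ) : coder mu2 (chain i k) = 0 := by
  induction k generalizing i with
  | zero => exact coder_mu2_nil
  | succ k ih =>
    cases k with
    | zero => exact coder_mu2_singleton _
    | succ k =>
      have h := ih (i - 1)
      rw [chain] at h
      have hm : mulV (0, .reeb i 0) (0, .reeb (i - 1) 0) = 0 := by
        apply mulV_of_mul_none
        rw [Basic.reeb_mul_reeb, if_neg]
        have := zmod_four_ne (i - 1)
        simpa using this
      rw [chain, chain, coder_mu2_cons, h, hm]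
      simp

theorem mergeSum_chain (φ : List BasisElt → Vec BasisElt) (i : ZMod 4) (k : ℕ) :
    mergeSum φ (chain i k) = 0 := by rw [mergeSum, coder_mu2_chain, map_zero]

theorem not_active_chain (s : Option (ZMod 4)) (i : ZMod 4) (k : ℕ) :
    ¬ Active s (chain i k) := by
  induction k generalizing s i with
  | zero => exact fun h => h
  | succ k ih => exact fun h => ih _ _ h.2

theorem not_active_chain_U (s : Option (ZMod 4)) (i : ZMod 4) (k : ℕ) (j : Fin 2)
    (r : List BasisElt) : ¬ Active s (chain i k ++ (1, .idem j) :: r) := by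
  induction k generalizing s i with
  | zero => exact fun h => h ⟨rfl, _, rfl⟩
  | succ k ih => exact fun h => ih _ _ h.2

theorem active_chain_U (s : Option (ZMod 4)) (i i' : ZMod 4) (k n : ℕ) (r : List BasisElt)
    (h : ∀ j ∈ s, j = i + 1) : Active s (chain i k ++ (1, .reeb i' n) :: r) ∧
      splitEntry (chain i k ++ (1, .reeb i' n) :: r) =
        chain i k ++ (1, .idem (source i')) :: (0, .reeb i' n) :: r := by
  induction k generalizing s i with
  | zero => exact ⟨by simp [chain, Active], rfl⟩
  | succ k ih =>
    obtain ⟨h1, h2⟩ := ih (some i) (i - 1) (by simp)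
    exact ⟨⟨h, h1⟩, by simp [chain, splitEntry, h2]⟩

/-- Adjacent letters of a chain have product zero and the outer terms are values on inactive lists.
Only the merges of `U` with its two neighbours could contribute, and `hp` excludes the left one. -/
theorem hdiff_chain_U {e : List BasisElt → Vec BasisElt} (he : ∀ l, ¬ Active none l → e l = 0)
    {p s : List BasisElt} {i : ZMod 4} {k : ℕ} (h : p ++ s = chain i k) (j : Fin 2)
    (hp : ∀ p' y z, p = p' ++ [y] → mulV y (1, .idem j) z ≠ 0 → e (p' ++ z :: s) = 0) :
    hdiff e (p ++ (1, .idem j) :: s) = (-1 : ℤ) ^ p.length • match s with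
      | [] => 0
      | x :: s' => lin (fun z => e (p ++ z :: s')) (mulV (1, .idem j) x) := by
  obtain ⟨h1, h2⟩ := chain_eq_append h
  have hU : ∀ i k r, e (chain i k ++ (1, .idem j) :: r) = 0 :=
    fun i k r => he _ (not_active_chain_U _ _ _ _ _)
  have e1 : leftTerm e (p ++ (1, .idem j) :: s) = 0 := by
    rcases p with _ | ⟨y, p⟩
    · rw [List.nil_append, leftTerm, h2, he _ (not_active_chain _ _ _), map_zero]
    · obtain ⟨h3, -⟩ := chain_eq_append (p := [y]) (s := p) h1
      have h4 := (chain_eq_append (p := [y]) (s := p) h1).2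
      rw [List.cons_append, leftTerm, h4, hU, map_zero]
  have e2 : rightTerm e (p ++ (1, .idem j) :: s) = 0 := by
    rcases List.eq_nil_or_concat s with rfl | ⟨s, y, rfl⟩
    · rw [rightTerm_snoc, h1, he _ (not_active_chain _ _ _), map_zero]
    · rw [List.concat_eq_append, ← List.cons_append, ← List.append_assoc, rightTerm_snoc, h1, hU,
        map_zero]
  have e3 : mergeSum (fun t => e (t ++ s)) (p ++ [(1, .idem j)]) = 0 := by
    rcases List.eq_nil_or_concat p with rfl | ⟨p', y, rfl⟩
    · exact mergeSum_singleton _ _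
    · rw [List.concat_eq_append] at h1 hp ⊢
      rw [List.append_assoc, List.singleton_append, mergeSum_append, h1, mergeSum_chain, zero_add,
        mergeSum_pair, lin_eq_zero, smul_zero]
      intro z hz
      simpa using hp p' y z rfl hz
  rw [hdiff, e1, e2, mergeSum_append, e3, smul_zero, sub_zero, sub_zero, zero_add]
  congr 1
  rcases s with _ | ⟨x, s⟩
  · exact mergeSum_singleton _ _
  · have e4 : mergeSum (fun t => e (p ++ (1, .idem j) :: t)) (x :: s) = 0 := by
      rw [h2, mergeSum_chain]
    rw [mergeSum_cons, e4, sub_zero]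

/-- Induction on the position of the letter multiplied by `U`. The equation on the list with a bare
`U` in front of that letter relates multiplying `U` to the right with multiplying it to the left,
and the latter is zero by induction. -/
theorem solve_chain_U {c : List BasisElt → Vec BasisElt}
    (hc : ∀ i k p s j, p ++ s = chain i k → c (p ++ (1, .idem j) :: s) = 0)
    {p : List BasisElt} {b : Basic} {s : List BasisElt} {i : ZMod 4} {k : ℕ}
    (h : p ++ (0, b) :: s = chain i k) : solve c (p ++ (1, b) :: s) = 0 := by
  induction hn : p.length using Nat.strong_induction_on generalizing p b s with
  | _ n ih =>
    obtain ⟨h1, h2⟩ := chain_eq_append h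
    rw [List.length_cons, chain] at h2
    simp only [List.cons.injEq, Prod.mk.injEq, true_and] at h2
    obtain ⟨rfl, h2⟩ := h2
    obtain ⟨hA, hs⟩ := active_chain_U none i (i - p.length) p.length 0 s (by simp)
    rw [← h1] at hA hs
    have key := hdiff_solve_splitEntry c hA
    rw [hs, hc i k _ _ _ h, hdiff_chain_U (fun l hl => solve_of_not_active c hl) h] at key
    · dsimp only at key
      rw [mulV_of_mul (b := .reeb (i - p.length) 0)
          ((Basic.idem_mul _ (.reeb (i - p.length) 0)).trans (if_pos rfl)),
        lin_bas] at key
      have h3 := congrArg (fun v => (-1 : ℤ) ^ p.length • v) key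
      simp only [smul_zero, smul_smul, ← mul_pow] at h3
      simpa using h3
    · intro p' y z hp hz
      obtain ⟨h3, h4⟩ := mulV_ne_zero hz
      have hy : y = (0, z.2) := by
        have := (chain_eq_append (p := p') (s := [y]) (hp ▸ h1)).2
        rw [List.length_singleton, chain] at this
        simp only [List.cons.injEq] at this
        rw [this.1] at h4 ⊢
        simp only [Basic.mul_idem] at h4
        split_ifs at h4
        rw [← Option.some.inj h4]
      have hz' : z = (1, z.2) := by rw [hy] at h3; exact Prod.ext h3 rfl
      rw [hz']
      refine ih p'.length (by rw [← hn, hp]; simp) (b := z.2) (s := (0, .reeb _ 0) :: s) ?_ rfl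
      rw [← hy, ← h, hp]
      simp

theorem hdiff_solve_chain {c : List BasisElt → Vec BasisElt} (i : ZMod 4) (k : ℕ) :
    hdiff (solve c) (chain i k) = 0 := by
  have h0 : ∀ i k, solve c (chain i k) = 0 :=
    fun i k => solve_of_not_active c (not_active_chain _ _ _)
  have e1 : leftTerm (solve c) (chain i k) = 0 := by
    cases k with
    | zero => rfl
    | succ k => rw [chain, leftTerm, h0, map_zero]
  have e2 : rightTerm (solve c) (chain i k) = 0 := by
    rcases List.eq_nil_or_concat (chain i k) with h | ⟨p, y, h⟩
    · rw [h, rightTerm_nil]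
    · rw [List.concat_eq_append] at h
      rw [h, rightTerm_snoc, (chain_eq_append h.symm).1, h0, map_zero]
  rw [hdiff, mergeSum_chain, e1, e2]
  simp

theorem hdiff_solve_chain_U {c : List BasisElt → Vec BasisElt}
    (hc : ∀ i k p s j, p ++ s = chain i k → c (p ++ (1, .idem j) :: s) = 0) (i : ZMod 4) (k : ℕ)
    (j : Fin 2) : hdiff (solve c) (chain i k ++ [(1, .idem j)]) = 0 := by
  rw [hdiff_chain_U (i := i) (k := k) (fun l hl => solve_of_not_active c hl) (by simp)]
  · simp
  · intro p' y z hp hz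
    obtain ⟨h3, h4⟩ := mulV_ne_zero hz
    have hy : y = (0, z.2) := by
      have := (chain_eq_append (p := p') (s := [y]) hp.symm).2
      rw [List.length_singleton, chain] at this
      simp only [List.cons.injEq] at this
      rw [this.1] at h4 ⊢
      simp only [Basic.mul_idem] at h4
      split_ifs at h4
      rw [← Option.some.inj h4]
    have hz' : z = (1, z.2) := by rw [hy] at h3; exact Prod.ext h3 rfl
    rw [hz']
    exact solve_chain_U hc (i := i) (k := k) (by rw [← hy, hp])

/-- After `ρ_j`, composability leaves two letters: `ρ_{j+1}`, with a nonzero product, and `ρ_{j-1}`,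
continuing the chain. -/
theorem eq_of_source_eq {i j : ZMod 4} (h : source i = source (j + 1)) : i = j + 1 ∨ i = j - 1 := by
  revert i j; decide

theorem exists_splitEntry_eq_of_U {j : Fin 2} {a : Fin 2} {r : List BasisElt}
    (hp : IsPath a r j) (hN : NoIdem r) (s : Option (ZMod 4)) (hr : r ≠ []) :
    ∃ l', Active s l' ∧ splitEntry l' = (1, .idem a) :: r := by
  rcases r with _ | ⟨⟨m, b⟩, r⟩
  · exact absurd rfl hr
  · refine ⟨(m + 1, b) :: r, ?_, ?_⟩
    · rintro ⟨rfl, j, rfl⟩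
      exact hN j (by simp)
    · rw [splitEntry, ← hp.1]

/-- The last alternative is the one where the preceding `ρ_j` composes with the first entry, so that
the list together with `ρ_j` is a split list. -/
theorem not_active_cases_aux {l : List BasisElt} {j : ZMod 4} {j' : Fin 2}
    (hp : IsPath (source (j + 1)) l j') (hN : NoIdem l) (hA : ¬ Active (some j) l) :
    (∃ k, l = chain (j - 1) k) ∨ (∃ k a, l = chain (j - 1) k ++ [(1, .idem a)]) ∨
      (∃ l', Active (some j) l' ∧ splitEntry l' = l) ∨
        ∃ n r, l = (0, .reeb (j + 1) n) :: r := by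
  induction l generalizing j with
  | nil => exact Or.inl ⟨0, rfl⟩
  | cons b r ih =>
    have hr : NoIdem r := fun j hj => hN j (List.mem_cons_of_mem _ hj)
    rcases b with ⟨_ | m, a | ⟨i, n⟩⟩
    · exact absurd (by simp) (hN a)
    · rcases eq_of_source_eq hp.1 with rfl | rfl
      · exact Or.inr (Or.inr (Or.inr ⟨_, _, rfl⟩))
      · rcases n with _ | n
        · have hp2 : IsPath (source (j - 1 + 1)) r j' := by
            have := hp.2
            simpa [Basic.right] using this
          rcases ih hp2 hr fun h => hA ⟨by simp, h⟩ with ⟨k, h⟩ | ⟨k, a, h⟩ | ⟨l', h, h'⟩ |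
            ⟨n, r', h⟩
          · exact Or.inl ⟨k + 1, by rw [chain, ← h]⟩
          · exact Or.inr (Or.inl ⟨k + 1, a, by rw [chain, h]; rfl⟩)
          · exact Or.inr (Or.inr (Or.inl ⟨(0, .reeb (j - 1) 0) :: l', ⟨by simp, h⟩,
              by rw [splitEntry, h']⟩))
          · exact Or.inr (Or.inr (Or.inl ⟨(0, .reeb (j - 1) (n + 1)) :: r', by simp [Active],
              by rw [splitEntry, h]⟩))
        · exact absurd (by simp [Active]) hA
    all_goals
      obtain ⟨rfl, a, ha⟩ := not_not.1 hA
      cases ha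
    rcases eq_or_ne r [] with rfl | hr'
    · exact Or.inr (Or.inl ⟨0, _, rfl⟩)
    · exact Or.inr (Or.inr (Or.inl (exists_splitEntry_eq_of_U hp.2 hr _ hr')))

/-- The matching is complete: among normalized composable lists, the unmatched ones are the chains
and the chains followed by one `U`. These carry the Hochschild cohomology. -/
theorem not_active_cases {l : List BasisElt} {j j' : Fin 2} (hp : IsPath j l j') (hN : NoIdem l)
    (hA : ¬ Active none l) : (∃ i k, l = chain i k) ∨
      (∃ i k a, l = chain i k ++ [(1, .idem a)]) ∨ ∃ l', Active none l' ∧ splitEntry l' = l := by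
  rcases l with _ | ⟨⟨_ | m, a | ⟨i, _ | n⟩⟩, r⟩
  · exact Or.inl ⟨0, 0, rfl⟩
  · exact absurd (by simp) (hN a)
  · have hr : NoIdem r := fun j hj => hN j (List.mem_cons_of_mem _ hj)
    have hp2 : IsPath (source (i + 1)) r j' := by
      have := hp.2
      simpa [Basic.right] using this
    rcases not_active_cases_aux hp2 hr fun h => hA ⟨by simp, h⟩ with ⟨k, h⟩ | ⟨k, a, h⟩ |
      ⟨l', h, h'⟩ | ⟨n, r', h⟩
    · exact Or.inl ⟨i, k + 1, by rw [chain, ← h]⟩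
    · exact Or.inr (Or.inl ⟨i, k + 1, a, by rw [chain, h]; rfl⟩)
    · exact Or.inr (Or.inr ⟨(0, .reeb i 0) :: l', ⟨by simp, h⟩, by rw [splitEntry, h']⟩)
    · exact Or.inr (Or.inr ⟨(0, .reeb i (n + 1)) :: r', by simp [Active],
        by rw [splitEntry, h]⟩)
  · exact absurd (by simp [Active]) hA
  all_goals
    obtain ⟨rfl, a, ha⟩ := not_not.1 hA
    cases ha
  rcases eq_or_ne r [] with rfl | hr'
  · exact Or.inr (Or.inl ⟨0, 0, _, rfl⟩)
  · exact Or.inr (Or.inr (exists_splitEntry_eq_of_U hp.2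
      (fun j hj => hN j (List.mem_cons_of_mem _ hj)) _ hr'))

/-- Normalized Hochschild cocycles that vanish on chains are coboundaries. -/
theorem exists_hdiff_eq {d k : ℤ} {w : ℕ} {c : List BasisElt → Vec BasisElt}
    (hA : Adm d w k c) (h0 : ∀ l, hdiff c l = 0) (h1 : ∀ i k, c (chain i k) = 0)
    (h2 : ∀ i k p s j, p ++ s = chain i k → c (p ++ (1, .idem j) :: s) = 0) :
    ∃ e, Adm (d + 1) w (k - 1) e ∧ e [] = 0 ∧ ∀ l, hdiff e l = c l := by
  have hB := (adm_solve hA).hdiff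
  simp only [add_sub_cancel_right, sub_add_cancel] at hB
  refine ⟨solve c, adm_solve hA, solve_of_not_active c fun h => h, fun l => ?_⟩
  rw [← sub_eq_zero]
  -- The difference is a cocycle, so it is enough that it vanishes on inactive lists. On split lists
  -- this is the construction of `solve`. On the unmatched lists both terms vanish.
  refine eq_zero_of_hdiff_eq_zero (c := fun l => hdiff (solve c) l - c l)
    (fun l => by rw [hdiff_sub, h0, sub_zero]; exact hdiff_hdiff _ _) (fun l hl => ?_) l
  ext x
  by_contra hx
  obtain ⟨hN, hD⟩ := (hB.sub hA) l x hx
  rcases not_active_cases (hD.1 _ _ ⟨rfl, rfl⟩) hN hl with ⟨i, k, rfl⟩ | ⟨i, k, a, rfl⟩ |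
    ⟨l', h, rfl⟩
  · rw [hdiff_solve_chain, h1] at hx
    simp at hx
  · rw [hdiff_solve_chain_U h2, h2 i k _ [] _ (by simp)] at hx
    simp at hx
  · rw [hdiff_solve_splitEntry c h, sub_self] at hx
    simp at hx

end Chains

end TorusAlgebra

namespace TorusAlgebra

open BarConstruction

section Tables

/-! ### Gradings of chains and of basis elements -/

/-- An integral model of the grading group: `(M, a, b, w)` stands for `(M/4; a/2, b/2) × w`. -/
def mulT (x y : ℤ × ℤ × ℤ × ℤ) : ℤ × ℤ × ℤ × ℤ :=
  (x.1 + y.1 + (x.2.1 * y.2.2.1 - x.2.2.1 * y.2.1), x.2.1 + y.2.1, x.2.2.1 + y.2.2.1,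
    x.2.2.2 + y.2.2.2)

/-- The element `g` is modelled by `x`. -/
def IsModel (g : Gam) (x : ℤ × ℤ × ℤ × ℤ) : Prop :=
  g.1.1.m = x.1 / 4 ∧ g.1.1.a = x.2.1 / 2 ∧ g.1.1.b = x.2.2.1 / 2 ∧ g.2.toAdd = x.2.2.2

theorem IsModel.mul {g h : Gam} {x y : ℤ × ℤ × ℤ × ℤ} (hg : IsModel g x) (hh : IsModel h y) :
    IsModel (g * h) (mulT x y) := by
  obtain ⟨h1, h2, h3, h4⟩ := hg
  obtain ⟨h1', h2', h3', h4'⟩ := hh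
  refine ⟨?_, ?_, ?_, ?_⟩
  · change g.1.1.m + h.1.1.m + (g.1.1.a * h.1.1.b - g.1.1.b * h.1.1.a) = _
    rw [h1, h1', h2, h2', h3, h3', mulT]
    push_cast
    ring
  · change g.1.1.a + h.1.1.a = _
    rw [h2, h2', mulT]
    push_cast
    ring
  · change g.1.1.b + h.1.1.b = _
    rw [h3, h3', mulT]
    push_cast
    ring
  · change g.2.toAdd + h.2.toAdd = _
    rw [h4, h4', mulT]

theorem IsModel.unique {g : Gam} {x y : ℤ × ℤ × ℤ × ℤ} (h : IsModel g x) (h' : IsModel g y) :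
    x = y := by
  obtain ⟨h1, h2, h3, h4⟩ := h
  obtain ⟨h1', h2', h3', h4'⟩ := h'
  refine Prod.ext ?_ (Prod.ext ?_ (Prod.ext ?_ ?_))
  · have := h1.symm.trans h1'
    field_simp at this
    exact_mod_cast this
  · have := h2.symm.trans h2'
    field_simp at this
    exact_mod_cast this
  · have := h3.symm.trans h3'
    field_simp at this
    exact_mod_cast this
  · exact h4.symm.trans h4'

theorem IsModel.eq {g h : Gam} {x : ℤ × ℤ × ℤ × ℤ} (hg : IsModel g x) (hh : IsModel h x) :
    g = h := by
  obtain ⟨h1, h2, h3, h4⟩ := hg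
  obtain ⟨h1', h2', h3', h4'⟩ := hh
  exact Prod.ext (Subtype.ext (Triple.ext (h1.trans h1'.symm) (h2.trans h2'.symm)
    (h3.trans h3'.symm))) (h4.trans h4'.symm)

theorem isModel_one : IsModel 1 (0, 0, 0, 0) := by
  refine ⟨?_, ?_, ?_, rfl⟩
  · change (0 : ℚ) = _; norm_num
  · change (0 : ℚ) = _; norm_num
  · change (0 : ℚ) = _; norm_num

/-- The gradings of the generators. -/
def rhoT (i : ZMod 4) : ℤ × ℤ × ℤ × ℤ :=
  if i = 1 then (-2, 1, -1, 0) else if i = 2 then (-2, 1, 1, 0)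
  else if i = 3 then (-2, -1, 1, 0) else (-6, -1, -1, 1)

theorem isModel_gammaRho (i : ZMod 4) : IsModel (gammaRho i) (rhoT i) := by
  fin_cases i
  · refine ⟨?_, ?_, ?_, rfl⟩
    · change (-3/2 : ℚ) = ((-6 : ℤ) : ℚ) / 4; norm_num
    · change (-1/2 : ℚ) = ((-1 : ℤ) : ℚ) / 2; norm_num
    · change (-1/2 : ℚ) = ((-1 : ℤ) : ℚ) / 2; norm_num
  · refine ⟨?_, ?_, ?_, rfl⟩
    · change (-1/2 : ℚ) = ((-2 : ℤ) : ℚ) / 4; norm_num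
    · change (1/2 : ℚ) = ((1 : ℤ) : ℚ) / 2; norm_num
    · change (-1/2 : ℚ) = ((-1 : ℤ) : ℚ) / 2; norm_num
  · refine ⟨?_, ?_, ?_, rfl⟩
    · change (-1/2 : ℚ) = ((-2 : ℤ) : ℚ) / 4; norm_num
    · change (1/2 : ℚ) = ((1 : ℤ) : ℚ) / 2; norm_num
    · change (1/2 : ℚ) = ((1 : ℤ) : ℚ) / 2; norm_num
  · refine ⟨?_, ?_, ?_, rfl⟩
    · change (-1/2 : ℚ) = ((-2 : ℤ) : ℚ) / 4; norm_num
    · change (-1/2 : ℚ) = ((-1 : ℤ) : ℚ) / 2; norm_num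
    · change (1/2 : ℚ) = ((1 : ℤ) : ℚ) / 2; norm_num

theorem isModel_shift (a b : ℤ) : IsModel (shift a b) (4 * a, 0, 0, b) := by
  have hD : ∀ n : ℕ, IsModel (lamD ^ n) (4 * n, 0, 0, 0) := by
    intro n
    induction n with
    | zero => simpa using isModel_one
    | succ n ih =>
      have h1 : IsModel lamD (4, 0, 0, 0) := by
        refine ⟨?_, ?_, ?_, rfl⟩
        · change (1 : ℚ) = ((4 : ℤ) : ℚ) / 4; norm_num
        · change (0 : ℚ) = ((0 : ℤ) : ℚ) / 2; norm_num
        · change (0 : ℚ) = ((0 : ℤ) : ℚ) / 2; norm_num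
      rw [pow_succ]
      convert ih.mul h1 using 1
      simp [mulT]
      ring
  have hinv : ∀ (g : Gam) (M w : ℤ), IsModel g (M, 0, 0, w) → IsModel g⁻¹ (-M, 0, 0, -w) := by
    rintro g M w ⟨h1, h2, h3, h4⟩
    refine ⟨?_, ?_, ?_, ?_⟩
    · change -g.1.1.m = _
      rw [h1]; push_cast; ring
    · change -g.1.1.a = _
      rw [h2]; simp
    · change -g.1.1.b = _
      rw [h3]; simp
    · change -g.2.toAdd = _
      rw [h4]
  have hW : ∀ n : ℕ, IsModel (lamW ^ n) (0, 0, 0, n) := by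
    intro n
    induction n with
    | zero => simpa using isModel_one
    | succ n ih =>
      have h1 : IsModel lamW (0, 0, 0, 1) := by
        refine ⟨?_, ?_, ?_, rfl⟩
        · change (0 : ℚ) = ((0 : ℤ) : ℚ) / 4; norm_num
        · change (0 : ℚ) = ((0 : ℤ) : ℚ) / 2; norm_num
        · change (0 : ℚ) = ((0 : ℤ) : ℚ) / 2; norm_num
      rw [pow_succ]
      convert ih.mul h1 using 1
      simp [mulT]
  have hD' : IsModel (lamD ^ a) (4 * a, 0, 0, 0) := by
    obtain ⟨n, rfl | rfl⟩ := a.eq_nat_or_neg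
    · simpa using hD n
    · simpa using hinv _ _ _ (hD n)
  have hW' : IsModel (lamW ^ b) (0, 0, 0, b) := by
    obtain ⟨n, rfl | rfl⟩ := b.eq_nat_or_neg
    · simpa using hW n
    · simpa using hinv _ _ _ (hW n)
  have h := hD'.mul hW'
  simp only [mulT, add_zero, zero_add, mul_zero, sub_zero] at h
  exact h

theorem isModel_shift_mul {g : Gam} {x : ℤ × ℤ × ℤ × ℤ} (a b : ℤ) (h : IsModel g x) :
    IsModel (shift a b * g) (x.1 + 4 * a, x.2.1, x.2.2.1, x.2.2.2 + b) := by
  convert (isModel_shift a b).mul h using 1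
  simp [mulT, add_comm]

/-- The gradings of the chords of length at most four. -/
def reebT (i : ZMod 4) : ℕ → ℤ × ℤ × ℤ × ℤ
  | 0 => rhoT i
  | n + 1 => mulT (rhoT i) (reebT (i + 1) n)

theorem isModel_reeb (i : ZMod 4) (n : ℕ) : IsModel (gammaBasic (.reeb i n)) (reebT i n) := by
  induction n generalizing i with
  | zero => simpa [gammaBasic_reeb, reebT] using isModel_gammaRho i
  | succ n ih =>
    have h : (Basic.reeb i 0).mul (.reeb (i + 1) n) = some (.reeb i (n + 1)) := by
      rw [Basic.reeb_mul_reeb, if_pos (by simp)]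
      congr 2; omega
    rw [gammaBasic_mul h]
    refine IsModel.mul ?_ (ih _)
    simpa [gammaBasic_reeb] using isModel_gammaRho i

/-- The gradings of the chains. -/
def chainT (i : ZMod 4) : ℕ → ℤ × ℤ × ℤ × ℤ
  | 0 => (0, 0, 0, 0)
  | n + 1 => mulT (rhoT i) (chainT (i - 1) n)

theorem isModel_chain (i : ZMod 4) (n : ℕ) : IsModel (gam (chain i n)) (chainT i n) := by
  induction n generalizing i with
  | zero => exact isModel_one
  | succ n ih =>
    rw [chain, gam_cons]
    refine IsModel.mul ?_ (ih _)
    have := isModel_gammaRho i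
    simpa [gamma, gammaBasic_reeb] using this

theorem mulT_assoc (x y z : ℤ × ℤ × ℤ × ℤ) : mulT (mulT x y) z = mulT x (mulT y z) := by
  simp only [mulT]
  refine Prod.ext ?_ (Prod.ext ?_ (Prod.ext ?_ ?_)) <;> simp only [] <;> ring

theorem mulT_central (M w : ℤ) (x : ℤ × ℤ × ℤ × ℤ) :
    mulT (M, 0, 0, w) x = (x.1 + M, x.2.1, x.2.2.1, x.2.2.2 + w) := by
  simp [mulT, add_comm]

/-- Four descending letters have the central grading `λ_d^{-4} λ_w`, whatever the first letter is.
-/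
theorem chainT_add_four (i : ZMod 4) (n : ℕ) : chainT i (n + 4) =
    ((chainT i n).1 - 16, (chainT i n).2.1, (chainT i n).2.2.1, (chainT i n).2.2.2 + 1) := by
  have h : ∀ i, mulT (mulT (mulT (rhoT i) (rhoT (i - 1))) (rhoT (i - 1 - 1)))
      (rhoT (i - 1 - 1 - 1)) = (-16, 0, 0, 1) := by decide
  have e : i - 1 - 1 - 1 - 1 = i := by revert i; decide
  simp only [chainT, e]
  rw [← mulT_assoc, ← mulT_assoc, ← mulT_assoc, h, mulT_central]
  rfl

/-- Four ascending letters have the central grading `λ_d^{-2} λ_w`, the grading of `U`. -/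
theorem reebT_add_four (i : ZMod 4) (n : ℕ) : reebT i (n + 4) =
    ((reebT i n).1 - 8, (reebT i n).2.1, (reebT i n).2.2.1, (reebT i n).2.2.2 + 1) := by
  have h : ∀ i, mulT (mulT (mulT (rhoT i) (rhoT (i + 1))) (rhoT (i + 1 + 1)))
      (rhoT (i + 1 + 1 + 1)) = (-8, 0, 0, 1) := by decide
  have e : i + 1 + 1 + 1 + 1 = i := by revert i; decide
  simp only [reebT, e]
  rw [← mulT_assoc, ← mulT_assoc, ← mulT_assoc, h, mulT_central]
  rfl

theorem chainT_eq (i : ZMod 4) (n : ℕ) : chainT i n = ((chainT i (n % 4)).1 - 16 * (n / 4 : ℕ),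
    (chainT i (n % 4)).2.1, (chainT i (n % 4)).2.2.1, (chainT i (n % 4)).2.2.2 + (n / 4 : ℕ)) := by
  induction n using Nat.strong_induction_on with
  | _ n ih =>
    by_cases hn : n < 4
    · rw [Nat.mod_eq_of_lt hn, Nat.div_eq_of_lt hn]
      simp
    · obtain ⟨m, rfl⟩ : ∃ m, n = m + 4 := ⟨n - 4, by omega⟩
      rw [chainT_add_four, ih m (by omega), Nat.add_mod_right, Nat.add_div_right _ (by norm_num)]
      push_cast
      refine Prod.ext ?_ (Prod.ext rfl (Prod.ext rfl ?_)) <;> simp only [] <;> ring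

theorem reebT_eq (i : ZMod 4) (n : ℕ) : reebT i n = ((reebT i (n % 4)).1 - 8 * (n / 4 : ℕ),
    (reebT i (n % 4)).2.1, (reebT i (n % 4)).2.2.1, (reebT i (n % 4)).2.2.2 + (n / 4 : ℕ)) := by
  induction n using Nat.strong_induction_on with
  | _ n ih =>
    by_cases hn : n < 4
    · rw [Nat.mod_eq_of_lt hn, Nat.div_eq_of_lt hn]
      simp
    · obtain ⟨m, rfl⟩ : ∃ m, n = m + 4 := ⟨n - 4, by omega⟩
      rw [reebT_add_four, ih m (by omega), Nat.add_mod_right, Nat.add_div_right _ (by norm_num)]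
      push_cast
      refine Prod.ext ?_ (Prod.ext rfl (Prod.ext rfl ?_)) <;> simp only [] <;> ring

/-- The possible gradings of a basis element relative to a chain with the same left idempotent. -/
theorem chain_grading {b : Basic} {i : ZMod 4} {n : ℕ} {A B : ℤ}
    (h : gammaBasic b = shift A B * gam (chain i n)) (hl : n ≠ 0 → b.left = source i) :
    ∃ p q : ℕ, B = q - p ∧ (n = 4 * p ∧ A = 4 * p - 2 * q ∨ n = 4 * p + 1 ∧ A = 4 * p - 2 * q ∨
      n = 4 * p + 3 ∧ A = 4 * p - 2 * q + 2) := by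
  have hc := isModel_shift_mul A B (isModel_chain i n)
  rw [← h, chainT_eq] at hc
  have hr : n % 4 < 4 := Nat.mod_lt _ (by norm_num)
  have hn := Nat.div_add_mod n 4
  set p := n / 4
  set r := n % 4
  clear_value p r
  rcases b with j | ⟨i', m⟩
  · have h1 := IsModel.unique hc isModel_one
    simp only [Prod.mk.injEq] at h1
    obtain ⟨h1, h2, h3, h4⟩ := h1
    have key : ∀ r : Fin 4, ∀ i : ZMod 4, (chainT i r).2.1 = 0 → (chainT i r).2.2.1 = 0 →
        r = 0 := by decide
    have hr0 : r = 0 := by simpa using key ⟨r, hr⟩ i h2 h3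
    subst hr0
    have e1 : chainT i 0 = (0, 0, 0, 0) := rfl
    rw [e1] at h1 h4
    simp only at h1 h4
    exact ⟨p, 0, by push_cast; omega, Or.inl ⟨by omega, by push_cast; omega⟩⟩
  · have hb := isModel_reeb i' m
    rw [reebT_eq] at hb
    have hs : m % 4 < 4 := Nat.mod_lt _ (by norm_num)
    have h1 := IsModel.unique hc hb
    set q := m / 4
    set s := m % 4
    clear_value q s
    simp only [Prod.mk.injEq] at h1
    obtain ⟨h1, h2, h3, h4⟩ := h1
    -- Blocks of four letters are central, so residues modulo four suffice. Comparing the components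
    -- `a` and `b` and the left idempotents excludes chains of length 2 modulo 4 and fixes the shift
    -- in the other cases.
    have key : ∀ r s : Fin 4, ∀ i i' : ZMod 4, (r = 0 ∨ source i' = source i) →
        (chainT i r).2.1 = (reebT i' s).2.1 → (chainT i r).2.2.1 = (reebT i' s).2.2.1 →
        r = 0 ∧ (reebT i' s).1 = (chainT i r).1 - 8 ∧
          (reebT i' s).2.2.2 = (chainT i r).2.2.2 + 1 ∨
        r = 1 ∧ (reebT i' s).1 = (chainT i r).1 ∧ (reebT i' s).2.2.2 = (chainT i r).2.2.2 ∨
        r = 3 ∧ (reebT i' s).1 = (chainT i r).1 + 8 ∧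
          (reebT i' s).2.2.2 = (chainT i r).2.2.2 := by decide
    have hl' : r = 0 ∨ source i' = source i := by
      by_cases h0 : n = 0
      · left; omega
      · exact Or.inr (hl h0)
    rcases key ⟨r, hr⟩ ⟨s, hs⟩ i i' (by simpa using hl') h2 h3 with ⟨k1, k2, k3⟩ |
      ⟨k1, k2, k3⟩ | ⟨k1, k2, k3⟩ <;> simp only [Fin.ext_iff] at k1 k2 k3
    · have k1 : r = 0 := k1
      exact ⟨p, q + 1, by push_cast; omega, Or.inl ⟨by omega, by push_cast; omega⟩⟩
    · have k1 : r = 1 := k1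
      exact ⟨p, q, by omega, Or.inr (Or.inl ⟨by omega, by omega⟩)⟩
    · have k1 : r = 3 := k1
      exact ⟨p, q, by omega, Or.inr (Or.inr ⟨by omega, by omega⟩)⟩

theorem length_chain (i : ZMod 4) (n : ℕ) : (chain i n).length = n := by
  induction n generalizing i with
  | zero => rfl
  | succ n ih => simp [chain, ih]

theorem gammaBasic_eq_of_gam {x : BasisElt} {a v : ℤ} {g : Gam}
    (h : gam [x] = shift a v * g) :
    gammaBasic x.2 = shift (a + 2 * x.1) (v - x.1) * g := by
  obtain ⟨m, b⟩ := x
  rw [gam_singleton, gamma_eq] at h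
  have := congrArg (fun g => shift (2 * m) (-m) * g) h
  simp only [← mul_assoc, shift_mul] at this
  simpa [add_comm, sub_eq_add_neg] using this

/-- For weight v, comparison with `chain_grading` gives d = 1 - 2(v + p) if n = 4p, and d = -2(v +
p) if n = 4p + 1 or n = 4p + 3; no other n occurs. With v ≥ 1, both d = -1 and d = -2 force v = 1
and p = 0. -/
theorem degRel_chain {d k : ℤ} {w : ℕ} {i : ZMod 4} {n : ℕ} {x : BasisElt}
    (h : DegRel d w k (chain i n) [x]) (hw : 1 ≤ w) :
    (d = -1 → n = 0) ∧ (d = -2 → w = 1 ∧ (n = 1 ∨ n = 3)) := by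
  obtain ⟨h1, -, v, h2, -, h3⟩ := h
  rw [length_chain] at h3
  obtain ⟨p, q, h5, h6⟩ := chain_grading (gammaBasic_eq_of_gam h3) (fun hn => by
    obtain ⟨n, rfl⟩ := Nat.exists_eq_succ_of_ne_zero hn
    exact (h1 x.2.left x.2.right ⟨rfl, rfl⟩).1.symm)
  simp only [List.length_singleton, Nat.cast_one] at h6
  omega

theorem gam_append_U (p s : List BasisElt) (j : Fin 2) :
    gam (p ++ (1, .idem j) :: s) = shift (-2) 1 * gam (p ++ s) := by
  have : gamma (1, .idem j) = shift (-2) 1 := by simp [gamma_eq, gammaBasic]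
  rw [gam_append, gam_append, gam_cons, this, ← mul_assoc, ← shift_comm, mul_assoc]

/-- The extra entry `U` changes the length by one and the grading by `λ_d^{-2} λ_w`. The comparison
now gives d = -2(v + p) if n = 4p and d = -1 - 2(v + p) if n = 4p + 1 or n = 4p + 3. -/
theorem degRel_chain_U {d k : ℤ} {w : ℕ} {i : ZMod 4} {n : ℕ} {x : BasisElt}
    {p s : List BasisElt} {j : Fin 2} (hps : p ++ s = chain i n)
    (h : DegRel d w k (p ++ (1, .idem j) :: s) [x]) (hw : 1 ≤ w) :
    d ≠ -1 ∧ (d = -2 → w = 1 ∧ n = 0) := by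
  obtain ⟨h1, -, v, h2, -, h3⟩ := h
  have hlen : (p ++ (1, .idem j) :: s).length = n + 1 := by
    rw [← length_chain i n, ← hps]; simp; omega
  rw [hlen, gam_append_U, hps, ← mul_assoc, shift_mul] at h3
  obtain ⟨q, q', h5, h6⟩ := chain_grading (gammaBasic_eq_of_gam h3) (fun hn => by
    obtain ⟨n, rfl⟩ := Nat.exists_eq_succ_of_ne_zero hn
    have h4 := h1 x.2.left x.2.right ⟨rfl, rfl⟩
    rcases p with _ | ⟨y, p⟩
    · rw [List.nil_append] at hps
      rw [hps] at h4
      exact h4.1.symm.trans h4.2.1.symm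
    · rw [chain, List.cons_append, List.cons.injEq] at hps
      rw [hps.1] at h4
      exact h4.1.symm)
  simp only [List.length_singleton, Nat.cast_one, Nat.cast_add] at h6
  omega

end Tables

end TorusAlgebra

/-! ### Additivity of coderivations, and coderivations without signs -/

namespace BarConstruction

noncomputable section

variable {B : Type}

theorem applyPrefix_add (c c' : List B → Vec B) (l : List B) :
    applyPrefix (fun l => c l + c' l) l = applyPrefix c l + applyPrefix c' l := by
  simp only [applyPrefix, map_add, LinearMap.add_apply, splitSum_add]

theorem coder_add (c c' : List B → Vec B) (l : List B) :
    coder (fun l => c l + c' l) l = coder c l + coder c' l := by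
  induction l with
  | nil => exact applyPrefix_add c c' []
  | cons b l ih =>
    rw [coder_cons, applyPrefix_add, ih, coder_cons, coder_cons, map_add]
    abel

theorem coder_neg (c : List B → Vec B) (l : List B) :
    coder (fun l => -c l) l = -coder c l := by
  have h := coder_add c (fun l => -c l) l
  have h0 : coder (fun _ : List B => (0 : Vec B)) l = 0 := by
    have := coder_add (fun _ : List B => (0 : Vec B)) (fun _ => 0) l
    simpa using this
  simp only [add_neg_cancel, h0] at h
  exact (neg_eq_of_add_eq_zero_right h.symm).symm

theorem coder_sub (c c' : List B → Vec B) (l : List B) :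
    coder (fun l => c l - c' l) l = coder c l - coder c' l := by
  simp only [sub_eq_add_neg, coder_add, coder_neg]

/-- The coderivation with corestriction `c`, without signs. -/
def sumCoder (c : List B → Vec B) : List B → Ten B
  | [] => applyPrefix c []
  | b :: l => applyPrefix c (b :: l) + cns (bas b) (sumCoder c l)

theorem sumCoder_cons (c : List B → Vec B) (b : B) (l : List B) :
    sumCoder c (b :: l) = applyPrefix c (b :: l) + cns (bas b) (sumCoder c l) := rfl

/-- The square of an odd coderivation is even, so its corestriction is inserted without signs. -/
theorem coder_coder {c : List B → Vec B} (hc : ∀ l, Odd l.length → c l = 0) (l : List B) :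
    lin (coder c) (coder c l) = sumCoder (circ c c) l := by
  induction l with
  | nil => exact coder_coder_nil hc
  | cons b l ih => rw [coder_coder_cons hc, ih, sumCoder]

theorem exists_of_sumCoder_ne_zero {c : List B → Vec B} {l l' : List B}
    (h : sumCoder c l l' ≠ 0) : ∃ p q s x, l = p ++ (q ++ s) ∧ l' = p ++ x :: s ∧ c q x ≠ 0 := by
  induction l generalizing l' with
  | nil =>
    obtain ⟨q, s, x, h1, h2, h3⟩ := exists_of_applyPrefix_ne_zero h
    exact ⟨[], q, s, x, h1, h2, h3⟩
  | cons b l ih =>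
    rw [sumCoder_cons] at h
    rcases TorusAlgebra.add_apply_ne_zero h with h | h
    · obtain ⟨q, s, x, h1, h2, h3⟩ := exists_of_applyPrefix_ne_zero h
      exact ⟨[], q, s, x, h1, h2, h3⟩
    · obtain ⟨y, t, rfl, hy, ht⟩ := exists_of_cns_ne_zero h
      have hyb : y = b := by
        by_contra hne
        exact hy (Finsupp.single_eq_of_ne hne)
      obtain ⟨p, q, s, x, rfl, rfl, h3⟩ := ih ht
      exact ⟨b :: p, q, s, x, rfl, by rw [hyb]; rfl, h3⟩

theorem counit_sumCoder (c : List B → Vec B) (l : List B) : counit (sumCoder c l) = 0 := by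
  cases l with
  | nil => exact counit_applyPrefix _ _
  | cons b l => rw [sumCoder_cons, map_add, counit_applyPrefix, counit_cns, add_zero]

theorem proj_sumCoder (c : List B → Vec B) (l : List B) : proj (sumCoder c l) = c l := by
  cases l with
  | nil => exact proj_applyPrefix _ _
  | cons b l => rw [sumCoder_cons, map_add, proj_applyPrefix, proj_cns, counit_sumCoder, zero_smul,
      add_zero]

theorem lin_circ (c c' c'' : List B → Vec B) (l : List B) :
    lin (circ c c') (coder c'' l) = lin c (lin (coder c') (coder c'' l)) := by
  rw [map_lin]; rfl

end

end BarConstruction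

namespace TorusAlgebra

open BarConstruction

noncomputable section Obstruction

/-! ### Leading parts -/

/-- The number `|l| - 3 w`, where `w` is the winding number of `l`. -/
def omega (l : List BasisElt) : ℤ := l.length - 3 * (gam l).2.toAdd

theorem omega_append (l m : List BasisElt) : omega (l ++ m) = omega l + omega m := by
  have : (gam l * gam m).2.toAdd = (gam l).2.toAdd + (gam m).2.toAdd := rfl
  rw [omega, omega, omega, gam_append, this, List.length_append]
  push_cast
  ring

theorem omega_cons (x : BasisElt) (l : List BasisElt) : omega (x :: l) = omega [x] + omega l :=
  omega_append [x] l

theorem toAdd_shift_mul (a b : ℤ) (g : Gam) : (shift a b * g).2.toAdd = b + g.2.toAdd := by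
  have h : (shift a b).2.toAdd = b := (isModel_shift a b).2.2.2
  have : (shift a b * g).2.toAdd = (shift a b).2.toAdd + g.2.toAdd := rfl
  rw [this, h]

theorem DegRel.le_omega {d k : ℤ} {w : ℕ} {l l' : List BasisElt} (h : DegRel d w k l l') :
    k ≤ omega l - omega l' := by
  obtain ⟨-, -, v, -, h2, h3⟩ := h
  rw [omega, omega, h3, toAdd_shift_mul]
  linarith

theorem DegRel.of_le_omega {d k k' : ℤ} {w : ℕ} {l l' : List BasisElt} (h : DegRel d w k l l')
    (hk : k' ≤ omega l - omega l') : DegRel d w k' l l' := by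
  obtain ⟨h1, h2, v, h3, h4, h5⟩ := h
  refine ⟨h1, h2, v, h3, ?_, h5⟩
  rw [omega, omega, h5, toAdd_shift_mul] at hk
  linarith

/-- The order of a given coefficient is the fixed number `omega l - omega [x]`, so it cannot exceed
every bound. -/
theorem eq_zero_of_gr {d : ℤ} {w : ℕ} {c : List BasisElt → Vec BasisElt} (h : ∀ k, Gr d w k c)
    (l : List BasisElt) : c l = 0 := by
  ext x
  by_contra hx
  have := (h (omega l - omega [x] + 1) l x hx).le_omega
  linarith

/-- All coefficients of `c` are in the same degree with respect to `omega`. -/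
def Exact (k : ℤ) (c : List BasisElt → Vec BasisElt) : Prop :=
  ∀ l x, c l x ≠ 0 → omega l - omega [x] = k

theorem omega_of_mulV {x y z : BasisElt} (h : mulV x y z ≠ 0) :
    omega [x] + omega [y] = omega [z] + 1 := by
  obtain ⟨h1, h2⟩ := mulV_ne_zero h
  have : (gamma x * gamma y).2.toAdd = (gamma x).2.toAdd + (gamma y).2.toAdd := rfl
  simp only [omega, gam_singleton, gamma_mul h1 h2, this, List.length_singleton]
  push_cast
  ring

theorem omega_of_coder_mu2 {l l' : List BasisElt} (h : coder mu2 l l' ≠ 0) :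
    omega l = omega l' + 1 := by
  obtain ⟨p, q, s, x, rfl, rfl, hx⟩ := exists_of_coder_ne_zero h
  rcases q with _ | ⟨y, _ | ⟨z, _ | ⟨t, q⟩⟩⟩
  · exact absurd rfl hx
  · exact absurd rfl hx
  · have := omega_of_mulV hx
    simp only [omega_append, omega_cons x s, omega_cons y [z]]
    linarith
  · exact absurd rfl hx

theorem Exact.hdiff {k : ℤ} {c : List BasisElt → Vec BasisElt} (h : Exact k c) :
    Exact (k + 1) (hdiff c) := by
  intro l x hx
  rcases sub_apply_ne_zero hx with h1 | h1
  · rcases sub_apply_ne_zero h1 with h2 | h2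
    · obtain ⟨l', h3, h4⟩ := exists_of_lin_ne_zero h2
      have := h l' x h4
      have := omega_of_coder_mu2 h3
      linarith
    · rcases l with _ | ⟨y, l⟩
      · exact absurd rfl h2
      · obtain ⟨z, hz, hyz⟩ := exists_of_lin_ne_zero h2
        have := h l z hz
        have := omega_of_mulV hyz
        rw [omega_cons]
        linarith
  · obtain ⟨p, y, z, rfl, hz, hyz⟩ := exists_of_rightTerm_ne_zero (smul_apply_ne_zero h1)
    have := h p z hz
    have := omega_of_mulV hyz
    rw [omega_append]
    linarith

/-- The part of `c` of degree `k` with respect to `omega`. -/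
def lead (k : ℤ) (c : List BasisElt → Vec BasisElt) (l : List BasisElt) : Vec BasisElt :=
  (c l).filter fun x => omega l - omega [x] = k

theorem lead_ne_zero {k : ℤ} {c : List BasisElt → Vec BasisElt} {l : List BasisElt}
    {x : BasisElt} (h : lead k c l x ≠ 0) : c l x ≠ 0 ∧ omega l - omega [x] = k := by
  by_cases hx : omega l - omega [x] = k
  · rw [lead, Finsupp.filter_apply, if_pos hx] at h
    exact ⟨h, hx⟩
  · rw [lead, Finsupp.filter_apply, if_neg hx] at h
    exact absurd rfl h

theorem exact_lead (k : ℤ) (c : List BasisElt → Vec BasisElt) : Exact k (lead k c) :=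
  fun _ _ h => (lead_ne_zero h).2

theorem adm_lead {d k k' : ℤ} {w : ℕ} {c : List BasisElt → Vec BasisElt} (h : Adm d w k c) :
    Adm d w k (lead k' c) := fun l x hx => h l x (lead_ne_zero hx).1

theorem lead_eq_zero {k : ℤ} {c : List BasisElt → Vec BasisElt} {l : List BasisElt}
    (h : c l = 0) : lead k c l = 0 := by rw [lead, h, Finsupp.filter_zero]

theorem adm_sub_lead {d k : ℤ} {w : ℕ} {c : List BasisElt → Vec BasisElt} (h : Adm d w k c) :
    Adm d w (k + 1) fun l => c l - lead k c l := by
  intro l x hx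
  have hk : omega l - omega [x] ≠ k := by
    intro hk
    rw [Finsupp.sub_apply, lead, Finsupp.filter_apply, if_pos hk, sub_self] at hx
    exact hx rfl
  have hx' : c l x ≠ 0 := by
    rcases sub_apply_ne_zero hx with h | h
    · exact h
    · exact (lead_ne_zero h).1
  obtain ⟨h1, h2⟩ := h l x hx'
  refine ⟨h1, h2.of_le_omega ?_⟩
  have := h2.le_omega
  omega

/-- The differential raises the order by exactly one. The part of order `k + 1` in `hdiff c` is
therefore the differential of the leading part. -/
theorem hdiff_lead_eq_zero {d k : ℤ} {w : ℕ} {c : List BasisElt → Vec BasisElt}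
    (h : Adm d w k c) (h' : Gr (d - 1) w (k + 2) (hdiff c)) (l : List BasisElt) :
    hdiff (lead k c) l = 0 := by
  ext x
  by_contra hx
  have h1 := (exact_lead k c).hdiff l x hx
  have e : hdiff (lead k c) l = hdiff c l - hdiff (fun l => c l - lead k c l) l := by
    rw [← hdiff_sub]
    congr 1
    funext l
    abel
  rw [e] at hx
  rcases sub_apply_ne_zero hx with h2 | h2
  · have := (h' l x h2).le_omega
    omega
  · have := ((adm_sub_lead h).hdiff.gr l x h2).le_omega
    omega

/-! ### The associativity relation and the Hochschild differential -/

theorem lin_mu2_applyPrefix (e : List BasisElt → Vec BasisElt) (l : List BasisElt) :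
    lin mu2 (applyPrefix e l) = rightTerm e l := by
  rw [applyPrefix, map_splitSum]
  refine splitSum_congr fun p s _ => ?_
  rw [cns_bas_right, map_lin]
  simp only [lin_bas]
  rcases s with _ | ⟨y, _ | ⟨z, s⟩⟩
  · exact lin_zero_fun _
  · rfl
  · exact lin_zero_fun _

theorem lin_mu2_cns (b : BasisElt) (x : Ten BasisElt) :
    lin mu2 (cns (bas b) x) = lmul b (proj x) := by
  rw [lin_cns, lin_bas, proj, map_lin]
  refine lin_congr fun l _ => ?_
  rcases l with _ | ⟨y, _ | ⟨z, s⟩⟩ <;> simp [mu2]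

theorem lin_mu2_coder (e : List BasisElt → Vec BasisElt) (l : List BasisElt) :
    lin mu2 (coder e l) = rightTerm e l - leftTerm e l := by
  cases l with
  | nil => rw [coder_nil, lin_mu2_applyPrefix, leftTerm, sub_zero]
  | cons b l => rw [coder_cons, map_sub, lin_mu2_applyPrefix, lin_mu2_cns, proj_coder, leftTerm]

theorem lin_mu2_sumCoder (e : List BasisElt → Vec BasisElt) (l : List BasisElt) :
    lin mu2 (sumCoder e l) = rightTerm e l + leftTerm e l := by
  cases l with
  | nil => rw [sumCoder, lin_mu2_applyPrefix, leftTerm, add_zero]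
  | cons b l => rw [sumCoder, map_add, lin_mu2_applyPrefix, lin_mu2_cns, proj_sumCoder, leftTerm]

theorem leftTerm_of_parity {e : List BasisElt → Vec BasisElt} {l : List BasisElt}
    (he : ∀ l', l'.length + 1 = l.length → e l' = 0) : leftTerm e l = 0 := by
  cases l with
  | nil => rfl
  | cons b l => rw [leftTerm, he l (by simp), map_zero]

theorem rightTerm_of_parity {e : List BasisElt → Vec BasisElt} {l : List BasisElt}
    (he : ∀ l', l'.length + 1 = l.length → e l' = 0) : rightTerm e l = 0 := by
  rcases List.eq_nil_or_concat l with rfl | ⟨p, y, rfl⟩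
  · rfl
  · rw [List.concat_eq_append] at he ⊢
    rw [rightTerm_snoc, he p (by simp), map_zero]

/-- The outer terms evaluate `e` on lists with one entry less, so they vanish in one parity and the
sign in `hdiff` becomes constant. The differential is then the commutator with `μ₂` that appears in
the linearised A∞-relation. -/
theorem hdiff_of_even {e : List BasisElt → Vec BasisElt} (he : ∀ l, Odd l.length → e l = 0)
    (l : List BasisElt) : hdiff e l = lin e (coder mu2 l) + lin mu2 (coder e l) := by
  rw [lin_mu2_coder, hdiff]
  change mergeSum e l - _ - _ = mergeSum e l + _
  rcases Nat.even_or_odd l.length with h | h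
  · have he' : ∀ l', l'.length + 1 = l.length → e l' = 0 := fun l' hl' => he l' (by
      rw [← hl', Nat.even_add_one, Nat.not_even_iff_odd] at h; exact h)
    rw [leftTerm_of_parity he', rightTerm_of_parity he']
    simp
  · rw [h.neg_one_pow]
    simp only [neg_smul, one_smul]
    abel

/-- For cochains nonzero only on lists of odd length, such as relations and components of
homomorphisms, the commutator with `μ₂` involves the coderivation without signs. -/
theorem hdiff_of_odd {e : List BasisElt → Vec BasisElt} (he : ∀ l, Even l.length → e l = 0)
    (l : List BasisElt) : hdiff e l = lin e (coder mu2 l) - lin mu2 (sumCoder e l) := by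
  rw [lin_mu2_sumCoder, hdiff]
  change mergeSum e l - _ - _ = mergeSum e l - _
  rcases Nat.even_or_odd l.length with h | h
  · rw [h.neg_one_pow, one_smul]
    abel
  · have he' : ∀ l', l'.length + 1 = l.length → e l' = 0 := fun l' hl' => he l' (by
      rw [← hl', Nat.odd_add_one, Nat.not_odd_iff_even] at h; exact h)
    rw [leftTerm_of_parity he', rightTerm_of_parity he']
    simp

theorem Adm.circ {d d' k k' : ℤ} {w w' : ℕ} {c c' : List BasisElt → Vec BasisElt}
    (h : Adm d w k c) (h' : Adm d' w' k' c') :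
    Adm (d' + d) (w' + w) (k' + k) (circ c c') := by
  refine fun l x hx => ⟨?_, h.gr.circ h'.gr l x hx⟩
  obtain ⟨l', h1, h2⟩ := exists_of_lin_ne_zero hx
  obtain ⟨p, q, s, y, rfl, rfl, hy⟩ := exists_of_coder_ne_zero h1
  have n1 := (h _ x h2).1
  have n2 := (h' _ y hy).1
  intro j hj
  have e1 := n1 j
  have e2 := n2 j
  simp only [List.mem_append, List.mem_cons] at hj e1
  tauto

theorem Gr.sumCoder {d k : ℤ} {w : ℕ} {c : List BasisElt → Vec BasisElt} (h : Gr d w k c)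
    {l l' : List BasisElt} (hl : sumCoder c l l' ≠ 0) : DegRel d w k l l' := by
  obtain ⟨p, q, s, x, rfl, rfl, hx⟩ := exists_of_sumCoder_ne_zero hl
  exact ((h q x hx).append_right s).append_left p

theorem Gr.odd {k : ℤ} {w : ℕ} {c : List BasisElt → Vec BasisElt} (h : Gr (-1) w k c)
    {l : List BasisElt} (hl : Odd l.length) : c l = 0 := h.parity fun he => by
  obtain ⟨a, ha⟩ := hl
  rw [ha, Int.even_iff] at he
  push_cast at he
  omega

theorem Gr.even {k : ℤ} {w : ℕ} {c : List BasisElt → Vec BasisElt} (h : Gr (-2) w k c)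
    {l : List BasisElt} (hl : Even l.length) : c l = 0 := h.parity fun he => by
  obtain ⟨a, ha⟩ := hl
  rw [ha, Int.even_iff] at he
  push_cast at he
  omega

/-- The failure of associativity is a Hochschild cocycle to leading order. -/
theorem gr_hdiff_circ {k : ℤ} {w : ℕ} {h : List BasisElt → Vec BasisElt} (hh : Gr (-1) 0 2 h)
    (hE : Gr (-2) w k (circ (fun l => mu2 l + h l) fun l => mu2 l + h l)) :
    Gr (-2 - 1) w (k + 2) (hdiff (circ (fun l => mu2 l + h l) fun l => mu2 l + h l)) := by
  set M := fun l => mu2 l + h l with hM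
  have hMo : ∀ l, Odd l.length → M l = 0 := fun l hl => by
    rw [hM]; simp only [mu2_odd l hl, hh.odd hl, add_zero]
  have e1 : ∀ x, lin M x = lin mu2 x + lin h x := fun x => lin_add_fun _ _ _
  have e2 : ∀ l, coder M l = coder mu2 l + coder h l := fun l => coder_add _ _ _
  -- The Bianchi identity: M applied to the square of its coderivation is read in two ways. The
  -- terms with `μ₂` form the Hochschild differential of `circ M M`, and the others involve `h`, of
  -- order at least 2.
  have key : ∀ l, hdiff (circ M M) l =
      lin h (sumCoder (circ M M) l) - lin (circ M M) (coder h l) := by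
    intro l
    have h1 := lin_circ M M M l
    rw [coder_coder hMo, e1, e2, map_add] at h1
    rw [hdiff_of_odd (fun l hl => hE.even hl), ← sub_eq_zero]
    rw [← sub_eq_zero] at h1
    rw [← h1]
    abel
  intro l x hx
  rw [key] at hx
  rcases sub_apply_ne_zero hx with h1 | h1
  · have := hh.lin (fun l' => hE.sumCoder) h1
    simpa using this
  · have := hE.lin (fun l' => hh.coder) h1
    simpa [add_comm] using this

/-- The correction step: subtracting `e` changes the failure of the relation by `hdiff e`, up to
terms of higher order. -/
theorem circ_sub {h e : List BasisElt → Vec BasisElt} (he : ∀ l, Odd l.length → e l = 0)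
    (l : List BasisElt) :
    circ (fun l => mu2 l + (h l - e l)) (fun l => mu2 l + (h l - e l)) l =
      circ (fun l => mu2 l + h l) (fun l => mu2 l + h l) l - hdiff e l - circ h e l - circ e h l +
        circ e e l := by
  rw [hdiff_of_even he]
  simp only [circ, coder_add, coder_sub, lin_add_fun, lin_sub_fun, map_add, map_sub]
  abel

theorem circ_mu2_add {h : List BasisElt → Vec BasisElt} (hh : ∀ l, Odd l.length → h l = 0)
    (l : List BasisElt) : circ (fun l => mu2 l + h l) (fun l => mu2 l + h l) l =
      hdiff h l + circ h h l := by
  rw [hdiff_of_even hh]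
  have h0 : lin mu2 (coder mu2 l) = 0 := circ_mu2_mu2 l
  simp only [circ, coder_add, lin_add_fun, map_add, h0]
  abel

/-- As `μ₂` is associative, what is left is `hdiff h`, of order 3, and `circ h h`, of order 4. Both
are normalized, which is not apparent for the terms with `μ₂` taken one by one. -/
theorem adm_circ_mu2_add {h : List BasisElt → Vec BasisElt} (hh : Adm (-1) 0 2 h) :
    Adm (-2) 0 3 (circ (fun l => mu2 l + h l) fun l => mu2 l + h l) := by
  intro l x hx
  rw [circ_mu2_add (fun l hl => hh.gr.odd hl)] at hx
  exact ((hh.hdiff.mono le_rfl le_rfl).add ((hh.circ hh).mono le_rfl (by norm_num))) l x hx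

end Obstruction

end TorusAlgebra

namespace TorusAlgebra

open BarConstruction

noncomputable section Words

/-! ### Words of tiling patterns -/

/-- The letters `i, i + 1, …, i + n - 1`. -/
def lets (i : ZMod 4) : ℕ → List (Option (ZMod 4))
  | 0 => []
  | n + 1 => some i :: lets (i + 1) n

theorem lets_eq_map (i : ZMod 4) (n : ℕ) :
    lets i n = (List.range n).map fun j : ℕ => some (i + (j : ZMod 4)) := by
  induction n generalizing i with
  | zero => rfl
  | succ n ih =>
    rw [List.range_succ_eq_map, List.map_cons, List.map_map, lets, ih, Nat.cast_zero, add_zero]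
    congr 1
    refine List.map_congr_left fun j _ => ?_
    simp only [Function.comp_apply, Nat.succ_eq_add_one, Nat.cast_add, Nat.cast_one]
    congr 1; ring

theorem letters_eq (i : ZMod 4) (n : ℕ) : letters i n = lets i (n + 1) := by
  rw [lets_eq_map, letters]
  induction List.range (n + 1) with
  | nil => rfl
  | cons a l ih => rw [List.map_cons, ← ih]; rfl

theorem count_none_lets (i : ZMod 4) (n : ℕ) : (lets i n).count none = 0 := by
  induction n generalizing i with
  | zero => rfl
  | succ n ih => simp [lets, ih]

theorem lets_add (i : ZMod 4) (m n : ℕ) : lets i (m + n) = lets i m ++ lets (i + m) n := by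
  induction m generalizing i with
  | zero => simp [lets]
  | succ m ih =>
    rw [show m + 1 + n = (m + n) + 1 by omega, lets, ih, lets]
    rw [List.cons_append, Nat.cast_add, Nat.cast_one]
    congr 3; ring

/-- The tree is not a leaf. -/
def IsNode (t : PlaneTree) : Prop := t ≠ .leaf

theorem IsNode.exists_eq {t : PlaneTree} (h : IsNode t) : ∃ t₁ t₂ t₃, t = .node t₁ t₂ t₃ := by
  cases t with
  | leaf => exact absurd rfl h
  | node t₁ t₂ t₃ => exact ⟨_, _, _, rfl⟩

theorem isNode_node (t₁ t₂ t₃ : PlaneTree) : IsNode (.node t₁ t₂ t₃) := PlaneTree.noConfusion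

theorem walk_node (t₁ t₂ t₃ : PlaneTree) (x : ZMod 4) : (PlaneTree.node t₁ t₂ t₃).walk x =
    some x :: (t₁.walk (x + 1) ++ some (x - 1) :: (t₂.walk x ++ some (x - 2) ::
      (t₃.walk (x - 1) ++ [some (x - 3)]))) := by
  simp [PlaneTree.walk]

/-- Walks form a prefix code. Ascending letters in front of the second walk would have to follow the
first branches of `t` upwards. Reaching a leaf there gives a mark where a letter is due, and meeting
the walk of `t'` contradicts `PlaneTree.walk_injective`. -/
theorem walk_conflict {t t' : PlaneTree} (ht : IsNode t) (ht' : IsNode t') (y : ZMod 4) (k : ℕ)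
    (r : List (Option (ZMod 4))) (hr : r ≠ [] ∨ k ≠ 0)
    (h : t.walk y ++ r = lets y k ++ t'.walk (y + k)) : False := by
  induction k generalizing t y r with
  | zero =>
    simp only [lets, Nat.cast_zero, add_zero, List.nil_append] at h
    have := (PlaneTree.walk_injective t t' y r [] (by simpa using h)).2
    simp_all
  | succ k ih =>
    obtain ⟨t₁, t₂, t₃, rfl⟩ := ht.exists_eq
    rw [walk_node, lets] at h
    simp only [List.cons_append, List.cons.injEq, true_and, List.append_assoc] at h
    have e : y + ((k + 1 : ℕ) : ZMod 4) = y + 1 + k := by push_cast; ring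
    rw [e] at h
    cases t₁ with
    | leaf =>
      obtain ⟨s₁, s₂, s₃, rfl⟩ := ht'.exists_eq
      cases k <;> simp [PlaneTree.walk, lets] at h
    | node s₁ s₂ s₃ =>
      exact ih (isNode_node _ _ _) (y + 1) _ (Or.inl (by simp)) h

theorem lets_walk_head {t : PlaneTree} (ht : IsNode t) (a : ZMod 4) (k : ℕ) :
    ∃ w, lets a k ++ t.walk (a + k) = some a :: w := by
  obtain ⟨t₁, t₂, t₃, rfl⟩ := ht.exists_eq
  cases k with
  | zero => exact ⟨_, by rw [walk_node]; simp [lets]; rfl⟩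
  | succ k => exact ⟨_, rfl⟩

theorem lets_walk_injective {t t' : PlaneTree} (ht : IsNode t) (ht' : IsNode t') (a a' : ZMod 4)
    (k k' : ℕ) (h : lets a k ++ t.walk (a + k) = lets a' k' ++ t'.walk (a' + k')) :
    a = a' ∧ k = k' ∧ t = t' := by
  have ha : a = a' := by
    obtain ⟨w, hw⟩ := lets_walk_head ht a k
    obtain ⟨w', hw'⟩ := lets_walk_head ht' a' k'
    rw [hw, hw'] at h
    simpa using (List.cons.inj h).1
  subst ha
  refine ⟨rfl, ?_⟩
  wlog hk : k ≤ k' generalizing k k' t t'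
  · obtain ⟨h1, h2⟩ := this ht' ht k' k h.symm (by omega)
    exact ⟨h1.symm, h2.symm⟩
  obtain ⟨n, rfl⟩ := Nat.exists_eq_add_of_le hk
  rw [lets_add, List.append_assoc, List.append_cancel_left_eq] at h
  have e : a + ((k + n : ℕ) : ZMod 4) = a + k + n := by push_cast; ring
  rw [e] at h
  rcases Nat.eq_zero_or_pos n with rfl | hn
  · refine ⟨rfl, ?_⟩
    have := PlaneTree.walk_injective t t' (a + k) [] [] (by simpa [lets] using h)
    exact this.1
  · exact (walk_conflict ht ht' (a + k) n [] (Or.inr (by omega)) (by simpa using h)).elim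

theorem walk_lets_injective {t t' : PlaneTree} (ht : IsNode t) (ht' : IsNode t') (a a' : ZMod 4)
    (k k' : ℕ) (h : t.walk a ++ lets (a - 2) k = t'.walk a' ++ lets (a' - 2) k') :
    a = a' ∧ k = k' ∧ t = t' := by
  have ha : a = a' := by
    obtain ⟨t₁, t₂, t₃, rfl⟩ := ht.exists_eq
    obtain ⟨s₁, s₂, s₃, rfl⟩ := ht'.exists_eq
    rw [walk_node, walk_node] at h
    simpa using (List.cons.inj h).1
  subst ha
  obtain ⟨h1, h2⟩ := PlaneTree.walk_injective t t' _ _ _ h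
  refine ⟨rfl, ?_, h1⟩
  have := congrArg List.length h2
  simpa [lets_eq_map] using this

/-- The output of a pattern which is extended to the right by `k` vertices. -/
def outR (a : ZMod 4) : ℕ → Basic
  | 0 => .idem (source a)
  | k + 1 => .reeb a k

/-- The word `w` is read off a tiling pattern with `d` vertices of valence `4` and output `o`, which
is extended to the left or not. -/
inductive Recognized : List (Option (ZMod 4)) → ℕ → Basic → Prop
  | right (a : ZMod 4) (k : ℕ) (t : PlaneTree) (ht : IsNode t) :
      Recognized (lets a k ++ t.walk (a + k)) t.size (outR a k)
  | left (a : ZMod 4) (k : ℕ) (t : PlaneTree) (ht : IsNode t) :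
      Recognized (t.walk a ++ lets (a - 2) (k + 1)) t.size (.reeb (a - 2) k)

theorem recognized_pattern (P : TilingPattern) : Recognized P.walk P.tree.size P.output := by
  obtain ⟨t₁, t₂, t₃, x, e⟩ := P
  cases e with
  | centered =>
    have := Recognized.right x 0 (.node t₁ t₂ t₃) (isNode_node _ _ _)
    simpa [lets, TilingPattern.walk, TilingPattern.output, outR, TilingPattern.tree] using this
  | right k =>
    have := Recognized.right (x - (k + 1)) (k + 1) (.node t₁ t₂ t₃) (isNode_node _ _ _)
    simpa [TilingPattern.walk, TilingPattern.output, outR, TilingPattern.tree, letters_eq]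
      using this
  | left k =>
    have := Recognized.left x k (.node t₁ t₂ t₃) (isNode_node _ _ _)
    simpa [TilingPattern.walk, TilingPattern.output, outR, TilingPattern.tree, letters_eq]
      using this

theorem exists_pattern {w : List (Option (ZMod 4))} {d : ℕ} {o : Basic} (h : Recognized w d o) :
    ∃ P : TilingPattern, P.walk = w ∧ P.tree.size = d ∧ P.output = o := by
  cases h with
  | right a k t ht =>
    obtain ⟨t₁, t₂, t₃, rfl⟩ := ht.exists_eq
    cases k with
    | zero => exact ⟨⟨t₁, t₂, t₃, a, .centered⟩, by simp [TilingPattern.walk, lets,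
        TilingPattern.tree], rfl, rfl⟩
    | succ k =>
      refine ⟨⟨t₁, t₂, t₃, a + (k + 1 : ℕ), .right k⟩, ?_, rfl, ?_⟩
      · simp [TilingPattern.walk, TilingPattern.tree, letters_eq]
      · simp [TilingPattern.output, outR]
  | left a k t ht =>
    obtain ⟨t₁, t₂, t₃, rfl⟩ := ht.exists_eq
    exact ⟨⟨t₁, t₂, t₃, a, .left k⟩, by simp [TilingPattern.walk, TilingPattern.tree,
      letters_eq], rfl, rfl⟩

/-- A tiling pattern is determined by its word. -/
theorem pattern_unique {P Q : TilingPattern} (h : P.walk = Q.walk) : P = Q := by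
  -- A pattern extended to the left is never read as a centered one or as one extended to the right.
  have conflict : ∀ (t₁ t₂ t₃ s₁ s₂ s₃ : PlaneTree) (a b : ZMod 4) (k k' : ℕ),
      (PlaneTree.node t₁ t₂ t₃).walk a ++ lets (a - 2) (k + 1) ≠
        lets b k' ++ (PlaneTree.node s₁ s₂ s₃).walk (b + k') := by
    intro t₁ t₂ t₃ s₁ s₂ s₃ a b k k' h
    have hab : a = b := by
      obtain ⟨w', hw'⟩ := lets_walk_head (isNode_node s₁ s₂ s₃) b k'
      rw [hw', walk_node] at h
      simpa using (List.cons.inj h).1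
    subst hab
    exact walk_conflict (isNode_node _ _ _) (isNode_node _ _ _) a k' _ (Or.inl (by simp [lets])) h
  have key : ∀ (t₁ t₂ t₃ : PlaneTree) (x : ZMod 4) (k : ℕ),
      lets (x - (k + 1)) (k + 1) ++ (PlaneTree.node t₁ t₂ t₃).walk x =
      lets (x - (k + 1)) (k + 1) ++ (PlaneTree.node t₁ t₂ t₃).walk (x - (k + 1) + (k + 1 : ℕ)) := by
    intro t₁ t₂ t₃ x k
    congr 2
    push_cast; ring
  have key0 : ∀ (t₁ t₂ t₃ : PlaneTree) (x : ZMod 4), (PlaneTree.node t₁ t₂ t₃).walk x =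
      lets x 0 ++ (PlaneTree.node t₁ t₂ t₃).walk (x + (0 : ℕ)) := by
    intro t₁ t₂ t₃ x
    simp [lets]
  obtain ⟨t₁, t₂, t₃, x, e⟩ := P
  obtain ⟨s₁, s₂, s₃, y, e'⟩ := Q
  have node := isNode_node
  cases e <;> cases e' <;>
    simp only [TilingPattern.walk, TilingPattern.tree, letters_eq] at h
  · rw [key0, key0 s₁] at h
    obtain ⟨rfl, -, h⟩ := lets_walk_injective (node _ _ _) (node _ _ _) _ _ _ _ h
    cases h; rfl
  · rw [key0, key] at h
    obtain ⟨-, h, -⟩ := lets_walk_injective (node _ _ _) (node _ _ _) _ _ _ _ h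
    omega
  · rw [key0] at h
    exact (conflict _ _ _ _ _ _ _ _ _ _ h.symm).elim
  · rw [key, key0 s₁] at h
    obtain ⟨-, h, -⟩ := lets_walk_injective (node _ _ _) (node _ _ _) _ _ _ _ h
    omega
  · rw [key, key s₁] at h
    obtain ⟨h1, h2, h⟩ := lets_walk_injective (node _ _ _) (node _ _ _) _ _ _ _ h
    cases h
    simp only [add_left_inj] at h2
    subst h2
    simp only [sub_left_inj] at h1
    rw [h1]
  · rw [key] at h
    exact (conflict _ _ _ _ _ _ _ _ _ _ h.symm).elim
  · rw [key0 s₁] at h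
    exact (conflict _ _ _ _ _ _ _ _ _ _ h).elim
  · rw [key s₁] at h
    exact (conflict _ _ _ _ _ _ _ _ _ _ h).elim
  · obtain ⟨rfl, h2, h⟩ := walk_lets_injective (node _ _ _) (node _ _ _) _ _ _ _ h
    cases h
    simp only [add_left_inj] at h2
    rw [h2]

end Words

end TorusAlgebra

namespace TorusAlgebra

open BarConstruction

noncomputable section Undeformed

/-! ### The undeformed operations -/

/-- All entries are chords or `U`-multiples of chords. -/
def Pure (l : List BasisElt) : Prop := ∀ b ∈ l, ∃ i n, b.2 = .reeb i n

/-- The letters of a basis element. -/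
def lettersB : BasisElt → List (Option (ZMod 4))
  | (_, .idem _) => []
  | (_, .reeb i n) => lets i (n + 1)

/-- The chords of a list, separated by `none`. -/
def word : List BasisElt → List (Option (ZMod 4))
  | [] => []
  | [b] => lettersB b
  | b :: b' :: l => lettersB b ++ none :: word (b' :: l)

/-- The word of the remaining entries of a list. -/
def tailWord : List BasisElt → List (Option (ZMod 4))
  | [] => []
  | b :: l => none :: word (b :: l)

theorem word_cons (b : BasisElt) (l : List BasisElt) : word (b :: l) = lettersB b ++ tailWord l := by
  cases l <;> simp [word, tailWord]

theorem toChords_eq_some {l : List BasisElt} {c : List (ZMod 4 × ℕ)} (h : toChords l = some c) :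
    Pure l ∧ List.intercalate [none] (c.map fun p => letters p.1 p.2) = word l := by
  induction l generalizing c with
  | nil =>
    cases h
    exact ⟨fun b hb => by simp at hb, rfl⟩
  | cons b l ih =>
    rcases b with ⟨m, j | ⟨i, n⟩⟩
    · simp [toChords] at h
    · simp only [toChords, Option.map_eq_some_iff] at h
      obtain ⟨c, hc, rfl⟩ := h
      obtain ⟨h1, h2⟩ := ih hc
      refine ⟨fun b hb => ?_, ?_⟩
      · rcases List.mem_cons.1 hb with rfl | hb
        · exact ⟨i, n, rfl⟩
        · exact h1 b hb
      · rcases l with _ | ⟨b', l⟩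
        · cases hc
          simp [List.intercalate, word, lettersB, letters_eq]
        · obtain ⟨p, c, rfl⟩ : ∃ p c', c = p :: c' := by
            rcases b' with ⟨m', j' | ⟨i', n'⟩⟩
            · simp [toChords] at hc
            · simp only [toChords, Option.map_eq_some_iff] at hc
              obtain ⟨c', -, rfl⟩ := hc
              exact ⟨_, _, rfl⟩
          rw [word, ← h2]
          simp [List.intercalate, lettersB, letters_eq]

theorem exists_toChords {l : List BasisElt} (h : Pure l) : ∃ c, toChords l = some c := by
  induction l with
  | nil => exact ⟨[], rfl⟩
  | cons b l ih =>
    obtain ⟨c, hc⟩ := ih fun b hb => h b (List.mem_cons_of_mem _ hb)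
    obtain ⟨i, n, hb⟩ := h b (by simp)
    obtain ⟨m, b⟩ := b
    simp only at hb
    subst hb
    exact ⟨(i, n) :: c, by simp [toChords, hc]⟩

/-- The undeformed operations on basis elements. -/
def und : List BasisElt → Vec BasisElt := undefBasic

/-- The operations counting tiling patterns. -/
def high (l : List BasisElt) : Vec BasisElt :=
  (toChords l).elim 0 fun c => countPatterns (powerU l) c

/-- By `pattern_unique` the sum over patterns has a single term, so every nonzero value is one basis
element with coefficient 1. -/
theorem high_of_recognized {l : List BasisElt} (hl : Pure l) {d : ℕ} {o : Basic}
    (h : Recognized (word l) d o) : high l = bas (powerU l + d, o) := by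
  obtain ⟨c, hc⟩ := exists_toChords hl
  obtain ⟨P, h1, rfl, rfl⟩ := exists_pattern h
  have hP : P.HasChordSequence c := by
    rw [TilingPattern.HasChordSequence, (toChords_eq_some hc).2, h1]
  rw [high, hc]
  change countPatterns (powerU l) c = _
  classical
  rw [countPatterns, finsum_eq_single _ P]
  · rw [finsum_eq_if, if_pos hP]; rfl
  · intro Q hQ
    rw [finsum_eq_if, if_neg]
    intro hQ'
    apply hQ
    apply pattern_unique
    rw [h1, ← (toChords_eq_some hc).2]
    exact hQ'

theorem exists_of_high_ne_zero {l : List BasisElt} {x : BasisElt} (h : high l x ≠ 0) :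
    Pure l ∧ ∃ d o, Recognized (word l) d o ∧ x = (powerU l + d, o) := by
  cases hc : toChords l with
  | none =>
    rw [high, hc] at h
    exact absurd rfl h
  | some c =>
    obtain ⟨h1, h2⟩ := toChords_eq_some hc
    refine ⟨h1, ?_⟩
    by_cases hP : ∃ P : TilingPattern, P.HasChordSequence c
    · obtain ⟨P, hP⟩ := hP
      have := recognized_pattern P
      rw [show P.walk = word l from hP.trans h2] at this
      refine ⟨_, _, this, ?_⟩
      rw [high_of_recognized h1 this] at h
      by_contra hne
      exact h (Finsupp.single_eq_of_ne hne)
    · rw [high, hc] at h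
      refine absurd ?_ h
      classical
      have h0 : ∀ P : TilingPattern, (∑ᶠ (_ : P.HasChordSequence c),
          elt (powerU l + P.tree.size) P.output) = 0 := fun P => by
        rw [finsum_eq_if, if_neg fun h => hP ⟨P, h⟩]
      have hz : countPatterns (powerU l) c = 0 := by
        rw [countPatterns]
        simp only [h0, finsum_zero]
      change (show Vec BasisElt from countPatterns (powerU l) c) x = 0
      rw [hz]
      rfl

theorem count_none_walk (t : PlaneTree) (x : ZMod 4) : (t.walk x).count none = 2 * t.size + 1 := by
  induction t generalizing x with
  | leaf => rfl
  | node t₁ t₂ t₃ h₁ h₂ h₃ =>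
    rw [walk_node]
    simp [h₁, h₂, h₃, PlaneTree.size]
    omega

theorem count_none_tailWord (l : List BasisElt) : (tailWord l).count none = l.length := by
  induction l with
  | nil => rfl
  | cons b l ih =>
    rw [tailWord, word_cons]
    have : (lettersB b).count none = 0 := by
      rcases b with ⟨m, j | ⟨i, n⟩⟩
      · rfl
      · exact count_none_lets _ _
    simp [ih, this]

theorem count_none_word (b : BasisElt) (l : List BasisElt) :
    (word (b :: l)).count none = l.length := by
  have : (lettersB b).count none = 0 := by
    rcases b with ⟨m, j | ⟨i, n⟩⟩
    · rfl
    · exact count_none_lets _ _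
  rw [word_cons, List.count_append, this, count_none_tailWord, zero_add]

theorem size_pos {t : PlaneTree} (ht : IsNode t) : 0 < t.size := by
  obtain ⟨t₁, t₂, t₃, rfl⟩ := ht.exists_eq
  simp [PlaneTree.size]

/-- A tree with d vertices of valence 4 has 2d + 1 leaves besides the root, and these separate the
chords. An extension adds no leaves. -/
theorem length_of_recognized {l : List BasisElt} {d : ℕ} {o : Basic}
    (h : Recognized (word l) d o) : l.length = 2 * d + 2 ∧ 0 < d := by
  rcases l with _ | ⟨b, l⟩
  · exfalso
    have : ∀ w, Recognized w d o → w ≠ [] := by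
      rintro w (⟨a, k, t, ht⟩ | ⟨a, k, t, ht⟩) <;>
      · obtain ⟨t₁, t₂, t₃, rfl⟩ := ht.exists_eq
        simp [walk_node]
    exact this _ h rfl
  · have h1 := count_none_word b l
    have : ∀ w, Recognized w d o → w.count none = 2 * d + 1 ∧ 0 < d := by
      rintro w (⟨a, k, t, ht⟩ | ⟨a, k, t, ht⟩) <;>
      · have := size_pos ht
        simp [count_none_walk, count_none_lets, this]
    obtain ⟨h2, h3⟩ := this _ h
    simp only [List.length_cons]
    omega

theorem high_of_length {l : List BasisElt} (h : l.length < 4) : high l = 0 := by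
  ext x
  by_contra hx
  obtain ⟨-, d, o, h1, -⟩ := exists_of_high_ne_zero hx
  have := length_of_recognized h1
  omega

theorem und_eq (l : List BasisElt) : und l = mu2 l + high l := by
  by_cases h : l.length = 2
  · rw [high_of_length (by omega), add_zero]
    obtain ⟨x, y, rfl⟩ := List.length_eq_two.1 h
    rfl
  · rw [mu2_of_length h, zero_add]
    rcases l with _ | ⟨x, _ | ⟨y, _ | ⟨z, l⟩⟩⟩
    · rfl
    · rfl
    · simp at h
    · rfl

/-! ### Junctions -/

/-- A walk along `w`, starting after the letter `a` and ending with the letter `b`: the letters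
increase by `1`, and decrease by `1` at the marks `none`. -/
def Run : ZMod 4 → List (Option (ZMod 4)) → ZMod 4 → Prop
  | a, [], b => a = b
  | a, some c :: w, b => c = a + 1 ∧ Run c w b
  | a, none :: some c :: w, b => c = a - 1 ∧ Run c w b
  | _, none :: _, _ => False

theorem run_lets (a : ZMod 4) (n : ℕ) (w : List (Option (ZMod 4))) (b : ZMod 4) :
    Run a (lets (a + 1) n ++ w) b ↔ Run (a + n) w b := by
  induction n generalizing a with
  | zero => simp [lets]
  | succ n ih =>
    have e : a + 1 + (n : ZMod 4) = a + ((n + 1 : ℕ) : ZMod 4) := by push_cast; ring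
    rw [lets, List.cons_append, Run, ih, e]
    simp

/-- Going around a branch leads from the sector labelled `y - 1` to the next one, labelled `y - 2`,
as if the branch were a leaf. -/
theorem run_walk (t : PlaneTree) (y : ZMod 4) (w : List (Option (ZMod 4))) (b : ZMod 4)
    (h : Run (y - 2) w b) : Run (y - 1) (t.walk y ++ some (y - 2) :: w) b := by
  have e : ∀ y : ZMod 4, y - 2 = y - 3 + 1 := by decide
  induction t generalizing y w with
  | leaf => exact ⟨by ring, h⟩
  | node t₁ t₂ t₃ h₁ h₂ h₃ =>
    rw [walk_node]
    simp only [List.cons_append, List.append_assoc, List.nil_append]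
    refine ⟨by ring, ?_⟩
    have := h₁ (y + 1) (t₂.walk y ++ some (y - 2) :: (t₃.walk (y - 1) ++
      some (y - 3) :: some (y - 2) :: w)) (by
        have := h₂ y (t₃.walk (y - 1) ++ some (y - 3) :: some (y - 2) :: w) (by
          have := h₃ (y - 1) (some (y - 2) :: w) ⟨by ring, h⟩
          have e1 : y - 1 - 1 = y - 2 := by ring
          have e2 : y - 1 - 2 = y - 3 := by ring
          rwa [e1, e2] at this)
        have e1 : y + 1 - 2 = y - 1 := by ring
        rwa [e1])
    have e1 : y + 1 - 2 = y - 1 := by ring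
    have e2 : y + 1 - 1 = y := by ring
    rwa [e1, e2] at this

theorem run_node {t : PlaneTree} (ht : IsNode t) (x : ZMod 4) (w : List (Option (ZMod 4)))
    (b : ZMod 4) (h : Run (x - 3) w b) : Run (x - 1) (t.walk x ++ w) b := by
  obtain ⟨t₁, t₂, t₃, rfl⟩ := ht.exists_eq
  rw [walk_node]
  simp only [List.cons_append, List.append_assoc, List.nil_append]
  refine ⟨by ring, ?_⟩
  have h3 := run_walk t₃ (x - 1) w b (by rwa [show x - 1 - 2 = x - 3 by ring])
  rw [show x - 1 - 1 = x - 2 by ring, show x - 1 - 2 = x - 3 by ring] at h3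
  have h2 := run_walk t₂ x _ b h3
  have h1 := run_walk t₁ (x + 1) (t₂.walk x ++ some (x - 2) :: (t₃.walk (x - 1) ++
      some (x - 3) :: w)) b (by rwa [show x + 1 - 2 = x - 1 by ring])
  rwa [show x + 1 - 1 = x by ring, show x + 1 - 2 = x - 1 by ring] at h1

theorem recognized_run {w : List (Option (ZMod 4))} {d : ℕ} {o : Basic}
    (h : Recognized w d o) : ∃ a b, Run (a - 1) w b ∧ o.left = source a ∧
      o.right = source (b + 1) := by
  have e : ∀ x : ZMod 4, source (x - 3 + 1) = source x := by decide
  cases h with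
  | right a k t ht =>
    refine ⟨a, a + k - 3, ?_, ?_, ?_⟩
    · have := run_lets (a - 1) k (t.walk (a + k)) (a + k - 3)
      rw [sub_add_cancel] at this
      rw [this, show a - 1 + k = a + k - 1 by ring]
      simpa using run_node ht (a + k) [] (a + k - 3) rfl
    · cases k <;> rfl
    · cases k with
      | zero => simp only [outR, Basic.right, e]; simp
      | succ k =>
        simp only [outR, Basic.right, e]
        push_cast
        congr 1; ring
  | left a k t ht =>
    refine ⟨a, a - 3 + (k + 1 : ℕ), ?_, ?_, ?_⟩
    · refine run_node ht a _ _ ?_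
      have := run_lets (a - 3) (k + 1) [] (a - 3 + (k + 1 : ℕ))
      rw [show a - 3 + 1 = a - 2 by ring, List.append_nil] at this
      exact this.2 rfl
    · have : ∀ x : ZMod 4, source (x - 2) = source x := by decide
      exact this a
    · simp only [Basic.right]
      congr 1; push_cast; ring

/-- Consecutive entries are composable in the way required by tiling patterns. -/
theorem run_word {a b : ZMod 4} {l : List BasisElt} (hl : Pure l) (hne : l ≠ [])
    (h : Run (a - 1) (word l) b) : IsPath (source a) l (source (b + 1)) := by
  induction l generalizing a with
  | nil => exact absurd rfl hne
  | cons x l ih =>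
    obtain ⟨i, n, hx⟩ := hl x (by simp)
    obtain ⟨m, x⟩ := x
    simp only at hx
    subst hx
    have hl' : Pure l := fun b hb => hl b (List.mem_cons_of_mem _ hb)
    rw [word_cons, lettersB] at h
    have hia : i = a := by
      have := h.1
      rw [sub_add_cancel] at this
      exact this
    subst hia
    have h2 := (run_lets (i - 1) (n + 1) (tailWord l) b).1 (by rwa [sub_add_cancel])
    refine ⟨rfl, ?_⟩
    have e : i - 1 + ((n + 1 : ℕ) : ZMod 4) = i + n := by push_cast; ring
    rw [e] at h2
    rcases l with _ | ⟨y, l⟩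
    · simp only [tailWord, Run] at h2
      rw [← h2]
      rfl
    · obtain ⟨i', n', hy⟩ := hl' y (by simp)
      obtain ⟨m', y⟩ := y
      simp only at hy
      subst hy
      rw [tailWord, word_cons, lettersB] at h2
      have h3 : i' = i + n - 1 := h2.1
      have h4 : Run (i' - 1) (word ((m', .reeb i' n') :: l)) b := by
        rw [word_cons, lettersB]
        exact ⟨by ring, h2.2⟩
      have := ih hl' (by simp) h4
      have e2 : ∀ x : ZMod 4, source (x - 1) = source (x + 1) := by decide
      rw [h3, e2] at this
      rw [h3]
      exact this

theorem run_append {a b : ZMod 4} {u w : List (Option (ZMod 4))} {c : ZMod 4}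
    (h : Run a (u ++ some c :: w) b) : Run c w b := by
  induction u using List.twoStepInduction generalizing a with
  | nil => exact h.2
  | singleton x =>
    rcases x with _ | x
    · exact h.2
    · exact h.2.2
  | cons_cons x y u ih1 ih2 =>
    rcases x with _ | x
    · rcases y with _ | y
      · exact h.elim
      · exact ih1 h.2
    · exact ih2 _ h.2

theorem word_append (p : List BasisElt) (x : BasisElt) (s : List BasisElt) :
    ∃ u, word (p ++ x :: s) = u ++ word (x :: s) := by
  induction p with
  | nil => exact ⟨[], rfl⟩
  | cons b p ih =>
    obtain ⟨u, hu⟩ := ih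
    refine ⟨lettersB b ++ none :: u, ?_⟩
    rw [List.cons_append, word_cons]
    cases h : p ++ x :: s with
    | nil => simp at h
    | cons y q => rw [tailWord, ← h, hu]; simp

/-- The operations vanish unless each chord starts one label before the end of the previous one. -/
theorem high_junction (p s : List BasisElt) (m m' : ℕ) (i i' : ZMod 4) (n n' : ℕ)
    (h : i' ≠ i + n - 1) : high (p ++ (m, .reeb i n) :: (m', .reeb i' n') :: s) = 0 := by
  ext x
  by_contra hx
  obtain ⟨-, d, o, h1, -⟩ := exists_of_high_ne_zero hx
  obtain ⟨a, b, h2, -, -⟩ := recognized_run h1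
  obtain ⟨u, hu⟩ := word_append p (m, .reeb i n) ((m', .reeb i' n') :: s)
  rw [hu, word_cons, lettersB, lets, List.cons_append] at h2
  have h3 := (run_lets i n (tailWord ((m', .reeb i' n') :: s)) b).1 (run_append h2)
  rw [tailWord, word_cons, lettersB] at h3
  exact h h3.1

/-! ### Gradings -/

/-- The product of the gradings of the letters of a word. -/
def gammaWord : List (Option (ZMod 4)) → Gam
  | [] => 1
  | none :: w => gammaWord w
  | some x :: w => gammaRho x * gammaWord w

theorem gammaWord_append (u w : List (Option (ZMod 4))) :
    gammaWord (u ++ w) = gammaWord u * gammaWord w := by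
  induction u with
  | nil => simp [gammaWord]
  | cons x u ih => cases x <;> simp [gammaWord, ih, mul_assoc]

theorem gammaWord_lets (i : ZMod 4) (n : ℕ) : gammaWord (lets i (n + 1)) = gammaBasic (.reeb i n) := by
  rw [gammaBasic_reeb, lets_eq_map]
  induction List.range (n + 1) with
  | nil => rfl
  | cons a l ih => simp [gammaWord, ih]

theorem gamma_four (x : ZMod 4) : gammaRho x * (gammaRho (x - 1) * (gammaRho (x - 2) *
    gammaRho (x - 3))) = shift (-4) 1 := by
  refine IsModel.eq ((isModel_gammaRho x).mul ((isModel_gammaRho (x - 1)).mul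
    ((isModel_gammaRho (x - 2)).mul (isModel_gammaRho (x - 3))))) ?_
  have h := isModel_shift (-4) 1
  convert h using 1
  revert x; decide

/-- Each vertex contributes four descending letters, whose product is the central element `λ_d^{-4}
λ_w`. The contributions of the branches in between are central as well and can be moved out. -/
theorem gammaWord_walk (t : PlaneTree) (x : ZMod 4) :
    gammaWord (t.walk x) = shift (-4 * t.size) t.size := by
  induction t generalizing x with
  | leaf => simp [PlaneTree.walk, gammaWord, PlaneTree.size]
  | node t₁ t₂ t₃ h₁ h₂ h₃ =>
    rw [walk_node]
    simp only [gammaWord, gammaWord_append, h₁, h₂, h₃, mul_one, PlaneTree.size]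
    have e : ∀ (g : Gam) (a b : ℤ) (h : Gam), g * (shift a b * h) = shift a b * (g * h) :=
      fun g a b h => by rw [← mul_assoc, ← shift_comm, mul_assoc]
    rw [e, e, e]
    simp only [e, gamma_four, shift_mul]
    congr 1 <;> push_cast <;> ring

theorem gamma_lettersB {x : BasisElt} {i : ZMod 4} {n : ℕ} (h : x.2 = .reeb i n) :
    gamma x = shift (-2 * x.1) x.1 * gammaWord (lettersB x) := by
  obtain ⟨m, b⟩ := x
  simp only at h
  subst h
  rw [gamma_eq, lettersB, gammaWord_lets]

theorem gam_eq_gammaWord {l : List BasisElt} (hl : Pure l) :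
    gam l = shift (-2 * powerU l) (powerU l) * gammaWord (word l) := by
  have key : ∀ l : List BasisElt, gammaWord (tailWord l) = gammaWord (word l) := by
    intro l
    cases l <;> rfl
  induction l with
  | nil => simp [powerU, word, gammaWord]
  | cons b l ih =>
    obtain ⟨i, n, hb⟩ := hl b (by simp)
    rw [gam_cons, gamma_lettersB hb, ih fun b hb => hl b (List.mem_cons_of_mem _ hb), word_cons,
      gammaWord_append, key, powerU_cons, mul_assoc, ← mul_assoc (gammaWord (lettersB b)),
      ← shift_comm, mul_assoc, ← mul_assoc, shift_mul]
    congr 2 <;> push_cast <;> ring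

theorem gammaWord_recognized {w : List (Option (ZMod 4))} {d : ℕ} {o : Basic}
    (h : Recognized w d o) : gammaWord w = shift (-4 * d) d * gammaBasic o := by
  cases h with
  | right a k t ht =>
    rw [gammaWord_append, gammaWord_walk, shift_comm]
    congr 1
    cases k with
    | zero => rfl
    | succ k => exact gammaWord_lets a k
  | left a k t ht => rw [gammaWord_append, gammaWord_walk, gammaWord_lets]

theorem gam_of_high_ne_zero {l : List BasisElt} {x : BasisElt} (hx : high l x ≠ 0) :
    gam [x] = shift ((l.length : ℤ) - 1 + -1) 0 * gam l := by
  obtain ⟨h1, d, o, h2, rfl⟩ := exists_of_high_ne_zero hx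
  rw [gam_eq_gammaWord h1, gammaWord_recognized h2, gam_singleton, gamma_eq,
    (length_of_recognized h2).1, ← mul_assoc, ← mul_assoc, shift_mul, shift_mul]
  congr 2 <;> push_cast <;> ring

/-- There are 2d + 2 ≥ 4 inputs and the weight is zero, hence order at least 3. The path condition
comes from the rule for the labels along the walk. -/
theorem adm_high : Adm (-1) 0 3 high := by
  intro l x hx
  obtain ⟨h1, d, o, h2, rfl⟩ := exists_of_high_ne_zero hx
  obtain ⟨h3, h4⟩ := length_of_recognized h2
  refine ⟨fun j hj => ?_, ?_, ?_, 0, le_rfl, ?_, ?_⟩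
  · obtain ⟨i, n, h⟩ := h1 _ hj
    simp at h
  · intro j j' hp
    obtain ⟨a, b, h5, h6, h7⟩ := recognized_run h2
    have := run_word h1 (by rintro rfl; simp at h3) h5
    rw [← h6, ← h7] at this
    rw [← hp.1, ← hp.2]
    exact this
  · rw [h3]; simp [Int.even_add]
  · rw [h3]; push_cast [List.length_singleton]; linarith
  · exact_mod_cast gam_of_high_ne_zero hx

/-- The undeformed operations are linear with respect to `U`. -/
theorem high_mulU (p : List BasisElt) (m : ℕ) (b : BasisElt) (s : List BasisElt) :
    high (p ++ (m + b.1, b.2) :: s) = mulU m (high (p ++ b :: s)) := by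
  have hw : word (p ++ (m + b.1, b.2) :: s) = word (p ++ b :: s) := by
    have hb : lettersB (m + b.1, b.2) = lettersB b := by
      rcases b with ⟨m, j | ⟨i, n⟩⟩ <;> rfl
    induction p with
    | nil => rw [List.nil_append, List.nil_append, word_cons, word_cons, hb]
    | cons a p ih =>
      rw [List.cons_append, List.cons_append, word_cons, word_cons]
      cases p with
      | nil => rw [List.nil_append, List.nil_append] at ih ⊢; rw [tailWord, tailWord, ih]
      | cons c p => rw [List.cons_append, List.cons_append] at ih ⊢; rw [tailWord, tailWord, ih]
  have hp : Pure (p ++ (m + b.1, b.2) :: s) ↔ Pure (p ++ b :: s) := by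
    simp only [Pure, List.mem_append, List.mem_cons, or_imp, forall_and, forall_eq]
  have hU : powerU (p ++ (m + b.1, b.2) :: s) = m + powerU (p ++ b :: s) := by
    simp [powerU]; omega
  by_cases h : Pure (p ++ b :: s) ∧ ∃ d o, Recognized (word (p ++ b :: s)) d o
  · obtain ⟨h1, d, o, h2⟩ := h
    rw [high_of_recognized h1 h2, high_of_recognized (hp.2 h1) (hw ▸ h2), mulU_bas, hU, add_assoc]
  · have h1 : high (p ++ b :: s) = 0 := by
      ext x
      by_contra hx
      obtain ⟨h1, d, o, h2, -⟩ := exists_of_high_ne_zero hx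
      exact h ⟨h1, d, o, h2⟩
    rw [h1, map_zero]
    ext x
    by_contra hx
    obtain ⟨h1, d, o, h2, -⟩ := exists_of_high_ne_zero hx
    exact h ⟨hp.1 h1, d, o, hw ▸ h2⟩

theorem high_idem (p : List BasisElt) (m : ℕ) (j : Fin 2) (s : List BasisElt) :
    high (p ++ (m, .idem j) :: s) = 0 := by
  ext x
  by_contra hx
  obtain ⟨h1, -⟩ := exists_of_high_ne_zero hx
  obtain ⟨i, n, h⟩ := h1 (m, .idem j) (by simp)
  simp at h

end Undeformed

end TorusAlgebra

namespace TorusAlgebra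

open BarConstruction

noncomputable section UndeformedRelation

/-! ### The relations of the undeformed algebra -/

/-- The word of `chain x k`, followed by `none` if it is not empty. -/
def pre : ZMod 4 → ℕ → List (Option (ZMod 4))
  | _, 0 => []
  | x, k + 1 => some x :: none :: pre (x - 1) k

theorem word_chain_append (x : ZMod 4) (k : ℕ) (b : BasisElt) (r : List BasisElt) :
    word (chain x k ++ b :: r) = pre x k ++ word (b :: r) := by
  induction k generalizing x with
  | zero => rfl
  | succ k ih =>
    rw [chain, List.cons_append, word_cons, pre]
    have : tailWord (chain (x - 1) k ++ b :: r) = none :: word (chain (x - 1) k ++ b :: r) := by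
      cases h : chain (x - 1) k ++ b :: r with
      | nil => simp at h
      | cons c l => rfl
    rw [this, ih]
    rfl

theorem pre_succ (x : ZMod 4) (k : ℕ) (w : List (Option (ZMod 4))) :
    pre x (k + 1) ++ w = pre x k ++ some (x - k) :: none :: w := by
  induction k generalizing x with
  | zero => simp [pre]
  | succ k ih =>
    rw [pre, List.cons_append, List.cons_append, ih, pre]
    have : x - 1 - (k : ZMod 4) = x - ((k + 1 : ℕ) : ZMod 4) := by push_cast; ring
    rw [this]
    rfl

theorem Recognized.cases_tree {w : List (Option (ZMod 4))} {d : ℕ} {o : Basic}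
    (h : Recognized w d o) :
    (∃ a t R, IsNode t ∧ w = t.walk a ++ R ∧ d = t.size ∧
      (∀ t', IsNode t' → Recognized (t'.walk a ++ R) t'.size o) ∧
      (R = [] ∨ ∃ k, R = lets (a - 2) (k + 1) ∧ o = .reeb (a - 2) k)) ∨
    ∃ a k t, IsNode t ∧ w = some a :: (lets (a + 1) k ++ t.walk (a + 1 + k)) ∧ d = t.size ∧
      o = .reeb a k := by
  cases h with
  | right a k t ht =>
    cases k with
    | zero =>
      refine Or.inl ⟨a, t, [], ht, by simp [lets], rfl, fun t' ht' => ?_, Or.inl rfl⟩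
      have := Recognized.right a 0 t' ht'
      simpa [lets] using this
    | succ k =>
      refine Or.inr ⟨a, k, t, ht, ?_, rfl, rfl⟩
      have : a + ((k + 1 : ℕ) : ZMod 4) = a + 1 + k := by push_cast; ring
      rw [this]; rfl
  | left a k t ht =>
    exact Or.inl ⟨a, t, _, ht, rfl, rfl, fun t' ht' => Recognized.left a k t' ht',
      Or.inr ⟨k, rfl, rfl⟩⟩

/-- The label `x - j` sits in the sector after the first `j` branches of the lowest vertex, which
are leaves. What follows is the next branch, which may be exchanged for any tree, or, after the last
sector, an extension to the left. For `j = 0` the label may also belong to an extension to the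
right. -/
theorem recognized_cases {x : ZMod 4} {j : ℕ} {w : List (Option (ZMod 4))} {d : ℕ} {o : Basic}
    (hw : w ≠ []) (h : Recognized (pre x j ++ some (x - j) :: w) d o) :
    (∃ (t : PlaneTree) (rest : List (Option (ZMod 4))), w = t.walk (x - j + 1) ++ some (x - j - 1) :: rest ∧
      ∀ t' : PlaneTree, ∃ d', d' + t.size = d + t'.size ∧ Recognized (pre x j ++ some (x - j) ::
        (t'.walk (x - j + 1) ++ some (x - j - 1) :: rest)) d' o) ∨
    (j = 3 ∧ d = 1 ∧ ∃ k, w = lets (x - j + 1) (k + 1) ∧ o = .reeb (x - j + 1) k) ∨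
    (j = 0 ∧ ∃ k t, IsNode t ∧ w = lets (x - j + 1) k ++ t.walk (x - j + 1 + k) ∧ d = t.size ∧
      o = .reeb (x - j) k) := by
  rcases h.cases_tree with ⟨a, t, R, ht, hw', rfl, hR, hR'⟩ | ⟨a, k, t, ht, hw', rfl, rfl⟩
  · obtain ⟨t₁, t₂, t₃, rfl⟩ := ht.exists_eq
    rw [walk_node] at hw'
    have hx : a = x := by
      cases j <;> simp only [pre, List.nil_append, List.cons_append, List.cons.injEq,
        Option.some.injEq] at hw'
      · simpa using hw'.1.symm
      · exact hw'.1.symm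
    subst hx
    -- The number `j` of leaves already met tells which sector of the lowest vertex has been
    -- reached; there are only four.
    rcases j with _ | _ | _ | _ | j
    · refine Or.inl ⟨t₁, t₂.walk a ++ some (a - 2) :: (t₃.walk (a - 1) ++ some (a - 3) :: R), ?_,
        fun t' : PlaneTree => ⟨t'.size + t₂.size + t₃.size + 1, by simp [PlaneTree.size]; omega, ?_⟩⟩
      · simpa [pre] using hw'
      · have := hR (.node t' t₂ t₃) (isNode_node _ _ _)
        simpa [pre, walk_node, PlaneTree.size] using this
    · cases t₁ with
      | node => simp [pre, walk_node] at hw'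
      | leaf =>
      refine Or.inl ⟨t₂, t₃.walk (a - 1) ++ some (a - 3) :: R, ?_,
        fun t' : PlaneTree => ⟨t'.size + t₃.size + 1, by simp [PlaneTree.size]; omega, ?_⟩⟩
      · have e : a - 1 - 1 = a - 2 := by ring
        simpa [pre, PlaneTree.walk, e] using hw'
      · have := hR (.node .leaf t' t₃) (isNode_node _ _ _)
        have e : a - 1 - 1 = a - 2 := by ring
        simpa [pre, walk_node, PlaneTree.size, PlaneTree.walk, e] using this
    · cases t₁ with
      | node => simp [pre, walk_node] at hw'
      | leaf =>
      cases t₂ with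
      | node => simp [pre, PlaneTree.walk] at hw'
      | leaf =>
      have e : a - (1 + 1) = a - 2 := by ring
      have e1 : a - 2 + 1 = a - 1 := by ring
      have e2 : a - 2 - 1 = a - 3 := by ring
      refine Or.inl ⟨t₃, R, ?_,
        fun t' : PlaneTree => ⟨t'.size + 1, by simp [PlaneTree.size]; omega, ?_⟩⟩
      · simpa [pre, PlaneTree.walk, e, e1, e2] using hw'
      · have := hR (.node .leaf .leaf t') (isNode_node _ _ _)
        simpa [pre, walk_node, PlaneTree.size, PlaneTree.walk, e, e1, e2] using this
    · cases t₁ with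
      | node => simp [pre, walk_node] at hw'
      | leaf =>
      cases t₂ with
      | node => simp [pre, PlaneTree.walk] at hw'
      | leaf =>
      cases t₃ with
      | node => simp [pre, PlaneTree.walk] at hw'
      | leaf =>
      have e : a - 3 + 1 = a - 2 := by ring
      have hwR : w = R := by
        simp only [pre, PlaneTree.walk, List.cons_append, List.nil_append, List.cons.injEq] at hw'
        exact hw'.2.2.2.2.2.2.2
      rcases hR' with hR' | ⟨k, hk, ho⟩
      · exact absurd (hwR.trans hR') hw
      · refine Or.inr (Or.inl ⟨rfl, rfl, k, ?_, ?_⟩)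
        · push_cast; rw [e, hwR, hk]
        · push_cast; rw [e, ho]
    · exfalso
      cases t₁ with
      | node => simp [pre, walk_node] at hw'
      | leaf =>
      cases t₂ with
      | node => simp [pre, PlaneTree.walk] at hw'
      | leaf =>
      cases t₃ with
      | node => simp [pre, PlaneTree.walk] at hw'
      | leaf =>
      rcases hR' with rfl | ⟨k, rfl, -⟩ <;> simp [pre, PlaneTree.walk, lets] at hw'
  · rcases j with _ | j
    · refine Or.inr (Or.inr ⟨rfl, k, t, ht, ?_, rfl, ?_⟩)
      · simp only [pre, List.nil_append, List.cons.injEq, Option.some.injEq] at hw'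
        rw [hw'.2, hw'.1]
      · simp only [pre, List.nil_append, List.cons.injEq, Option.some.injEq] at hw'
        rw [hw'.1]
    · exfalso
      obtain ⟨t₁, t₂, t₃, rfl⟩ := ht.exists_eq
      cases k <;> simp [pre, lets, walk_node] at hw'

theorem lets_append_eq {a b : ZMod 4} {n : ℕ} {w u v : List (Option (ZMod 4))}
    (h : lets a n ++ w = u ++ some b :: v) :
    (∃ k, u ++ lets b (k + 1) = lets a n ∧ some b :: v = lets b (k + 1) ++ w) ∨
      ∃ u', u = lets a n ++ u' ∧ w = u' ++ some b :: v := by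
  induction n generalizing a u with
  | zero => exact Or.inr ⟨u, rfl, h⟩
  | succ n ih =>
    rcases u with _ | ⟨c, u⟩
    · rw [lets, List.cons_append, List.nil_append, List.cons.injEq] at h
      obtain ⟨h1, rfl⟩ := h
      cases h1
      exact Or.inl ⟨n, rfl, rfl⟩
    · rw [lets, List.cons_append, List.cons_append, List.cons.injEq] at h
      obtain ⟨rfl, h⟩ := h
      rcases ih h with ⟨k, h1, h2⟩ | ⟨u', rfl, h2⟩
      · exact Or.inl ⟨k, by rw [List.cons_append, h1]; rfl, h2⟩
      · exact Or.inr ⟨u', rfl, h2⟩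

/-- A word can be cut after the chord that contains a given letter. -/
theorem exists_of_word_eq {y : BasisElt} {r : List BasisElt} {u v : List (Option (ZMod 4))}
    {b : ZMod 4} (h : word (y :: r) = u ++ some b :: v) :
    ∃ p s k, r = p ++ s ∧ some b :: v = lets b (k + 1) ++ tailWord s ∧
      word (y :: p) = u ++ lets b (k + 1) := by
  induction r generalizing y u with
  | nil =>
    rw [word_cons] at h
    rcases y with ⟨m, j | ⟨i, n⟩⟩
    · simp [lettersB, tailWord] at h
    · rcases lets_append_eq h with ⟨k, h1, h2⟩ | ⟨u', -, h2⟩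
      · exact ⟨[], [], k, rfl, h2, h1.symm⟩
      · simp [tailWord] at h2
  | cons z r ih =>
    have key : ∀ u', tailWord (z :: r) = u' ++ some b :: v → ∃ p s k, z :: r = z :: p ++ s ∧
        some b :: v = lets b (k + 1) ++ tailWord s ∧
        word (y :: z :: p) = lettersB y ++ u' ++ lets b (k + 1) := by
      intro u' h
      rcases u' with _ | ⟨c, u'⟩
      · simp [tailWord] at h
      · rw [tailWord, List.cons_append, List.cons.injEq] at h
        obtain ⟨rfl, h⟩ := h
        obtain ⟨p, s, k, rfl, h1, h2⟩ := ih h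
        refine ⟨p, s, k, rfl, h1, ?_⟩
        rw [word_cons, tailWord, h2]
        simp
    rw [word_cons] at h
    rcases y with ⟨m, j | ⟨i, n⟩⟩
    · obtain ⟨p, s, k, h1, h2, h3⟩ := key u h
      exact ⟨z :: p, s, k, h1, h2, h3⟩
    · rcases lets_append_eq h with ⟨k, h1, h2⟩ | ⟨u', rfl, h2⟩
      · exact ⟨[], z :: r, k, rfl, h2, h1.symm⟩
      · obtain ⟨p, s, k, h1, h2, h3⟩ := key u' h2
        exact ⟨z :: p, s, k, h1, h2, h3⟩

theorem word_append_tailWord (y : BasisElt) (p s : List BasisElt) :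
    word (y :: (p ++ s)) = word (y :: p) ++ tailWord s := by
  induction p generalizing y with
  | nil => rw [word_cons, word_cons]; simp [tailWord]
  | cons z p ih => rw [word_cons, List.cons_append, tailWord, ih, word_cons y (z :: p), tailWord]; simp


theorem powerU_append (p s : List BasisElt) : powerU (p ++ s) = powerU p + powerU s := by
  simp [powerU]

theorem powerU_chain (x : ZMod 4) (k : ℕ) : powerU (chain x k) = 0 := by
  induction k generalizing x with
  | zero => rfl
  | succ k ih => rw [chain, powerU_cons, ih]

theorem pure_chain (x : ZMod 4) (k : ℕ) : Pure (chain x k) := by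
  induction k generalizing x with
  | zero => intro b hb; simp [chain] at hb
  | succ k ih =>
    intro b hb
    rcases List.mem_cons.1 hb with rfl | hb
    · exact ⟨_, _, rfl⟩
    · exact ih _ b hb

theorem Pure.append {p s : List BasisElt} (hp : Pure p) (hs : Pure s) : Pure (p ++ s) :=
  fun b hb => (List.mem_append.1 hb).elim (hp b) (hs b)

theorem Pure.cons {b : BasisElt} {s : List BasisElt} (hb : ∃ i n, b.2 = .reeb i n) (hs : Pure s) :
    Pure (b :: s) := fun c hc => (List.mem_cons.1 hc).elim (fun h => h ▸ hb) (hs c)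

theorem Pure.left {p s : List BasisElt} (h : Pure (p ++ s)) : Pure p :=
  fun b hb => h b (List.mem_append_left _ hb)

theorem Pure.right {p s : List BasisElt} (h : Pure (p ++ s)) : Pure s :=
  fun b hb => h b (List.mem_append_right _ hb)

theorem high_ne_zero_iff {l : List BasisElt} (hl : Pure l) :
    high l ≠ 0 ↔ ∃ d o, Recognized (word l) d o := by
  constructor
  · intro h
    obtain ⟨x, hx⟩ := Finsupp.ne_iff.1 h
    obtain ⟨-, d, o, h, -⟩ := exists_of_high_ne_zero hx
    exact ⟨d, o, h⟩
  · rintro ⟨d, o, h⟩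
    rw [high_of_recognized hl h]
    simp [bas]

variable {m n j : ℕ} {x g : ZMod 4} {r : List BasisElt}

theorem word_chain_merge (hg : g = x - j) :
    word (chain x j ++ (m, .reeb g (n + 1)) :: r) =
      pre x j ++ some (x - j) :: word ((m, .reeb (g + 1) n) :: r) := by
  rw [word_chain_append, word_cons, word_cons, hg]
  rfl

theorem word_chain_insert (x : ZMod 4) (j m k : ℕ) (i : ZMod 4) (s : List BasisElt) :
    word (chain x (j + 1) ++ (m, .reeb i k) :: s) =
      pre x j ++ some (x - j) :: none :: (lets i (k + 1) ++ tailWord s) := by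
  rw [word_chain_append, pre_succ, word_cons]
  rfl

/-- If a chord is composed with the outer operation then the inner pattern is extended to the
left. -/
theorem exists_of_insert_ne_zero (hg : g = x - j) {p s : List BasisElt} {z : BasisElt}
    (h : lin (fun b => high (chain x (j + 1) ++ b :: s)) (high ((m, .reeb (g + 1) n) :: p)) z ≠ 0) :
    ∃ t k d o, IsNode t ∧
      word ((m, .reeb (g + 1) n) :: p) = t.walk (g + 1) ++ lets (g - 1) (k + 1) ∧
      Recognized (pre x j ++ some (x - j) :: none :: (lets (g - 1) (k + 1) ++ tailWord s)) d o := by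
  obtain ⟨y, h1, h2⟩ := exists_of_lin_ne_zero h
  obtain ⟨hp, d, o, h3, rfl⟩ := exists_of_high_ne_zero h1
  rcases h3.cases_tree with ⟨a, t, R, ht, hw, rfl, -, hR⟩ | ⟨a, k, t, ht, hw, rfl, rfl⟩
  · have ha : a = g + 1 := by
      obtain ⟨t₁, t₂, t₃, rfl⟩ := ht.exists_eq
      rw [walk_node, word_cons] at hw
      exact (Option.some.inj (List.cons.inj hw).1).symm
    rcases hR with rfl | ⟨k, rfl, rfl⟩
    · exfalso
      have ho : ∃ i, o = .idem i := by
        rw [List.append_nil] at hw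
        rw [hw] at h3
        have h4 := Recognized.right a 0 t ht
        simp only [lets, Nat.cast_zero, add_zero, List.nil_append] at h4
        obtain ⟨P, hP1, -, hP2⟩ := exists_pattern h3
        obtain ⟨Q, hQ1, -, hQ2⟩ := exists_pattern h4
        have := pattern_unique (hP1.trans hQ1.symm)
        subst this
        exact ⟨_, hP2.symm.trans hQ2⟩
      obtain ⟨i, rfl⟩ := ho
      rw [high_idem] at h2
      exact h2 rfl
    · subst ha
      have e : g + 1 - 2 = g - 1 := by ring
      rw [e] at h2 hw
      obtain ⟨-, d, o, h4, -⟩ := exists_of_high_ne_zero h2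
      rw [word_chain_insert] at h4
      exact ⟨t, k, d, o, ht, hw, h4⟩
  · exfalso
    have ha : a = g + 1 := by
      rw [word_cons] at hw
      exact (Option.some.inj (List.cons.inj hw).1).symm
    subst ha
    have hc : chain x (j + 1) = chain x j ++ [(0, .reeb g 0)] := by
      rw [hg]
      clear * -
      induction j generalizing x with
      | zero => simp [chain]
      | succ j ih =>
        have e : x - ((j + 1 : ℕ) : ZMod 4) = x - 1 - j := by push_cast; ring
        rw [chain, ih, chain, e]
        rfl
    rw [hc, List.append_assoc, List.singleton_append, high_junction] at h2
    · exact h2 rfl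
    · have := zmod_four_ne (g - 1)
      rw [sub_add_cancel] at this
      simpa using this.symm

/-- A pattern extended to the left has an output starting with `ρ_{g-1}`, which `ρ_g` annihilates.
The pattern is therefore centered or extended to the right. -/
theorem exists_of_lmul_ne_zero {z : BasisElt}
    (h : lmul (0, .reeb g 0) (high ((m, .reeb (g + 1) n) :: r)) z ≠ 0) :
    ∃ k t, IsNode t ∧ word ((m, .reeb (g + 1) n) :: r) = lets (g + 1) k ++ t.walk (g + 1 + k) := by
  obtain ⟨b, h1, h2⟩ := exists_of_lin_ne_zero h
  obtain ⟨-, d, o, h3, rfl⟩ := exists_of_high_ne_zero h1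
  rcases h3.cases_tree with ⟨a, t, R, ht, hw, rfl, -, hR⟩ | ⟨a, k, t, ht, hw, rfl, rfl⟩
  · have ha : a = g + 1 := by
      obtain ⟨t₁, t₂, t₃, rfl⟩ := ht.exists_eq
      rw [walk_node, word_cons] at hw
      exact (Option.some.inj (List.cons.inj hw).1).symm
    subst ha
    rcases hR with rfl | ⟨k, rfl, rfl⟩
    · exact ⟨0, t, ht, by simpa [lets] using hw⟩
    · exfalso
      rw [mulV_of_mul_none] at h2
      · exact h2 rfl
      · rw [Basic.reeb_mul_reeb, if_neg]
        have := zmod_four_ne (g - 1)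
        rw [sub_add_cancel] at this
        rw [show g + 1 - 2 = g - 1 by ring]
        simpa using this
  · have ha : a = g + 1 := by
      rw [word_cons] at hw
      exact (Option.some.inj (List.cons.inj hw).1).symm
    subst ha
    refine ⟨k + 1, t, ht, ?_⟩
    rw [hw, lets]
    have : g + 1 + ((k + 1 : ℕ) : ZMod 4) = g + 1 + 1 + k := by push_cast; ring
    rw [this]
    rfl

/-- Splitting the letter `ρ_g` off a chord cuts the pattern at the corresponding sector. If a
nontrivial branch follows, it becomes an inner pattern extended to the left, with a leaf in its
place outside. If the letter belongs to an extension to the right, it multiplies the output of a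
shorter pattern. If the sector is the last one of a tree with a single vertex, only the chord of the
left extension remains, times `U`. -/
theorem high_merge (hr : Pure r) (hg : g = x - j) :
    high (chain x j ++ (m, .reeb g (n + 1)) :: r) =
      (splitSum r fun p s => lin (fun b => high (chain x (j + 1) ++ b :: s))
        (high ((m, .reeb (g + 1) n) :: p))) +
      (if j = 0 then lmul (0, .reeb g 0) (high ((m, .reeb (g + 1) n) :: r)) else 0) +
      (if j = 3 ∧ r = [] then bas (m + 1, .reeb (g + 1) n) else 0) := by
  set y : BasisElt := (m, .reeb (g + 1) n) with hy
  have hyp : ∀ p, Pure p → Pure (y :: p) := fun p hp => hp.cons ⟨_, _, rfl⟩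
  have hL : Pure (chain x j ++ (m, .reeb g (n + 1)) :: r) :=
    (pure_chain _ _).append (hr.cons ⟨_, _, rfl⟩)
  have hw0 : word (y :: r) ≠ [] := by rw [word_cons]; simp [y, lettersB, lets]
  have hcount : ∀ p, (word (y :: p)).count none = p.length := fun p => count_none_word y p
  have hwalk : ∀ t : PlaneTree, IsNode t → ∀ w, (t.walk (g + 1) ++ w).count none ≠ 0 := by
    intro t ht w
    rw [List.count_append, count_none_walk]; omega
  by_cases h : ∃ d o, Recognized (word (chain x j ++ (m, .reeb g (n + 1)) :: r)) d o
  · obtain ⟨d, o, h⟩ := h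
    rw [high_of_recognized hL h, powerU_append, powerU_chain, powerU_cons, zero_add]
    rw [word_chain_merge hg] at h
    have hsum : (¬ ∃ t rest, IsNode t ∧ word (y :: r) = t.walk (g + 1) ++ some (g - 1) :: rest) →
        (splitSum r fun p s => lin (fun b => high (chain x (j + 1) ++ b :: s))
          (high (y :: p))) = 0 := by
      intro hne
      refine splitSum_eq_zero fun p s hps => ?_
      ext z
      by_contra hz
      obtain ⟨t, k, d, o, ht, h1, -⟩ := exists_of_insert_ne_zero hg hz
      refine hne ⟨t, lets (g - 1 + 1) k ++ tailWord s, ht, ?_⟩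
      rw [← hps, word_append_tailWord, h1]
      simp [lets]
    rcases recognized_cases hw0 h with ⟨t, rest, h1, h2⟩ | ⟨rfl, rfl, k, h1, rfl⟩ |
      ⟨rfl, k, t, ht, h1, rfl, rfl⟩
    · rw [← hg] at h1 h2
      have ht : IsNode t := by
        rintro rfl
        rw [word_cons] at h1
        simp [y, lettersB, lets, PlaneTree.walk] at h1
      obtain ⟨p, s, k, rfl, h3, h4⟩ := exists_of_word_eq h1
      have e : g + 1 - 2 = g - 1 := by ring
      have h5 : Recognized (word (y :: p)) t.size (.reeb (g - 1) k) := by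
        rw [h4]
        have := Recognized.left (g + 1) k t ht
        rwa [e] at this
      -- Cut the branch off: the outer pattern has a leaf in its place.
      obtain ⟨d', h6, h7⟩ := h2 .leaf
      rw [PlaneTree.walk, List.singleton_append, h3, hg, ← word_chain_insert x j
        (m + powerU p + t.size), ← hg] at h7
      have h8 : (if j = 0 then lmul (0, .reeb g 0) (high (y :: (p ++ s))) else 0) = 0 := by
        split_ifs
        · ext z
          by_contra hz
          obtain ⟨k', t', ht', h8⟩ := exists_of_lmul_ne_zero hz
          exact walk_conflict ht ht' (g + 1) k' _ (Or.inl (by simp)) (h1.symm.trans h8)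
        · rfl
      rw [h8, splitSum_eq_single p s rfl, high_of_recognized (hyp p hr.left) h5, lin_bas,
        powerU_cons, high_of_recognized _ h7, powerU_append p, powerU_append (chain _ _),
        powerU_chain, powerU_cons, if_neg, add_zero, add_zero, zero_add]
      · congr 2
        simp only [PlaneTree.size, add_zero] at h6
        omega
      · rintro ⟨-, h8⟩
        have h9 := hcount (p ++ s)
        rw [h1, h8] at h9
        exact hwalk t ht _ h9
      · exact (pure_chain _ _).append (hr.right.cons ⟨_, _, rfl⟩)
      · intro p' s' hps hne
        ext z
        by_contra hz
        obtain ⟨t', k', d, o, ht', h9, -⟩ := exists_of_insert_ne_zero hg hz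
        have h10 := word_append_tailWord y p' s'
        rw [hps, h1, h9, List.append_assoc] at h10
        obtain ⟨rfl, -⟩ := PlaneTree.walk_injective _ _ _ _ _ h10
        have h11 := hcount p
        have h12 := hcount p'
        rw [h4, List.count_append, count_none_lets] at h11
        rw [h9, List.count_append, count_none_lets] at h12
        exact hne (List.append_inj hps (by omega)).1
    · have hr0 : r = [] := by
        have := hcount r
        rw [h1, count_none_lets] at this
        exact List.length_eq_zero_iff.1 this.symm
      subst hr0
      rw [hsum, if_neg (by omega), if_pos ⟨rfl, rfl⟩]
      · have : k = n := by
          have := congrArg List.length h1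
          simpa [y, word, lettersB, lets_eq_map] using this.symm
        subst this
        simp [hg, powerU]
      · rintro ⟨t, rest, ht, h2⟩
        have := hcount []
        rw [h2] at this
        exact hwalk t ht _ this
    · rw [hsum, if_pos rfl, if_neg (by omega)]
      · rw [← hg] at h1 ⊢
        have h2 : Recognized (word (y :: r)) t.size (outR (g + 1) k) := by
          rw [h1]; exact Recognized.right _ _ _ ht
        rw [high_of_recognized (hyp r hr) h2, lmul, lin_bas, powerU_cons, mulV_of_mul (b := .reeb g k)]
        · simp [y]
        · cases k with
          | zero => exact (Basic.mul_idem (.reeb g 0) _).trans (if_pos (by simp [Basic.right]))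
          | succ k => rw [outR, Basic.reeb_mul_reeb]; simp
      · rintro ⟨t', rest, ht', h2⟩
        rw [← hg] at h1
        exact walk_conflict ht' ht (g + 1) k _ (Or.inl (by simp)) (h2.symm.trans h1)
  · have h0 : high (chain x j ++ (m, .reeb g (n + 1)) :: r) = 0 := by
      by_contra h0
      exact h ((high_ne_zero_iff hL).1 h0)
    rw [word_chain_merge hg] at h
    have h1 : (if j = 0 then lmul (0, .reeb g 0) (high (y :: r)) else 0) = 0 := by
      split_ifs with hj
      · ext z
        by_contra hz
        obtain ⟨k, t, ht, h1⟩ := exists_of_lmul_ne_zero hz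
        subst hj
        refine h ⟨t.size, outR g (k + 1), ?_⟩
        rw [h1, ← hg]
        have := Recognized.right g (k + 1) t ht
        have e : g + ((k + 1 : ℕ) : ZMod 4) = g + 1 + k := by push_cast; ring
        rwa [e] at this
      · rfl
    rw [h0, h1, splitSum_eq_zero, if_neg, add_zero, add_zero]
    · rintro ⟨rfl, rfl⟩
      refine h ⟨1, .reeb (x - 2) n, ?_⟩
      have := Recognized.left x n (.node .leaf .leaf .leaf) (isNode_node _ _ _)
      have e : g + 1 = x - 2 := by rw [hg]; push_cast; ring
      have e1 : x - 1 - 1 = x - 2 := by ring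
      simpa [pre, walk_node, PlaneTree.walk, PlaneTree.size, word, lettersB, e, e1] using this
    · intro p s hps
      ext z
      by_contra hz
      obtain ⟨t, k, d, o, ht, h2, h3⟩ := exists_of_insert_ne_zero hg hz
      rcases recognized_cases (by simp) h3 with ⟨t', rest, h4, h5⟩ | ⟨-, -, k', h4, -⟩ |
        ⟨-, k', t', ht', h4, -⟩
      · have ht' : t' = .leaf := by
          cases t' with
          | leaf => rfl
          | node => simp [walk_node] at h4
        subst ht'
        -- Conversely, gluing the inner tree onto the leaf gives a pattern for the merged list.
        obtain ⟨d', -, h6⟩ := h5 t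
        refine h ⟨d', o, ?_⟩
        rw [PlaneTree.walk, List.singleton_append, List.cons.injEq] at h4
        rw [← h4.2, ← hg, ← List.append_assoc, ← h2, ← word_append_tailWord, hps] at h6
        rw [← hg]
        exact h6
      · simp [lets] at h4
      · obtain ⟨w, hw⟩ := lets_walk_head ht' (x - j + 1) k'
        rw [hw] at h4
        simp at h4

end UndeformedRelation

end TorusAlgebra

/-! ### The A∞-relations of the undeformed algebra -/

namespace TorusAlgebra

open BarConstruction

noncomputable section UndeformedSquare

theorem und_of_length {l : List BasisElt} (h : l.length ≠ 2) : und l = high l := by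
  rw [und_eq, mu2_of_length h, zero_add]

theorem und_pair (x y : BasisElt) : und [x, y] = mulV x y := by
  rw [und_eq, high_of_length (by simp), add_zero]
  rfl

theorem und_idem (p : List BasisElt) (m : ℕ) (a : Fin 2) (s : List BasisElt)
    (h : p.length + s.length ≠ 1) : und (p ++ (m, .idem a) :: s) = 0 := by
  rw [und_of_length (by simp; omega), high_idem]

theorem und_junction (p s : List BasisElt) (m m' : ℕ) (i : ZMod 4) (n n' : ℕ)
    (h : p ≠ [] ∨ s ≠ []) : und (p ++ (m, .reeb i n) :: (m', .reeb (i + n + 1) n') :: s) = 0 := by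
  rw [und_of_length, high_junction]
  · have := zmod_four_ne (i + n - 1)
    rw [sub_add_cancel] at this
    exact this.symm
  · have : p.length ≠ 0 ∨ s.length ≠ 0 := by simpa using h
    simp; omega

theorem und_odd (l : List BasisElt) (h : Odd l.length) : und l = 0 := by
  rw [und_eq, mu2_odd l h, zero_add]
  exact adm_high.gr.odd h

theorem und_nil : und [] = 0 := by rw [und_of_length (by simp), high_of_length (by simp)]

theorem pre_eq_word (x : ZMod 4) (k : ℕ) : word (chain x (k + 1)) = pre x k ++ [some (x - k)] := by
  have : chain x (k + 1) = chain x k ++ [(0, .reeb (x - k) 0)] := by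
    have h := chain_eq_append (p := (chain x (k + 1)).take k) (s := (chain x (k + 1)).drop k)
      (i := x) (k := k + 1) (by simp)
    rw [← List.take_append_drop k (chain x (k + 1)), h.1, h.2]
    simp [length_chain, chain]
  rw [this, word_chain_append]
  rfl

theorem recognized_chain_four (x : ZMod 4) :
    Recognized (word (chain x 4)) 1 (.idem (source x)) := by
  have := Recognized.right x 0 (.node .leaf .leaf .leaf) (isNode_node _ _ _)
  have e : x - 1 - 1 = x - 2 := by ring
  have e1 : x - 2 - 1 = x - 3 := by ring
  simpa [walk_node, PlaneTree.walk, lets, outR, PlaneTree.size, pre_eq_word, pre, e, e1] using this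

/-- By `chain_grading` a pattern with d vertices read along a chain has k = 4d. As k = 2d + 2 as
well, d = 1. -/
theorem high_chain (x : ZMod 4) (k : ℕ) :
    high (chain x k) = if k = 4 then bas (1, .idem (source x)) else 0 := by
  split_ifs with hk
  · rw [hk, high_of_recognized (pure_chain x 4) (recognized_chain_four x), powerU_chain]
  · ext z
    by_contra hz
    obtain ⟨h1, d, o, h2, -⟩ := exists_of_high_ne_zero hz
    obtain ⟨h3, h4⟩ := length_of_recognized h2
    rw [length_chain] at h3
    have h5 := gam_eq_gammaWord h1
    rw [powerU_chain, gammaWord_recognized h2] at h5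
    obtain ⟨a, b, h6, h7, -⟩ := recognized_run h2
    obtain ⟨p, q, h8, h9⟩ := chain_grading (b := o) (i := x) (n := k) (A := 4 * d) (B := -d)
      (by rw [h5]; simp only [← mul_assoc, shift_mul]; simp [shift_zero])
      (fun h0 => by
        obtain ⟨n, rfl⟩ := Nat.exists_eq_succ_of_ne_zero h0
        rw [Nat.succ_eq_add_one, pre_eq_word] at h6
        have : x = a := by
          cases n with
          | zero => simpa [pre, Run] using h6.1
          | succ n => simpa [pre] using h6.1
        rw [this, h7])
    omega

theorem und_chain (x : ZMod 4) (k : ℕ) :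
    und (chain x k) = if k = 4 then bas (1, .idem (source x)) else 0 := by
  have : mu2 (chain x k) = 0 := by rw [← proj_coder mu2, coder_mu2_chain, map_zero]
  rw [und_eq, this, zero_add, high_chain]

theorem lin_applyPrefix {N : Type*} [AddCommGroup N] (Φ : List BasisElt → N)
    (c : List BasisElt → Vec BasisElt) (l : List BasisElt) :
    lin Φ (applyPrefix c l) = splitSum l fun p s => lin (fun b => Φ (b :: s)) (c p) := by
  simp only [applyPrefix, map_splitSum, cns_bas_right, map_lin, lin_bas]

theorem lin_coder_cons {N : Type*} [AddCommGroup N] (Φ : List BasisElt → N)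
    (c : List BasisElt → Vec BasisElt) (b : BasisElt) (l : List BasisElt) :
    lin Φ (coder c (b :: l)) = lin Φ (applyPrefix c (b :: l)) -
      lin (fun t => Φ (b :: t)) (coder c l) := by
  rw [coder_cons, map_sub, cns_bas_left, map_lin]
  simp only [lin_bas]

variable {m n : ℕ} {x : ZMod 4} {r : List BasisElt}

theorem chain_succ (x : ZMod 4) (k : ℕ) :
    chain x (k + 1) = chain x k ++ [(0, .reeb (x - k) 0)] := by
  have h := chain_eq_append (p := (chain x (k + 1)).take k) (s := (chain x (k + 1)).drop k)
    (i := x) (k := k + 1) (by simp)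
  rw [← List.take_append_drop k (chain x (k + 1)), h.1, h.2]
  simp [length_chain, chain]

theorem und_chain_append (k : ℕ) (g : ZMod 4) (hg : g = x - k) (p : List BasisElt)
    (h : k ≠ 0 ∨ p ≠ []) : und (chain x (k + 1) ++ (m, .reeb (g + 1) n) :: p) = 0 := by
  subst hg
  rw [chain_succ, List.append_assoc, List.singleton_append]
  have := und_junction (chain x k) p 0 m (x - k) 0 n (by
    rcases h with h | h
    · left
      rw [← List.length_pos_iff_ne_nil, length_chain]; omega
    · exact Or.inr h)
  simpa using this

/-- On an initial segment inside the chain only four letters give a nonzero value, and `hΦ` removes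
that term. A segment crossing the junction contains `ρ_g` followed by `ρ_{g+1}`, which no tiling
pattern allows, so only the product of these two entries remains. -/
theorem lin_applyPrefix_chain {N : Type*} [AddCommGroup N] (Φ : List BasisElt → N) (k : ℕ)
    (g : ZMod 4) (hg : g = x - k)
    (hΦ : ∀ a, 3 ≤ k → Φ ((1, .idem a) :: (chain (x - 4) (k - 3) ++ (m, .reeb (g + 1) n) :: r)) = 0) :
    lin Φ (applyPrefix und (chain x (k + 1) ++ (m, .reeb (g + 1) n) :: r)) =
      if k = 0 then Φ ((m, .reeb g (n + 1)) :: r) else 0 := by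
  rw [lin_applyPrefix]
  have key : ∀ p s, p ++ s = chain x (k + 1) ++ (m, .reeb (g + 1) n) :: r →
      (k ≠ 0 ∨ p ≠ [(0, .reeb g 0), (m, .reeb (g + 1) n)]) →
      lin (fun b => Φ (b :: s)) (und p) = 0 := by
    intro p s hps hk
    rcases List.append_eq_append_iff.1 hps with ⟨c, h1, h2⟩ | ⟨c, h1, h2⟩
    · obtain ⟨h3, h4⟩ := chain_eq_append h1.symm
      rw [h3, und_chain]
      split_ifs with h5
      · have h6 := congrArg List.length h1
        rw [length_chain, List.length_append, h5] at h6
        rw [lin_bas, h2, h4, h5, show c.length = k - 3 by omega]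
        exact hΦ _ (by omega)
      · exact map_zero _
    · rcases c with _ | ⟨c, p'⟩
      · rw [List.append_nil] at h1
        rw [h1, und_chain]
        split_ifs with h5
        · rw [lin_bas]
          obtain rfl : k = 3 := by omega
          rw [List.nil_append] at h2
          rw [← h2]
          exact hΦ _ le_rfl
        · exact map_zero _
      · rw [List.cons_append, List.cons.injEq] at h2
        rw [h1, ← h2.1, und_chain_append k g hg, map_zero]
        by_contra h5
        simp only [not_or, not_not] at h5
        refine hk.elim (fun h => h h5.1) fun h => h ?_
        rw [h1, h5.1, h5.2, ← h2.1, hg, h5.1]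
        simp [chain]
  split_ifs with hk
  · subst hk
    rw [splitSum_eq_single [(0, .reeb g 0), (m, .reeb (g + 1) n)] r (by simp [chain, hg])]
    · rw [und_pair, mulV_of_mul (b := .reeb g (n + 1)), lin_bas]
      · simp
      · simp [Basic.reeb_mul_reeb]
    · exact fun p s h h' => key p s h (Or.inr h')
  · exact splitSum_eq_zero fun p s h => key p s h (Or.inl hk)

/-- Removing the letters of the chain one at a time gives the sign. Only the product at the junction
and the operations behind the chain survive. -/
theorem lin_coder_chain {N : Type*} [AddCommGroup N] (Φ : List BasisElt → N) (k : ℕ)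
    (g : ZMod 4) (hg : g = x - k)
    (hΦ : ∀ a p q, Φ (p ++ (1, .idem a) :: (q ++ (m, .reeb (g + 1) n) :: r)) = 0) :
    lin Φ (coder und (chain x (k + 1) ++ (m, .reeb (g + 1) n) :: r)) =
      (-1 : ℤ) ^ k • (Φ (chain x k ++ (m, .reeb g (n + 1)) :: r) -
        lin (fun t => Φ (chain x (k + 1) ++ t)) (coder und ((m, .reeb (g + 1) n) :: r))) := by
  induction k generalizing x Φ with
  | zero =>
    have h := lin_applyPrefix_chain Φ 0 g hg (fun a h => absurd h (by omega)) (m := m) (n := n) (r := r)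
    simp only [chain, List.cons_append, List.nil_append] at h ⊢
    rw [lin_coder_cons, h]
    simp
  | succ k ih =>
    have h := lin_applyPrefix_chain Φ (k + 1) g hg (fun a h => hΦ a [] _) (m := m) (n := n) (r := r)
    have h1 := ih (x := x - 1) (fun t => Φ ((0, .reeb x 0) :: t)) (by rw [hg]; push_cast; ring)
      fun a p q => hΦ a (_ :: p) q
    rw [if_neg (by omega)] at h
    rw [chain, List.cons_append] at h ⊢
    rw [lin_coder_cons, h, h1, chain, pow_succ]
    simp [chain]

theorem lin_coder_chain_tail (k : ℕ) (g : ZMod 4) (hg : g = x - k) :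
    lin (fun t => und (chain x (k + 1) ++ t)) (coder und ((m, .reeb (g + 1) n) :: r)) =
      splitSum r fun p s => lin (fun b => und (chain x (k + 1) ++ b :: s))
        (und ((m, .reeb (g + 1) n) :: p)) := by
  rw [lin_coder_cons, lin_applyPrefix, splitSum_cons, und_nil, map_zero, zero_add, sub_eq_self]
  refine lin_eq_zero fun t ht => ?_
  obtain ⟨p, q, s, z, -, rfl, -⟩ := exists_of_coder_ne_zero ht
  exact und_chain_append k g hg _ (Or.inr (by simp))

/-- The counterpart of `high_merge` for the product. It is associativity if `k = 0` and `r` has one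
entry, and otherwise both sides vanish. -/
theorem mu2_chain_merge (k : ℕ) (g : ZMod 4) (hg : g = x - k) :
    mu2 (chain x k ++ (m, .reeb g (n + 1)) :: r) =
      splitSum r fun p s => lin (fun b => und (chain x (k + 1) ++ b :: s))
        (mu2 ((m, .reeb (g + 1) n) :: p)) := by
  rcases r with _ | ⟨b, r⟩
  · have h : mu2 [(m, .reeb (g + 1) n)] = 0 := mu2_of_length (by simp)
    simp only [splitSum_nil, h, map_zero]
    by_cases hk : k = 1
    · subst hk
      have e : chain x 1 = [(0, .reeb x 0)] := rfl
      rw [e]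
      change mulV _ _ = 0
      rw [mulV_of_mul_none]
      rw [Basic.reeb_mul_reeb, if_neg]
      subst hg
      have := zmod_four_ne (x - 1)
      rw [sub_add_cancel] at this
      simpa using this
    · exact mu2_of_length (by simpa [length_chain] using hk)
  · rw [splitSum_eq_single (l := b :: r) [b] r rfl]
    · change _ = lin _ (mulV _ b)
      by_cases h : k = 0 ∧ r = []
      · obtain ⟨rfl, rfl⟩ := h
        have e : chain x (0 + 1) = [(0, .reeb g 0)] := by rw [hg]; simp [chain]
        have h1 := mulV_assoc (0, .reeb g 0) (m, .reeb (g + 1) n) b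
        rw [mulV_of_mul (b := .reeb g (n + 1)) (by simp [Basic.reeb_mul_reeb]), rmul, lin_bas] at h1
        simp only [e, List.singleton_append, und_pair]
        simp only [zero_add] at h1
        exact h1
      · rw [mu2_of_length, lin_eq_zero]
        · intro z hz
          obtain ⟨h1, h2⟩ := mulV_ne_zero hz
          obtain ⟨n', hn⟩ : ∃ n', z.2 = .reeb (g + 1) n' := by
            rcases b with ⟨m', j | ⟨i, l⟩⟩
            · rw [Basic.mul_idem] at h2
              split_ifs at h2
              exact ⟨n, (Option.some.inj h2).symm⟩
            · rw [Basic.reeb_mul_reeb] at h2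
              split_ifs at h2
              exact ⟨_, (Option.some.inj h2).symm⟩
          obtain ⟨m', z⟩ := z
          simp only at hn
          subst hn
          refine und_chain_append k g hg _ ?_
          by_contra h5
          exact h (by simpa using h5)
        · have h5 : k ≠ 0 ∨ r.length ≠ 0 := by
            by_contra h5
            exact h (by simpa using h5)
          simp [length_chain]
          omega
    · intro p s hps hne
      rw [mu2_of_length, map_zero]
      intro h
      rcases p with _ | ⟨c, _ | ⟨c', p⟩⟩
      · simp at h
      · simp at hps
        exact hne (by rw [hps.1])
      · simp at h

theorem splitSum_mu2_chain (c : List BasisElt → Vec BasisElt) (k : ℕ) (g : ZMod 4)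
    (hg : g = x - k) :
    (splitSum r fun p s => lin (fun b => mu2 (chain x (k + 1) ++ b :: s)) (c p)) =
      if k = 0 then lmul (0, .reeb g 0) (c r) else 0 := by
  split_ifs with hk
  · subst hk
    have e : chain x (0 + 1) = [(0, .reeb g 0)] := by rw [hg]; simp [chain]
    rw [splitSum_eq_single r [] (by simp)]
    · rw [e]
      rfl
    · intro p s hps hp
      refine lin_eq_zero fun b _ => mu2_of_length ?_
      rcases s with _ | ⟨z, s⟩
      · exact absurd (by simpa using hps) hp
      · simp [e]
  · refine splitSum_eq_zero fun p s _ => lin_eq_zero fun b _ => mu2_of_length ?_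
    simp [length_chain]
    omega

/-- The product at the junction cancels the composites with an operation behind the chain, by
`high_merge` and `mu2_chain_merge`. The exception is a chain of four letters followed by a single
chord, where the extra term cancels the product of the chord with `μ₄` of the chain. -/
theorem circ_und_chain_append (hr : Pure r) (k : ℕ) (g : ZMod 4) (hg : g = x - k) :
    circ und und (chain x (k + 1) ++ (m, .reeb (g + 1) n) :: r) = 0 := by
  have key : und (chain x k ++ (m, .reeb g (n + 1)) :: r) -
      lin (fun t => und (chain x (k + 1) ++ t)) (coder und ((m, .reeb (g + 1) n) :: r)) =
      if k = 3 ∧ r = [] then bas (m + 1, .reeb (g + 1) n) else 0 := by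
    have h1 : ∀ p s, lin (fun b => und (chain x (k + 1) ++ b :: s))
        (high ((m, .reeb (g + 1) n) :: p)) = lin (fun b => mu2 (chain x (k + 1) ++ b :: s))
        (high ((m, .reeb (g + 1) n) :: p)) + lin (fun b => high (chain x (k + 1) ++ b :: s))
        (high ((m, .reeb (g + 1) n) :: p)) := by
      intro p s
      rw [← lin_add_fun]
      exact lin_congr fun b _ => und_eq _
    rw [lin_coder_chain_tail k g hg, und_eq, mu2_chain_merge k g hg, high_merge hr hg]
    simp only [und_eq ((m, .reeb (g + 1) n) :: _), map_add, splitSum_add, h1]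
    rw [splitSum_mu2_chain _ k g hg]
    abel
  have hΦ : ∀ (b : BasisElt) (p q : List BasisElt) a,
      und (b :: (p ++ (1, .idem a) :: (q ++ (m, .reeb (g + 1) n) :: r))) = 0 :=
    fun b p q a => und_idem (b :: p) _ _ _ (by simp; omega)
  rw [circ]
  rcases k with _ | k
  · have h := lin_applyPrefix_chain und 0 g hg (fun a h => absurd h (by omega)) (m := m) (n := n)
      (r := r)
    simp only [chain, List.cons_append, List.nil_append] at h key ⊢
    rw [lin_coder_cons, h, if_pos trivial, key, if_neg (by omega)]
  · have h1 := lin_coder_chain (x := x - 1) (fun t => und ((0, .reeb x 0) :: t)) k g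
      (by rw [hg]; push_cast; ring) (fun a p q => hΦ _ p q a)
    have e : ∀ l, (0, .reeb x 0) :: (chain (x - 1) k ++ l) = chain x (k + 1) ++ l := fun l => rfl
    have e1 : ∀ l, (0, .reeb x 0) :: (chain (x - 1) (k + 1) ++ l) = chain x (k + 1 + 1) ++ l :=
      fun l => rfl
    simp only [e, e1, key] at h1
    rw [← e1, lin_coder_cons, h1, e1]
    split_ifs with h2
    · obtain ⟨h2, rfl⟩ := h2
      obtain rfl : k = 2 := by omega
      have e2 : chain x (2 + 1 + 1) = chain x 4 := rfl
      rw [lin_applyPrefix, e2, splitSum_eq_single (chain x 4) [(m, .reeb (g + 1) n)] rfl]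
      · rw [und_chain, if_pos rfl, lin_bas, und_pair, mulV_of_mul (b := .reeb (g + 1) n)]
        · simp [add_comm]
        · refine (Basic.idem_mul _ _).trans (if_pos ?_)
          have h3 : ∀ x : ZMod 4, source x = source (x - ((2 + 1 : ℕ) : ZMod 4) + 1) := by decide
          rw [hg]
          exact h3 x
      · intro p s hps hp
        rcases List.append_eq_append_iff.1 hps with ⟨c, h3, -⟩ | ⟨c, h3, h4⟩
        · rw [(chain_eq_append h3.symm).1, und_chain, if_neg, map_zero]
          intro h5
          have h6 := congrArg List.length h3
          rw [List.length_append, h5, length_chain] at h6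
          have : c = [] := List.length_eq_zero_iff.1 (by omega)
          exact hp (by rw [h3, this, List.append_nil])
        · rcases c with _ | ⟨c, c'⟩
          · exact absurd (by simpa using h3) hp
          · rw [List.cons_append, List.cons.injEq] at h4
            rw [h3, ← h4.1, show chain x 4 = chain x (3 + 1) from rfl,
              und_chain_append 3 g hg _ (Or.inl (by omega)), map_zero]
    · rw [lin_applyPrefix_chain _ (k + 1) g hg, if_neg (by omega), smul_zero, sub_zero]
      intro a h3
      refine und_idem [] _ _ _ ?_
      simp only [List.length_nil, List.length_append, List.length_cons, length_chain]
      intro h4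
      exact h2 ⟨by omega, List.length_eq_zero_iff.1 (by omega)⟩

/-- The inner operation must consume four consecutive letters and gives a multiple of an idempotent,
so the outer one must be the product. This leaves length five, where `μ₂(μ₄, ρ)` and `μ₂(ρ, μ₄)`
both equal `U ρ_x` and have opposite signs. -/
theorem circ_und_chain (k : ℕ) : circ und und (chain x k) = 0 := by
  by_cases hk : k = 5
  · subst hk
    have h4 : coder und (chain (x - 1 - 1) 3) = 0 := by
      ext l
      by_contra hl
      obtain ⟨p, q, s, z, h1, -, h2⟩ := exists_of_coder_ne_zero hl
      have h3 := congrArg List.length h1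
      rw [length_chain, List.length_append, List.length_append] at h3
      rw [(chain_eq_append (p := q) (s := s) (chain_eq_append h1.symm).2).1, und_chain,
        if_neg (by omega)] at h2
      exact h2 rfl
    have h5 : ∀ (Φ : List BasisElt → Vec BasisElt) y k, lin Φ (applyPrefix und (chain y (4 + k))) =
        Φ ((1, .idem (source y)) :: chain (y - 4) k) := by
      intro Φ y k
      have e : chain y (4 + k) = chain y 4 ++ chain (y - 4) k := by
        have h := chain_eq_append (p := (chain y (4 + k)).take 4) (s := (chain y (4 + k)).drop 4)
          (i := y) (k := 4 + k) (by simp)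
        rw [← List.take_append_drop 4 (chain y (4 + k)), h.1, h.2]
        simp [length_chain]
      rw [lin_applyPrefix, splitSum_eq_single (chain y 4) (chain (y - 4) k) e.symm, und_chain,
        if_pos rfl, lin_bas]
      intro p s hps hp
      obtain ⟨h1, -⟩ := chain_eq_append hps
      rw [h1, und_chain, if_neg, map_zero]
      intro h2
      exact hp (by rw [h1, h2])
    have e5 : chain x 5 = (0, .reeb x 0) :: (0, .reeb (x - 1) 0) :: chain (x - 1 - 1) 3 := rfl
    have e1 := h5 und x 1
    have e2 := h5 (fun t => und ((0, .reeb x 0) :: t)) (x - 1) 0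
    rw [show chain x (4 + 1) = chain x 5 from rfl, e5] at e1
    rw [show chain (x - 1) (4 + 0) = (0, .reeb (x - 1) 0) :: chain (x - 1 - 1) 3 from rfl] at e2
    rw [circ, e5, lin_coder_cons, e1, lin_coder_cons, e2, h4, map_zero, sub_zero]
    simp only [chain]
    have h6 : ∀ x : ZMod 4, x - 4 = x ∧ source (x + 1) = source (x - 1) := by decide
    rw [und_pair, und_pair, mulV_of_mul (b := .reeb x 0), mulV_of_mul (b := .reeb x 0), sub_eq_zero]
    · simp
    · refine (Basic.mul_idem (.reeb x 0) _).trans (if_pos ?_)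
      simpa [Basic.right] using (h6 x).2
    · rw [(h6 x).1]
      exact (Basic.idem_mul _ _).trans (if_pos rfl)
  · ext z
    by_contra hz
    obtain ⟨l, h1, h2⟩ := exists_of_lin_ne_zero hz
    obtain ⟨p, q, s, y, h3, rfl, h4⟩ := exists_of_coder_ne_zero h1
    have h5 := congrArg List.length h3
    rw [length_chain, List.length_append, List.length_append] at h5
    rw [(chain_eq_append (p := q) (s := s) (chain_eq_append h3.symm).2).1, und_chain] at h4
    split_ifs at h4 with h6
    · have : y = (1, .idem (source (x - p.length))) := by
        by_contra h7
        exact h4 (Finsupp.single_eq_of_ne h7)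
      rw [this, und_idem _ _ _ _ (by omega)] at h2
      exact h2 rfl
    · exact h4 rfl

theorem circ_und_idem (p : List BasisElt) (m : ℕ) (j : Fin 2) (s : List BasisElt) :
    circ und und (p ++ (m, .idem j) :: s) = 0 := by
  have e : und = fun l => mu2 l + high l := funext und_eq
  rw [e, circ_mu2_add (fun l => adm_high.gr.odd), hdiff_idem adm_high.gr (fun p s => high_idem p m j s)
    (fun p b s => high_mulU p m b s), zero_add]
  ext x
  by_contra hx
  obtain ⟨l, h1, h2⟩ := exists_of_lin_ne_zero hx
  obtain ⟨p', q, s', z, h3, rfl, h4⟩ := exists_of_coder_ne_zero h1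
  have hp : Pure (p ++ (m, .idem j) :: s) := by
    rw [h3]
    obtain ⟨h5, -⟩ := exists_of_high_ne_zero h4
    obtain ⟨h6, -⟩ := exists_of_high_ne_zero h2
    exact h6.left.append (h5.append fun b hb => h6.right b (List.mem_cons_of_mem _ hb))
  obtain ⟨i, n, h⟩ := hp (m, .idem j) (by simp)
  simp at h

theorem exists_of_pure_splitEntry {l : List BasisElt} {s : Option (ZMod 4)} (h : Active s l)
    (hp : Pure (splitEntry l)) : ∃ x k n r m, (∀ j ∈ s, j = x + 1) ∧ Pure r ∧
      splitEntry l = chain x (k + 1) ++ (m, .reeb (x - (k : ℕ) + 1) n) :: r := by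
  induction l generalizing s with
  | nil => exact h.elim
  | cons b l ih =>
    rcases b with ⟨_ | m, j | ⟨i, _ | n⟩⟩
    · exact h.elim
    · obtain ⟨x, k, n, r, m, h1, h2, h3⟩ := ih h.2 fun b hb => hp b (List.mem_cons_of_mem _ hb)
      obtain rfl : i = x + 1 := h1 _ rfl
      refine ⟨x + 1, k + 1, n, r, m, h.1, h2, ?_⟩
      have e : x + 1 - ((k + 1 : ℕ) : ZMod 4) = x - k := by push_cast; ring
      have e1 : chain (x + 1) (k + 1 + 1) = (0, .reeb (x + 1) 0) :: chain x (k + 1) := by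
        rw [chain, add_sub_cancel_right]
      rw [splitEntry, h3, e, e1]
      rfl
    · exact ⟨i, 0, n, l, 0, h, fun b hb => hp b (by simp [splitEntry, hb]),
        by simp [splitEntry, chain]⟩
    all_goals
      obtain ⟨i, n, h⟩ := hp (1, .idem _) (List.mem_cons_self ..)
      simp at h

/-- The leading part of the failure is a cocycle that vanishes on inactive lists, by the explicit
computations above, so it is zero. Repeating this pushes the order beyond every bound. -/
theorem circ_und_und (l : List BasisElt) : circ und und l = 0 := by
  have e : und = fun l => mu2 l + high l := funext und_eq
  have hh : Adm (-1) 0 2 high := adm_high.mono le_rfl (by norm_num)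
  have key : ∀ n : ℕ, Adm (-2) 0 (3 + n) (circ und und) := by
    intro n
    induction n with
    | zero => rw [e]; simpa using adm_circ_mu2_add hh
    | succ n ih =>
      have h1 : Gr (-2 - 1) 0 (3 + n + 2) (hdiff (circ und und)) := by
        rw [e] at ih ⊢
        exact gr_hdiff_circ hh.gr ih.gr
      have h2 : ∀ l, lead (3 + n) (circ und und) l = 0 := by
        refine eq_zero_of_hdiff_eq_zero (hdiff_lead_eq_zero ih h1) fun l hl => lead_eq_zero ?_
        ext z
        by_contra hz
        obtain ⟨hN, hD⟩ := ih l z hz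
        by_cases hp : Pure l
        · rcases not_active_cases (hD.1 _ _ ⟨rfl, rfl⟩) hN hl with ⟨i, k, rfl⟩ | ⟨i, k, a, rfl⟩ |
            ⟨l', h3, rfl⟩
          · rw [circ_und_chain] at hz
            exact hz rfl
          · obtain ⟨i, n, h⟩ := hp (1, .idem a) (by simp)
            simp at h
          · obtain ⟨x, k, n, r, m, -, h4, h5⟩ := exists_of_pure_splitEntry h3 hp
            rw [h5, circ_und_chain_append h4 k _ rfl] at hz
            exact hz rfl
        · obtain ⟨⟨m, b⟩, h3, h4⟩ : ∃ b ∈ l, ¬ ∃ i n, b.2 = .reeb i n := by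
            simpa [Pure] using hp
          rcases b with j | ⟨i, n⟩
          · obtain ⟨p, s, rfl⟩ := List.append_of_mem h3
            rw [circ_und_idem] at hz
            exact hz rfl
          · exact h4 ⟨_, _, rfl⟩
      have h3 := adm_sub_lead ih
      simp only [h2, sub_zero] at h3
      push_cast
      rw [← add_assoc]
      exact h3
  refine eq_zero_of_gr (d := -2) (w := 0) (fun k => (key k.toNat).gr.mono le_rfl ?_) l
  have := Int.self_le_toNat k
  omega

end UndeformedSquare

end TorusAlgebra

/-! ### Pointwise limits of cochains -/

namespace BarConstruction

open Filter

noncomputable section Limits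

variable {B : Type}

theorem applyPrefix_congr {c c' : List B → Vec B} {l : List B}
    (h : ∀ q s, l = q ++ s → c q = c' q) : applyPrefix c l = applyPrefix c' l :=
  splitSum_congr fun q s hs => by rw [h q s hs.symm]

theorem coder_congr {c c' : List B → Vec B} {l : List B}
    (h : ∀ p q s, l = p ++ (q ++ s) → c q = c' q) : coder c l = coder c' l := by
  induction l with
  | nil => exact applyPrefix_congr fun q s hs => h [] q s hs
  | cons b l ih =>
    rw [coder_cons, coder_cons, applyPrefix_congr fun q s hs => h [] q s hs,
      ih fun p q s hs => h (b :: p) q s (by rw [hs]; rfl)]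

variable {s : ℕ → List B → Vec B} {c : List B → Vec B}

theorem eventually_lin {s : ℕ → List B → Vec B} {c : List B → Vec B}
    (h : ∀ l, ∀ᶠ n in atTop, s n l = c l) (v : Ten B) :
    ∀ᶠ n in atTop, lin (s n) v = lin c v := by
  filter_upwards [(eventually_all_finset v.support).2 fun l _ => h l] with n hn
  exact lin_congr fun l hl => hn l (Finsupp.mem_support_iff.2 hl)

theorem eventually_sublists (h : ∀ l, ∀ᶠ n in atTop, s n l = c l) (l : List B) :
    ∀ᶠ n in atTop, ∀ p q r, l = p ++ (q ++ r) → s n q = c q := by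
  have := (eventually_all_finite (l := atTop) (p := fun q n => s n q = c q)
    (List.finite_toSet l.sublists)).2 fun q _ => h q
  filter_upwards [this] with n hn p q r hl
  refine hn q ?_
  rw [List.mem_sublists, hl]
  exact (List.sublist_append_left q r).trans (List.sublist_append_right p _)

theorem eventually_coder (h : ∀ l, ∀ᶠ n in atTop, s n l = c l) (l : List B) :
    ∀ᶠ n in atTop, coder (s n) l = coder c l := by
  filter_upwards [eventually_sublists h l] with n hn
  exact coder_congr hn

theorem eventually_circ (h : ∀ l, ∀ᶠ n in atTop, s n l = c l) (l : List B) :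
    ∀ᶠ n in atTop, circ (s n) (s n) l = circ c c l := by
  filter_upwards [eventually_coder h l, eventually_lin h (coder c l)] with n h1 h2
  rw [circ, h1, h2, circ]

end Limits

end BarConstruction

namespace TorusAlgebra

open BarConstruction Filter

noncomputable section Existence

/-! ### Bounds for the weight -/

/-- The number 4m + 8w, for grading (m; a, b) × w, is zero on `U` and on any four consecutive
letters of a chord. Its values on basis elements are thus those on short chords. -/
theorem exists_isModel (b : BasisElt) :
    ∃ z, IsModel (gamma b) z ∧ -4 < z.1 + 8 * z.2.2.2 ∧ z.1 + 8 * z.2.2.2 ≤ 4 := by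
  obtain ⟨m, b⟩ := b
  obtain ⟨z, h1, h2⟩ : ∃ z, IsModel (gammaBasic b) z ∧ -4 < z.1 + 8 * z.2.2.2 ∧
      z.1 + 8 * z.2.2.2 ≤ 4 := by
    rcases b with j | ⟨i, n⟩
    · exact ⟨_, isModel_one, by norm_num⟩
    · refine ⟨_, isModel_reeb i n, ?_⟩
      have h : ∀ i, ∀ n < 4, -4 < (reebT i n).1 + 8 * (reebT i n).2.2.2 ∧
        (reebT i n).1 + 8 * (reebT i n).2.2.2 ≤ 4 := by decide
      have := h i (n % 4) (Nat.mod_lt _ (by norm_num))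
      rw [reebT_eq]
      simp only
      omega
  refine ⟨_, (gamma_eq m b).symm ▸ isModel_shift_mul _ _ h1, ?_⟩
  simp only
  omega

theorem exists_isModel_gam (l : List BasisElt) : ∃ z, IsModel (gam l) z := by
  induction l with
  | nil => exact ⟨_, isModel_one⟩
  | cons b l ih =>
    obtain ⟨z, hz⟩ := ih
    obtain ⟨y, hy, -⟩ := exists_isModel b
    exact ⟨_, gam_cons b l ▸ hy.mul hz⟩

/-- For fixed inputs and `d`, the component m of the output does not depend on the weight, whereas
the winding number grows with it. Since 4m + 8w is bounded above on basis elements, so are the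
weight and the order. -/
theorem exists_bound (d : ℤ) (l : List BasisElt) :
    ∃ N, ∀ k w x, DegRel d w k l [x] → k ≤ N := by
  obtain ⟨y, hy⟩ := exists_isModel_gam l
  refine ⟨l.length - 1 + 3 * |8 - (y.1 + 4 * (l.length - 1 + d)) - 8 * y.2.2.2|, ?_⟩
  rintro k w x ⟨-, -, v, -, h1, h2⟩
  obtain ⟨z, hz, -, hz'⟩ := exists_isModel x
  have h3 := IsModel.unique (gam_singleton x ▸ hz) (h2 ▸ isModel_shift_mul _ _ hy)
  rw [h3] at hz'
  simp only [List.length_singleton, Nat.cast_one] at hz' h1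
  have := le_abs_self (8 - (y.1 + 4 * ((l.length : ℤ) - 1 + d)) - 8 * y.2.2.2)
  omega

/-- A sequence of cochains whose successive differences are of increasing order converges. -/
theorem exists_limit {d : ℤ} {w : ℕ} {s : ℕ → List BasisElt → Vec BasisElt}
    (h : ∀ n : ℕ, Gr d w n fun l => s n l - s (n + 1) l) :
    ∃ c : List BasisElt → Vec BasisElt, ∀ l, ∀ᶠ n in atTop, s n l = c l := by
  have key : ∀ l, ∃ N, ∀ n ≥ N, s n l = s N l := by
    intro l
    obtain ⟨N, hN⟩ := exists_bound d l
    refine ⟨N.toNat + 1, fun n hn => ?_⟩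
    induction n, hn using Nat.le_induction with
    | base => rfl
    | succ n hn ih =>
      rw [← ih, eq_comm, ← sub_eq_zero]
      ext x
      by_contra hx
      have := hN _ _ _ (h n l x hx)
      omega
  choose N hN using key
  exact ⟨fun l => s (N l) l, fun l => eventually_atTop.2 ⟨N l, hN l⟩⟩

theorem eventually_eq_zero {d : ℤ} {w : ℕ} {s : ℕ → List BasisElt → Vec BasisElt}
    (h : ∀ n : ℕ, Gr d w n (s n)) (l : List BasisElt) : ∀ᶠ n in atTop, s n l = 0 := by
  obtain ⟨N, hN⟩ := exists_bound d l
  filter_upwards [eventually_ge_atTop (N.toNat + 1)] with n hn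
  ext x
  by_contra hx
  have := hN _ _ _ (h n l x hx)
  omega

/-! ### Existence of deformations -/

/-- The curvature. -/
def curv : Vec BasisElt := ∑ j : ZMod 4, bas (0, .reeb j 3)

theorem lin_curv {N : Type*} [AddCommGroup N] (φ : BasisElt → N) :
    lin φ curv = ∑ j : ZMod 4, φ (0, .reeb j 3) := by
  rw [curv, map_sum]
  simp only [lin_bas]

theorem gr_und : Gr (-1) 0 1 und := by
  have := gr_mu2.add (adm_high.gr.mono le_rfl (by norm_num))
  rwa [← show und = fun l => mu2 l + high l from funext und_eq] at this

/-- The operations of all weights, given the ones of positive weight. -/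
def total (e : List BasisElt → Vec BasisElt) (l : List BasisElt) : Vec BasisElt :=
  mu2 l + (high l + e l)

theorem circ_total (e : List BasisElt → Vec BasisElt) (l : List BasisElt) :
    circ (total e) (total e) l = circ und e l + circ e und l + circ e e l := by
  have h := circ_und_und l
  have e1 : total e = fun l => und l + e l := by
    funext l
    rw [total, und_eq, add_assoc]
  rw [e1]
  simp only [circ, coder_add, lin_add_fun, map_add] at h ⊢
  rw [h]
  abel

/-- The undeformed relation removes the weight zero part, so every remaining term contains `e` and
has positive weight. -/
theorem adm_circ_total {e : List BasisElt → Vec BasisElt} (he : Adm (-1) 1 2 e) :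
    Adm (-2) 1 3 (circ (total e) (total e)) := by
  have h1 : Adm (-1) 0 2 fun l => high l + e l :=
    (adm_high.mono le_rfl (by norm_num)).add (he.mono (by norm_num) le_rfl)
  intro l x hx
  refine ⟨(adm_circ_mu2_add h1 l x hx).1, ?_⟩
  rw [circ_total] at hx
  have g1 := gr_und.circ he.gr
  have g2 := he.gr.circ gr_und
  have g3 := he.gr.circ he.gr
  norm_num at g1 g2 g3
  exact ((g1.add g2).add (g3.mono (by norm_num) (by norm_num))) l x hx

theorem coder_und_chain {i : ZMod 4} {n : ℕ} (hn : n < 4) : coder und (chain i n) = 0 := by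
  ext l
  by_contra hl
  obtain ⟨p, q, s, z, h1, -, h2⟩ := exists_of_coder_ne_zero hl
  have h3 := congrArg List.length h1
  rw [length_chain, List.length_append, List.length_append] at h3
  rw [(chain_eq_append (p := q) (s := s) (chain_eq_append h1.symm).2).1, und_chain,
    if_neg (by omega)] at h2
  exact h2 rfl

theorem lin_applyPrefix_curv {N : Type*} [AddCommGroup N] {e : List BasisElt → Vec BasisElt}
    (h0 : e [] = curv) (Φ : List BasisElt → N) {l : List BasisElt}
    (h : ∀ p s, p ++ s = l → p ≠ [] → e p = 0) :
    lin Φ (applyPrefix e l) = ∑ j : ZMod 4, Φ ((0, .reeb j 3) :: l) := by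
  rw [lin_applyPrefix, splitSum_eq_single (l := l) [] l rfl, h0, lin_curv]
  intro p s hps hp
  rw [h p s hps hp, map_zero]

theorem coder_eq_zero_of_curv {e : List BasisElt → Vec BasisElt} (h0 : e [] = curv)
    {N : Type*} [AddCommGroup N] (Φ : List BasisElt → N) : lin Φ (coder e []) =
      ∑ j : ZMod 4, Φ [(0, .reeb j 3)] :=
  lin_applyPrefix_curv h0 Φ fun _ _ h hp => absurd (List.append_eq_nil_iff.1 h).1 hp

variable {e : List BasisElt → Vec BasisElt}

theorem apply_chain_eq_zero (he : Adm (-1) 1 2 e) (i : ZMod 4) {n : ℕ} (hn : n ≠ 0) :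
    e (chain i n) = 0 := by
  ext x
  by_contra hx
  exact hn ((degRel_chain (he _ x hx).2 le_rfl).1 rfl)

theorem circ_und_curv_singleton (h0 : e [] = curv) (b : BasisElt) (hb : e [b] = 0) :
    circ und e [b] = (∑ j : ZMod 4, mulV (0, .reeb j 3) b) - ∑ j : ZMod 4, mulV b (0, .reeb j 3) := by
  rw [circ, lin_coder_cons, lin_applyPrefix_curv h0, coder_eq_zero_of_curv h0]
  · simp only [und_pair]
  · intro p s hps hp
    rcases p with _ | ⟨c, p⟩
    · exact absurd rfl hp
    · rw [List.cons_append, List.cons.injEq, List.append_eq_nil_iff] at hps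
      rw [hps.1, hps.2.1, hb]

/-- On each side a single summand survives, and both give the chord of five letters starting with
`ρ_i`. -/
theorem curv_comm_chord (i : ZMod 4) : (∑ j : ZMod 4, mulV (0, .reeb j 3) (0, .reeb i 0)) =
    ∑ j : ZMod 4, mulV (0, .reeb i 0) (0, .reeb j 3) := by
  have h4 : ∀ j i : ZMod 4, i = j + 3 + 1 ↔ j = i := by decide
  rw [Finset.sum_eq_single i, Finset.sum_eq_single (i + 1), mulV_of_mul (b := .reeb i 4),
    mulV_of_mul (b := .reeb i 4)]
  · rw [Basic.reeb_mul_reeb, if_pos (by simp)]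
  · rw [Basic.reeb_mul_reeb, if_pos]
    simpa using (h4 i i).2 rfl
  · intro j _ hj
    rw [mulV_of_mul_none]
    rw [Basic.reeb_mul_reeb, if_neg]
    simpa using hj
  · simp
  · intro j _ hj
    rw [mulV_of_mul_none]
    rw [Basic.reeb_mul_reeb, if_neg]
    intro h
    exact hj ((h4 j i).1 (by simpa using h))
  · simp

theorem curv_comm_U (a : Fin 2) : (∑ j : ZMod 4, mulV (0, .reeb j 3) (1, .idem a)) =
    ∑ j : ZMod 4, mulV (1, .idem a) (0, .reeb j 3) := by
  refine Finset.sum_congr rfl fun j _ => ?_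
  have h1 : (Basic.reeb j 3).right = source j := by
    have : ∀ j : ZMod 4, source (j + 3 + 1) = source j := by decide
    exact this j
  by_cases h : source j = a
  · rw [mulV_of_mul (x := (1, .idem a)) (b := .reeb j 3), mulV_of_mul (b := .reeb j 3)]
    rotate_left
    · exact (Basic.mul_idem (.reeb j 3) _).trans (if_pos (h1.trans h))
    · exact (Basic.idem_mul _ (.reeb j 3)).trans (if_pos h.symm)
    · rfl
  · rw [mulV_of_mul_none, mulV_of_mul_none]
    · exact (Basic.idem_mul _ (.reeb j 3)).trans (if_neg fun h2 => h h2.symm)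
    · exact (Basic.mul_idem (.reeb j 3) _).trans (if_neg fun h2 => h (h1.symm.trans h2))

/-- The curvature is inserted at the four places of the chain, giving inputs for `μ₄`. At the front
it yields a pattern extended to the right, at the end one extended to the left, with equal outputs
and opposite signs. In the two middle places the labels do not match. -/
theorem circ_und_curv_chain_three (he : Adm (-1) 1 2 e) (h0 : e [] = curv) (i : ZMod 4) :
    circ und e (chain i 3) = 0 := by
  have h1 : ∀ i n p s, p ++ s = chain i n → p ≠ [] → e p = 0 := by
    intro i n p s hps hp
    rw [(chain_eq_append hps).1]
    exact apply_chain_eq_zero he _ fun h => hp (List.length_eq_zero_iff.1 h)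
  have key : ∀ (Φ : List BasisElt → Vec BasisElt) i n, lin Φ (coder e (chain i (n + 1))) =
      (∑ j : ZMod 4, Φ ((0, .reeb j 3) :: chain i (n + 1))) -
        lin (fun t => Φ ((0, .reeb i 0) :: t)) (coder e (chain (i - 1) n)) := by
    intro Φ i n
    have h2 := lin_applyPrefix_curv h0 Φ (h1 i (n + 1))
    rw [chain] at h2 ⊢
    rw [lin_coder_cons, h2]
  have e0 : ∀ i, chain i 0 = [] := fun i => rfl
  rw [circ, key, key, key, e0, coder_eq_zero_of_curv h0]
  obtain ⟨a, rfl⟩ : ∃ a, i = a + 2 := ⟨i - 2, by ring⟩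
  have hu : ∀ x y z t, und [x, y, z, t] = high [x, y, z, t] :=
    fun x y z t => und_of_length (by simp)
  have hw1 : ∀ a : ZMod 4, word ((0, .reeb a 3) :: chain (a + 2) 3) =
      lets a 3 ++ (PlaneTree.node .leaf .leaf .leaf).walk (a + 3) := by decide
  have hw2 : ∀ a : ZMod 4, word (chain (a + 2) 3 ++ [(0, .reeb (a - 1) 3)]) =
      (PlaneTree.node .leaf .leaf .leaf).walk (a + 2) ++ lets (a + 2 - 2) 3 := by decide
  have hp : ∀ j i k l : ZMod 4, ∀ n m p q, Pure [(0, .reeb j n), (0, .reeb i m), (0, .reeb k p),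
      (0, .reeb l q)] := by
    intro j i k l n m p q b hb
    simp only [List.mem_cons, List.not_mem_nil, or_false] at hb
    rcases hb with rfl | rfl | rfl | rfl <;> exact ⟨_, _, rfl⟩
  have s0 : ∑ j : ZMod 4, und ((0, .reeb j 3) :: chain (a + 2) (2 + 1)) =
      bas (1, .reeb a 2) := by
    rw [Finset.sum_eq_single a]
    · change und [_, _, _, _] = _
      rw [hu, high_of_recognized (hp _ _ _ _ _ _ _ _)
        (hw1 a ▸ Recognized.right a 3 _ (isNode_node .leaf .leaf .leaf))]
      rfl
    · intro j _ hj
      change und [_, _, _, _] = _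
      rw [hu]
      refine high_junction [] _ _ _ _ _ _ _ fun h => hj ?_
      have : ∀ a j : ZMod 4, a + 2 = j + 3 - 1 → j = a := by decide
      exact this a j (by simpa using h)
    · simp
  have s3 : ∑ j : ZMod 4, und [(0, .reeb (a + 2) 0), (0, .reeb (a + 2 - 1) 0),
      (0, .reeb (a + 2 - 1 - 1) 0), (0, .reeb j 3)] = bas (1, .reeb a 2) := by
    rw [Finset.sum_eq_single (a - 1)]
    · have h2 := Recognized.left (a + 2) 2 _ (isNode_node .leaf .leaf .leaf)
      rw [← hw2] at h2
      rw [hu, high_of_recognized (hp _ _ _ _ _ _ _ _) h2]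
      simp [powerU, PlaneTree.size]
    · intro j _ hj
      rw [hu]
      refine high_junction [_, _] [] _ _ _ _ _ _ fun h => hj ?_
      have : ∀ a j : ZMod 4, j = a + 2 - 1 - 1 + (0 : ℕ) - 1 → j = a - 1 := by decide
      exact this a j h
    · simp
  have s1 : ∑ j : ZMod 4, und ((0, .reeb (a + 2) 0) :: (0, .reeb j 3) ::
      chain (a + 2 - 1) (1 + 1)) = 0 := by
    refine Finset.sum_eq_zero fun j _ => ?_
    change und [_, _, _, _] = _
    rw [hu]
    by_cases h : j = a + 2 + (0 : ℕ) - 1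
    · refine high_junction [_] _ _ _ _ _ _ _ ?_
      have : ∀ a : ZMod 4, a + 2 - 1 ≠ a + 2 + (0 : ℕ) - 1 + (3 : ℕ) - 1 := by decide
      rw [h]
      exact this a
    · exact high_junction [] _ _ _ _ _ _ _ h
  have s2 : ∑ j : ZMod 4, und ((0, .reeb (a + 2) 0) :: (0, .reeb (a + 2 - 1) 0) ::
      (0, .reeb j 3) :: chain (a + 2 - 1 - 1) (0 + 1)) = 0 := by
    refine Finset.sum_eq_zero fun j _ => ?_
    change und [_, _, _, _] = _
    rw [hu]
    by_cases h : j = a + 2 - 1 + (0 : ℕ) - 1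
    · refine high_junction [_, _] _ _ _ _ _ _ _ ?_
      have : ∀ a : ZMod 4, a + 2 - 1 - 1 ≠ a + 2 - 1 + (0 : ℕ) - 1 + (3 : ℕ) - 1 := by decide
      rw [h]
      exact this a
    · exact high_junction [_] _ _ _ _ _ _ _ h
  rw [s0, s1, s2, s3]
  abel

/-- The gradings leave weight one and the lengths 1 and 3. Terms with two factors `e` have weight at
least two, and the undeformed operations vanish on chains of length less than four, so only the
insertions of the curvature remain. -/
theorem circ_total_chain (he : Adm (-1) 1 2 e) (h0 : e [] = curv) (i : ZMod 4) (n : ℕ) :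
    circ (total e) (total e) (chain i n) = 0 := by
  ext x
  by_contra hx
  obtain ⟨-, h1⟩ := adm_circ_total he _ x hx
  obtain ⟨-, hn⟩ := (degRel_chain h1 le_rfl).2 rfl
  have h2 : circ e e (chain i n) = 0 := by
    ext y
    by_contra hy
    have := (degRel_chain (he.gr.circ he.gr _ y hy) (by norm_num)).2 (by norm_num)
    omega
  have h3 : circ e und (chain i n) = 0 := by rw [circ, coder_und_chain (by omega), map_zero]
  rw [circ_total, h2, h3, add_zero, add_zero] at hx
  rcases hn with rfl | rfl
  · have h4 : chain i 1 = [(0, .reeb i 0)] := rfl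
    rw [h4, circ_und_curv_singleton h0 _ (h4 ▸ apply_chain_eq_zero he i one_ne_zero),
      curv_comm_chord, sub_self] at hx
    exact hx rfl
  · rw [circ_und_curv_chain_three he h0] at hx
    exact hx rfl

/-- The gradings leave only the list consisting of `U` alone, where the relation says that the
curvature commutes with `U`. -/
theorem circ_total_chain_U (he : Adm (-1) 1 2 e) (h0 : e [] = curv) {i : ZMod 4} {n : ℕ}
    {p s : List BasisElt} (hps : p ++ s = chain i n) (a : Fin 2) :
    circ (total e) (total e) (p ++ (1, .idem a) :: s) = 0 := by
  ext x
  by_contra hx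
  obtain ⟨-, h1⟩ := adm_circ_total he _ x hx
  obtain ⟨-, rfl⟩ := (degRel_chain_U hps h1 le_rfl).2 rfl
  obtain ⟨rfl, rfl⟩ := List.append_eq_nil_iff.1 hps
  have h2 : circ e e ([] ++ [(1, .idem a)]) = 0 := by
    ext y
    by_contra hy
    have := (degRel_chain_U hps (he.gr.circ he.gr _ y hy) (by norm_num)).2 (by norm_num)
    omega
  have h3 : circ e und ([] ++ [(1, .idem a)]) = 0 := by
    rw [circ, List.nil_append, lin_coder_cons, lin_applyPrefix, coder_nil, lin_applyPrefix]
    simp only [splitSum_cons, splitSum_nil, und_nil, und_odd [(1, .idem a)] (by simp), map_zero]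
    simp
  have h4 : e [(1, .idem a)] = 0 := by
    ext y
    by_contra hy
    exact (degRel_chain_U (p := []) (s := []) (i := i) (n := 0) rfl (he.gr _ y hy) le_rfl).1 rfl
  rw [circ_total, h2, h3, add_zero, add_zero, List.nil_append, circ_und_curv_singleton h0 _ h4,
    curv_comm_U, sub_self] at hx
  exact hx rfl

/-- Subtract a primitive of the leading part of the failure. It has order `k - 1`, so its composites
with terms of order 2 have order `k + 1`. Its composite with itself has order `2k - 2`, and `3 ≤ k`
makes this large enough. -/
theorem exists_next (he : Adm (-1) 1 2 e) (h0 : e [] = curv) {k : ℤ} (hk : 3 ≤ k)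
    (h : Adm (-2) 1 k (circ (total e) (total e))) :
    ∃ e', Adm (-1) 1 2 e' ∧ e' [] = curv ∧ Adm (-2) 1 (k + 1) (circ (total e') (total e')) ∧
      Adm (-1) 1 (k - 1) fun l => e l - e' l := by
  have hh : Adm (-1) 0 2 fun l => high l + e l :=
    (adm_high.mono le_rfl (by norm_num)).add (he.mono (by norm_num) le_rfl)
  obtain ⟨c, hc1, hc2, hc3⟩ := exists_hdiff_eq (adm_lead (k' := k) h)
    (hdiff_lead_eq_zero h (gr_hdiff_circ hh.gr h.gr))
    (fun i n => lead_eq_zero (circ_total_chain he h0 i n))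
    (fun i n p s a hps => lead_eq_zero (circ_total_chain_U he h0 hps a))
  norm_num at hc1
  have he' : Adm (-1) 1 2 fun l => e l - c l := he.sub (hc1.mono le_rfl (by linarith))
  refine ⟨fun l => e l - c l, he', by simp only [h0, hc2, sub_zero], ?_, by simpa using hc1⟩
  intro l x hx
  refine ⟨(adm_circ_total he' l x hx).1, ?_⟩
  have e1 : (total fun l => e l - c l) = fun l => mu2 l + ((high l + e l) - c l) := by
    funext l; rw [total]; abel
  rw [e1, circ_sub (fun l => hc1.gr.odd), hc3] at hx
  have g1 := (adm_sub_lead h).gr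
  have g2 := hh.gr.circ hc1.gr
  have g3 := hc1.gr.circ hh.gr
  have g4 := hc1.gr.circ hc1.gr
  norm_num at g2 g3 g4
  exact (((g1.sub (g2.mono le_rfl (by linarith))).sub (g3.mono le_rfl (by linarith))).add
    (g4.mono (by norm_num) (by linarith))) l x hx

/-- The operations of positive weight of a deformation. -/
theorem exists_deformation : ∃ e, Adm (-1) 1 2 e ∧ e [] = curv ∧
    ∀ l, circ (total e) (total e) l = 0 := by
  let S : ℕ → Type := fun n => { e : List BasisElt → Vec BasisElt // Adm (-1) 1 2 e ∧ e [] = curv ∧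
    Adm (-2) 1 (3 + n) (circ (total e) (total e)) }
  have hnext : ∀ n (e : S n), ∃ e' : S (n + 1), Adm (-1) 1 (2 + n) fun l => e.1 l - e'.1 l := by
    rintro n ⟨e, h1, h2, h3⟩
    obtain ⟨e', h4, h5, h6, h7⟩ := exists_next h1 h2 (by linarith) h3
    refine ⟨⟨e', h4, h5, ?_⟩, ?_⟩
    · push_cast
      rwa [← add_assoc]
    · rwa [show (3 : ℤ) + n - 1 = 2 + n by ring] at h7
  -- The iteration starts from the curvature alone, which has order 0 - 1 + 3 = 2.
  have h0 : Adm (-1) 1 2 (fun l : List BasisElt => if l = [] then curv else 0) := by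
    have h1 : ∀ j, reebT j 3 = (4 * (-2), 0, 0, 1) := by decide
    intro l x hx
    beta_reduce at hx
    by_cases hl : l = []
    · subst hl
      rw [if_pos rfl, curv, Finsupp.finsetSum_apply] at hx
      obtain ⟨j, -, hj⟩ := Finset.exists_ne_zero_of_sum_ne_zero hx
      obtain rfl : x = (0, .reeb j 3) := by
        by_contra h
        exact hj (Finsupp.single_eq_of_ne h)
      refine ⟨fun j h => by simp at h, fun j' j'' h => ?_, by simp, 1, le_rfl, by norm_num, ?_⟩
      · rw [← h.1, ← h.2]
        have : ∀ j : ZMod 4, source j = source (j + 3 + 1) := by decide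
        exact this j
      · have h2 := IsModel.eq (h1 j ▸ isModel_reeb j 3) (isModel_shift (-2) 1)
        rw [gam_singleton, gamma_eq, h2]
        norm_num [shift_zero]
    · rw [if_neg hl] at hx
      exact absurd rfl hx
  choose next hnext using hnext
  let s : ∀ n, S n := fun n => Nat.rec ⟨_, h0, if_pos rfl, by simpa using adm_circ_total h0⟩ next n
  obtain ⟨e, he⟩ := exists_limit (s := fun n => (s n).1) fun n =>
    (hnext n (s n)).gr.mono le_rfl (by linarith)
  have hev : ∀ l, ∀ᶠ n in atTop, total (s n).1 l = total e l := fun l =>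
    (he l).mono fun n hn => by rw [total, total, hn]
  refine ⟨e, fun l x hx => ?_, ?_, fun l => ?_⟩
  · obtain ⟨n, hn⟩ := (he l).exists
    rw [← hn] at hx
    exact (s n).2.1 l x hx
  · obtain ⟨n, hn⟩ := (he []).exists
    rw [← hn]
    exact (s n).2.2.1
  -- For large `n` the approximation agrees with the limit on everything that enters the relation on
  -- `l`, and the order of its failure exceeds the bound for `l`.
  · obtain ⟨n, h1, h2⟩ := ((eventually_circ hev l).and (eventually_eq_zero
      (s := fun n => circ (total (s n).1) (total (s n).1))
      (fun n => (s n).2.2.2.gr.mono le_rfl (by linarith)) l)).exists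
    exact h1.symm.trans h2

end Existence

end TorusAlgebra

/-! ### Coalgebra maps with identity linear part -/

namespace BarConstruction

open Filter

noncomputable section Unipotent

variable {B : Type}

/-- The corestriction of a coalgebra map with identity linear part. -/
def mor (φ : List B → Vec B) (l : List B) : Vec B := proj (bas l) + φ l

/-- The pairing of `c` and `K` with the deconcatenation coproduct. -/
def conv (c : List B → Vec B) (K : List B → Ten B) (l : List B) : Ten B :=
  splitSum l fun p s => cns (c p) (K s)

theorem exists_of_conv_ne_zero {c : List B → Vec B} {K : List B → Ten B} {l l' : List B}
    (h : conv c K l l' ≠ 0) :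
    ∃ p s x t, p ++ s = l ∧ l' = x :: t ∧ c p x ≠ 0 ∧ K s t ≠ 0 := by
  obtain ⟨p, s, hps, h'⟩ := exists_of_splitSum_apply_ne_zero h
  obtain ⟨x, t, rfl, hx, ht⟩ := exists_of_cns_ne_zero h'
  exact ⟨p, s, x, t, hps, rfl, hx, ht⟩

theorem conv_sub (c : List B → Vec B) (K K' : List B → Ten B) (l : List B) :
    conv c (fun l => K l - K' l) l = conv c K l - conv c K' l := by
  simp only [conv, map_sub, splitSum_sub]

theorem conv_sub_left (c c' : List B → Vec B) (K : List B → Ten B) (l : List B) :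
    conv (fun l => c l - c' l) K l = conv c K l - conv c' K l := by
  simp only [conv, map_sub, LinearMap.sub_apply, splitSum_sub]

theorem proj_bas_singleton (b : B) : proj (bas [b]) = bas b := by simp [proj]

theorem proj_bas_nil : proj (bas ([] : List B)) = 0 := by simp [proj]

theorem proj_bas_of_length {l : List B} (h : l.length ≠ 1) : proj (bas l) = 0 := by
  rcases l with _ | ⟨x, _ | ⟨y, l⟩⟩
  · exact proj_bas_nil
  · exact absurd rfl h
  · simp [proj]

theorem proj_bas_ne_zero {l : List B} {x : B} (h : proj (bas l) x ≠ 0) : l = [x] := by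
  rcases l with _ | ⟨y, _ | ⟨z, l⟩⟩
  · rw [proj_bas_nil] at h
    exact absurd rfl h
  · rw [proj_bas_singleton] at h
    by_contra hne
    refine h (Finsupp.single_eq_of_ne fun hxy => hne ?_)
    rw [hxy]
  · rw [proj_bas_of_length (by simp)] at h
    exact absurd rfl h

theorem splitSum_proj_cons {N : Type*} [AddCommGroup N] (Ψ : Vec B → List B → N)
    (h : ∀ s, Ψ 0 s = 0) (b : B) (l : List B) :
    (splitSum l fun p s => Ψ (proj (bas (b :: p))) s) = Ψ (bas b) l := by
  rw [splitSum_eq_single (l := l) [] l rfl, proj_bas_singleton]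
  intro p s _ hp
  rw [proj_bas_of_length, h]
  simpa using hp

theorem mor_nil {φ : List B → Vec B} (h : φ [] = 0) : mor φ [] = 0 := by
  rw [mor, proj_bas_nil, h, add_zero]

theorem coalg_mor_cons {φ : List B → Vec B} (h : φ [] = 0) (b : B) (l : List B) :
    coalg (mor φ) (b :: l) =
      cns (bas b) (coalg (mor φ) l) + conv φ (coalg (mor φ)) (b :: l) := by
  rw [coalg_cons]
  simp only [mor, map_add, LinearMap.add_apply, splitSum_add]
  rw [splitSum_proj_cons (fun v s => cns v (coalg (mor φ) s)) (fun s => by simp), conv,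
    splitSum_cons, h, map_zero, LinearMap.zero_apply, zero_add]

theorem even_mor {φ : List B → Vec B} (h : ∀ l, Even l.length → φ l = 0) (l : List B)
    (hl : Even l.length) : mor φ l = 0 := by
  rw [mor, h l hl, proj_bas_of_length, add_zero]
  intro h1
  rw [h1] at hl
  exact absurd hl (by decide)

/-- The corestriction of `defect`. -/
def error (f c c' : List B → Vec B) (l : List B) : Vec B :=
  lin f (coder c l) - lin c' (coalg f l)

theorem defect_mor_nil {φ : List B → Vec B} (h : ∀ l, Even l.length → φ l = 0)
    (c c' : List B → Vec B) :
    defect (mor φ) c c' [] = conv (error (mor φ) c c') (coalg (mor φ)) [] := by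
  rw [defect_eq (even_mor h), splitSum_nil, mor_nil (h [] (by simp)), map_zero,
    LinearMap.zero_apply, smul_zero, add_zero, proj_defect (mor_nil (h [] (by simp)))]
  rfl

/-- The recursion `defect_eq` with the identity part separated from `φ`, so that the orders of the
terms can be compared. -/
theorem defect_mor_cons {φ : List B → Vec B} (h : ∀ l, Even l.length → φ l = 0)
    (c c' : List B → Vec B) (b : B) (l : List B) : defect (mor φ) c c' (b :: l) =
      conv (error (mor φ) c c') (coalg (mor φ)) (b :: l) -
        cns (bas b) (defect (mor φ) c c' l) - conv φ (defect (mor φ) c c') (b :: l) := by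
  have h0 : φ [] = 0 := h [] (by simp)
  have h1 : (splitSum (b :: l) fun p s => (-1 : ℤ) ^ p.length • cns (mor φ p)
      (defect (mor φ) c c' s)) = -(cns (bas b) (defect (mor φ) c c' l) +
        conv φ (defect (mor φ) c c') (b :: l)) := by
    have h2 : ∀ p s, (-1 : ℤ) ^ p.length • cns (mor φ p) (defect (mor φ) c c' s) =
        -(cns (mor φ p) (defect (mor φ) c c' s)) := by
      intro p s
      rcases Nat.even_or_odd p.length with hp | hp
      · rw [even_mor h p hp]
        simp
      · rw [hp.neg_one_pow, neg_one_smul]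
    simp only [h2, splitSum_neg]
    rw [splitSum_cons, mor_nil h0, conv, splitSum_cons, h0]
    simp only [mor, map_add, LinearMap.add_apply, splitSum_add]
    rw [splitSum_proj_cons (fun v s => cns v (defect (mor φ) c c' s)) (fun s => by simp)]
    simp
  rw [defect_eq (even_mor h), splitSum_add, h1]
  simp only [proj_defect (mor_nil h0)]
  rw [conv, ← sub_eq_add_neg, sub_sub]
  rfl

/-- The morphism relation for the corestrictions of the defect. -/
theorem lin_defect {f c c' : List B → Vec B} (hf : f [] = 0) (hc : ∀ l, lin (coder c) (coder c l) = 0)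
    (hc' : ∀ l, lin (coder c') (coder c' l) = 0) (l : List B) :
    lin c' (defect f c c' l) + lin (error f c c') (coder c l) = 0 := by
  have h1 : lin (coder c') (defect f c c' l) = lin (coder c') (lin (coalg f) (coder c l)) := by
    rw [defect, map_sub, map_lin (lin (coder c')) (coder c')]
    simp only [hc', lin_zero_fun, sub_zero]
  have h2 : lin (defect f c c') (coder c l) = -lin (coder c') (lin (coalg f) (coder c l)) := by
    have : lin (defect f c c') (coder c l) = lin (coalg f) (lin (coder c) (coder c l)) -
        lin (coder c') (lin (coalg f) (coder c l)) := by
      rw [map_lin, map_lin, ← lin_sub_fun]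
      rfl
    rw [this, hc, map_zero, zero_sub]
  have h3 : lin (error f c c') (coder c l) = proj (lin (defect f c c') (coder c l)) := by
    rw [map_lin]
    simp only [proj_defect hf]
    rfl
  rw [h3, h2, ← h1, map_neg, proj_lin_coder, add_neg_cancel]

theorem coalg_congr {f f' : List B → Vec B} {l : List B}
    (h : ∀ p q s, l = p ++ (q ++ s) → f q = f' q) : coalg f l = coalg f' l := by
  induction hn : l.length using Nat.strong_induction_on generalizing l with
  | _ n ih =>
    cases l with
    | nil => rfl
    | cons b l =>
      rw [coalg_cons, coalg_cons]
      refine splitSum_congr fun p s hps => ?_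
      subst hps
      subst hn
      rw [h [] (b :: p) s rfl, ih s.length (by simp) (fun p' q s' hs =>
        h (b :: p ++ p') q s' (by simp [hs])) rfl]

theorem eventually_coalg {s : ℕ → List B → Vec B} {c : List B → Vec B}
    (h : ∀ l, ∀ᶠ n in atTop, s n l = c l) (l : List B) :
    ∀ᶠ n in atTop, coalg (s n) l = coalg c l := by
  filter_upwards [eventually_sublists h l] with n hn
  exact coalg_congr hn

theorem eventually_error {s : ℕ → List B → Vec B} {f : List B → Vec B}
    (h : ∀ l, ∀ᶠ n in atTop, s n l = f l) (c c' : List B → Vec B) (l : List B) :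
    ∀ᶠ n in atTop, error (s n) c c' l = error f c c' l := by
  filter_upwards [eventually_coalg h l, eventually_lin h (coder c l)] with n h1 h2
  rw [error, error, h1, h2]

end Unipotent

end BarConstruction

/-! ### Uniqueness: constructing a homomorphism order by order -/

namespace TorusAlgebra

open BarConstruction Filter

noncomputable section Uniqueness

/-- The sum over all ways of cutting a list in two of the products of the values. -/
def cup (c c' : List BasisElt → Vec BasisElt) (l : List BasisElt) : Vec BasisElt :=
  splitSum l fun p s => lin (fun x => lmul x (c' s)) (c p)

theorem cup_sub_left (c c' c'' : List BasisElt → Vec BasisElt) (l : List BasisElt) :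
    cup (fun l => c l - c' l) c'' l = cup c c'' l - cup c' c'' l := by
  simp only [cup, map_sub, splitSum_sub]

theorem cup_sub_right (c c' c'' : List BasisElt → Vec BasisElt) (l : List BasisElt) :
    cup c (fun l => c' l - c'' l) l = cup c c' l - cup c c'' l := by
  simp only [cup, map_sub, lin_sub_fun, splitSum_sub]

theorem Adm.cup {d d' k k' : ℤ} {w w' : ℕ} {c c' : List BasisElt → Vec BasisElt}
    (h : Adm d w k c) (h' : Adm d' w' k' c') :
    Adm (d + d' + -1) (w + w') (k + k' + 1) (cup c c') := by
  intro l z hz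
  obtain ⟨p, s, rfl, h1⟩ := exists_of_splitSum_apply_ne_zero hz
  obtain ⟨x, hx, h2⟩ := exists_of_lin_ne_zero h1
  obtain ⟨y, hy, h3⟩ := exists_of_lin_ne_zero h2
  refine ⟨fun j hj => ?_, ?_⟩
  · rcases List.mem_append.1 hj with hj | hj
    · exact (h p x hx).1 j hj
    · exact (h' s y hy).1 j hj
  · simpa using ((h p x hx).2.append (h' s y hy).2).trans (DegRel.of_mulV h3)

theorem Gr.even_zero {k : ℤ} {w : ℕ} {c : List BasisElt → Vec BasisElt} (h : Gr 0 w k c)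
    (l : List BasisElt) (hl : Even l.length) : c l = 0 := h.parity fun he => by
  obtain ⟨a, ha⟩ := hl
  rw [ha, Int.even_iff] at he
  push_cast at he
  omega

theorem Gr.conv {d d' k k' : ℤ} {w w' : ℕ} {c : List BasisElt → Vec BasisElt}
    {K : List BasisElt → Ten BasisElt} (h : Gr d w k c) {l l' : List BasisElt}
    (hK : ∀ p s t, p ++ s = l → c p ≠ 0 → K s t ≠ 0 → DegRel d' w' k' s t)
    (hl : conv c K l l' ≠ 0) : DegRel (d + d') (w + w') (k + k') l l' := by
  obtain ⟨p, s, x, t, rfl, rfl, hx, ht⟩ := exists_of_conv_ne_zero hl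
  exact (h p x hx).append (hK p s t rfl (fun h0 => hx (by rw [h0]; rfl)) ht)

theorem DegRel.of_cns {d k : ℤ} {w : ℕ} {b : BasisElt} {v : Ten BasisElt} {l l' : List BasisElt}
    (hv : ∀ t, v t ≠ 0 → DegRel d w k l t) (h : cns (bas b) v l' ≠ 0) :
    DegRel d w k (b :: l) l' := by
  obtain ⟨y, t, rfl, hy, ht⟩ := exists_of_cns_ne_zero h
  obtain rfl : y = b := by
    by_contra hne
    exact hy (Finsupp.single_eq_of_ne hne)
  exact (hv t ht).cons y

/-- Without inputs merged, there is no weight. -/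
theorem degRel_singleton {w : ℕ} {k : ℤ} {b x : BasisElt} (h : DegRel 0 w k [b] [x]) : w = 0 := by
  obtain ⟨-, -, v, h1, -, h2⟩ := h
  obtain ⟨y, hy, hy'⟩ := exists_isModel b
  obtain ⟨z, hz, hz'⟩ := exists_isModel x
  rw [gam_singleton, gam_singleton] at h2
  have := IsModel.unique hz (h2 ▸ isModel_shift_mul _ _ hy)
  rw [this] at hz'
  simp only [List.length_singleton] at hz'
  omega

/-- By the bound in `exists_isModel`, an operation without inputs has weight at most one. -/
theorem degRel_nil {w : ℕ} {k : ℤ} {x : BasisElt} (h : DegRel (-1) w k [] [x]) : w ≤ 1 := by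
  obtain ⟨-, -, v, h1, -, h2⟩ := h
  obtain ⟨z, hz, hz'⟩ := exists_isModel x
  rw [gam_singleton, gam_nil] at h2
  have := IsModel.unique hz (h2 ▸ isModel_shift_mul _ _ isModel_one)
  rw [this] at hz'
  simp only [List.length_singleton, List.length_nil] at hz'
  omega

section

variable {φ : List BasisElt → Vec BasisElt}

theorem mor_singleton (hφ : Adm 0 1 3 φ) (b : BasisElt) : mor φ [b] = bas b := by
  have : φ [b] = 0 := by
    ext x
    by_contra hx
    exact absurd (degRel_singleton (hφ _ x hx).2) one_ne_zero
  rw [mor, this, add_zero, proj_bas_singleton]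

theorem gr_mor_of_adm (hφ : Adm 0 1 0 φ) : Gr 0 0 0 (mor φ) := by
  intro l x hx
  rcases add_apply_ne_zero hx with h | h
  · rw [proj_bas_ne_zero h]
    exact DegRel.refl _
  · exact (hφ l x h).2.mono (by norm_num) le_rfl

theorem gr_mor (hφ : Adm 0 1 3 φ) : Gr 0 0 0 (mor φ) :=
  gr_mor_of_adm (hφ.mono le_rfl (by norm_num))

/-- Apart from the identity, every term involves `φ` at least once, and so has order at least 3. -/
theorem degRel_coalg_sub (hφ : Adm 0 1 3 φ) (l : List BasisElt) :
    ∀ l', (coalg (mor φ) l - bas l) l' ≠ 0 → DegRel 0 1 3 l l' := by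
  have h0 : φ [] = 0 := hφ.gr.even_zero [] (by simp)
  induction l with
  | nil =>
    intro l' h
    rw [coalg_nil, sub_self] at h
    exact absurd rfl h
  | cons b l ih =>
    intro l' h
    rw [coalg_mor_cons h0, ← cns_bas, add_sub_right_comm, ← map_sub] at h
    rcases add_apply_ne_zero h with h1 | h1
    · exact DegRel.of_cns ih h1
    · simpa using hφ.gr.conv (fun p s t _ _ ht => (gr_mor hφ).coalg ht) h1

variable {c c' : List BasisElt → Vec BasisElt}

theorem degRel_defect (hφ : Adm 0 1 3 φ) {k : ℤ} (hE : Gr (-1) 1 k (error (mor φ) c c'))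
    (l l' : List BasisElt) (h : defect (mor φ) c c' l l' ≠ 0) : DegRel (-1) 1 k l l' := by
  have he := hφ.gr.even_zero
  induction hn : l.length using Nat.strong_induction_on generalizing l l' with
  | _ n ih =>
    subst hn
    cases l with
    | nil =>
      rw [defect_mor_nil he] at h
      simpa using hE.conv (fun p s t _ _ ht => (gr_mor hφ).coalg ht) h
    | cons b l =>
      rw [defect_mor_cons he] at h
      rcases sub_apply_ne_zero h with h | h
      · rcases sub_apply_ne_zero h with h | h
        · simpa using hE.conv (fun p s t _ _ ht => (gr_mor hφ).coalg ht) h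
        · exact DegRel.of_cns (fun t ht => ih _ (by simp) l t ht rfl) h
      · have h1 := hφ.gr.conv (d' := -1) (w' := 1) (k' := k) (fun p s t hps hp ht => ?_) h
        · simp only [zero_add] at h1
          exact h1.mono (by norm_num) (by linarith)
        refine ih _ ?_ s t ht rfl
        rw [← hps, List.length_append]
        have : p ≠ [] := fun h0 => hp (by rw [h0, he [] (by simp)])
        have := List.length_pos_iff.2 this
        omega

/-- To leading order the coalgebra map is the identity, so the defect is the coderivation with the
error as corestriction. The other terms of the recursion contain an additional `φ`. -/
theorem degRel_defect_sub (hφ : Adm 0 1 3 φ) {k : ℤ} (hE : Gr (-1) 1 k (error (mor φ) c c'))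
    (l : List BasisElt) : ∀ l', (defect (mor φ) c c' l - coder (error (mor φ) c c') l) l' ≠ 0 →
      DegRel (-1) 1 (k + 1) l l' := by
  have he := hφ.gr.even_zero
  have e1 : ∀ l, applyPrefix (error (mor φ) c c') l = conv (error (mor φ) c c') bas l :=
    fun l => rfl
  induction l with
  | nil =>
    intro l' h
    rw [defect_mor_nil he, coder_nil, e1, ← conv_sub] at h
    obtain ⟨p, s, x, t, hps, -, -, ht⟩ := exists_of_conv_ne_zero h
    rw [(List.append_eq_nil_iff.1 hps).2, coalg_nil, sub_self] at ht
    exact absurd rfl ht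
  | cons b l ih =>
    intro l' h
    have e2 : defect (mor φ) c c' (b :: l) - coder (error (mor φ) c c') (b :: l) =
        conv (error (mor φ) c c') (fun l => coalg (mor φ) l - bas l) (b :: l) -
          cns (bas b) (defect (mor φ) c c' l - coder (error (mor φ) c c') l) -
            conv φ (defect (mor φ) c c') (b :: l) := by
      rw [defect_mor_cons he, coder_cons, e1, conv_sub, map_sub]
      abel
    rw [e2] at h
    rcases sub_apply_ne_zero h with h | h
    · rcases sub_apply_ne_zero h with h | h
      · exact (hE.conv (fun p s t _ _ ht => degRel_coalg_sub hφ s t ht) h).mono (by norm_num)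
          (by linarith)
      · exact DegRel.of_cns ih h
    · have := hφ.gr.conv (fun p s t _ _ ht => degRel_defect hφ hE s t ht) h
      simp only [zero_add] at this
      exact this.mono (by norm_num) (by linarith)

/-- The error of an approximate morphism is a Hochschild cocycle to leading order. -/
theorem gr_hdiff_error (hφ : Adm 0 1 3 φ) {h h' : List BasisElt → Vec BasisElt}
    (hh : Gr (-1) 0 2 h) (hh' : Gr (-1) 0 2 h')
    (hc : ∀ l, lin (coder fun l => mu2 l + h l) (coder (fun l => mu2 l + h l) l) = 0)
    (hc' : ∀ l, lin (coder fun l => mu2 l + h' l) (coder (fun l => mu2 l + h' l) l) = 0) {k : ℤ}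
    (hE : Gr (-1) 1 k (error (mor φ) (fun l => mu2 l + h l) fun l => mu2 l + h' l)) :
    Gr (-1 - 1) 1 (k + 2)
      (hdiff (error (mor φ) (fun l => mu2 l + h l) fun l => mu2 l + h' l)) := by
  set M := fun l => mu2 l + h l with hM
  set M' := fun l => mu2 l + h' l with hM'
  set E := error (mor φ) M M' with hEdef
  intro l x hx
  have h1 := lin_defect (mor_nil (hφ.gr.even_zero [] (by simp))) hc hc' l
  have e1 : lin M' (defect (mor φ) M M' l) = lin mu2 (defect (mor φ) M M' l - coder E l) +
      lin mu2 (coder E l) + lin h' (defect (mor φ) M M' l) := by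
    rw [← map_add, sub_add_cancel]
    exact lin_add_fun _ _ _
  have e2 : lin E (coder M l) = lin E (coder mu2 l) + lin E (coder h l) := by
    rw [hM, coder_add, map_add]
  rw [e1, e2] at h1
  have e3 : hdiff E l = -(lin mu2 (defect (mor φ) M M' l - coder E l) +
      lin h' (defect (mor φ) M M' l) + lin E (coder h l)) := by
    rw [hdiff_of_even (fun l => hE.odd), eq_neg_iff_add_eq_zero, ← h1]
    abel
  rw [e3, Finsupp.neg_apply, neg_ne_zero] at hx
  rcases add_apply_ne_zero hx with hx | hx
  · rcases add_apply_ne_zero hx with hx | hx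
    · exact (gr_mu2.lin (degRel_defect_sub hφ hE l) hx).mono (by norm_num) (by linarith)
    · exact (hh'.lin (degRel_defect hφ hE l) hx).mono (by norm_num) (by linarith)
  · exact (hE.lin (fun l' => hh.coder) hx).mono (by norm_num) (by linarith)

theorem lin_mu2_cns_right (v : Vec BasisElt) (x : Ten BasisElt) :
    lin mu2 (cns v x) = lin (fun b => lmul b (proj x)) v := by
  refine linear_ext_apply (lin mu2 ∘ₗ cns.flip x) (lin _) (fun b => ?_) v
  simp only [LinearMap.comp_apply, LinearMap.flip_apply, lin_bas]
  exact lin_mu2_cns b x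

theorem cup_proj (c : List BasisElt → Vec BasisElt) (l : List BasisElt) :
    cup c (fun l => proj (bas l)) l = rightTerm c l := by
  rw [← lin_mu2_applyPrefix, applyPrefix, map_splitSum]
  simp only [lin_mu2_cns_right]
  rfl

/-- The product sees two blocks. Both are treated by the identity, or exactly one by `φ`, or both by
`φ`. -/
theorem lin_mu2_coalg (h0 : φ [] = 0) (l : List BasisElt) :
    lin mu2 (coalg (mor φ) l) = mu2 l + lin mu2 (sumCoder φ l) + cup φ φ l := by
  cases l with
  | nil => simp [h0, lin_mu2_sumCoder, leftTerm, cup, mu2]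
  | cons b l =>
    have e1 : lin mu2 (conv φ (coalg (mor φ)) (b :: l)) = cup φ (mor φ) (b :: l) := by
      rw [conv, map_splitSum]
      simp only [lin_mu2_cns_right, proj_coalg (mor_nil h0)]
      rfl
    have e2 : cup φ (mor φ) (b :: l) = rightTerm φ (b :: l) + cup φ φ (b :: l) := by
      rw [← cup_proj]
      simp only [cup, mor, map_add, lin_add_fun, splitSum_add]
    have e3 : mu2 (b :: l) = lmul b (proj (bas l)) := by
      rw [← lin_mu2_cns, cns_bas, lin_bas]
    rw [coalg_mor_cons h0, map_add, e1, e2, lin_mu2_cns, proj_coalg (mor_nil h0), mor, map_add,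
      e3, lin_mu2_sumCoder, leftTerm]
    abel

/-- The terms linear in `φ` and containing only the product combine to `hdiff φ`. All terms are now
normalized, except possibly the last one, for which `noIdem_of_coalg` is needed. -/
theorem error_eq (hφ : Adm 0 1 3 φ) (h h' : List BasisElt → Vec BasisElt) (l : List BasisElt) :
    error (mor φ) (fun l => mu2 l + h l) (fun l => mu2 l + h' l) l =
      h l + hdiff φ l + circ φ h l - cup φ φ l - lin h' (coalg (mor φ) l) := by
  have e1 : lin (mor φ) (coder (fun l => mu2 l + h l) l) =
      mu2 l + h l + lin φ (coder mu2 l) + lin φ (coder h l) := by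
    have : lin (mor φ) (coder (fun l => mu2 l + h l) l) =
        proj (coder (fun l => mu2 l + h l) l) + lin φ (coder (fun l => mu2 l + h l) l) := by
      rw [← lin_bas_fun (coder (fun l => mu2 l + h l) l), map_lin proj, lin_bas_fun]
      exact lin_add_fun _ _ _
    rw [this, proj_coder, coder_add, map_add, ← add_assoc]
  have e2 : lin (fun l => mu2 l + h' l) (coalg (mor φ) l) =
      lin mu2 (coalg (mor φ) l) + lin h' (coalg (mor φ) l) := lin_add_fun _ _ _
  rw [error, e1, e2, lin_mu2_coalg (hφ.gr.even_zero [] (by simp)), hdiff_of_odd hφ.gr.even_zero,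
    circ]
  abel

theorem noIdem_of_coalg (hφ : Adm 0 1 3 φ) (l l' : List BasisElt) (h : coalg (mor φ) l l' ≠ 0) :
    NoIdem l' → NoIdem l := by
  refine coalg_induction (R := fun l l' => NoIdem l' → NoIdem l) (fun h => h) ?_ l l' h
  intro b p s x t hx hs hN j hj
  rcases List.mem_append.1 hj with hj | hj
  · rcases add_apply_ne_zero hx with h1 | h1
    · have := proj_bas_ne_zero h1
      rw [this, List.mem_singleton] at hj
      exact hN j (by simp [hj])
    · exact (hφ _ _ h1).1 j hj
  · exact hs (fun j hj => hN j (by simp [hj])) j hj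

theorem noIdem_of_error (hφ : Adm 0 1 3 φ) {h h' : List BasisElt → Vec BasisElt}
    (hh : Adm (-1) 0 2 h) (hh' : Adm (-1) 0 2 h') (l : List BasisElt) (x : BasisElt)
    (hx : error (mor φ) (fun l => mu2 l + h l) (fun l => mu2 l + h' l) l x ≠ 0) : NoIdem l := by
  rw [error_eq hφ] at hx
  rcases sub_apply_ne_zero hx with hx | hx
  · rcases sub_apply_ne_zero hx with hx | hx
    · rcases add_apply_ne_zero hx with hx | hx
      · rcases add_apply_ne_zero hx with hx | hx
        · exact (hh l x hx).1
        · exact (hφ.hdiff l x hx).1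
      · exact (hφ.circ hh l x hx).1
    · exact (hφ.cup hφ l x hx).1
  · obtain ⟨l', h1, h2⟩ := exists_of_lin_ne_zero hx
    exact noIdem_of_coalg hφ l l' h1 (hh' l' x h2).1

theorem degRel_coalg_sub_coalg (hφ : Adm 0 1 3 φ) {c : List BasisElt → Vec BasisElt} {k : ℤ}
    (hc : Adm 0 1 k c) (hφ' : Adm 0 1 3 fun l => φ l - c l) (l l' : List BasisElt)
    (h : (coalg (mor fun l => φ l - c l) l - coalg (mor φ) l) l' ≠ 0) : DegRel 0 1 k l l' := by
  have h0 := hφ.gr.even_zero [] (by simp)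
  have h0' := hφ'.gr.even_zero [] (by simp)
  induction hn : l.length using Nat.strong_induction_on generalizing l l' with
  | _ n ih =>
    subst hn
    cases l with
    | nil =>
      rw [coalg_nil, coalg_nil, sub_self] at h
      exact absurd rfl h
    | cons b l =>
      have e : coalg (mor fun l => φ l - c l) (b :: l) - coalg (mor φ) (b :: l) =
          cns (bas b) (coalg (mor fun l => φ l - c l) l - coalg (mor φ) l) +
          conv φ (fun l => coalg (mor fun l => φ l - c l) l - coalg (mor φ) l) (b :: l) -
          conv c (coalg (mor fun l => φ l - c l)) (b :: l) := by
        rw [coalg_mor_cons h0, coalg_mor_cons h0', conv_sub_left, conv_sub, map_sub]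
        abel
      rw [e] at h
      rcases sub_apply_ne_zero h with h | h
      · rcases add_apply_ne_zero h with h | h
        · exact DegRel.of_cns (fun t ht => ih _ (by simp) l t ht rfl) h
        · refine (hφ.gr.conv (d' := 0) (w' := 1) (k' := k) (fun p s t hps hp ht => ?_) h).mono
            (by norm_num) (by linarith)
          refine ih _ ?_ s t ht rfl
          rw [← hps, List.length_append]
          have : p ≠ [] := fun h1 => hp (by rw [h1, h0])
          have := List.length_pos_iff.2 this
          omega
      · simpa using hc.gr.conv (fun p s t _ _ ht => (gr_mor hφ').coalg ht) h

/-- Changing `φ` by `c` changes the error by `hdiff c`, up to terms of higher order. -/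
theorem error_sub (hφ : Adm 0 1 3 φ) {c : List BasisElt → Vec BasisElt}
    (hφ' : Adm 0 1 3 fun l => φ l - c l) (h h' : List BasisElt → Vec BasisElt)
    (l : List BasisElt) :
    error (mor fun l => φ l - c l) (fun l => mu2 l + h l) (fun l => mu2 l + h' l) l =
      error (mor φ) (fun l => mu2 l + h l) (fun l => mu2 l + h' l) l - hdiff c l - circ c h l +
        cup c φ l + cup (fun l => φ l - c l) c l -
          lin h' (coalg (mor fun l => φ l - c l) l - coalg (mor φ) l) := by
  rw [error_eq hφ, error_eq hφ', hdiff_sub, map_sub, cup_sub_right]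
  simp only [circ, lin_sub_fun, cup_sub_left]
  abel

end

theorem total_eq (e : List BasisElt → Vec BasisElt) :
    total e = fun l => mu2 l + (high l + e l) := rfl

theorem adm_high_add {e : List BasisElt → Vec BasisElt} (he : Adm (-1) 1 2 e) :
    Adm (-1) 0 2 fun l => high l + e l :=
  (adm_high.mono le_rfl (by norm_num)).add (he.mono (by norm_num) le_rfl)

theorem total_odd {e : List BasisElt → Vec BasisElt} (he : Adm (-1) 1 2 e) (l : List BasisElt)
    (hl : Odd l.length) : total e l = 0 := by
  rw [total, mu2_odd l hl, (adm_high_add he).gr.odd hl, add_zero]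

section

variable {e e' : List BasisElt → Vec BasisElt}

/-- In the degree of the error the gradings leave only the empty list, and there the error is the
difference of the curvatures. Its leading part is therefore a coboundary and can be removed. The
assumption `4 ≤ k` keeps the order of the correction at least 3. -/
theorem exists_next_mor (he : Adm (-1) 1 2 e) (he' : Adm (-1) 1 2 e') (h0 : e [] = curv)
    (h0' : e' [] = curv) (hc : ∀ l, circ (total e) (total e) l = 0)
    (hc' : ∀ l, circ (total e') (total e') l = 0) {φ : List BasisElt → Vec BasisElt}
    (hφ : Adm 0 1 3 φ) {k : ℤ} (hk : 4 ≤ k) (hE : Adm (-1) 1 k (error (mor φ) (total e) (total e'))) :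
    ∃ φ', Adm 0 1 3 φ' ∧ Adm (-1) 1 (k + 1) (error (mor φ') (total e) (total e')) ∧
      Adm 0 1 (k - 1) fun l => φ l - φ' l := by
  have hh := adm_high_add he
  have hh' := adm_high_add he'
  have hnil : error (mor φ) (total e) (total e') [] = 0 := by
    have h1 : total e [] = curv := by simp [total, mu2, h0, show high [] = 0 from by simpa [mu2] using (und_eq []).symm.trans und_nil]
    have h1' : total e' [] = curv := by simp [total, mu2, h0', show high [] = 0 from by simpa [mu2] using (und_eq []).symm.trans und_nil]
    rw [error, coder_eq_zero_of_curv h1, coalg_nil, lin_bas, h1', curv]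
    simp only [mor_singleton hφ, sub_self]
  obtain ⟨c, hc1, hc2, hc3⟩ := exists_hdiff_eq (adm_lead (k' := k) hE)
    (hdiff_lead_eq_zero hE (gr_hdiff_error hφ hh.gr hh'.gr
      (coder_coder_eq_zero (total_odd he) hc) (coder_coder_eq_zero (total_odd he') hc') hE.gr))
    (fun i n => by
      ext x
      by_contra hx
      have := lead_ne_zero hx
      have hn := (degRel_chain (hE _ x this.1).2 le_rfl).1 rfl
      subst hn
      exact this.1 (by rw [show chain i 0 = [] from rfl, hnil]; rfl))
    (fun i n p s a hps => by
      ext x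
      by_contra hx
      exact (degRel_chain_U hps (hE _ x (lead_ne_zero hx).1).2 le_rfl).1 rfl)
  norm_num at hc1
  have hφ' : Adm 0 1 3 fun l => φ l - c l := hφ.sub (hc1.mono le_rfl (by linarith))
  refine ⟨fun l => φ l - c l, hφ', fun l x hx => ⟨noIdem_of_error hφ' hh hh' l x hx, ?_⟩,
    by simpa using hc1⟩
  rw [total_eq, total_eq, error_sub hφ hφ', hc3] at hx
  have g1 := (adm_sub_lead hE).gr
  have g2 := hc1.circ hh
  have g3 := hc1.cup hφ
  have g4 := hφ'.cup hc1
  norm_num at g2 g3 g4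
  rcases sub_apply_ne_zero hx with hx | hx
  · exact (((g1.sub (g2.gr.mono le_rfl (by linarith))).add (g3.gr.mono (by norm_num)
      (by linarith))).add (g4.gr.mono (by norm_num) (by linarith))) l x hx
  · exact (hh'.gr.lin (degRel_coalg_sub_coalg hφ hc1 hφ' l) hx).mono (by norm_num) (by linarith)

theorem exists_mor (he : Adm (-1) 1 2 e) (he' : Adm (-1) 1 2 e') (h0 : e [] = curv)
    (h0' : e' [] = curv) (hc : ∀ l, circ (total e) (total e) l = 0)
    (hc' : ∀ l, circ (total e') (total e') l = 0) :
    ∃ φ, Adm 0 1 3 φ ∧ ∀ l, error (mor φ) (total e) (total e') l = 0 := by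
  let S : ℕ → Type := fun n => { φ : List BasisElt → Vec BasisElt // Adm 0 1 3 φ ∧
    Adm (-1) 1 (4 + n) (error (mor φ) (total e) (total e')) }
  have hnext : ∀ n (φ : S n), ∃ φ' : S (n + 1), Adm 0 1 (3 + n) fun l => φ.1 l - φ'.1 l := by
    rintro n ⟨φ, h1, h2⟩
    obtain ⟨φ', h3, h4, h5⟩ := exists_next_mor he he' h0 h0' hc hc' h1 (by linarith) h2
    refine ⟨⟨φ', h3, ?_⟩, ?_⟩
    · push_cast
      rwa [← add_assoc]
    · rwa [show (4 : ℤ) + n - 1 = 3 + n by ring] at h5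
  have hs : Adm 0 1 3 fun _ : List BasisElt => (0 : Vec BasisElt) := fun l x hx => absurd rfl hx
  -- For `φ = 0` the error is `e - e'`. It vanishes on the empty list since the curvatures agree, so
  -- by parity there are at least two inputs, and the order is at least 2 - 1 + 3 = 4.
  have hs' : Adm (-1) 1 (4 + (0 : ℕ)) (error (mor fun _ => 0) (total e) (total e')) := by
    have e1 : coalg (mor fun _ : List BasisElt => (0 : Vec BasisElt)) = bas := by
      refine (eq_coalg rfl fun b l => ?_).symm
      simp only [mor, add_zero]
      rw [splitSum_proj_cons (fun v s => cns v (bas s)) (fun s => by simp), cns_bas]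
    have e2 : ∀ l, error (mor fun _ => 0) (total e) (total e') l = e l - e' l := by
      intro l
      have e3 : lin (mor fun _ => 0) (coder (total e) l) = total e l := by
        rw [← proj_coder (total e)]
        have e4 : mor (fun _ => 0) = fun l : List BasisElt => proj (bas l) := by
          funext l
          rw [mor, add_zero]
        rw [e4, ← map_lin, lin_bas_fun]
      rw [error, e3, e1, lin_bas, total, total]
      abel
    intro l x hx
    rw [e2] at hx
    obtain ⟨h1, h2, h3, v, h4, h5, h6⟩ := (he.sub he') l x hx
    refine ⟨h1, h2, h3, v, h4, ?_, h6⟩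
    have hl : l ≠ [] := by
      rintro rfl
      rw [h0, h0', sub_self] at hx
      exact hx rfl
    have := List.length_pos_iff.2 hl
    rw [Int.even_iff] at h3
    simp only [List.length_singleton, Nat.cast_one] at h3 ⊢
    omega
  choose next hnext using hnext
  let s : ∀ n, S n := fun n => Nat.rec ⟨_, hs, hs'⟩ next n
  obtain ⟨φ, hlim⟩ := exists_limit (s := fun n => (s n).1) fun n =>
    (hnext n (s n)).gr.mono le_rfl (by linarith)
  have hev : ∀ l, ∀ᶠ n in atTop, mor (s n).1 l = mor φ l := fun l =>
    (hlim l).mono fun n hn => by rw [mor, mor, hn]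
  refine ⟨φ, fun l x hx => ?_, fun l => ?_⟩
  · obtain ⟨n, hn⟩ := (hlim l).exists
    rw [← hn] at hx
    exact (s n).2.1 l x hx
  · obtain ⟨n, h1, h2⟩ := ((eventually_error hev (total e) (total e') l).and (eventually_eq_zero
      (s := fun n => error (mor (s n).1) (total e) (total e'))
      (fun n => (s n).2.2.gr.mono le_rfl (by linarith)) l)).exists
    exact h1.symm.trans h2

end

end Uniqueness

end TorusAlgebra

/-! ### Components of given weight of a linear map -/

namespace BarConstruction

noncomputable section Filters

variable {X Y Z : Type} {B : Type}

/-- The restriction to a subset of a basis. -/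
def filterMap (p : Y → Prop) [DecidablePred p] : (Y →₀ ℤ) →ₗ[ℤ] (Y →₀ ℤ) where
  toFun := Finsupp.filter p
  map_add' _ _ := Finsupp.filter_add
  map_smul' _ _ := Finsupp.filter_smul

theorem filter_lin (p : Y → Prop) [DecidablePred p] (K : X → Y →₀ ℤ) (v : X →₀ ℤ) :
    (lin K v).filter p = lin (fun x => (K x).filter p) v :=
  map_lin (filterMap p) K v

theorem lin_filter {N : Type*} [AddCommGroup N] (p : X → Prop) [DecidablePred p] (φ : X → N)
    (v : X →₀ ℤ) : lin φ (v.filter p) = lin (fun x => if p x then φ x else 0) v := by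
  refine linear_ext_apply (lin φ ∘ₗ (filterMap p)) (lin _) (fun x => ?_) v
  rw [LinearMap.comp_apply, lin_bas]
  change lin φ ((bas x).filter p) = _
  by_cases h : p x
  · rw [Finsupp.filter_single_of_pos _ h, if_pos h, lin_bas]
  · rw [Finsupp.filter_single_of_neg _ h, if_neg h, map_zero]

theorem filter_splitSum {α : Type*} (p : Y → Prop) [DecidablePred p] (l : List α)
    (Φ : List α → List α → Y →₀ ℤ) :
    (splitSum l Φ).filter p = splitSum l fun q s => (Φ q s).filter p :=
  map_splitSum ((filterMap p)) l Φ

theorem cns_apply_cons (v : Vec B) (x : Ten B) (b : B) (l : List B) :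
    cns v x (b :: l) = v b * x l := by
  classical
  refine linear_ext_apply (Finsupp.lapply (b :: l) ∘ₗ cns.flip x) ((Finsupp.lapply b).smulRight (x l))
    (fun y => ?_) v
  refine linear_ext_apply (Finsupp.lapply (b :: l) ∘ₗ cns (bas y))
    (((Finsupp.lapply b : Vec B →ₗ[ℤ] ℤ) (bas y)) • Finsupp.lapply l) (fun t => ?_) x
  simp only [LinearMap.comp_apply, cns_bas, LinearMap.smul_apply, Finsupp.lapply_apply,
    Finsupp.single_apply, List.cons.injEq]
  split_ifs <;> simp_all

theorem cns_apply_nil (v : Vec B) (x : Ten B) : cns v x [] = 0 := counit_cns v x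

/-- The component of weight `w` of a map between free modules on graded sets. -/
def wcomp (u : X → ℤ) (v : Y → ℤ) (w : ℕ) (K : X → Y →₀ ℤ) (x : X) : Y →₀ ℤ :=
  (K x).filter fun y => v y = u x + w

/-- All components are of nonnegative weight. -/
def Nonneg (u : X → ℤ) (v : Y → ℤ) (K : X → Y →₀ ℤ) : Prop := ∀ x y, K x y ≠ 0 → u x ≤ v y

variable {u : X → ℤ} {v : Y → ℤ} {t : Z → ℤ}

theorem wcomp_apply (w : ℕ) (K : X → Y →₀ ℤ) (x : X) (y : Y) :
    wcomp u v w K x y = if v y = u x + w then K x y else 0 := Finsupp.filter_apply _ _ _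

theorem wcomp_ne_zero {w : ℕ} {K : X → Y →₀ ℤ} {x : X} {y : Y} (h : wcomp u v w K x y ≠ 0) :
    v y = u x + w ∧ K x y ≠ 0 := by
  rw [wcomp_apply] at h
  split_ifs at h with h1
  · exact ⟨h1, h⟩
  · exact absurd rfl h

theorem wcomp_eq_zero {w : ℕ} {K : X → Y →₀ ℤ} {x : X} (h : K x = 0) : wcomp u v w K x = 0 := by
  rw [wcomp, h, Finsupp.filter_zero]

/-- The weights of the two factors are determined by the intermediate basis element. They are
natural numbers because neither map lowers the grading. -/
theorem sum_wcomp {K : Y → Z →₀ ℤ} {L : X → Y →₀ ℤ} (hK : Nonneg v t K) (hL : Nonneg u v L)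
    (w : ℕ) (x : X) : ∑ p ∈ Finset.HasAntidiagonal.antidiagonal w, lin (wcomp v t p.1 K) (wcomp u v p.2 L x) =
      wcomp u t w (fun x => lin K (L x)) x := by
  simp only [wcomp, lin_filter, filter_lin]
  rw [← LinearMap.sum_apply]
  have h : ∀ s : Finset (ℕ × ℕ), ∀ φ : ℕ × ℕ → Y → Z →₀ ℤ, (∑ p ∈ s, lin (φ p)) (L x) =
      lin (fun y => ∑ p ∈ s, φ p y) (L x) := by
    intro s φ
    rw [LinearMap.sum_apply]
    classical
    induction s using Finset.induction_on with
    | empty => simp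
    | insert a s ha ih => simp only [Finset.sum_insert ha, lin_add_fun, ih]
  rw [h]
  refine lin_congr fun y hy => ?_
  ext z
  rw [Finsupp.finsetSum_apply, Finsupp.filter_apply]
  by_cases hz : K y z = 0
  · rw [hz, ite_self]
    refine Finset.sum_eq_zero fun p _ => ?_
    split_ifs
    · simp only [Finsupp.filter_apply, hz, ite_self]
    · rfl
  · have h1 := hL x y hy
    have h2 := hK y z hz
    by_cases h3 : t z = u x + w
    · rw [if_pos h3, Finset.sum_eq_single ((t z - v y).toNat, (v y - u x).toNat),
        if_pos (by simp only; omega), Finsupp.filter_apply, if_pos (by simp only; omega)]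
      · rintro ⟨a, b⟩ - hab
        split_ifs with h4
        · rw [Finsupp.filter_apply, if_neg]
          intro h5
          refine hab (Prod.ext ?_ ?_) <;> simp only at h4 h5 ⊢ <;> omega
        · rfl
      · intro h4
        refine absurd (Finset.HasAntidiagonal.mem_antidiagonal.2 ?_) h4
        simp only
        omega
    · rw [if_neg h3]
      refine Finset.sum_eq_zero fun p hp => ?_
      rw [Finset.HasAntidiagonal.mem_antidiagonal] at hp
      split_ifs with h4
      · rw [Finsupp.filter_apply, if_neg (by omega)]
      · rfl

end Filters

end BarConstruction

/-! ### Weights as differences of winding numbers -/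

namespace TorusAlgebra

open BarConstruction

noncomputable section Weights

/-- The winding number of a list. -/
def winding (l : List BasisElt) : ℤ := (gam l).2.toAdd

theorem winding_append (l m : List BasisElt) : winding (l ++ m) = winding l + winding m := by
  rw [winding, gam_append]
  rfl

theorem winding_cons (b : BasisElt) (l : List BasisElt) :
    winding (b :: l) = winding [b] + winding l := winding_append [b] l

theorem winding_eq {a b : ℤ} {l l' : List BasisElt} (h : gam l' = shift a b * gam l) :
    winding l' = winding l + b := by
  rw [winding, winding, h, toAdd_shift_mul, add_comm]

theorem DegRel.winding_le {d k : ℤ} {w : ℕ} {l l' : List BasisElt} (h : DegRel d w k l l') :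
    winding l + w ≤ winding l' := by
  obtain ⟨-, -, v, h1, -, h2⟩ := h
  rw [winding_eq h2]
  omega

/-- The component of weight `w` of a cochain. -/
def part (w : ℕ) (c : List BasisElt → Vec BasisElt) : List BasisElt → Vec BasisElt :=
  wcomp winding (fun x => winding [x]) w c

/-- The component of weight `w` of a map of tensor modules. -/
def tenPart (w : ℕ) (K : List BasisElt → Ten BasisElt) : List BasisElt → Ten BasisElt :=
  wcomp winding winding w K

theorem part_ne_zero {w : ℕ} {c : List BasisElt → Vec BasisElt} {l : List BasisElt}
    {x : BasisElt} (h : part w c l x ≠ 0) : winding [x] = winding l + w ∧ c l x ≠ 0 :=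
  wcomp_ne_zero h

theorem part_eq_zero {w : ℕ} {c : List BasisElt → Vec BasisElt} {l : List BasisElt}
    (h : c l = 0) : part w c l = 0 := wcomp_eq_zero h

variable {d k : ℤ} {c c' : List BasisElt → Vec BasisElt}

theorem Gr.nonneg (h : Gr d 0 k c) : Nonneg winding (fun x => winding [x]) c := fun l x hx => by
  simpa using (h l x hx).winding_le

theorem Gr.coder_nonneg (h : Gr d 0 k c) : Nonneg winding winding (BarConstruction.coder c) :=
  fun l x hx => by simpa using (Gr.coder h hx).winding_le

theorem Gr.coalg_nonneg (h : Gr 0 0 0 c) : Nonneg winding winding (BarConstruction.coalg c) :=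
  fun l x hx => by simpa using (Gr.coalg h hx).winding_le

theorem filter_cns {p : List BasisElt → Prop} [DecidablePred p] {q : BasisElt → Prop}
    [DecidablePred q] (v : Vec BasisElt) (x : Ten BasisElt)
    (h : ∀ y t, x t ≠ 0 → (p (y :: t) ↔ q y)) : (cns v x).filter p = cns (v.filter q) x := by
  ext l
  cases l with
  | nil => rw [Finsupp.filter_apply, cns_apply_nil, cns_apply_nil, ite_self]
  | cons y t =>
    rw [Finsupp.filter_apply, cns_apply_cons, cns_apply_cons, Finsupp.filter_apply]
    by_cases ht : x t = 0
    · rw [ht, mul_zero, mul_zero, ite_self]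
    · simp only [h y t ht, ite_mul, zero_mul]

theorem applyPrefix_part (w : ℕ) (c : List BasisElt → Vec BasisElt) (l : List BasisElt) :
    applyPrefix (part w c) l = tenPart w (applyPrefix c) l := by
  rw [tenPart, wcomp, applyPrefix, applyPrefix, filter_splitSum]
  refine splitSum_congr fun p s hps => (filter_cns _ _ fun y t ht => ?_).symm
  obtain rfl : t = s := by
    by_contra hne
    exact ht (Finsupp.single_eq_of_ne hne)
  rw [← hps, winding_cons, winding_append, ← add_left_inj (winding t)]
  constructor <;> intro h <;> linarith

theorem coder_part (w : ℕ) (c : List BasisElt → Vec BasisElt) (l : List BasisElt) :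
    coder (part w c) l = tenPart w (coder c) l := by
  induction l with
  | nil => exact applyPrefix_part w c []
  | cons b l ih =>
    rw [coder_cons, ih, applyPrefix_part]
    simp only [tenPart, wcomp, coder_cons, Finsupp.filter_sub]
    congr 1
    ext t
    rw [Finsupp.filter_apply]
    cases t with
    | nil => rw [cns_apply_nil, cns_apply_nil, ite_self]
    | cons y t =>
      rw [cns_apply_cons, cns_apply_cons, Finsupp.filter_apply]
      by_cases hy : y = b
      · subst hy
        simp only [winding_cons y t, winding_cons y l, add_assoc, add_right_inj, mul_ite, mul_zero]
      · rw [Finsupp.single_eq_of_ne hy, zero_mul, zero_mul, ite_self]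

theorem sum_lin_coder (h : Gr d 0 k c) {d' k' : ℤ} (h' : Gr d' 0 k' c') (w : ℕ)
    (l : List BasisElt) : ∑ p ∈ Finset.HasAntidiagonal.antidiagonal w, lin (part p.1 c) (coder (part p.2 c') l) =
      part w (fun l => lin c (coder c' l)) l := by
  simp only [coder_part]
  exact sum_wcomp h.nonneg h'.coder_nonneg w l

theorem sum_lin_coalg (h : Gr d 0 k c) (h' : Gr 0 0 0 c') (w : ℕ) (l : List BasisElt) :
    ∑ p ∈ Finset.HasAntidiagonal.antidiagonal w, lin (part p.1 c) (tenPart p.2 (coalg c') l) =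
      part w (fun l => lin c (coalg c' l)) l :=
  sum_wcomp h.nonneg h'.coalg_nonneg w l

theorem tenPart_coalg_nil (w : ℕ) :
    tenPart w (coalg c) [] = if w = 0 then bas [] else 0 := by
  rw [tenPart, wcomp, coalg_nil]
  by_cases h : w = 0
  · rw [if_pos h, Finsupp.filter_single_of_pos _ (by simp [h])]
  · rw [if_neg h, Finsupp.filter_single_of_neg]
    simpa using h

theorem sum_ite_antidiagonal (w : ℕ) {a b a' b' r r' : ℤ} (h : a ≤ a') (h' : b ≤ b') :
    ∑ q ∈ Finset.HasAntidiagonal.antidiagonal w, (if a' = a + q.1 then r else 0) * (if b' = b + q.2 then r' else 0) =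
      if a' + b' = a + b + w then r * r' else 0 := by
  split_ifs with h1
  · rw [Finset.sum_eq_single ((a' - a).toNat, (b' - b).toNat), if_pos (by simp only; omega),
      if_pos (by simp only; omega)]
    · rintro ⟨x, y⟩ - hxy
      by_contra hne
      have h2 := left_ne_zero_of_mul hne
      have h3 := right_ne_zero_of_mul hne
      rw [ne_eq, ite_eq_right_iff, Classical.not_imp] at h2 h3
      refine hxy (Prod.ext ?_ ?_)
      · have := h2.1
        simp only at this ⊢
        omega
      · have := h3.1
        simp only at this ⊢
        omega
    · intro h4
      refine absurd (Finset.HasAntidiagonal.mem_antidiagonal.2 ?_) h4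
      simp only
      omega
  · refine Finset.sum_eq_zero fun p hp => ?_
    rw [Finset.HasAntidiagonal.mem_antidiagonal] at hp
    by_cases h2 : a' = a + p.1
    · rw [if_neg (show ¬ b' = b + (p.2 : ℤ) by omega), mul_zero]
    · rw [if_neg h2, zero_mul]

/-- This is the recursion which `compose_eq` requires of the weighted components of a coalgebra map.
-/
theorem tenPart_coalg_cons (hc : Gr 0 0 0 c) (w : ℕ) (b : BasisElt) (l : List BasisElt) :
    tenPart w (coalg c) (b :: l) = splitSum l fun p s => ∑ q ∈ Finset.HasAntidiagonal.antidiagonal w,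
      cns (part q.1 c (b :: p)) (tenPart q.2 (coalg c) s) := by
  rw [tenPart, wcomp, coalg_cons, filter_splitSum]
  refine splitSum_congr fun p s hps => ?_
  ext t
  rw [Finsupp.filter_apply, Finsupp.finsetSum_apply]
  cases t with
  | nil => simp only [cns_apply_nil, ite_self, Finset.sum_const_zero]
  | cons y t =>
    simp only [cns_apply_cons, part, tenPart, wcomp_apply]
    by_cases h1 : c (b :: p) y = 0
    · simp only [h1, zero_mul, ite_self, Finset.sum_const_zero]
    by_cases h2 : coalg c s t = 0
    · simp only [h2, mul_zero, ite_self, Finset.sum_const_zero]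
    rw [sum_ite_antidiagonal w (by simpa using (hc _ _ h1).winding_le)
      (by simpa using (hc.coalg h2).winding_le), ← winding_append, ← winding_append, ← hps]
    rfl

/-- A cochain of nonnegative weight vanishes if all its components do. -/
theorem eq_zero_of_part_eq_zero (hc : Gr d 0 k c) {l : List BasisElt} (h : ∀ w, part w c l = 0) :
    c l = 0 := by
  ext x
  by_contra hx
  have h1 := (hc l x hx).winding_le
  have h2 := DFunLike.congr_fun (h (winding [x] - winding l).toNat) x
  rw [part, wcomp_apply, if_pos (by omega)] at h2
  exact hx h2

end Weights

/-! ### The inverse homomorphism -/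

noncomputable section Inverse

theorem proj_apply (x : Ten BasisElt) (b : BasisElt) : proj x b = x [b] := by
  classical
  refine linear_ext_apply (Finsupp.lapply b ∘ₗ proj) (Finsupp.lapply [b]) (fun l => ?_) x
  rw [LinearMap.comp_apply, Finsupp.lapply_apply, Finsupp.lapply_apply]
  by_cases h : l = [b]
  · rw [h, proj_bas_singleton, Finsupp.single_eq_same, Finsupp.single_eq_same]
  · rw [Finsupp.single_eq_of_ne (Ne.symm h)]
    by_contra hne
    exact h (proj_bas_ne_zero hne)

/-- Idempotents in a list persist. -/
def KeepsIdem (l l' : List BasisElt) : Prop :=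
  (l' = [] → l = []) ∧ ∀ p j s, l = p ++ (0, .idem j) :: s → ∃ p' s', l' = p' ++ (0, .idem j) :: s' ∧
    (p' = [] → p = []) ∧ (s' = [] → s = [])

/-- As `φ` is normalized, an idempotent entry forms a block by itself and is kept. The conditions on
the ends of the list ensure that nothing on either side of it is lost. The relation is reflexive and
transitive, so it passes to the inverse. -/
theorem keepsIdem_coalg {φ : List BasisElt → Vec BasisElt} (hφ : Adm 0 1 3 φ)
    (l l' : List BasisElt) (h : coalg (mor φ) l l' ≠ 0) : KeepsIdem l l' := by
  refine coalg_induction ⟨fun h => h, fun p j s hl => by simp at hl⟩ ?_ l l' h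
  intro b p s c t hx ⟨hs1, hs2⟩
  refine ⟨fun h => by simp at h, fun P j S hl => ?_⟩
  rcases List.append_eq_append_iff.1 hl with ⟨a, ha, hs⟩ | ⟨a, ha, hs⟩
  · obtain ⟨p', s', rfl, h1, h2⟩ := hs2 a j S hs
    exact ⟨c :: p', s', rfl, fun h => by simp at h, h2⟩
  · cases a with
    | nil =>
      obtain ⟨p', s', rfl, h1, h2⟩ := hs2 [] j S (by simpa using hs.symm)
      exact ⟨c :: p', s', rfl, fun h => by simp at h, h2⟩
    | cons a A =>
      rw [List.cons_append, List.cons.injEq] at hs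
      obtain ⟨rfl, rfl⟩ := hs
      rcases add_apply_ne_zero hx with h1 | h1
      · have h2 := proj_bas_ne_zero h1
        rw [ha] at h2
        rcases P with _ | ⟨P, Q⟩
        · rw [List.nil_append, List.cons.injEq] at h2
          obtain ⟨rfl, rfl⟩ := h2
          exact ⟨[], t, rfl, fun _ => rfl, hs1⟩
        · simp at h2
      · exact absurd (ha ▸ (hφ _ _ h1).1) (not_noIdem P A j)

variable {φ : List BasisElt → Vec BasisElt}

/-- The inverse inherits from `φ` both the degrees and unitality, through `DegRel` and `KeepsIdem`.
If a list with an idempotent entry has `[x]` in its image, then it is `[x]` itself, where the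
nonlinear part vanishes. -/
theorem exists_inverse_mor (hφ : Adm 0 1 3 φ) : ∃ ψ, Adm 0 1 0 ψ ∧
    (∀ x, lin (coalg (mor ψ)) (lin (coalg (mor φ)) x) = x) ∧
      ∀ x, lin (coalg (mor φ)) (lin (coalg (mor ψ)) x) = x := by
  obtain ⟨g, h0, h1, h2, h3, h4⟩ := exists_inverse (mor_singleton hφ)
  have e : g = mor fun l => g l - proj (bas l) := by
    funext l
    rw [mor, add_sub_cancel]
  refine ⟨fun l => g l - proj (bas l), ?_, e ▸ h2, e ▸ h3⟩
  intro l x hx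
  have hl : l ≠ [x] := by
    rintro rfl
    beta_reduce at hx
    rw [h1, proj_bas_singleton, sub_self] at hx
    exact hx rfl
  have hg : coalg g l [x] ≠ 0 := by
    rw [← proj_apply, proj_coalg h0]
    rcases sub_apply_ne_zero hx with h | h
    · exact h
    · exact absurd (proj_bas_ne_zero h) hl
  have hK := h4 KeepsIdem (fun l => ⟨fun h => h, fun p j s h => ⟨p, s, h, id, id⟩⟩)
    (fun l m n h h' => ⟨fun hn => h.1 (h'.1 hn), fun p j s hl => by
      obtain ⟨p', s', h5, h6, h7⟩ := h.2 p j s hl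
      obtain ⟨p'', s'', h8, h9, h10⟩ := h'.2 p' j s' h5
      exact ⟨p'', s'', h8, fun h => h6 (h9 h), fun h => h7 (h10 h)⟩⟩) (keepsIdem_coalg hφ) l [x] hg
  have hD := h4 (fun l l' => l = l' ∨ DegRel 0 1 0 l l') (fun l => Or.inl rfl)
    (by
      rintro l m n (rfl | h) (rfl | h')
      · exact Or.inl rfl
      · exact Or.inr h'
      · exact Or.inr h
      · exact Or.inr ((h.trans h').mono (by norm_num) le_rfl))
    (fun l l' h => by
      by_cases hne : l = l'
      · exact Or.inl hne
      · refine Or.inr ((degRel_coalg_sub hφ l l' ?_).mono le_rfl (by norm_num))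
        rwa [Finsupp.sub_apply, Finsupp.single_eq_of_ne (Ne.symm hne), sub_zero]) l [x] hg
  refine ⟨fun j hj => ?_, hD.resolve_left hl⟩
  obtain ⟨p, s, hps⟩ := List.append_of_mem hj
  obtain ⟨p', s', h5, h6, h7⟩ := hK.2 p j s hps
  rcases p' with _ | ⟨a, p'⟩
  · rw [List.nil_append, List.cons.injEq] at h5
    refine hl ?_
    rw [hps, h6 rfl, h7 h5.2.symm, h5.1]
    rfl
  · simp at h5

/-- Multiply F D = D' F by the inverse of F on both sides and project. -/
theorem lin_mor_of_inverse {ψ c c' : List BasisElt → Vec BasisElt} (hφ : Adm 0 1 3 φ)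
    (hψ : Adm 0 1 0 ψ) (h1 : ∀ x, lin (coalg (mor ψ)) (lin (coalg (mor φ)) x) = x)
    (h2 : ∀ x, lin (coalg (mor φ)) (lin (coalg (mor ψ)) x) = x)
    (h : ∀ l, error (mor φ) c c' l = 0) (l : List BasisElt) :
    lin (mor ψ) (coder c' l) = lin c (coalg (mor ψ) l) := by
  have h0 := mor_nil (hφ.gr.even_zero [] (by simp))
  have h0' := mor_nil (hψ.gr.even_zero [] (by simp))
  have h3 : ∀ x, lin (coalg (mor φ)) (lin (coder c) x) =
      lin (coder c') (lin (coalg (mor φ)) x) := by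
    intro x
    have := defect_eq_zero (even_mor hφ.gr.even_zero) (fun l => (proj_defect h0 c c' l).trans (h l))
    rw [map_lin, map_lin]
    exact lin_congr fun l _ => sub_eq_zero.1 (this l)
  have h4 := h3 (coalg (mor ψ) l)
  have h5 := h2 (bas l)
  rw [lin_bas] at h5
  rw [h5, lin_bas] at h4
  rw [← proj_lin_coalg h0', ← h4, h1, proj_lin_coder]

end Inverse

end TorusAlgebra

/-! ### Tensors of vectors, and the sums `insertion` and `compose` in terms of cochains -/

namespace BarConstruction

noncomputable section Tensors

variable {B : Type} {N : Type*} [AddCommGroup N]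

/-- The tensor product of a list of vectors. -/
def tens : List (Vec B) → Ten B
  | [] => bas []
  | a :: l => cns a (tens l)

theorem lin_tens_cons (φ : List B → N) (a : Vec B) (l : List (Vec B)) :
    lin φ (tens (a :: l)) = lin (fun b => lin (fun t => φ (b :: t)) (tens l)) a := lin_cns _ _ _

theorem lin_tens_append (φ : List B → N) (p s : List (Vec B)) :
    lin φ (tens (p ++ s)) = lin (fun q => lin (fun t => φ (q ++ t)) (tens s)) (tens p) := by
  induction p generalizing φ with
  | nil => rw [tens, lin_bas]; rfl
  | cons a p ih =>
    rw [List.cons_append, lin_tens_cons, lin_tens_cons]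
    simp only [ih, List.cons_append]

theorem lin_sum_fun {ι : Type*} {X : Type} (s : Finset ι) (φ : ι → X → N) (v : X →₀ ℤ) :
    lin (fun x => ∑ i ∈ s, φ i x) v = ∑ i ∈ s, lin (φ i) v := by
  simp only [lin_apply, Finset.smul_sum]
  rw [Finset.sum_comm]

theorem tens_map_bas (l : List B) : tens (l.map bas) = bas l := by
  induction l with
  | nil => rfl
  | cons b l ih => rw [List.map_cons, tens, ih, cns_bas]

theorem forall_of_tens_ne_zero {l : List (Vec B)} {bs : List B} (h : tens l bs ≠ 0) :
    List.Forall₂ (fun a b => a b ≠ 0) l bs := by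
  induction l generalizing bs with
  | nil =>
    obtain rfl : bs = [] := by
      by_contra hne
      exact h (Finsupp.single_eq_of_ne hne)
    exact List.Forall₂.nil
  | cons a l ih =>
    obtain ⟨b, t, rfl, hb, ht⟩ := exists_of_cns_ne_zero h
    exact List.Forall₂.cons hb (ih ht)

theorem lin_splitSum_tens (Ψ : List B → List B → N) (l : List (Vec B)) :
    lin (fun bs => splitSum bs Ψ) (tens l) = splitSum l fun p s => bil Ψ (tens p) (tens s) := by
  change copair Ψ (tens l) = _
  induction l generalizing Ψ with
  | nil => simp [tens, bil]
  | cons a l ih =>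
    rw [tens, copair_cns, ih, splitSum_cons]
    congr 1
    · rw [tens, bil_bas_nil]; rfl
    · refine splitSum_congr fun p s _ => ?_
      rw [tens, copair_congr_lin]

theorem lin_coder (φ : List B → N) (c : List B → Vec B) (l : List B) :
    lin φ (coder c l) = splitSum l fun p t => splitSum t fun q s =>
      (-1 : ℤ) ^ p.length • lin (fun x => φ (p ++ x :: s)) (c q) := by
  have hp : ∀ (φ : List B → N) (l : List B), lin φ (applyPrefix c l) =
      splitSum l fun q s => lin (fun x => φ (x :: s)) (c q) := by
    intro φ l
    rw [applyPrefix, map_splitSum]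
    simp only [cns_bas_right, map_lin, lin_bas]
  induction l generalizing φ with
  | nil => simp [coder_nil, hp]
  | cons b l ih =>
    rw [coder_cons, map_sub, hp, cns_bas_left, map_lin]
    simp only [lin_bas]
    rw [ih, splitSum_cons b l fun p t => _, sub_eq_add_neg, ← splitSum_neg]
    simp only [← splitSum_neg]
    congr 1
    · simp [splitSum_cons]
    · simp [pow_succ]

theorem lin_lin_coder (φ : List B → N) (c : List B → Vec B) (l : List (Vec B)) :
    lin (fun bs => lin φ (coder c bs)) (tens l) = splitSum l fun p t => splitSum t fun q s =>
      (-1 : ℤ) ^ p.length • lin φ (tens (p ++ lin c (tens q) :: s)) := by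
  simp only [lin_coder]
  rw [lin_splitSum_tens]
  refine splitSum_congr fun p t _ => ?_
  rw [bil]
  simp only [lin_splitSum_tens]
  rw [lin_splitSum]
  refine splitSum_congr fun q s _ => ?_
  rw [lin_tens_append, ← lin_smul_fun]
  refine lin_congr fun pb hpb => ?_
  rw [bil, lin_tens_cons, (forall_of_tens_ne_zero hpb).length_eq, map_lin]
  simp only [lin_smul_fun]
  exact congrArg _ (lin_congr fun qb _ => lin_comm _ _ _)

theorem tens_eq_zero {l : List (Vec B)} (h : (0 : Vec B) ∈ l) : tens l = 0 := by
  induction l with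
  | nil => simp at h
  | cons a l ih =>
    rw [tens]
    rcases List.mem_cons.1 h with rfl | h
    · rw [map_zero, LinearMap.zero_apply]
    · rw [ih h, map_zero]

end Tensors

noncomputable section Insertion

variable {B : Type}

/-- The inner operation vanishes for odd `s`, so the sign `(-1)^(r + st)` reduces to the sign
`(-1)^r` of the coderivation. -/
theorem insertion_eq {f g : ℕ → List (Vec B) → Vec B} {F G : ℕ → List B → Vec B}
    (hf : ∀ w l, f w l = lin (F w) (tens l)) (hg : ∀ w l, g w l = lin (G w) (tens l))
    (hG : ∀ w l, Odd l.length → G w l = 0) (w : ℕ) (l : List (Vec B)) :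
    WeightedAInf.insertion f g w l = lin (fun bs => ∑ p ∈ Finset.HasAntidiagonal.antidiagonal w,
      lin (F p.1) (coder (G p.2) bs)) (tens l) := by
  have h0 : ∀ w l, Odd l.length → g w l = 0 := by
    intro w l hl
    rw [hg]
    refine lin_eq_zero fun bs hbs => hG w bs ?_
    rwa [← (forall_of_tens_ne_zero hbs).length_eq]
  rw [lin_sum_fun, WeightedAInf.insertion]
  refine Finset.sum_congr rfl fun u _ => ?_
  rw [lin_lin_coder, splitSum_eq_sum]
  refine Finset.sum_congr rfl fun r hr => ?_
  rw [splitSum_eq_sum, List.length_drop]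
  refine Finset.sum_congr rfl fun s hs => ?_
  rw [Finset.mem_range] at hr hs
  rw [← hf, ← hg, List.drop_drop, List.length_take, min_eq_left (by omega)]
  rcases Nat.even_or_odd s with he | ho
  · rw [pow_add, (he.mul_right _).neg_one_pow, mul_one]
  · rw [h0 _ ((l.drop r).take s) (by rwa [List.length_take, List.length_drop,
      min_eq_left (by omega)]), hf, tens_eq_zero (by simp), map_zero, smul_zero, smul_zero]

end Insertion

noncomputable section Composition

open WeightedAInf

variable {B : Type} {N : Type*} [AddCommGroup N]

theorem sum_antidiagonalTuple_succ (m n : ℕ) (Θ : (Fin (m + 1) → ℕ) → N) :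
    ∑ i ∈ Finset.Nat.antidiagonalTuple (m + 1) n, Θ i =
      ∑ p ∈ Finset.HasAntidiagonal.antidiagonal n,
        ∑ j ∈ Finset.Nat.antidiagonalTuple m p.2, Θ (Fin.cons p.1 j) := by
  rw [Finset.sum_sigma']
  refine Finset.sum_bij' (fun i _ => ⟨(i 0, ∑ k, i (Fin.succ k)), fun k => i (Fin.succ k)⟩)
    (fun x _ => Fin.cons x.1.1 x.2) ?_ ?_ ?_ ?_ ?_
  · intro i hi
    rw [Finset.Nat.mem_antidiagonalTuple, Fin.sum_univ_succ] at hi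
    simp [Finset.Nat.mem_antidiagonalTuple, hi]
  · rintro ⟨⟨a, b⟩, j⟩ hx
    simp only [Finset.mem_sigma, Finset.HasAntidiagonal.mem_antidiagonal,
      Finset.Nat.mem_antidiagonalTuple] at hx
    simp [Finset.Nat.mem_antidiagonalTuple, Fin.sum_univ_succ, hx.1, hx.2]
  · intro i _
    exact Fin.cons_self_tail i
  · rintro ⟨⟨a, b⟩, j⟩ hx
    simp only [Finset.mem_sigma, Finset.HasAntidiagonal.mem_antidiagonal,
      Finset.Nat.mem_antidiagonalTuple] at hx
    simp [hx.2]
  · intro i _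
    exact congrArg Θ (Fin.cons_self_tail i).symm

theorem block_cons_zero {A : Type*} {m : ℕ} (l : List A) (a : ℕ) (j : Fin m → ℕ) :
    block l (Fin.cons a j : Fin (m + 1) → ℕ) 0 = l.take a := by
  simp [block]

theorem block_cons_succ {A : Type*} {m : ℕ} (l : List A) (a : ℕ) (j : Fin m → ℕ) (k : Fin m) :
    block l (Fin.cons a j : Fin (m + 1) → ℕ) k.succ = block (l.drop a) j k := by
  have h : ∑ x ∈ Finset.univ.filter (· < k.succ), (Fin.cons a j : Fin (m + 1) → ℕ) x =
      a + ∑ x ∈ Finset.univ.filter (· < k), j x := by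
    rw [Finset.sum_filter, Finset.sum_filter, Fin.sum_univ_succ, if_pos (Fin.succ_pos k)]
    simp
  rw [block, block, h, Fin.cons_succ, List.drop_drop]

theorem length_block {A : Type*} {m : ℕ} {l : List A} {i : Fin m → ℕ} (h : ∑ k, i k = l.length)
    (k : Fin m) : (block l i k).length = i k := by
  have h1 : ∑ j ∈ Finset.univ.filter (· < k), i j + i k ≤ l.length := by
    rw [← h, add_comm, ← Finset.sum_insert (s := Finset.univ.filter (· < k)) (by simp)]
    exact Finset.sum_le_sum_of_subset (Finset.subset_univ _)
  rw [block, List.length_take, List.length_drop, min_eq_left (by omega)]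

/-- The sum over all ways of cutting a list in `m` blocks, and of distributing the weight. -/
def cutSum {A : Type*} (Φ : List A → N) (f : ℕ → List A → A) (w : ℕ) (l : List A) (m : ℕ) : N :=
  ∑ i ∈ Finset.Nat.antidiagonalTuple m l.length, ∑ v ∈ Finset.Nat.antidiagonalTuple m w,
    Φ (List.ofFn fun k : Fin m => f (v k) (block l i k))

theorem cutSum_zero {A : Type*} (Φ : List A → N) (f : ℕ → List A → A) (w : ℕ) (l : List A) :
    cutSum Φ f w l 0 = if l = [] ∧ w = 0 then Φ [] else 0 := by
  cases l <;> cases w <;> simp [cutSum]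

theorem cutSum_succ {A : Type*} (Φ : List A → N) (f : ℕ → List A → A) (w : ℕ) (l : List A)
    (m : ℕ) : cutSum Φ f w l (m + 1) = splitSum l fun p s =>
      ∑ q ∈ Finset.HasAntidiagonal.antidiagonal w, cutSum (fun t => Φ (f q.1 p :: t)) f q.2 s m := by
  rw [cutSum, sum_antidiagonalTuple_succ, Finset.Nat.sum_antidiagonal_eq_sum_range_succ_mk,
    splitSum_eq_sum]
  refine Finset.sum_congr rfl fun r hr => ?_
  simp only [sum_antidiagonalTuple_succ, cutSum, List.length_drop, List.ofFn_succ, Fin.cons_zero,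
    Fin.cons_succ, block_cons_zero, block_cons_succ]
  rw [Finset.sum_comm]

variable {f : ℕ → List (Vec B) → Vec B} {F : ℕ → List B → Vec B} {K : ℕ → List B → Ten B}

/-- Empty blocks contribute zero because `F w []` vanishes. So at most as many blocks as inputs
occur, and cutting off the first block reproduces the recursion for `K`. -/
theorem sum_cutSum (hf : ∀ w l, f w l = lin (F w) (tens l)) (hF : ∀ w, F w [] = 0)
    (h0 : ∀ w, K w [] = if w = 0 then bas [] else 0)
    (h1 : ∀ w b l, K w (b :: l) = splitSum l fun p s =>
      ∑ q ∈ Finset.HasAntidiagonal.antidiagonal w, cns (F q.1 (b :: p)) (K q.2 s))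
    (n : ℕ) (φ : List B → N) (w : ℕ) (l : List (Vec B)) (hl : l.length ≤ n) :
    ∑ m ∈ Finset.range (n + 1), cutSum (fun t => lin φ (tens t)) f w l m =
      lin (fun bs => lin φ (K w bs)) (tens l) := by
  have hnil : ∀ w, f w [] = 0 := fun w => by rw [hf, tens, lin_bas, hF]
  have hz : ∀ (φ : List B → N) w l m, cutSum (fun t => lin φ (tens (0 :: t))) f w l m = 0 := by
    intro φ w l m
    simp [cutSum, tens]
  induction n generalizing φ w l with
  | zero =>
    obtain rfl := List.length_eq_zero_iff.1 (Nat.le_zero.1 hl)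
    rw [Finset.sum_range_one, cutSum_zero, tens, lin_bas, lin_bas, h0]
    by_cases hw : w = 0 <;> simp [hw]
  | succ n ih =>
    rw [Finset.sum_range_succ', cutSum_zero]
    simp only [cutSum_succ]
    cases l with
    | nil =>
      simp only [splitSum_nil, hnil, hz, Finset.sum_const_zero]
      rw [tens, lin_bas, lin_bas, h0]
      by_cases hw : w = 0 <;> simp [hw]
    | cons a l =>
      rw [if_neg (by simp), add_zero, ← splitSum_finset_sum, splitSum_cons]
      simp only [hnil, hz, Finset.sum_const_zero, zero_add]
      have e1 : ∀ (p s : List (Vec B)) (q : ℕ × ℕ), s.length ≤ n →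
          ∑ m ∈ Finset.range (n + 1),
            cutSum (fun t => lin φ (tens (f q.1 (a :: p) :: t))) f q.2 s m =
          lin (fun b => lin (fun pb => lin (fun sb => lin φ (cns (F q.1 (b :: pb)) (K q.2 sb)))
            (tens s)) (tens p)) a := by
        intro p s q hs
        have e2 : ∀ v x, lin φ (cns v x) = lin (fun t => lin (fun b => φ (b :: t)) v) x :=
          fun v x => by rw [lin_cns, lin_comm]
        have e3 : ∀ v, lin (fun sb => lin φ (cns v (K q.2 sb))) (tens s) =
            lin (fun b => lin (fun sb => lin (fun t => φ (b :: t)) (K q.2 sb)) (tens s)) v := by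
          intro v
          simp only [lin_cns]
          exact lin_comm _ _ _
        have e4 : ∀ m, cutSum (fun t => lin φ (tens (f q.1 (a :: p) :: t))) f q.2 s m =
            cutSum (fun t => lin (fun t => lin (fun b => φ (b :: t)) (f q.1 (a :: p))) (tens t))
              f q.2 s m := by
          intro m
          simp only [tens, e2]
        simp only [e4]
        rw [ih _ _ _ hs]
        simp only [← e2, e3]
        rw [hf, lin_tens_cons, map_lin]
        exact lin_congr fun b _ => map_lin _ _ _
      rw [lin_tens_cons]
      simp only [h1, map_splitSum, map_sum, lin_splitSum_tens]
      rw [lin_splitSum]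
      refine splitSum_congr fun p s hps => ?_
      rw [Finset.sum_comm]
      have hs : s.length ≤ n := by
        rw [← hps, List.length_cons, List.length_append] at hl
        omega
      simp only [bil, lin_sum_fun]
      exact Finset.sum_congr rfl fun q _ => e1 p s q hs

theorem compose_eq {g : ℕ → List (Vec B) → Vec B} {G : ℕ → List B → Vec B}
    (hg : ∀ w l, g w l = lin (G w) (tens l)) (hf : ∀ w l, f w l = lin (F w) (tens l))
    (hF : ∀ w l, Even l.length → F w l = 0) (h0 : ∀ w, K w [] = if w = 0 then bas [] else 0)
    (h1 : ∀ w b l, K w (b :: l) = splitSum l fun p s =>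
      ∑ q ∈ Finset.HasAntidiagonal.antidiagonal w, cns (F q.1 (b :: p)) (K q.2 s))
    (w : ℕ) (l : List (Vec B)) : compose g f w l =
      lin (fun bs => ∑ q ∈ Finset.HasAntidiagonal.antidiagonal w, lin (G q.1) (K q.2 bs)) (tens l) := by
  have hf0 : ∀ w l, Even l.length → f w l = 0 := by
    intro w l hl
    rw [hf]
    refine lin_eq_zero fun bs hbs => hF w bs ?_
    rwa [← (forall_of_tens_ne_zero hbs).length_eq]
  have e1 : ∀ m, ∑ i ∈ Finset.Nat.antidiagonalTuple m l.length,
      ∑ v ∈ Finset.Nat.antidiagonalTuple (m + 1) w,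
      (-1 : ℤ) ^ (∑ k : Fin m, (m - 1 - (k : ℕ)) * (i k + 1)) •
        g (v 0) (List.ofFn fun k : Fin m => f (v k.succ) (block l i k)) =
      ∑ q ∈ Finset.HasAntidiagonal.antidiagonal w,
        cutSum (fun t => lin (G q.1) (tens t)) f q.2 l m := by
    intro m
    simp only [cutSum]
    rw [eq_comm, Finset.sum_comm]
    refine Finset.sum_congr rfl fun i hi => ?_
    rw [sum_antidiagonalTuple_succ, eq_comm]
    refine Finset.sum_congr rfl fun q _ => Finset.sum_congr rfl fun v _ => ?_
    simp only [Fin.cons_zero, Fin.cons_succ, hg]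
    -- If all blocks are odd then every summand of the exponent is even, and otherwise the term
    -- vanishes. So the composition has no signs.
    by_cases ho : ∀ k, Odd (i k)
    · rw [Even.neg_one_pow, one_smul]
      exact Finset.even_sum _ fun k _ => (ho k).add_one.mul_left _
    · push Not at ho
      obtain ⟨k, hk⟩ := ho
      rw [tens_eq_zero, map_zero, smul_zero]
      rw [List.mem_ofFn]
      refine ⟨k, hf0 _ _ ?_⟩
      rw [length_block (Finset.Nat.mem_antidiagonalTuple.1 hi)]
      exact Nat.not_odd_iff_even.1 hk
  rw [compose]
  simp only [e1]
  rw [Finset.sum_comm, lin_sum_fun]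
  exact Finset.sum_congr rfl fun q _ =>
    sum_cutSum hf (fun w => hF w [] (by simp)) h0 h1 _ _ _ _ (by omega)

end Composition

end BarConstruction

/-! ### Multilinear maps and scalars -/

namespace BarConstruction

noncomputable section Multilinear

variable {B : Type} {N : Type*} [AddCommGroup N]

theorem lin_tens_add (φ : List B → N) (p s : List (Vec B)) (a b : Vec B) :
    lin φ (tens (p ++ (a + b) :: s)) = lin φ (tens (p ++ a :: s)) + lin φ (tens (p ++ b :: s)) := by
  simp only [lin_tens_append, lin_tens_cons, map_add, lin_add_fun]

/-- A multilinear function is determined by its values on basis elements. -/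
theorem eq_lin_tens {f : List (Vec B) → N} (hf : ∀ (p s : List (Vec B)) (a b : Vec B),
    f (p ++ (a + b) :: s) = f (p ++ a :: s) + f (p ++ b :: s)) (l : List (Vec B)) :
    f l = lin (fun bs => f (bs.map bas)) (tens l) := by
  have key : ∀ (l p : List (Vec B)), f (p ++ l) = lin (fun bs => f (p ++ bs.map bas)) (tens l) := by
    intro l
    induction l with
    | nil => intro p; rw [tens, lin_bas]; rfl
    | cons a l ih =>
      intro p
      have h : f (p ++ a :: l) = lin (fun b => f (p ++ bas b :: l)) a :=
        linear_ext_apply (AddMonoidHom.toIntLinearMap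
          (AddMonoidHom.mk' (fun a => f (p ++ a :: l)) (hf p l)))
          (lin _) (fun b => by rw [lin_bas]; rfl) a
      rw [h, lin_tens_cons]
      refine lin_congr fun b _ => ?_
      have := ih (p ++ [bas b])
      simp only [List.append_assoc, List.singleton_append] at this
      exact this
  exact key l []

/-- Multiplication of basis elements by scalars. -/
def scaleMap (r : B → ℤ) : Vec B →ₗ[ℤ] Vec B := lin fun b => r b • bas b

theorem scaleMap_apply (r : B → ℤ) (a : Vec B) (x : B) : scaleMap r a x = r x * a x := by
  classical
  refine linear_ext_apply (Finsupp.lapply x ∘ₗ scaleMap r) (r x • Finsupp.lapply x) (fun b => ?_) a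
  by_cases h : b = x <;> simp [scaleMap, h]

theorem lin_scaleMap (φ : B → N) (r : B → ℤ) (a : Vec B) :
    lin φ (scaleMap r a) = lin (fun b => r b • φ b) a := by
  rw [scaleMap, map_lin]
  simp only [map_smul, lin_bas]

variable {c : List B → Vec B} {r r' : B → ℤ}

theorem lin_tens_balanced (h : ∀ p x y s, c (p ++ x :: y :: s) ≠ 0 → r x = r' y)
    (p s : List (Vec B)) (a b : Vec B) : lin c (tens (p ++ scaleMap r a :: b :: s)) =
      lin c (tens (p ++ a :: scaleMap r' b :: s)) := by
  simp only [lin_tens_append, lin_tens_cons, lin_scaleMap]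
  refine lin_congr fun q _ => lin_congr fun x _ => ?_
  rw [← lin_smul_fun]
  refine lin_congr fun y _ => ?_
  rw [← lin_smul_fun, ← lin_smul_fun]
  refine lin_congr fun t _ => ?_
  by_cases h0 : c (q ++ x :: y :: t) = 0
  · rw [h0, smul_zero, smul_zero]
  · rw [h _ _ _ _ h0]

theorem lin_tens_left (h : ∀ b l x, c (b :: l) x ≠ 0 → r b = r' x) (a : Vec B)
    (l : List (Vec B)) : lin c (tens (scaleMap r a :: l)) = scaleMap r' (lin c (tens (a :: l))) := by
  simp only [lin_tens_cons, lin_scaleMap, map_lin]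
  refine lin_congr fun b _ => ?_
  rw [← lin_smul_fun]
  refine lin_congr fun t _ => ?_
  ext x
  rw [scaleMap_apply, Finsupp.smul_apply, smul_eq_mul]
  by_cases h0 : c (b :: t) x = 0
  · rw [h0, mul_zero, mul_zero]
  · rw [h _ _ _ h0]

theorem lin_tens_right (h : ∀ p b x, c (p ++ [b]) x ≠ 0 → r b = r' x) (a : Vec B)
    (p : List (Vec B)) : lin c (tens (p ++ [scaleMap r a])) =
      scaleMap r' (lin c (tens (p ++ [a]))) := by
  simp only [lin_tens_append, lin_tens_cons, lin_scaleMap, map_lin]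
  simp only [tens, lin_bas]
  refine lin_congr fun q _ => lin_congr fun b _ => ?_
  ext x
  rw [scaleMap_apply, Finsupp.smul_apply, smul_eq_mul]
  by_cases h0 : c (q ++ [b]) x = 0
  · rw [h0, mul_zero, mul_zero]
  · rw [h _ _ _ h0]

end Multilinear

end BarConstruction

/-! ### Bimodule maps, homogeneity and units for maps given by cochains -/

namespace TorusAlgebra

open BarConstruction WeightedAInf

noncomputable section Operations

/-- The multilinear map with given values on basis elements. -/
def ofCochain (c : List BasisElt → Vec BasisElt) (l : List Alg) : Alg := lin c (tens l)

theorem undef_eq : undef = ofCochain und := by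
  have key : ∀ (l : List Alg) (F : List BasisElt → Alg),
      extend F l = lin (N := Vec BasisElt) F (tens (B := BasisElt) l) := by
    intro l
    induction l with
    | nil => intro F; exact (lin_bas (N := Vec BasisElt) F []).symm
    | cons a l ih =>
      intro F
      refine Eq.trans (b := lin (N := Vec BasisElt) (X := BasisElt)
        (fun b => extend (fun bs => F (b :: bs)) l) a) rfl ?_
      exact (lin_congr fun b _ => ih _).trans (lin_tens_cons (N := Vec BasisElt) F a l).symm
  funext l
  exact key l _

theorem left_smul (k : Ground) (a : Alg) : k • a = scaleMap (fun b : BasisElt => k b.2.left) a :=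
  alg_ext fun b => (scaleMap_apply (fun b : BasisElt => k b.2.left) a b).symm

theorem right_smul (k : Ground) (a : Alg) :
    a <• k = scaleMap (fun b : BasisElt => k b.2.right) a :=
  alg_ext fun b => (scaleMap_apply (fun b : BasisElt => k b.2.right) a b).symm

/-- The inputs with nonzero value are composable. -/
def Composable (c : List BasisElt → Vec BasisElt) : Prop :=
  ∀ l x, c l x ≠ 0 → IsPath x.2.left l x.2.right

variable {c : List BasisElt → Vec BasisElt}

/-- On basis elements the ground ring acts through left and right idempotents, so each bimodule
axiom compares two adjacent vertices of the path. -/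
theorem isTensorMap_ofCochain (h : Composable c) : IsTensorMap Ground (ofCochain c) where
  add p s a b := lin_tens_add c p s a b
  balanced p s a b k := by
    rw [left_smul, right_smul]
    refine lin_tens_balanced (fun p x y s h0 => ?_) p s a b
    obtain ⟨z, hz⟩ := Finsupp.ne_iff.1 h0
    obtain ⟨i, -, -, h2, -⟩ := isPath_append.1 (h _ z hz)
    exact congrArg k h2.symm
  left l a k := by
    rw [left_smul, left_smul]
    exact lin_tens_left (fun b l x h0 => congrArg k (h _ x h0).1) a l
  right l a k := by
    rw [right_smul, right_smul]
    refine lin_tens_right (fun p b x h0 => ?_) a l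
    obtain ⟨i, -, -, h2⟩ := isPath_append.1 (h _ x h0)
    exact congrArg k h2
  empty k := by
    rw [left_smul, right_smul]
    refine alg_ext fun x => ?_
    have e : ofCochain c [] = c [] := lin_bas _ _
    refine (scaleMap_apply _ _ x).trans (Eq.trans ?_ (scaleMap_apply _ _ x).symm)
    by_cases h0 : c [] x = 0
    · rw [e, h0, mul_zero, mul_zero]
    · have : x.2.left = x.2.right := h [] x h0
      rw [this]

theorem gam_of_tens_ne_zero {l : List (Gam × Vec BasisElt)}
    (hl : ∀ p ∈ l, ∀ b, p.2 b ≠ 0 → gamma b = p.1) {bs : List BasisElt}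
    (h : tens (l.map Prod.snd) bs ≠ 0) : gam bs = (l.map Prod.fst).prod := by
  have h' := forall_of_tens_ne_zero h
  clear h
  induction l generalizing bs with
  | nil =>
    rw [List.map_nil, List.forall₂_nil_left_iff] at h'
    rw [h']
    rfl
  | cons a l ih =>
    rw [List.map_cons, List.forall₂_cons_left_iff] at h'
    obtain ⟨b, t, hb, ht, rfl⟩ := h'
    rw [gam_cons, List.map_cons, List.prod_cons, ih (fun p hp => hl p (by simp [hp])) ht,
      hl a (by simp) b hb]

theorem isHomogeneousMap_ofCochain {C : ℕ → Gam}
    (h : ∀ l x, c l x ≠ 0 → gam [x] = C l.length * gam l) :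
    IsHomogeneousMap homog C (ofCochain c) := by
  intro l hl x hx
  obtain ⟨bs, h1, h2⟩ := exists_of_lin_ne_zero (show lin c (tens (l.map Prod.snd)) x ≠ 0 from hx)
  have h3 := h bs x h2
  have h4 : l.length = bs.length :=
    (List.length_map Prod.snd).symm.trans (forall_of_tens_ne_zero h1).length_eq
  rw [← h4, gam_singleton] at h3
  exact h3.trans (congrArg _ (gam_of_tens_ne_zero (fun p hp b hb => hl p hp b hb) h1))

theorem smul_one_apply (k : Ground) : k • (1 : Alg) =
    (k 0 • bas (0, .idem 0) + k 1 • bas (0, .idem 1) : Vec BasisElt) := by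
  have e : (1 : Alg) = (bas (0, .idem 0) + bas (0, .idem 1) : Vec BasisElt) := rfl
  rw [left_smul, e, map_add, scaleMap, lin_bas, lin_bas]
  rfl

theorem exists_idem_of_unit {l : List Alg} {bs : List BasisElt} {k : Ground}
    (hk : k • (1 : Alg) ∈ l) (h : tens (B := BasisElt) l bs ≠ 0) : ¬ NoIdem bs := by
  have h' := forall_of_tens_ne_zero h
  clear h
  induction l generalizing bs with
  | nil => simp at hk
  | cons a l ih =>
    obtain ⟨b, t, hb, ht, rfl⟩ := List.forall₂_cons_left_iff.1 h'
    rcases List.mem_cons.1 hk with rfl | hk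
    · rw [smul_one_apply] at hb
      intro hN
      have : ∀ j, b ≠ (0, .idem j) := fun j hj => hN j (by simp [hj])
      rw [Finsupp.add_apply, Finsupp.smul_apply, Finsupp.smul_apply,
        Finsupp.single_eq_of_ne (this 0), Finsupp.single_eq_of_ne (this 1)] at hb
      simp at hb
    · exact fun hN => ih hk ht fun j hj => hN j (by simp [hj])

theorem ofCochain_unit {l : List Alg} (h : ∀ bs x, bs.length = l.length → c bs x ≠ 0 → NoIdem bs)
    (hk : ∃ k : Ground, k • (1 : Alg) ∈ l) : ofCochain c l = 0 := by
  obtain ⟨k, hk⟩ := hk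
  refine lin_eq_zero fun bs hbs => Finsupp.ext fun x => ?_
  by_contra hx
  exact exists_idem_of_unit hk hbs (h bs x (forall_of_tens_ne_zero hbs).length_eq.symm hx)

theorem lin_und_unit_right (a : Vec BasisElt) (k : Ground) :
    lin und (tens [a, k 0 • bas (0, .idem 0) + k 1 • bas (0, .idem 1)]) =
      scaleMap (fun b => k b.2.right) a := by
  simp only [lin_tens_cons, map_add, map_smul, lin_bas]
  simp only [tens, lin_bas, und_pair]
  refine lin_congr fun x _ => ?_
  rcases (by decide : ∀ j : Fin 2, j = 0 ∨ j = 1) x.2.right with h | h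
  · rw [mulV_idem_right 0 h, mulV_of_mul_none (y := (0, .idem 1))]
    · simp [h]
    · rw [Basic.mul_idem, if_neg (by simp [h])]
  · rw [mulV_idem_right 0 h, mulV_of_mul_none (y := (0, .idem 0))]
    · simp [h]
    · rw [Basic.mul_idem, if_neg (by simp [h])]

theorem lin_und_unit_left (a : Vec BasisElt) (k : Ground) :
    lin und (tens [k 0 • bas (0, .idem 0) + k 1 • bas (0, .idem 1), a]) =
      scaleMap (fun b => k b.2.left) a := by
  simp only [lin_tens_cons, map_add, map_smul, lin_bas]
  simp only [tens, lin_bas, und_pair, ← lin_smul_fun, ← lin_add_fun]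
  refine lin_congr fun x _ => ?_
  rcases (by decide : ∀ j : Fin 2, j = 0 ∨ j = 1) x.2.left with h | h
  · rw [mulV_idem_left 0 h, mulV_of_mul_none (x := (0, .idem 1))]
    · simp [h]
    · rw [Basic.idem_mul, if_neg (by simp [h])]
  · rw [mulV_idem_left 0 h, mulV_of_mul_none (x := (0, .idem 0))]
    · simp [h]
    · rw [Basic.idem_mul, if_neg (by simp [h])]

theorem undef_mul_unit (a : Alg) (k : Ground) : undef [a, k • (1 : Alg)] = a <• k := by
  rw [undef_eq, right_smul]
  exact (congrArg (fun u : Vec BasisElt => lin und (tens [a, u])) (smul_one_apply k)).trans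
    (lin_und_unit_right a k)

theorem undef_unit_mul (a : Alg) (k : Ground) : undef [k • (1 : Alg), a] = k • a := by
  rw [undef_eq]
  exact (congrArg (fun u : Vec BasisElt => lin und (tens [u, a])) (smul_one_apply k)).trans
    ((lin_und_unit_left a k).trans (left_smul k a).symm)

end Operations

end TorusAlgebra

/-! ### Passing between deformations and their total cochains -/

namespace TorusAlgebra

open BarConstruction WeightedAInf

noncomputable section Deformations

theorem DegRel.of_winding {d k : ℤ} {w n : ℕ} {l l' : List BasisElt} (h : DegRel d w k l l')
    (hn : winding l' = winding l + n) :
    DegRel d n k l l' ∧ gam l' = shift ((l.length : ℤ) - l'.length + d) n * gam l := by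
  obtain ⟨h1, h2, v, h3, h4, h5⟩ := h
  have h6 := winding_eq h5
  obtain rfl : v = n := by omega
  exact ⟨⟨h1, h2, v, le_rfl, h4, h5⟩, h5⟩

theorem gam_of_part_ne_zero {d k : ℤ} {w v : ℕ} {c : List BasisElt → Vec BasisElt}
    (hc : Gr d w k c) {l : List BasisElt} {x : BasisElt} (h : part v c l x ≠ 0) :
    gam [x] = shift ((l.length : ℤ) - 1 + d) v * gam l := by
  obtain ⟨h1, h2⟩ := part_ne_zero h
  simpa using ((hc l x h2).of_winding h1).2

theorem composable_part {d k : ℤ} {w : ℕ} {c : List BasisElt → Vec BasisElt} (hc : Gr d w k c)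
    (v : ℕ) : Composable (part v c) := fun _ _ h => hc.path (part_ne_zero h).2

theorem winding_of_und_ne_zero {l : List BasisElt} {x : BasisElt} (h : und l x ≠ 0) :
    winding [x] = winding l := by
  rw [und_eq] at h
  rcases add_apply_ne_zero h with h | h
  · rcases l with _ | ⟨y, _ | ⟨z, _ | ⟨t, l⟩⟩⟩
    · exact absurd rfl h
    · exact absurd rfl h
    · obtain ⟨h1, h2⟩ := mulV_ne_zero h
      rw [winding, winding, gam_singleton, gamma_mul h1 h2, gam_cons, gam_singleton]
    · exact absurd rfl h
  · simpa using winding_eq (gam_of_high_ne_zero h)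

section

variable {a c : List BasisElt → Vec BasisElt} {d k : ℤ}

theorem part_zero_add (ha : ∀ l x, a l x ≠ 0 → winding [x] = winding l) (hc : Gr d 1 k c)
    (l : List BasisElt) : part 0 (fun l => a l + c l) l = a l := by
  ext x
  rw [part, wcomp_apply, Finsupp.add_apply]
  have h1 : winding [x] = winding l + (0 : ℕ) → c l x = 0 := by
    intro h
    by_contra hx
    have := (hc l x hx).winding_le
    omega
  split_ifs with h
  · rw [h1 h, add_zero]
  · by_contra hx
    exact h (by rw [ha l x (Ne.symm hx)]; simp)

theorem part_pos_add (ha : ∀ l x, a l x ≠ 0 → winding [x] = winding l) {w : ℕ} (hw : w ≠ 0)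
    {l : List BasisElt} {x : BasisElt} (h : part w (fun l => a l + c l) l x ≠ 0) : c l x ≠ 0 := by
  obtain ⟨h1, h2⟩ := part_ne_zero h
  refine (add_apply_ne_zero h2).resolve_left fun h3 => hw ?_
  have := ha l x h3
  omega

end

variable {e : List BasisElt → Vec BasisElt}

theorem total_eq_und (e : List BasisElt → Vec BasisElt) : total e = fun l => und l + e l := by
  funext l
  rw [total, und_eq, add_assoc]

theorem gr_total (he : Adm (-1) 1 2 e) : Gr (-1) 0 1 (total e) := by
  rw [total_eq_und]
  exact gr_und.add (he.gr.mono (by norm_num) (by norm_num))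

theorem part_zero_total (he : Adm (-1) 1 2 e) : part 0 (total e) = und := by
  rw [total_eq_und]
  funext l
  exact part_zero_add (fun l x => winding_of_und_ne_zero) he.gr l

theorem noIdem_of_part_total (he : Adm (-1) 1 2 e) {w : ℕ} {l : List BasisElt} {x : BasisElt}
    (h : part w (total e) l x ≠ 0) (hw : ¬ (w = 0 ∧ l.length = 2)) : NoIdem l := by
  by_cases hw0 : w = 0
  · subst hw0
    rw [part_zero_total he, und_of_length fun h => hw ⟨rfl, h⟩] at h
    exact (adm_high l x h).1
  · rw [total_eq_und] at h
    exact (he l x (part_pos_add (fun l x => winding_of_und_ne_zero) hw0 h)).1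

theorem curvatureElt_eq : curvatureElt = curv := by
  rw [curv]
  exact (show (bas (0, .reeb 1 3) + bas (0, .reeb 2 3) + bas (0, .reeb 3 3) +
    bas (0, .reeb 0 3) : Vec BasisElt) = bas (0, .reeb 0 3) + bas (0, .reeb 1 3) +
      bas (0, .reeb 2 3) + bas (0, .reeb 3 3) by abel).trans
    (Fin.sum_univ_four fun j : ZMod 4 => (bas (0, .reeb j 3) : Vec BasisElt)).symm

theorem insertion_ofCochain {d k : ℤ} {c : List BasisElt → Vec BasisElt} (hc : Gr d 0 k c)
    (he : Adm (-1) 1 2 e) (w : ℕ) (l : List Alg) :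
    insertion (fun w => ofCochain (part w c)) (fun w => ofCochain (part w (total e))) w l =
      ofCochain (part w fun l => lin c (coder (total e) l)) l := by
  refine (insertion_eq (fun _ _ => rfl) (fun _ _ => rfl)
    (fun w l hl => part_eq_zero (total_odd he l hl)) w l).trans ?_
  exact lin_congr fun bs _ => sum_lin_coder hc (gr_total he) w bs

theorem compose_ofCochain {d k : ℤ} {c f : List BasisElt → Vec BasisElt} (hc : Gr d 0 k c)
    (hf : Gr 0 0 0 f) (w : ℕ) (l : List Alg) :
    compose (fun w => ofCochain (part w c)) (fun w => ofCochain (part w f)) w l =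
      ofCochain (part w fun l => lin c (coalg f l)) l := by
  refine (compose_eq (G := fun w => part w c) (F := fun w => part w f)
    (K := fun w => tenPart w (coalg f)) (fun _ _ => rfl) (fun _ _ => rfl)
    (fun w l hl => part_eq_zero (hf.even_zero l hl)) (fun w => tenPart_coalg_nil w)
    (tenPart_coalg_cons hf) w l).trans ?_
  exact lin_congr fun bs _ => sum_lin_coalg hc hf w bs

theorem ofCochain_eq_zero {c : List BasisElt → Vec BasisElt} {l : List Alg}
    (h : ∀ bs : List BasisElt, bs.length = l.length → c bs = 0) : ofCochain c l = 0 :=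
  lin_eq_zero fun bs hbs => h bs (forall_of_tens_ne_zero hbs).length_eq.symm

theorem isDeformation_total (he : Adm (-1) 1 2 e) (h0 : e [] = curv)
    (hc : ∀ l, circ (total e) (total e) l = 0) :
    IsDeformation fun w => ofCochain (part w (total e)) where
  weighted :=
    { tensor := fun w => isTensorMap_ofCochain (composable_part (gr_total he) w)
      parity := fun w l hl => ofCochain_eq_zero fun bs hbs =>
        part_eq_zero (total_odd he bs (hbs ▸ hl))
      uncurved := by
        rw [part_zero_total he]
        exact (lin_bas und []).trans und_nil
      mul_unit := fun a k => by
        rw [part_zero_total he, ← undef_eq]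
        exact undef_mul_unit a k
      unit_mul := fun a k => by
        rw [part_zero_total he, ← undef_eq]
        exact undef_unit_mul a k
      unital := fun w l hw hk => ofCochain_unit (fun bs x hbs hx =>
        noIdem_of_part_total he hx (hbs ▸ hw)) hk
      relation := fun w l => by
        rw [insertion_ofCochain (gr_total he) he]
        exact ofCochain_eq_zero fun bs _ => part_eq_zero (hc bs) }
  undeformed := by rw [part_zero_total he, undef_eq]
  graded := fun w => isHomogeneousMap_ofCochain fun l x hx => by
    rw [gam_of_part_ne_zero (gr_total he) hx, shift, zpow_natCast]
    congr 3
    ring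
  curvature := by
    rw [curvatureElt_eq]
    refine (lin_bas (part 1 (total e)) []).trans ?_
    have h1 : total e [] = curv := by rw [total_eq_und]; simp only [und_nil, h0, zero_add]
    rw [← h1]
    -- The operation without inputs is concentrated in weight one: the weight is positive, and it is
    -- at most one by `degRel_nil`.
    refine Finsupp.filter_eq_self_iff _ _ |>.2 fun x hx => ?_
    rw [h1, ← h0] at hx
    have h2 := (he [] x hx).2
    have h3 := h2.winding_le
    have h4 := degRel_nil (h2.of_winding (n := (winding [x] - winding []).toNat) (by omega)).1
    change winding [x] = winding [] + (1 : ℕ)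
    omega

/-! ### Recovering the operations from their values on basis elements -/

/-- Converse of `isTensorMap_ofCochain`: acting with the idempotent of one entry, and moving it
across the tensor sign or out of the map, annihilates every coefficient that is not composable. -/
theorem isPath_of_isTensorMap {f : List Alg → Alg} (hf : IsTensorMap Ground f) :
    Composable fun bs => f (bs.map (bas : BasisElt → Vec BasisElt)) := by
  have hs : ∀ (b : BasisElt) (k : Ground), k b.2.left = 1 →
      k • (show Alg from (bas b : Vec BasisElt)) = (bas b : Vec BasisElt) := by
    intro b k hk
    have h : lin (fun b => k b.2.left • (bas b : Vec BasisElt)) (bas b) = bas b := by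
      rw [lin_bas, hk, one_smul]
    exact (left_smul _ _).trans h
  have hs' : ∀ (b : BasisElt) (k : Ground), k b.2.right = 1 →
      (show Alg from (bas b : Vec BasisElt)) <• k = (bas b : Vec BasisElt) := by
    intro b k hk
    have h : lin (fun b => k b.2.right • (bas b : Vec BasisElt)) (bas b) = bas b := by
      rw [lin_bas, hk, one_smul]
    exact (right_smul _ _).trans h
  have hz : ∀ (b : BasisElt) (k : Ground), k b.2.left = 0 →
      k • (show Alg from (bas b : Vec BasisElt)) = 0 := by
    intro b k hk
    have h : lin (fun b => k b.2.left • (bas b : Vec BasisElt)) (bas b) = 0 := by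
      rw [lin_bas, hk, zero_smul]
    exact (left_smul _ _).trans h
  have hf0 : ∀ (l l' : List Alg), f (l ++ 0 :: l') = 0 := by
    intro l l'
    have := hf.add l l' 0 0
    rwa [add_zero, left_eq_add] at this
  have hmid : ∀ (l : List BasisElt) (p : List Alg) (b : BasisElt) (x : BasisElt),
      coeff (f (p ++ (show Alg from (bas b : Vec BasisElt)) ::
        l.map (bas : BasisElt → Vec BasisElt))) x ≠ 0 → IsPath b.2.right l x.2.right := by
    intro l
    induction l with
    | nil =>
      intro p b x hx
      change b.2.right = x.2.right
      by_contra hne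
      have h1 := hf.right p (show Alg from (bas b : Vec BasisElt)) (Pi.single b.2.right 1)
      rw [hs' b _ (Pi.single_eq_same _ _)] at h1
      have h2 := congrArg (fun a => coeff a x) h1
      simp only [coeff_op_smul, MulOpposite.unop_op, Pi.single_eq_of_ne' hne, zero_mul] at h2
      exact hx h2
    | cons y l ih =>
      intro p b x hx
      refine ⟨?_, ?_⟩
      · by_contra hne
        have h1 := hf.balanced p (l.map (bas : BasisElt → Vec BasisElt))
          (show Alg from (bas b : Vec BasisElt)) (show Alg from (bas y : Vec BasisElt))
          (Pi.single b.2.right 1)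
        rw [hs' b _ (Pi.single_eq_same _ _), hz y _ (Pi.single_eq_of_ne hne _)] at h1
        have h2 := hf0 (p ++ [show Alg from (bas b : Vec BasisElt)])
          (l.map (bas : BasisElt → Vec BasisElt))
        rw [List.append_assoc, List.singleton_append, ← h1] at h2
        refine hx ?_
        exact (congrArg (fun a => coeff a x) h2).trans (coeff_zero x)
      · refine ih (p ++ [show Alg from (bas b : Vec BasisElt)]) y x ?_
        rw [List.append_assoc, List.singleton_append]
        exact hx
  intro l x hx
  cases l with
  | nil =>
    change x.2.left = x.2.right
    by_contra hne
    have h1 := congrArg (fun a => coeff a x) (hf.empty (Pi.single x.2.left 1))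
    simp only [coeff_smul, coeff_op_smul, MulOpposite.unop_op, Pi.single_eq_same,
      Pi.single_eq_of_ne' hne, one_mul, zero_mul] at h1
    exact hx h1
  | cons b l =>
    refine ⟨?_, hmid l [] b x hx⟩
    by_contra hne
    have h1 := hf.left (l.map (bas : BasisElt → Vec BasisElt))
      (show Alg from (bas b : Vec BasisElt)) (Pi.single b.2.left 1)
    rw [hs b _ (Pi.single_eq_same _ _)] at h1
    have h2 := congrArg (fun a => coeff a x) h1
    simp only [coeff_smul, Pi.single_eq_of_ne' hne, zero_mul] at h2
    exact hx h2

variable {μ : ℕ → List Alg → Alg}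

/-- The values on basis elements. -/
def toCochain (f : List Alg → Alg) (bs : List BasisElt) : Vec BasisElt :=
  f (bs.map (bas : BasisElt → Vec BasisElt))

theorem eq_ofCochain {f : List Alg → Alg} (hf : IsTensorMap Ground f) :
    f = ofCochain (toCochain f) :=
  funext fun l => eq_lin_tens (B := BasisElt) (N := Vec BasisElt) (f := f) hf.add l

theorem gam_of_toCochain (hμ : IsDeformation μ) {w : ℕ} {l : List BasisElt} {x : BasisElt}
    (h : toCochain (μ w) l x ≠ 0) : gam [x] = shift ((l.length : ℤ) - 1 + -1) w * gam l := by
  have h1 := hμ.graded w (l.map fun b => (gamma b, (bas b : Vec BasisElt))) (by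
    intro p hp b hb
    obtain ⟨y, -, rfl⟩ := List.mem_map.1 hp
    by_contra hne
    refine hb (Finsupp.single_eq_of_ne ?_)
    rintro rfl
    exact hne rfl)
  rw [List.map_map, List.map_map, List.length_map] at h1
  have h2 : gamma x = _ := h1 x h
  rw [gam_singleton, h2, shift, zpow_natCast, show (l.length : ℤ) - 1 + -1 = l.length - 2 by ring]
  rfl

theorem degRel_of_toCochain (hμ : IsDeformation μ) {w : ℕ} {l : List BasisElt} {x : BasisElt}
    (h : toCochain (μ w) l x ≠ 0) : DegRel (-1) w ((l.length : ℤ) - 1 + 3 * w) l [x] := by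
  refine ⟨fun j j' hj => ?_, ?_, w, le_rfl, by simp, by simpa using gam_of_toCochain hμ h⟩
  · have := isPath_of_isTensorMap (hμ.weighted.tensor w) l x h
    rw [← hj.1, ← hj.2]
    exact this
  · have he : Even l.length := by
      by_contra ho
      refine h ?_
      rw [toCochain, hμ.weighted.parity w _ (by
        exact (List.length_map (bas : BasisElt → Vec BasisElt)).symm ▸ Nat.not_even_iff_odd.1 ho)]
      rfl
    simpa using he

theorem noIdem_of_toCochain (hμ : IsDeformation μ) {w : ℕ} (hw : w ≠ 0) {l : List BasisElt}
    {x : BasisElt} (h : toCochain (μ w) l x ≠ 0) : NoIdem l := by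
  intro j hj
  refine h ?_
  rw [toCochain, hμ.weighted.unital w _ (fun h => hw h.1) ⟨Pi.single j 1, ?_⟩]
  · rfl
  · refine List.mem_map.2 ⟨_, hj, Eq.trans ?_ (smul_one_apply _).symm⟩
    fin_cases j <;> simp <;> rfl

/-- For given inputs only finitely many weights contribute, by `exists_bound`, so the operations of
positive weight can be added up. Winding numbers separate them again, and all relations together
become the vanishing of `circ (total e) (total e)`. -/
theorem exists_total (hμ : IsDeformation μ) : ∃ e, Adm (-1) 1 2 e ∧ e [] = curv ∧
    (∀ l, circ (total e) (total e) l = 0) ∧ μ = fun w => ofCochain (part w (total e)) := by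
  have hz : ∀ l, ∃ n : ℕ, ∀ w > n, toCochain (μ w) l = 0 := by
    intro l
    obtain ⟨n, hn⟩ := exists_bound (-1) l
    refine ⟨(n + 1).toNat, fun w hw => Finsupp.ext fun x => ?_⟩
    by_contra hx
    have := hn _ _ _ (degRel_of_toCochain hμ hx)
    omega
  choose n hn using hz
  set e : List BasisElt → Vec BasisElt := fun l =>
    ∑ w ∈ Finset.Icc 1 (n l), toCochain (μ w) l with he
  have hne : ∀ l x, e l x ≠ 0 → ∃ w, w ≠ 0 ∧ toCochain (μ w) l x ≠ 0 := by
    intro l x hx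
    rw [he] at hx
    simp only [Finsupp.finsetSum_apply] at hx
    obtain ⟨w, hw, h⟩ := Finset.exists_ne_zero_of_sum_ne_zero hx
    exact ⟨w, by have := (Finset.mem_Icc.1 hw).1; omega, h⟩
  have hA : Adm (-1) 1 2 e := by
    intro l x hx
    obtain ⟨w, hw, h⟩ := hne l x hx
    exact ⟨noIdem_of_toCochain hμ hw h, (degRel_of_toCochain hμ h).mono (by omega) (by omega)⟩
  have hpart : ∀ w, part w (total e) = toCochain (μ w) := by
    intro w
    by_cases hw : w = 0
    · subst hw
      rw [part_zero_total hA, hμ.undeformed, undef_eq]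
      funext l
      change _ = lin und (tens (l.map bas))
      rw [tens_map_bas, lin_bas]
    · funext l
      ext x
      rw [part, wcomp_apply]
      split_ifs with h
      · have h1 : und l x = 0 := by
          by_contra hx
          have := winding_of_und_ne_zero hx
          omega
        rw [total_eq_und, Finsupp.add_apply, h1, zero_add, he]
        simp only [Finsupp.finsetSum_apply]
        rw [Finset.sum_eq_single w]
        · intro v _ hv
          -- The winding numbers of inputs and output determine the weight, so no other weight
          -- contributes to this coefficient.
          by_contra hx
          have := winding_eq (gam_of_toCochain hμ hx)
          omega
        · intro hw'
          rw [hn l w (by rw [Finset.mem_Icc] at hw'; omega)]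
          rfl
      · by_contra hx
        exact h (winding_eq (gam_of_toCochain hμ (Ne.symm hx)))
  have hμe : μ = fun w => ofCochain (part w (total e)) := by
    funext w
    rw [hpart]
    exact eq_ofCochain (hμ.weighted.tensor w)
  refine ⟨e, hA, ?_, fun l => ?_, hμe⟩
  · have h1 : part 1 (total e) [] = curv := by
      rw [hpart]
      exact hμ.curvature.trans curvatureElt_eq
    ext x
    rw [← h1, part, wcomp_apply]
    split_ifs with h
    · rw [total_eq_und]
      simp only [und_nil, zero_add]
    · by_contra hx
      obtain ⟨w, hw, h2⟩ := hne [] x hx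
      have h3 := degRel_nil ((degRel_of_toCochain hμ h2).mono le_rfl
        (show (_ : ℤ) ≤ _ from le_rfl))
      refine h ?_
      rw [winding_eq (gam_of_toCochain hμ h2)]
      have : w = 1 := by omega
      rw [this]
  · have g := (gr_total hA).circ (gr_total hA)
    refine eq_zero_of_part_eq_zero (d := -1 + -1) (k := 1 + 1) (c := circ (total e) (total e))
      (g.mono le_rfl le_rfl) fun w => ?_
    have h1 := hμ.weighted.relation w (l.map (bas : BasisElt → Vec BasisElt))
    rw [hμe, insertion_ofCochain (gr_total hA) hA] at h1
    have h2 : lin (part w (circ (total e) (total e))) (tens (l.map bas)) = 0 := h1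
    rwa [tens_map_bas, lin_bas] at h2

/-! ### Isomorphisms -/

theorem part_proj (w : ℕ) (l : List Alg) :
    ofCochain (part w fun l => proj (bas l)) l = idHom w l := by
  have hlen : l.length ≠ 1 → ofCochain (part w fun l => proj (bas l)) l = 0 := fun h =>
    ofCochain_eq_zero fun bs hbs => part_eq_zero (proj_bas_of_length (hbs ▸ h))
  rcases l with _ | ⟨a, _ | ⟨b, l⟩⟩
  · rw [hlen (by simp)]
    cases w <;> rfl
  · cases w with
    | zero =>
      have h1 : (part 0 fun l : List BasisElt => proj (bas l)) = fun l => proj (bas l) := by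
        funext l
        ext x
        rw [part, wcomp_apply]
        split_ifs with h
        · rfl
        · by_contra hx
          exact h (by rw [proj_bas_ne_zero (Ne.symm hx)]; simp)
      have h2 : ∀ a : Vec BasisElt, lin (fun l => proj (bas l)) (tens [a]) = a := by
        intro a
        rw [← map_lin, lin_bas_fun, tens, tens, proj_cns]
        simp [counit]
      rw [h1]
      exact h2 a
    | succ w =>
      refine ofCochain_eq_zero fun bs _ => Finsupp.ext fun x => ?_
      by_contra hx
      obtain ⟨h1, h2⟩ := part_ne_zero hx
      rw [proj_bas_ne_zero h2] at h1
      push_cast at h1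
      omega
  · rw [hlen (by simp)]
    cases w <;> rfl

variable {φ e e' : List BasisElt → Vec BasisElt}

theorem isDeformationHom_mor (hφ : Adm 0 1 0 φ) (he : Adm (-1) 1 2 e) (he' : Adm (-1) 1 2 e')
    (h : ∀ l, lin (mor φ) (coder (total e) l) = lin (total e') (coalg (mor φ) l)) :
    IsDeformationHom Ground homog lamD lamW (fun w => ofCochain (part w (total e)))
      (fun w => ofCochain (part w (total e'))) fun w => ofCochain (part w (mor φ)) where
  tensor w := isTensorMap_ofCochain (composable_part (gr_mor_of_adm hφ) w)
  parity w l hl := ofCochain_eq_zero fun bs hbs =>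
    part_eq_zero ((gr_mor_of_adm hφ).even_zero bs (hbs ▸ hl))
  weight_zero := by
    funext l
    rw [← part_proj]
    have h1 : ∀ l x, proj (bas l) x ≠ 0 → winding [x] = winding l := fun l x hx => by
      rw [proj_bas_ne_zero hx]
    refine lin_congr fun bs _ => ?_
    refine (part_zero_add h1 hφ.gr bs).trans (Eq.symm ?_)
    ext x
    rw [part, wcomp_apply]
    split_ifs with h2
    · rfl
    · by_contra hx
      exact h2 (by rw [h1 bs x (Ne.symm hx)]; simp)
  unital w l hw hk := ofCochain_unit (fun bs x _ hx => (hφ bs x (part_pos_add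
    (a := fun l => proj (bas l)) (fun l x hx => by rw [proj_bas_ne_zero hx]) hw.ne' hx)).1) hk
  graded w := isHomogeneousMap_ofCochain fun l x hx => by
    rw [gam_of_part_ne_zero (gr_mor_of_adm hφ) hx, shift, zpow_natCast, add_zero]
  relation w l := by
    rw [insertion_ofCochain (gr_mor_of_adm hφ) he, compose_ofCochain
      ((gr_total he').mono le_rfl le_rfl) (gr_mor_of_adm hφ)]
    simp only [h]

theorem deformationIso (he : Adm (-1) 1 2 e) (he' : Adm (-1) 1 2 e') (h0 : e [] = curv)
    (h0' : e' [] = curv) (hc : ∀ l, circ (total e) (total e) l = 0)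
    (hc' : ∀ l, circ (total e') (total e') l = 0) :
    DeformationIso Ground homog lamD lamW (fun w => ofCochain (part w (total e)))
      fun w => ofCochain (part w (total e')) := by
  obtain ⟨φ, hφ, h1⟩ := exists_mor he he' h0 h0' hc hc'
  obtain ⟨ψ, hψ, h2, h3⟩ := exists_inverse_mor hφ
  have hφ' : Adm 0 1 0 φ := hφ.mono le_rfl (by norm_num)
  refine ⟨fun w => ofCochain (part w (mor φ)), fun w => ofCochain (part w (mor ψ)),
    isDeformationHom_mor hφ' he he' fun l => sub_eq_zero.1 (h1 l),
    isDeformationHom_mor hψ he' he (lin_mor_of_inverse hφ hψ h2 h3 h1), ?_, ?_⟩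
  · funext w l
    rw [compose_ofCochain (gr_mor_of_adm hψ) (gr_mor_of_adm hφ'), ← part_proj]
    have h4 : ∀ l, lin (mor ψ) (coalg (mor φ) l) = proj (bas l) := by
      intro l
      rw [← proj_lin_coalg (mor_nil (hψ.gr.even_zero [] (by simp)))]
      have := h2 (bas l)
      rw [lin_bas] at this
      rw [this]
    simp only [h4]
  · funext w l
    rw [compose_ofCochain (gr_mor_of_adm hφ') (gr_mor_of_adm hψ), ← part_proj]
    have h4 : ∀ l, lin (mor φ) (coalg (mor ψ) l) = proj (bas l) := by
      intro l
      rw [← proj_lin_coalg (mor_nil (hφ.gr.even_zero [] (by simp)))]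
      have := h3 (bas l)
      rw [lin_bas] at this
      rw [this]
    simp only [h4]

end Deformations

end TorusAlgebra

theorem mainTheorem11 :
    (∃ μ : ℕ → List TorusAlgebra.Alg → TorusAlgebra.Alg, TorusAlgebra.IsDeformation μ) ∧
      ∀ μ μ' : ℕ → List TorusAlgebra.Alg → TorusAlgebra.Alg,
        TorusAlgebra.IsDeformation μ → TorusAlgebra.IsDeformation μ' →
          WeightedAInf.DeformationIso TorusAlgebra.Ground TorusAlgebra.homog
            TorusAlgebra.lamD TorusAlgebra.lamW μ μ' := by
  refine ⟨?_, fun μ μ' hμ hμ' => ?_⟩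
  · obtain ⟨e, he, h0, hc⟩ := TorusAlgebra.exists_deformation
    exact ⟨_, TorusAlgebra.isDeformation_total he h0 hc⟩
  · obtain ⟨e, he, h0, hc, rfl⟩ := TorusAlgebra.exists_total hμ
    obtain ⟨e', he', h0', hc', rfl⟩ := TorusAlgebra.exists_total hμ'
    exact TorusAlgebra.deformationIso he he' h0 h0' hc hc'
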